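/- Let $V:\mathbb R\to\mathbb R$ be a Schwartz function (i.e. $V$ is smooth and $|\partial_x^\alpha V(x)|\lesssim_{\alpha,N}\langle x\rangle^{-N}$ for all $\alpha,N$, where $\langle x\rangle=(1+x^2)^{1/2}$), and assume that the Schrödinger operator $H=-\partial_x^2+V$ on $L^2(\mathbb R)$, with domain $H^2(\mathbb R)$, has no eigenvalues. Let $B=\sqrt{H+1}$ be the nonnegative self-adjoint square root, $e^{itB}$ its unitary group, and $P_c$ the projection onto the continuous subspace of $H$ (the orthogonal complement of the span of the eigenvectors). Let $f_\pm(x,\xi)$ be the solutions of $Hf_\pm=\xi^2f_\pm$ with $e^{\mp ix\xi}f_\pm(x,\xi)\to1$ as $x\to\pm\infty$, let $m_+(x,\xi)=e^{-ix\xi}f_+(x,\xi)$, and let $T(\xi)=\dfrac{2i\xi}{2i\xi-\int V(x)m_+(x,\xi)\,dx}$ be the transmission coefficient, extended by continuity to $\xi=0$. Put $$\psi(x,\xi)=\frac1{\sqrt{2\pi}}\begin{cases}T(\xi)f_+(x,\xi),&\xi\ge0,\\ T(-\xi)f_-(x,-\xi),&\xi<0,\end{cases}$$ and let $\widetilde f(\xi)=\int_{\mathbb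 R}\overline{\psi(x,\xi)}\,f(x)\,dx$ be the distorted Fourier transform of $f\in L^2(\mathbb R)$, the integral being understood as the limit in $L^2_\xi$ of the integrals over $[-R,R]$ as $R\to\infty$. A zero energy resonance is a bounded nontrivial solution $\varphi$ of $-\varphi''+V\varphi=0$ on $\mathbb R$; $V$ is called generic if there is none and exceptional otherwise. Then there is a constant $C$, depending only on $V$, such that $$\big\|\langle x\rangle^{-2}e^{itB}P_cf\big\|_{L^\infty_x}\le C\,\langle t\rangle^{-1}\Big(\|\partial_\xi\widetilde f\|_{L^1_\xi}+\|\widetilde f\|_{L^1_\xi}+\|f\|_{H^1_x}\Big)$$ for all $t\in\mathbb R$ and all complex-valued $f\in H^1(\mathbb R)$ such that $\widetilde f\in L^1$ and its weak derivative $\partial_\xi\widetilde f$ on $\mathbb R$ is in $L^1$, provided that one of the following holds: (i) $V$ is generic; (ii) $V$ is even and exceptional with an even zero energy resonance, and $f$ is odd; (iii) $V$ is even and exceptional with an odd zero energy resonance, and $f$ is even. -/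

import Mathlib

open MeasureTheory Filter Topology
open scoped ENNReal ContDiff SchwartzMap InnerProductSpace

noncomputable section

namespace LocalDecay

/-- The complex Hilbert space `L²(ℝ)`. -/
abbrev L2 : Type := Lp ℂ 2 (volume : Measure ℝ)

/-- The Japanese bracket `⟨x⟩ = (1 + x²)^{1/2}`. -/
def jap (x : ℝ) : ℝ := Real.sqrt (1 + x ^ 2)

/-! ### Weak derivatives -/

/-- `g` is the weak (distributional) derivative of `f` on `ℝ`. -/
def HasWeakDeriv (f g : ℝ → ℂ) : Prop :=
  LocallyIntegrable f volume ∧ LocallyIntegrable g volume ∧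
    ∀ φ : ℝ → ℝ, ContDiff ℝ ∞ φ → HasCompactSupport φ →
      ∫ x, deriv φ x • f x = -∫ x, φ x • g x

theorem HasWeakDeriv.unique {f g h : ℝ → ℂ} (hg : HasWeakDeriv f g) (hh : HasWeakDeriv f h) :
    g =ᵐ[volume] h := by
  refine ae_eq_of_integral_contDiff_smul_eq hg.2.1 hh.2.1 fun φ h1 h2 => ?_
  have := (hg.2.2 φ h1 h2).symm.trans (hh.2.2 φ h1 h2)
  exact neg_injective this

theorem HasWeakDeriv.congr {f g f' g' : ℝ → ℂ} (h : HasWeakDeriv f g)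
    (hf : f =ᵐ[volume] f') (hg : g =ᵐ[volume] g') : HasWeakDeriv f' g' := by
  refine ⟨h.1.congr hf, h.2.1.congr hg, fun φ h1 h2 => ?_⟩
  have e1 : ∫ x, deriv φ x • f' x = ∫ x, deriv φ x • f x :=
    integral_congr_ae (hf.mono fun x hx => by simp [hx])
  have e2 : ∫ x, φ x • g' x = ∫ x, φ x • g x :=
    integral_congr_ae (hg.mono fun x hx => by simp [hx])
  rw [e1, e2, h.2.2 φ h1 h2]

theorem HasWeakDeriv.smul {f g : ℝ → ℂ} (h : HasWeakDeriv f g) (c : ℂ) :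
    HasWeakDeriv (c • f) (c • g) := by
  refine ⟨h.1.smul c, h.2.1.smul c, fun φ h1 h2 => ?_⟩
  have := h.2.2 φ h1 h2
  simp only [Pi.smul_apply, smul_comm _ c, integral_smul]
  rw [this, smul_neg]

theorem HasWeakDeriv.add {f g f' g' : ℝ → ℂ} (h : HasWeakDeriv f g) (h' : HasWeakDeriv f' g') :
    HasWeakDeriv (f + f') (g + g') := by
  refine ⟨h.1.add h'.1, h.2.1.add h'.2.1, fun φ h1 h2 => ?_⟩
  have hd : Continuous (deriv φ) := h1.continuous_deriv (by simp)
  have i1 := h.1.integrable_smul_left_of_hasCompactSupport hd h2.deriv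
  have i2 := h'.1.integrable_smul_left_of_hasCompactSupport hd h2.deriv
  have i3 := h.2.1.integrable_smul_left_of_hasCompactSupport h1.continuous h2
  have i4 := h'.2.1.integrable_smul_left_of_hasCompactSupport h1.continuous h2
  simp only [Pi.add_apply, smul_add]
  rw [integral_add i1 i2, integral_add i3 i4, h.2.2 φ h1 h2, h'.2.2 φ h1 h2, neg_add]

theorem hasWeakDeriv_zero : HasWeakDeriv 0 0 :=
  ⟨locallyIntegrable_zero, locallyIntegrable_zero, fun φ _ _ => by simp⟩

/-! ### The Schrödinger operator -/

/-- The graph of `H = -∂ₓ² + V` on `L²(ℝ)` with domain the Sobolev space `H²(ℝ)`: the pairs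
`(u, w)` such that `u` has a first and a second weak derivative in `L²`
and `w = -u'' + V u`. -/
def schrodingerGraph (V : 𝓢(ℝ, ℝ)) : Submodule ℂ (L2 × L2) where
  carrier := {p | ∃ u' u'' : L2, HasWeakDeriv p.1 u' ∧ HasWeakDeriv u' u'' ∧
    ∀ᵐ x : ℝ, p.2 x = -u'' x + (V x : ℂ) * p.1 x}
  zero_mem' := by
    have h0 : HasWeakDeriv ((0 : L2) : ℝ → ℂ) ((0 : L2) : ℝ → ℂ) :=
      hasWeakDeriv_zero.congr (Lp.coeFn_zero _ _ _).symm (Lp.coeFn_zero _ _ _).symm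
    refine ⟨0, 0, h0, h0, ?_⟩
    filter_upwards with x
    simp
  add_mem' := by
    rintro ⟨u, w⟩ ⟨v, z⟩ ⟨u1, u2, h1, h2, h3⟩ ⟨v1, v2, k1, k2, k3⟩
    refine ⟨u1 + v1, u2 + v2,
      (h1.add k1).congr (Lp.coeFn_add _ _).symm (Lp.coeFn_add _ _).symm,
      (h2.add k2).congr (Lp.coeFn_add _ _).symm (Lp.coeFn_add _ _).symm, ?_⟩
    filter_upwards [h3, k3, Lp.coeFn_add u v, Lp.coeFn_add w z, Lp.coeFn_add u2 v2]
      with x a b c d e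
    simp only [Prod.mk_add_mk, c, d, e, Pi.add_apply] at *
    rw [a, b]; ring
  smul_mem' := by
    rintro c ⟨u, w⟩ ⟨u1, u2, h1, h2, h3⟩
    refine ⟨c • u1, c • u2,
      (h1.smul c).congr (Lp.coeFn_smul _ _).symm (Lp.coeFn_smul _ _).symm,
      (h2.smul c).congr (Lp.coeFn_smul _ _).symm (Lp.coeFn_smul _ _).symm, ?_⟩
    filter_upwards [h3, Lp.coeFn_smul c u, Lp.coeFn_smul c w, Lp.coeFn_smul c u2]
      with x a b d e
    simp only [Prod.smul_mk, b, d, e, Pi.smul_apply, smul_eq_mul] at *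
    rw [a]; ring

/-- The graph is single-valued. -/
theorem schrodingerGraph_single (V : 𝓢(ℝ, ℝ)) (p : L2 × L2) (hp : p ∈ schrodingerGraph V)
    (h0 : p.1 = 0) : p.2 = 0 := by
  obtain ⟨u, w⟩ := p
  obtain ⟨u1, u2, h1, h2, h3⟩ := hp
  simp only at h0 h1 h3 ⊢
  subst h0
  have z := Lp.coeFn_zero ℂ 2 (volume : Measure ℝ)
  have e1 : (u1 : ℝ → ℂ) =ᵐ[volume] 0 :=
    h1.unique (hasWeakDeriv_zero.congr z.symm (by rfl))
  have e2 : (u2 : ℝ → ℂ) =ᵐ[volume] 0 :=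
    h2.unique (hasWeakDeriv_zero.congr e1.symm (by rfl))
  refine Lp.ext ?_
  filter_upwards [h3, z, e2] with x a b c
  rw [a, c, b]
  simp

/-- The Schrödinger operator `H = -∂ₓ² + V` as an unbounded operator on `L²(ℝ)`,
with domain `H²(ℝ)`. -/
def schrodinger (V : 𝓢(ℝ, ℝ)) : L2 →ₗ.[ℂ] L2 := (schrodingerGraph V).toLinearPMap

theorem schrodinger_graph (V : 𝓢(ℝ, ℝ)) : (schrodinger V).graph = schrodingerGraph V :=
  Submodule.toLinearPMap_graph_eq _ fun p hp h0 => schrodingerGraph_single V p hp h0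

/-- The set of all eigenvectors of `H`. -/
def eigenvectors (V : 𝓢(ℝ, ℝ)) : Set L2 :=
  {φ | φ ≠ 0 ∧ ∃ z : ℂ, (φ, z • φ) ∈ (schrodinger V).graph}

/-- The projection `P_c` onto the continuous subspace of `H`, that is, the orthogonal projection
onto the orthogonal complement of the span of the eigenvectors of `H`. -/
def Pc (V : 𝓢(ℝ, ℝ)) : L2 →L[ℂ] L2 :=
  (Submodule.span ℂ (eigenvectors V))ᗮ.starProjection

/-! ### Square roots and unitary groups of unbounded operators -/

/-- `B` is a nonnegative self-adjoint square root of the unbounded operator `A`: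
`B` is self-adjoint, `⟪f, B f⟫ ≥ 0` on its domain, and `B ∘ B = A` (with equal domains). -/
def IsNonnegSqrt (A B : L2 →ₗ.[ℂ] L2) : Prop :=
  IsSelfAdjoint B ∧ (∀ f : B.domain, 0 ≤ (⟪(f : L2), B f⟫_ℂ).re) ∧
    ∀ f g : L2, (f, g) ∈ A.graph ↔ ∃ k : L2, (f, k) ∈ B.graph ∧ (k, g) ∈ B.graph

/-- The (unique) nonnegative self-adjoint square root of `A`. -/
def sqrtOp (A : L2 →ₗ.[ℂ] L2) : L2 →ₗ.[ℂ] L2 := Classical.epsilon (IsNonnegSqrt A)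

/-- `U` is the strongly continuous one-parameter unitary group with infinitesimal generator `iB`
(in the sense of Stone's theorem). -/
def IsUnitaryGroup (B : L2 →ₗ.[ℂ] L2) (U : ℝ → L2 →L[ℂ] L2) : Prop :=
  (∀ t, U t ∈ unitary (L2 →L[ℂ] L2)) ∧ U 0 = 1 ∧ (∀ s t, U (s + t) = U s * U t) ∧
    (∀ f, Continuous fun t => U t f) ∧
    ∀ f g : L2, (f, g) ∈ B.graph ↔ HasDerivAt (fun t => U t f) (Complex.I • g) 0

/-- The (unique) unitary group `t ↦ e^{itB}` of the self-adjoint operator `B`. -/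
def expI (B : L2 →ₗ.[ℂ] L2) : ℝ → L2 →L[ℂ] L2 := Classical.epsilon (IsUnitaryGroup B)

/-- `B = (H + 1)^{1/2} = (-∂ₓ² + V + 1)^{1/2}`. -/
def B (V : 𝓢(ℝ, ℝ)) : L2 →ₗ.[ℂ] L2 :=
  sqrtOp ((LinearMap.id : L2 →ₗ[ℂ] L2) +ᵥ schrodinger V)

/-! ### Scattering theory and the distorted Fourier transform -/

/-- `f` is a classical solution of `-f'' + V f = ξ² f` on `ℝ`. -/
def IsSolution (V : 𝓢(ℝ, ℝ)) (ξ : ℝ) (f : ℝ → ℂ) : Prop :=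
  ContDiff ℝ 2 f ∧ ∀ x, -deriv (deriv f) x + (V x : ℂ) * f x = (ξ : ℂ) ^ 2 * f x

/-- The Jost solution `x ↦ f₊(x, ξ)`: it solves `H f₊ = ξ² f₊` and `f₊ ∼ e^{ixξ}` at `+∞`. -/
def jostPlus (V : 𝓢(ℝ, ℝ)) (ξ : ℝ) : ℝ → ℂ :=
  Classical.epsilon fun f => IsSolution V ξ f ∧
    Tendsto (fun x : ℝ => Complex.exp (-(Complex.I * x * ξ)) * f x) atTop (𝓝 1)

/-- The Jost solution `x ↦ f₋(x, ξ)`: it solves `H f₋ = ξ² f₋` and `f₋ ∼ e^{-ixξ}` at `-∞`. -/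
def jostMinus (V : 𝓢(ℝ, ℝ)) (ξ : ℝ) : ℝ → ℂ :=
  Classical.epsilon fun f => IsSolution V ξ f ∧
    Tendsto (fun x : ℝ => Complex.exp (Complex.I * x * ξ) * f x) atBot (𝓝 1)

/-- `m₊(x, ξ) = e^{-ixξ} f₊(x, ξ)`. -/
def mPlus (V : 𝓢(ℝ, ℝ)) (ξ x : ℝ) : ℂ := Complex.exp (-(Complex.I * x * ξ)) * jostPlus V ξ x

/-- The transmission coefficient `2iξ / (2iξ - ∫ V m₊)` at a frequency `ξ ≠ 0`. -/
def transmissionAux (V : 𝓢(ℝ, ℝ)) (ξ : ℝ) : ℂ :=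
  2 * Complex.I * ξ / (2 * Complex.I * ξ - ∫ x : ℝ, (V x : ℂ) * mPlus V ξ x)

/-- The transmission coefficient `T(ξ)`, extended by continuity to `ξ = 0`. -/
def transmission (V : 𝓢(ℝ, ℝ)) (ξ : ℝ) : ℂ :=
  if ξ = 0 then limUnder (𝓝[≠] (0 : ℝ)) (transmissionAux V) else transmissionAux V ξ

/-- The generalized eigenfunctions `ψ(x, ξ)`. -/
def psi (V : 𝓢(ℝ, ℝ)) (x ξ : ℝ) : ℂ :=
  ((Real.sqrt (2 * Real.pi))⁻¹ : ℝ) *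
    (if 0 ≤ ξ then transmission V ξ * jostPlus V ξ x
      else transmission V (-ξ) * jostMinus V (-ξ) x)

/-- `g` is the distorted Fourier transform of `f ∈ L²`: the `L²_ξ`-limit, as `R → ∞`, of
`∫_{-R}^{R} conj(ψ(x, ξ)) f(x) dx`. -/
def IsDistFT (V : 𝓢(ℝ, ℝ)) (f g : L2) : Prop :=
  Tendsto (fun R : ℝ => eLpNorm (fun ξ : ℝ =>
    (∫ x in (-R)..R, starRingEnd ℂ (psi V x ξ) * f x) - g ξ) 2 volume) atTop (𝓝 0)

/-- The distorted Fourier transform on `L²(ℝ)`. -/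
def distFT (V : 𝓢(ℝ, ℝ)) (f : L2) : L2 := Classical.epsilon (IsDistFT V f)

/-! ### Resonances and parity -/

/-- `φ` is a zero energy resonance: a bounded nontrivial solution of `-φ'' + V φ = 0`. -/
def IsResonance (V : 𝓢(ℝ, ℝ)) (φ : ℝ → ℂ) : Prop :=
  IsSolution V 0 φ ∧ (∃ M : ℝ, ∀ x, ‖φ x‖ ≤ M) ∧ φ ≠ 0

/-- `V` is generic: there is no zero energy resonance. -/
def IsGeneric (V : 𝓢(ℝ, ℝ)) : Prop := ¬ ∃ φ, IsResonance V φ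

/-- The parity assumptions on the potential, on the zero energy resonance and on `f`: either `V`
is generic, or `V` is even and exceptional with an even resonance and `f` is odd, or `V` is even
and exceptional with an odd resonance and `f` is even. -/
def ParityAssumption (V : 𝓢(ℝ, ℝ)) (f : L2) : Prop :=
  IsGeneric V ∨
  ((∀ x, V (-x) = V x) ∧ (∃ φ, IsResonance V φ ∧ ∀ x, φ (-x) = φ x) ∧
    ∀ᵐ x : ℝ, f (-x) = -f x) ∨
  ((∀ x, V (-x) = V x) ∧ (∃ φ, IsResonance V φ ∧ ∀ x, φ (-x) = -φ x) ∧
    ∀ᵐ x : ℝ, f (-x) = f x)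

end LocalDecay

end

/-!
The evolution is written as an oscillatory integral in the distorted Fourier variable and estimated
by one integration by parts, once the oscillation of the phase has been seen to be nonstationary
with respect to a kernel that vanishes at zero frequency.

**Jost solutions.** The function `m₊(x, k) = e^{-ikx} f₊(x, k)` solves a Volterra equation on
`(x, ∞)`. Conjugating this equation by the weight `wt` turns the Volterra operator `volOp` into a
contraction of the bounded continuous functions, for every `k` in the closed upper half-plane `UH`,
and `volOp` is differentiable in `k` up to the real axis. Hence `m₊ = O(1 + |x|)` and
`∂_k m₊ = O((1 + |x|)²)`, uniformly in `k` (`exists_norm_mP_le`, `exists_norm_mPk_le`); the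
Wronskian `W(k) = 2ik - ∫ V m₊` of the Jost solutions is differentiable as well, and the scattering
relations give `|W(ξ)| ≥ 2 |ξ|` on the real line (`two_abs_le_norm_Wr`).

**Spectral representation.** A zero of `W` with `Im k > 0` would make the Jost solutions
proportional, hence produce an eigenvector (`Wr_ne_zero_of_eigenvectors`). So the resolvent kernel,
multiplied by `k`, is holomorphic in the upper half-plane and continuous up to the boundary, and
shifting the contour to infinity shows that the distorted Fourier transform `FT` is an isometry
(`exists_inversion_bound`, `plancherel`). Green's identity shows that it intertwines `(H + 1)⁻¹`
with multiplication by `(1 + ξ²)⁻¹` (`FT_resOp`). By uniqueness of the nonnegative square root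
(`IsNonnegSqrt.mem_graph_iff`) and of the unitary group with a given generator
(`IsUnitaryGroup.eq`), `e^{itB}` acts as `e^{it⟨ξ⟩}` (`expI_eq`). It is not needed that `FT` is onto:
the projection onto its range commutes with the multipliers involved (`rangeProj_expMul`).

**Regularity at low frequencies.** The kernel has the form `(ξ / ⟨ξ⟩) w(ξ, x)` with `w` and `∂_ξ w`
bounded by `(1 + |x|)²`; this is `RegularAt`. The kernel is a multiple of `ξ f₊(x, ξ) / W(ξ)`, so
this is clear if `W(0) ≠ 0`, which is the generic case (`IsGeneric.Wr_zero_ne`). If `V` is even,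
then `W(ξ) = 2 f₊(0, ξ) f₊'(0, ξ)`, and the parity of `f` folds the negative frequencies onto the
positive ones (`FT_parity`), which replaces `f₊(x, ξ)` by its odd or even part. The odd part of
`f₊ / W` is the quotient by `f₊(0, ξ)` of a solution with Cauchy data independent of `ξ`, and the
even part the quotient by `f₊'(0, ξ)` of such a solution. The denominator does not vanish at `ξ = 0`
when the resonance is even (`IsResonance.fP_zero_ne`), respectively odd
(`IsResonance.fP'_zero_ne`), and the numerator is controlled by a Volterra equation on the interval
`(0, x)` (`exists_norm_le_of_cauchy`).

**Decay.** Since `(ξ / ⟨ξ⟩) e^{it⟨ξ⟩}` is the derivative of `e^{it⟨ξ⟩} / (it)`, one integration by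
parts against the `W^{1,1}` function `FT f` gains `1 / |t|` (`norm_integral_mul_expMul_le`,
`norm_integral_regular_le`).
-/

noncomputable section

namespace LocalDecay

open scoped BoundedContinuousFunction

/-! ### Volterra equations on the line -/

/-- The tail `x ↦ ∫_x^∞ f`. -/
def tail {E : Type*} [NormedAddCommGroup E] [NormedSpace ℝ E] (f : ℝ → E) (x : ℝ) : E :=
  ∫ y in Set.Ioi x, f y

section tail

variable {E : Type*} [NormedAddCommGroup E] [NormedSpace ℝ E]

theorem tail_eq_sub {f : ℝ → E} (hf : Integrable f) (a x : ℝ) :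
    tail f x = tail f a - ∫ y in a..x, f y := by
  have := intervalIntegral.integral_interval_add_Ioi (a := a) (b := x) (f := f) (μ := volume)
    hf.integrableOn hf.integrableOn
  unfold tail
  rw [← this]; abel

theorem hasDerivAt_tail [CompleteSpace E] {f : ℝ → E} (hf : Integrable f) (hc : Continuous f)
    (x : ℝ) : HasDerivAt (tail f) (-f x) x := by
  have h : HasDerivAt (fun x => tail f 0 - ∫ y in (0 : ℝ)..x, f y) (-f x) x := by
    have := (intervalIntegral.integral_hasDerivAt_right (hf.intervalIntegrable (a := 0) (b := x))
      (hc.stronglyMeasurableAtFilter _ _) hc.continuousAt)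
    simpa using this.const_sub (tail f 0)
  exact h.congr_of_eventuallyEq (Eventually.of_forall fun y => tail_eq_sub hf 0 y)

theorem tendsto_tail_atTop {f : ℝ → E} (hf : Integrable f) :
    Tendsto (tail f) atTop (𝓝 0) := by
  have h := intervalIntegral_tendsto_integral_Ioi (μ := volume) (0 : ℝ) hf.integrableOn tendsto_id
  have h2 : Tendsto (fun x => tail f 0 - ∫ y in (0 : ℝ)..x, f y) atTop (𝓝 (tail f 0 - tail f 0)) :=
    tendsto_const_nhds.sub h
  rw [sub_self] at h2
  exact h2.congr fun x => (tail_eq_sub hf 0 x).symm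

theorem tail_nonneg {f : ℝ → ℝ} (h : ∀ x, 0 ≤ f x) (x : ℝ) : 0 ≤ tail f x :=
  integral_nonneg fun y => h y

theorem tail_le {f : ℝ → ℝ} (hf : Integrable f) (h : ∀ x, 0 ≤ f x) (x : ℝ) :
    tail f x ≤ ∫ y, f y :=
  setIntegral_le_integral hf (Eventually.of_forall h)

end tail

/-- A potential `q` with a continuous integrable majorant `ρ` of `(1 + |y|)^6 |q y|`. -/
structure VoltData (q ρ : ℝ → ℝ) : Prop where
  meas : Measurable q
  cont : Continuous ρ
  int : Integrable ρ
  bound : ∀ y, (1 + |y|) ^ 6 * |q y| ≤ ρ y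

/-- A convolution kernel on the half-line `[0, ∞)` of at most cubic growth that vanishes at `0`. -/
structure KerBd (A : ℝ) (d : ℝ → ℂ) : Prop where
  cont : Continuous d
  zero : d 0 = 0
  bound : ∀ s, 0 ≤ s → ‖d s‖ ≤ A * (1 + s) ^ 3

theorem KerBd.nonneg {A : ℝ} {d : ℝ → ℂ} (h : KerBd A d) : 0 ≤ A := by
  have := h.bound 0 le_rfl
  simpa [h.zero] using this

/-- The weight `(1 + |x|)^3 exp (2 ∫_x^∞ ρ)`. The exponential factor makes the Volterra operator
a contraction. -/
def wt (ρ : ℝ → ℝ) (x : ℝ) : ℝ := (1 + |x|) ^ 3 * Real.exp (2 * tail ρ x)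

/-- The kernel of the Volterra operator, conjugated by the weight. -/
def vker (q ρ : ℝ → ℝ) (d : ℝ → ℂ) (x y : ℝ) : ℂ :=
  ((wt ρ x)⁻¹ : ℝ) * d (max (y - x) 0) * ((q y * wt ρ y : ℝ) : ℂ)

theorem wt_pos (ρ : ℝ → ℝ) (x : ℝ) : 0 < wt ρ x := by unfold wt; positivity

theorem wt_ne (ρ : ℝ → ℝ) (x : ℝ) : (wt ρ x : ℂ) ≠ 0 := by
  exact_mod_cast (wt_pos ρ x).ne'

theorem one_add_max_le (x y : ℝ) : 1 + max (y - x) 0 ≤ (1 + |x|) * (1 + |y|) := by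
  have h1 := abs_nonneg x
  have h2 := abs_nonneg y
  have h3 := neg_abs_le x
  have h4 := le_abs_self y
  have : max (y - x) 0 ≤ |x| + |y| := max_le (by linarith) (by positivity)
  nlinarith [mul_nonneg h1 h2]

namespace VoltData

variable {q ρ : ℝ → ℝ} (hq : VoltData q ρ)
include hq

theorem rho_nonneg (y : ℝ) : 0 ≤ ρ y := le_trans (by positivity) (hq.bound y)

theorem continuous_tail : Continuous (tail ρ) :=
  continuous_iff_continuousAt.2 fun x => (hasDerivAt_tail hq.int hq.cont x).continuousAt

theorem continuous_wt : Continuous (wt ρ) := by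
  have := hq.continuous_tail
  unfold wt
  fun_prop

theorem le_wt (x : ℝ) : (1 + |x|) ^ 3 ≤ wt ρ x :=
  le_mul_of_one_le_right (by positivity)
    (Real.one_le_exp (mul_nonneg zero_le_two (tail_nonneg hq.rho_nonneg x)))

theorem wt_le (x : ℝ) : wt ρ x ≤ Real.exp (2 * ∫ y, ρ y) * (1 + |x|) ^ 3 := by
  rw [mul_comm]
  unfold wt
  gcongr
  exact tail_le hq.int hq.rho_nonneg x

/-- The weighted potential `ρ exp (2 ∫_y^∞ ρ)` has a primitive. -/
theorem integral_Ioi_weight (x : ℝ) :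
    ∫ y in Set.Ioi x, ρ y * Real.exp (2 * tail ρ y) = (Real.exp (2 * tail ρ x) - 1) / 2 := by
  have hd : ∀ y, HasDerivAt (fun y => -(Real.exp (2 * tail ρ y) / 2))
      (ρ y * Real.exp (2 * tail ρ y)) y := fun y => by
    have := ((((hasDerivAt_tail hq.int hq.cont y).const_mul 2).exp).div_const 2).neg
    exact this.congr_deriv (by ring)
  have ht : Tendsto (fun y => -(Real.exp (2 * tail ρ y) / 2)) atTop (𝓝 (-(Real.exp (2 * 0) / 2))) :=
    (((Real.continuous_exp.tendsto _).comp
      ((tendsto_tail_atTop hq.int).const_mul 2)).div_const 2).neg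
  rw [integral_Ioi_of_hasDerivAt_of_tendsto (hd x).continuousAt.continuousWithinAt
    (fun y _ => hd y) ?_ ht]
  · simp; ring
  · exact integrableOn_Ioi_deriv_of_nonneg (hd x).continuousAt.continuousWithinAt
      (fun y _ => hd y) (fun y _ => mul_nonneg (hq.rho_nonneg y) (Real.exp_pos _).le) ht

/-- The growth of the kernel `d` and of the polynomial part of the weight is absorbed by six powers
of `1 + |y|`, which leaves the exponential factors. -/
theorem norm_vker_le {A : ℝ} {d : ℝ → ℂ} (hd : KerBd A d) (x y : ℝ) :
    ‖vker q ρ d x y‖ ≤ A * (Real.exp (2 * tail ρ x))⁻¹ *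
      (Set.Ioi x).indicator (fun y => ρ y * Real.exp (2 * tail ρ y)) y := by
  by_cases hxy : y ∈ Set.Ioi x
  · rw [Set.indicator_of_mem hxy]
    have h1 := hd.bound (max (y - x) 0) (le_max_right _ _)
    have h2 : (1 + max (y - x) 0) ^ 3 ≤ ((1 + |x|) * (1 + |y|)) ^ 3 :=
      pow_le_pow_left₀ (by positivity) (one_add_max_le x y) 3
    have hA := hd.nonneg
    have h3 : ‖d (max (y - x) 0)‖ ≤ A * ((1 + |x|) * (1 + |y|)) ^ 3 :=
      h1.trans (by gcongr)
    have hx : (0 : ℝ) < 1 + |x| := by positivity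
    have hw : 0 < wt ρ x := wt_pos ρ x
    have hw' : 0 < wt ρ y := wt_pos ρ y
    have e : ‖vker q ρ d x y‖ = (wt ρ x)⁻¹ * ‖d (max (y - x) 0)‖ * (|q y| * wt ρ y) := by
      simp only [vker, norm_mul, Complex.norm_real, Real.norm_eq_abs, abs_inv,
        abs_of_pos hw, abs_of_pos hw']
    rw [e]
    calc (wt ρ x)⁻¹ * ‖d (max (y - x) 0)‖ * (|q y| * wt ρ y)
        ≤ (wt ρ x)⁻¹ * (A * ((1 + |x|) * (1 + |y|)) ^ 3) * (|q y| * wt ρ y) := by gcongr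
      _ = A * (Real.exp (2 * tail ρ x))⁻¹ *
          (((1 + |y|) ^ 6 * |q y|) * Real.exp (2 * tail ρ y)) := by
          unfold wt; field_simp
      _ ≤ _ := by
          have := hq.bound y
          gcongr
  · have : max (y - x) 0 = 0 := max_eq_right (by simpa using hxy)
    rw [Set.indicator_of_notMem hxy, vker, this, hd.zero]
    simp

theorem norm_vker_le' {A : ℝ} {d : ℝ → ℂ} (hd : KerBd A d) (x y : ℝ) :
    ‖vker q ρ d x y‖ ≤ A * Real.exp (2 * ∫ y, ρ y) * ρ y := by
  have hA := hd.nonneg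
  have hρ := hq.rho_nonneg y
  have h1 : (Real.exp (2 * tail ρ x))⁻¹ ≤ 1 :=
    inv_le_one_of_one_le₀ (Real.one_le_exp (mul_nonneg zero_le_two (tail_nonneg hq.rho_nonneg x)))
  have h2 : (Set.Ioi x).indicator (fun y => ρ y * Real.exp (2 * tail ρ y)) y
      ≤ ρ y * Real.exp (2 * ∫ y, ρ y) := by
    refine (Set.indicator_le_self' (fun y _ => mul_nonneg (hq.rho_nonneg y)
      (Real.exp_pos _).le) y).trans ?_
    have := tail_le hq.int hq.rho_nonneg y
    gcongr
  have h3 : 0 ≤ (Set.Ioi x).indicator (fun y => ρ y * Real.exp (2 * tail ρ y)) y :=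
    Set.indicator_nonneg (fun y _ => mul_nonneg (hq.rho_nonneg y) (Real.exp_pos _).le) y
  calc _ ≤ _ := hq.norm_vker_le hd x y
    _ ≤ A * 1 * (ρ y * Real.exp (2 * ∫ y, ρ y)) := by gcongr
    _ = _ := by ring

theorem measurable_vker {d : ℝ → ℂ} (hd : Continuous d) (x : ℝ) :
    Measurable (vker q ρ d x) := by
  have h1 := hq.meas
  have h2 := hq.continuous_wt.measurable
  have h3 := hd.measurable
  unfold vker
  fun_prop

theorem continuous_vker {d : ℝ → ℂ} (hd : Continuous d) (y : ℝ) :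
    Continuous fun x => vker q ρ d x y := by
  have h2 := hq.continuous_wt
  unfold vker
  refine (Continuous.mul (Complex.continuous_ofReal.comp (h2.inv₀ fun x => (wt_pos ρ x).ne'))
    (by fun_prop)).mul continuous_const

theorem integrable_vker_mul {A : ℝ} {d : ℝ → ℂ} (hd : KerBd A d) (u : ℝ →ᵇ ℂ) (x : ℝ) :
    Integrable fun y => vker q ρ d x y * u y := by
  refine Integrable.mono' (g := fun y => A * Real.exp (2 * ∫ y, ρ y) * ρ y * ‖u‖)
    ((hq.int.const_mul _).mul_const _)
    ((hq.measurable_vker hd.cont x).mul u.continuous.measurable).aestronglyMeasurable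
    (Eventually.of_forall fun y => ?_)
  rw [norm_mul]
  have := hq.norm_vker_le' hd x y
  exact mul_le_mul this (u.norm_coe_le_norm y) (norm_nonneg _) ((norm_nonneg _).trans this)

theorem continuous_integral_vker {A : ℝ} {d : ℝ → ℂ} (hd : KerBd A d) (u : ℝ →ᵇ ℂ) :
    Continuous fun x => ∫ y, vker q ρ d x y * u y := by
  refine continuous_of_dominated (bound := fun y => A * Real.exp (2 * ∫ y, ρ y) * ρ y * ‖u‖)
    (fun x => (hq.integrable_vker_mul hd u x).aestronglyMeasurable)
    (fun x => Eventually.of_forall fun y => ?_) ((hq.int.const_mul _).mul_const _)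
    (Eventually.of_forall fun y => (hq.continuous_vker hd.cont y).mul continuous_const)
  rw [norm_mul]
  have := hq.norm_vker_le' hd x y
  exact mul_le_mul this (u.norm_coe_le_norm y) (norm_nonneg _) ((norm_nonneg _).trans this)

/-- The conjugated operator has norm at most `A / 2`, however large the potential is. -/
theorem norm_integral_vker_le {A : ℝ} {d : ℝ → ℂ} (hd : KerBd A d) (u : ℝ →ᵇ ℂ) (x : ℝ) :
    ‖∫ y, vker q ρ d x y * u y‖ ≤ A / 2 * ‖u‖ := by
  have hA := hd.nonneg
  have hi : Integrable ((Set.Ioi x).indicator (fun y => ρ y * Real.exp (2 * tail ρ y))) := by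
    refine Integrable.indicator ?_ measurableSet_Ioi
    refine Integrable.mono' (g := fun y => ρ y * Real.exp (2 * ∫ y, ρ y)) (hq.int.mul_const _)
      ((hq.cont.mul (by have := hq.continuous_tail; fun_prop)).aestronglyMeasurable)
      (Eventually.of_forall fun y => ?_)
    have := tail_le hq.int hq.rho_nonneg y
    have hρ := hq.rho_nonneg y
    rw [Real.norm_of_nonneg (by positivity)]
    gcongr
  have h1 : ‖∫ y, vker q ρ d x y * u y‖ ≤ ∫ y, A * (Real.exp (2 * tail ρ x))⁻¹ *
      (Set.Ioi x).indicator (fun y => ρ y * Real.exp (2 * tail ρ y)) y * ‖u‖ := by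
    refine norm_integral_le_of_norm_le ((hi.const_mul _).mul_const _)
      (Eventually.of_forall fun y => ?_)
    rw [norm_mul]
    have := hq.norm_vker_le hd x y
    exact mul_le_mul this (u.norm_coe_le_norm y) (norm_nonneg _) ((norm_nonneg _).trans this)
  refine h1.trans ?_
  rw [integral_mul_const, integral_const_mul, integral_indicator measurableSet_Ioi,
    hq.integral_Ioi_weight]
  have h3 : (Real.exp (2 * tail ρ x))⁻¹ * ((Real.exp (2 * tail ρ x) - 1) / 2) ≤ 1 / 2 := by
    have := Real.exp_pos (2 * tail ρ x)
    rw [inv_mul_le_iff₀ this]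
    linarith
  calc _ = A * ((Real.exp (2 * tail ρ x))⁻¹ * ((Real.exp (2 * tail ρ x) - 1) / 2)) * ‖u‖ := by ring
    _ ≤ A * (1 / 2) * ‖u‖ := by gcongr
    _ = _ := by ring

end VoltData

/-- Bounded operators on the space of bounded continuous functions. -/
abbrev BCOp : Type := (ℝ →ᵇ ℂ) →L[ℂ] (ℝ →ᵇ ℂ)

open Classical in
/-- The Volterra operator `u ↦ ∫_x^∞ d (y - x) q(y) u(y) dy`, conjugated by the weight, acting on
bounded continuous functions; it is `0` by convention if the data are not admissible. -/
def volOp (q ρ : ℝ → ℝ) (d : ℝ → ℂ) : BCOp :=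
  if h : VoltData q ρ ∧ ∃ A, KerBd A d then
    LinearMap.mkContinuous
      { toFun := fun u => BoundedContinuousFunction.ofNormedAddCommGroup
          (fun x => ∫ y, vker q ρ d x y * u y)
          (h.1.continuous_integral_vker h.2.choose_spec u) _
          (h.1.norm_integral_vker_le h.2.choose_spec u)
        map_add' := fun u v => by
          ext x
          simp only [BoundedContinuousFunction.coe_ofNormedAddCommGroup,
            BoundedContinuousFunction.coe_add, Pi.add_apply, mul_add]
          exact integral_add (h.1.integrable_vker_mul h.2.choose_spec u x)
            (h.1.integrable_vker_mul h.2.choose_spec v x)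
        map_smul' := fun c u => by
          ext x
          simp only [BoundedContinuousFunction.coe_ofNormedAddCommGroup,
            BoundedContinuousFunction.coe_smul, smul_eq_mul, RingHom.id_apply, mul_left_comm _ c,
            integral_const_mul] }
      (h.2.choose / 2)
      (fun u => BoundedContinuousFunction.norm_ofNormedAddCommGroup_le _
        (mul_nonneg (div_nonneg h.2.choose_spec.nonneg zero_le_two) (norm_nonneg u))
        (h.1.norm_integral_vker_le h.2.choose_spec u))
  else 0

section volOp

variable {q ρ : ℝ → ℝ} (hq : VoltData q ρ)
include hq

theorem volOp_apply {A : ℝ} {d : ℝ → ℂ} (hd : KerBd A d) (u : ℝ →ᵇ ℂ) (x : ℝ) :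
    volOp q ρ d u x = ∫ y, vker q ρ d x y * u y := by
  rw [volOp, dif_pos ⟨hq, A, hd⟩]
  rfl

theorem norm_volOp_le {A : ℝ} {d : ℝ → ℂ} (hd : KerBd A d) : ‖volOp q ρ d‖ ≤ A / 2 := by
  have hA : 0 ≤ A / 2 := div_nonneg hd.nonneg zero_le_two
  refine ContinuousLinearMap.opNorm_le_bound _ hA fun u => ?_
  refine (BoundedContinuousFunction.norm_le (by positivity)).2 fun x => ?_
  rw [volOp_apply hq hd]
  exact hq.norm_integral_vker_le hd u x

/-- Linearity of `volOp` in the kernel, in the form of a first-order Taylor remainder. -/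
theorem volOp_sub_sub {A A' A'' A''' : ℝ} {d d' e f : ℝ → ℂ} (hd : KerBd A d) (hd' : KerBd A' d')
    (he : KerBd A'' e) (hf : KerBd A''' f) (c : ℂ) (h : ∀ s, f s = d s - d' s - c * e s) :
    volOp q ρ d - volOp q ρ d' - c • volOp q ρ e = volOp q ρ f := by
  ext u x
  simp only [sub_apply, smul_apply,
    BoundedContinuousFunction.coe_sub, Pi.sub_apply, BoundedContinuousFunction.coe_smul,
    volOp_apply hq hd, volOp_apply hq hd', volOp_apply hq he, volOp_apply hq hf, smul_eq_mul]
  have i1 := hq.integrable_vker_mul hd u x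
  have i2 := hq.integrable_vker_mul hd' u x
  have i3 : Integrable fun y => vker q ρ d x y * u y - vker q ρ d' x y * u y := i1.sub i2
  rw [← integral_const_mul, ← integral_sub i1 i2,
    ← integral_sub i3 ((hq.integrable_vker_mul he u x).const_mul c)]
  refine integral_congr_ae (Eventually.of_forall fun y => ?_)
  simp only [vker, h]
  ring

end volOp

/-! ### The free kernel `∫_0^s e^{2iku} du` and its dependence on `k` -/

/-- The closed upper half-plane. -/
def UH : Set ℂ := {k | 0 ≤ k.im}

theorem ofReal_mem_UH (ξ : ℝ) : (ξ : ℂ) ∈ UH := by simp [UH]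

/-- The free kernel `D_k(s) = ∫_0^s e^{2iku} du = (e^{2iks} - 1) / (2ik)`. -/
def dker (k : ℂ) (s : ℝ) : ℂ := ∫ u in (0 : ℝ)..s, Complex.exp (2 * Complex.I * k * u)

/-- The derivative of `dker` in `k`. -/
def dker' (k : ℂ) (s : ℝ) : ℂ :=
  ∫ u in (0 : ℝ)..s, 2 * Complex.I * u * Complex.exp (2 * Complex.I * k * u)

theorem norm_exp_le {k : ℂ} (hk : k ∈ UH) {u : ℝ} (hu : 0 ≤ u) :
    ‖Complex.exp (2 * Complex.I * k * u)‖ ≤ 1 := by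
  rw [Complex.norm_exp, Real.exp_le_one_iff]
  have : (2 * Complex.I * k * u).re = -(2 * (k.im * u)) := by simp; ring
  rw [this]
  have h : 0 ≤ k.im := hk
  nlinarith [mul_nonneg h hu]

theorem hasDerivAt_dker (k : ℂ) (s : ℝ) :
    HasDerivAt (dker k) (Complex.exp (2 * Complex.I * k * s)) s := by
  have hc : Continuous fun u : ℝ => Complex.exp (2 * Complex.I * k * u) := by fun_prop
  exact intervalIntegral.integral_hasDerivAt_right (hc.intervalIntegrable _ _)
    (hc.stronglyMeasurableAtFilter _ _) hc.continuousAt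

theorem hasDerivAt_dker' (k : ℂ) (s : ℝ) :
    HasDerivAt (dker' k) (2 * Complex.I * s * Complex.exp (2 * Complex.I * k * s)) s := by
  have hc : Continuous fun u : ℝ => 2 * Complex.I * u * Complex.exp (2 * Complex.I * k * u) := by
    fun_prop
  exact intervalIntegral.integral_hasDerivAt_right (hc.intervalIntegrable _ _)
    (hc.stronglyMeasurableAtFilter _ _) hc.continuousAt

theorem dker_zero (k : ℂ) : dker k 0 = 0 := by simp [dker]

theorem dker'_zero (k : ℂ) : dker' k 0 = 0 := by simp [dker']

theorem two_I_mul_dker (k : ℂ) (s : ℝ) :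
    2 * Complex.I * k * dker k s = Complex.exp (2 * Complex.I * k * s) - 1 := by
  have h : ∀ u ∈ Set.uIcc 0 s, HasDerivAt (fun u : ℝ => Complex.exp (2 * Complex.I * k * u))
      (2 * Complex.I * k * Complex.exp (2 * Complex.I * k * u)) u := fun u _ => by
    have h1 : HasDerivAt (fun u : ℝ => 2 * Complex.I * k * (u : ℂ)) (2 * Complex.I * k * 1) u :=
      (Complex.ofRealCLM.hasDerivAt (x := u)).const_mul _
    convert h1.cexp using 1
    ring
  have hc : Continuous fun u : ℝ => 2 * Complex.I * k * Complex.exp (2 * Complex.I * k * u) := by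
    fun_prop
  rw [dker, ← intervalIntegral.integral_const_mul,
    intervalIntegral.integral_eq_sub_of_hasDerivAt h (hc.intervalIntegrable _ _)]
  simp

theorem norm_dker_le {k : ℂ} (hk : k ∈ UH) {s : ℝ} (hs : 0 ≤ s) : ‖dker k s‖ ≤ s := by
  have := intervalIntegral.norm_integral_le_of_norm_le_const (a := 0) (b := s) (C := 1)
    (f := fun u : ℝ => Complex.exp (2 * Complex.I * k * u)) fun u hu =>
      norm_exp_le hk (by rw [Set.uIoc_of_le hs] at hu; exact hu.1.le)
  rw [dker]
  simpa [abs_of_nonneg hs] using this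

theorem norm_dker'_le {k : ℂ} (hk : k ∈ UH) {s : ℝ} (hs : 0 ≤ s) : ‖dker' k s‖ ≤ 2 * s ^ 2 := by
  have := intervalIntegral.norm_integral_le_of_norm_le_const (a := 0) (b := s) (C := 2 * s)
    (f := fun u : ℝ => 2 * Complex.I * u * Complex.exp (2 * Complex.I * k * u)) fun u hu => by
      rw [Set.uIoc_of_le hs] at hu
      have h1 := norm_exp_le hk hu.1.le
      have h2 : ‖2 * Complex.I * (u : ℂ)‖ = 2 * u := by simp [abs_of_pos hu.1]
      rw [norm_mul, h2]
      nlinarith [hu.1, hu.2, norm_nonneg (Complex.exp (2 * Complex.I * k * u))]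
  simp only [sub_zero, abs_of_nonneg hs] at this
  calc _ ≤ _ := this
    _ = _ := by ring

/-- A Taylor estimate that is uniform in the left half-plane: no smallness of `w` is assumed. -/
theorem norm_exp_taylor {z w : ℂ} (hz : ‖Complex.exp z‖ ≤ 1) (hw : ‖Complex.exp (z + w)‖ ≤ 1) :
    ‖Complex.exp (z + w) - Complex.exp z - w * Complex.exp z‖ ≤ 3 * ‖w‖ ^ 2 := by
  rcases le_or_gt ‖w‖ 1 with h | h
  · have := Complex.norm_exp_sub_one_sub_id_le h
    have e : Complex.exp (z + w) - Complex.exp z - w * Complex.exp z =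
        Complex.exp z * (Complex.exp w - 1 - w) := by rw [Complex.exp_add]; ring
    rw [e, norm_mul]
    nlinarith [norm_nonneg (Complex.exp z), norm_nonneg (Complex.exp w - 1 - w), sq_nonneg ‖w‖]
  · calc _ ≤ ‖Complex.exp (z + w)‖ + ‖Complex.exp z‖ + ‖w‖ * ‖Complex.exp z‖ := by
          rw [← norm_mul]
          exact (norm_sub_le _ _).trans (add_le_add_left (norm_sub_le _ _) _)
      _ ≤ 1 + 1 + ‖w‖ * 1 := by gcongr
      _ ≤ _ := by nlinarith

/-- The kernel is differentiable in `k` within the closed upper half-plane, with a quadratic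
remainder; the cubic growth of the remainder in `s` is the reason for the cubic weight. -/
theorem norm_dker_taylor {k l : ℂ} (hk : k ∈ UH) (hl : l ∈ UH) {s : ℝ} (hs : 0 ≤ s) :
    ‖dker l s - dker k s - (l - k) * dker' k s‖ ≤ 12 * ‖l - k‖ ^ 2 * s ^ 3 := by
  have hc : ∀ k : ℂ, IntervalIntegrable (fun u : ℝ => Complex.exp (2 * Complex.I * k * u))
      volume 0 s := fun k => Continuous.intervalIntegrable (by fun_prop) _ _
  have hc' : IntervalIntegrable (fun u : ℝ => (l - k) * (2 * Complex.I * u *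
      Complex.exp (2 * Complex.I * k * u))) volume 0 s :=
    Continuous.intervalIntegrable (by fun_prop) _ _
  rw [dker, dker, dker', ← intervalIntegral.integral_const_mul,
    ← intervalIntegral.integral_sub (hc l) (hc k),
    ← intervalIntegral.integral_sub ((hc l).sub (hc k)) hc']
  have := intervalIntegral.norm_integral_le_of_norm_le_const (a := 0) (b := s)
    (C := 12 * ‖l - k‖ ^ 2 * s ^ 2)
    (f := fun u : ℝ => Complex.exp (2 * Complex.I * l * u) - Complex.exp (2 * Complex.I * k * u)
      - (l - k) * (2 * Complex.I * u * Complex.exp (2 * Complex.I * k * u))) fun u hu => by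
      rw [Set.uIoc_of_le hs] at hu
      have h1 := norm_exp_le hk hu.1.le
      have h2 := norm_exp_le hl hu.1.le
      have e : 2 * Complex.I * l * u = 2 * Complex.I * k * u + 2 * Complex.I * (l - k) * u := by
        ring
      rw [e] at h2 ⊢
      have h3 := norm_exp_taylor h1 h2
      have e2 : (l - k) * (2 * Complex.I * u * Complex.exp (2 * Complex.I * k * u)) =
        2 * Complex.I * (l - k) * u * Complex.exp (2 * Complex.I * k * u) := by ring
      rw [e2]
      refine h3.trans ?_
      have h4 : ‖2 * Complex.I * (l - k) * u‖ = 2 * ‖l - k‖ * u := by simp [abs_of_pos hu.1]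
      rw [h4]
      have : u ^ 2 ≤ s ^ 2 := pow_le_pow_left₀ hu.1.le hu.2 2
      nlinarith [sq_nonneg ‖l - k‖]
  simp only [sub_zero, abs_of_nonneg hs] at this
  calc _ ≤ _ := this
    _ = _ := by ring

theorem kerBd_dker {k : ℂ} (hk : k ∈ UH) : KerBd 1 (dker k) where
  cont := continuous_iff_continuousAt.2 fun s => (hasDerivAt_dker k s).continuousAt
  zero := dker_zero k
  bound := fun s hs => (norm_dker_le hk hs).trans (by nlinarith [pow_nonneg hs 2, pow_nonneg hs 3])

theorem kerBd_dker' {k : ℂ} (hk : k ∈ UH) : KerBd 2 (dker' k) where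
  cont := continuous_iff_continuousAt.2 fun s => (hasDerivAt_dker' k s).continuousAt
  zero := dker'_zero k
  bound := fun s hs => (norm_dker'_le hk hs).trans (by nlinarith [pow_nonneg hs 2, pow_nonneg hs 3])

theorem kerBd_taylor {k l : ℂ} (hk : k ∈ UH) (hl : l ∈ UH) :
    KerBd (12 * ‖l - k‖ ^ 2) (fun s => dker l s - dker k s - (l - k) * dker' k s) where
  cont := ((kerBd_dker hl).cont.sub (kerBd_dker hk).cont).sub
    (continuous_const.mul (kerBd_dker' hk).cont)
  zero := by simp [dker_zero, dker'_zero]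
  bound := fun s hs => (norm_dker_taylor hk hl hs).trans (by
    have : s ^ 3 ≤ (1 + s) ^ 3 := pow_le_pow_left₀ hs (by linarith) 3
    gcongr)

theorem hasDerivWithinAt_of_sq {G : Type*} [NormedAddCommGroup G] [NormedSpace ℂ G] {f : ℂ → G}
    {f' : G} {s : Set ℂ} {k : ℂ} (C : ℝ)
    (h : ∀ l ∈ s, ‖f l - f k - (l - k) • f'‖ ≤ C * ‖l - k‖ ^ 2) : HasDerivWithinAt f f' s k := by
  rw [hasDerivWithinAt_iff_isLittleO]
  have h1 : (fun l => f l - f k - (l - k) • f') =O[𝓝[s] k] fun l => ‖l - k‖ ^ 2 :=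
    Asymptotics.IsBigO.of_bound C (by
      filter_upwards [self_mem_nhdsWithin] with l hl
      simpa using h l hl)
  refine h1.trans_isLittleO ?_
  have h2 : (fun l : ℂ => ‖l - k‖ ^ 2) =o[𝓝 (k : ℂ)] fun l => l - k := by
    have := (Asymptotics.isLittleO_pow_id (𝕜 := ℂ) (n := 2) (by norm_num)).norm_left
    have h3 : Tendsto (fun l : ℂ => l - k) (𝓝 k) (𝓝 0) := by
      have : ContinuousAt (fun l : ℂ => l - k) k := by fun_prop
      simpa [ContinuousAt] using this
    have h4 := this.comp_tendsto h3
    simpa [Function.comp_def] using h4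
  exact h2.mono nhdsWithin_le_nhds

/-! ### The resolvent of the Volterra operator -/

section resolvent

variable {q ρ : ℝ → ℝ} (hq : VoltData q ρ)
include hq

theorem hasDerivWithinAt_volOp {k : ℂ} (hk : k ∈ UH) :
    HasDerivWithinAt (fun l => (volOp q ρ (dker l) : BCOp)) (volOp q ρ (dker' k)) UH k := by
  refine hasDerivWithinAt_of_sq (G := BCOp) 6 fun l hl => ?_
  rw [volOp_sub_sub hq (kerBd_dker hl) (kerBd_dker hk) (kerBd_dker' hk) (kerBd_taylor hk hl) (l - k)
    (fun s => rfl)]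
  refine (norm_volOp_le hq (kerBd_taylor hk hl)).trans (le_of_eq (by ring))

omit hq in
/-- The solution `u` of the Volterra equation `u = a + K_k u`. -/
def volSol (q ρ : ℝ → ℝ) (k : ℂ) (a : ℝ →ᵇ ℂ) : ℝ →ᵇ ℂ :=
  Ring.inverse ((1 : BCOp) - volOp q ρ (dker k)) a

theorem norm_volOp_lt {k : ℂ} (hk : k ∈ UH) : ‖volOp q ρ (dker k)‖ < 1 :=
  (norm_volOp_le hq (kerBd_dker hk)).trans_lt (by norm_num)

theorem isUnit_one_sub_volOp {k : ℂ} (hk : k ∈ UH) : IsUnit ((1 : BCOp) - volOp q ρ (dker k)) :=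
  isUnit_one_sub_of_norm_lt_one (R := BCOp) (norm_volOp_lt hq hk)

theorem volSol_eq {k : ℂ} (hk : k ∈ UH) (a : ℝ →ᵇ ℂ) :
    volSol q ρ k a = a + volOp q ρ (dker k) (volSol q ρ k a) := by
  have h := Ring.mul_inverse_cancel _ (isUnit_one_sub_volOp hq hk)
  have h2 : volSol q ρ k a - volOp q ρ (dker k) (volSol q ρ k a) = a :=
    congrArg (fun T : BCOp => T a) h
  exact sub_eq_iff_eq_add.1 h2

theorem volSol_unique {k : ℂ} (hk : k ∈ UH) {a u : ℝ →ᵇ ℂ}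
    (h : u = a + volOp q ρ (dker k) u) : u = volSol q ρ k a := by
  have h1 := Ring.inverse_mul_cancel _ (isUnit_one_sub_volOp hq hk)
  have h2 : Ring.inverse ((1 : BCOp) - volOp q ρ (dker k)) (u - volOp q ρ (dker k) u) = u :=
    congrArg (fun T : BCOp => T u) h1
  rw [sub_eq_iff_eq_add.2 h] at h2
  exact h2.symm

theorem norm_le_of_volterra {k : ℂ} (hk : k ∈ UH) {a u : ℝ →ᵇ ℂ}
    (h : u = a + volOp q ρ (dker k) u) : ‖u‖ ≤ 2 * ‖a‖ := by
  have h1 : ‖u‖ ≤ ‖a‖ + 1 / 2 * ‖u‖ := by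
    nth_rewrite 1 [h]
    refine (norm_add_le _ _).trans (add_le_add_right ?_ _)
    exact (ContinuousLinearMap.le_opNorm _ _).trans
      (mul_le_mul_of_nonneg_right (norm_volOp_le hq (kerBd_dker hk)) (norm_nonneg _))
  linarith

theorem norm_volSol_le {k : ℂ} (hk : k ∈ UH) (a : ℝ →ᵇ ℂ) : ‖volSol q ρ k a‖ ≤ 2 * ‖a‖ :=
  norm_le_of_volterra hq hk (volSol_eq hq hk a)

/-- The solution of a Volterra equation depends differentiably on the spectral parameter, up to
the boundary of the upper half-plane; the derivative solves the differentiated equation. -/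
theorem exists_hasDerivWithinAt_volSol {k : ℂ} (hk : k ∈ UH) {a : ℂ → ℝ →ᵇ ℂ} {a' : ℝ →ᵇ ℂ}
    (ha : HasDerivWithinAt a a' UH k) :
    ∃ u' : ℝ →ᵇ ℂ, HasDerivWithinAt (fun l => volSol q ρ l (a l)) u' UH k ∧
      u' = a' + volOp q ρ (dker' k) (volSol q ρ k (a k)) + volOp q ρ (dker k) u' := by
  obtain ⟨v, hv⟩ := isUnit_one_sub_volOp hq hk
  have h1 : HasDerivWithinAt (fun l => (1 : BCOp) - volOp q ρ (dker l)) (-volOp q ρ (dker' k)) UH k :=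
    (hasDerivWithinAt_volOp hq hk).const_sub (1 : BCOp)
  have h2 := hasFDerivAt_ringInverse (𝕜 := ℂ) (R := BCOp) v
  rw [hv] at h2
  have h3 : HasDerivWithinAt (fun l => Ring.inverse ((1 : BCOp) - volOp q ρ (dker l)))
      (((↑v⁻¹ : BCOp).comp (volOp q ρ (dker' k))).comp (↑v⁻¹ : BCOp)) UH k := by
    refine (HasFDerivAt.comp_hasDerivWithinAt (F := BCOp) (E := BCOp) k h2 h1).congr_deriv ?_
    refine ContinuousLinearMap.ext fun u => ?_
    change -((↑v⁻¹ : BCOp) (-(volOp q ρ (dker' k) ((↑v⁻¹ : BCOp) u)))) = _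
    rw [map_neg, neg_neg]
    rfl
  have h4 := h3.clm_apply ha
  refine ⟨_, h4, ?_⟩
  have hK : ∀ u, volOp q ρ (dker k) u = u - (v : BCOp) u := fun u => by
    rw [hv]; simp
  have hv1 : ∀ u, (v : BCOp)
      ((↑v⁻¹ : BCOp) u) = u := fun u =>
    congrArg (fun T : BCOp => T u) v.mul_inv
  have hi : Ring.inverse (1 - volOp q ρ (dker k)) = ↑v⁻¹ := by rw [← hv, Ring.inverse_unit]
  rw [hK]
  simp only [volSol, hi, ContinuousLinearMap.comp_apply, map_add, hv1]
  abel

end resolvent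

/-! ### Growth bounds for solutions of Volterra equations -/

section growth

variable {q ρ : ℝ → ℝ} (hq : VoltData q ρ)
include hq

theorem wt_mul_volOp {A : ℝ} {d : ℝ → ℂ} (hd : KerBd A d) (u : ℝ →ᵇ ℂ) (x : ℝ) :
    (wt ρ x : ℂ) * volOp q ρ d u x =
      ∫ y, d (max (y - x) 0) * ((q y : ℂ) * ((wt ρ y : ℂ) * u y)) := by
  rw [volOp_apply hq hd, ← integral_const_mul]
  refine integral_congr_ae (Eventually.of_forall fun y => ?_)
  have := wt_ne ρ x
  simp only [vker]
  push_cast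
  field_simp

theorem norm_wt_mul_le (u : ℝ →ᵇ ℂ) (x : ℝ) :
    ‖(wt ρ x : ℂ) * u x‖ ≤ Real.exp (2 * ∫ y, ρ y) * ‖u‖ * (1 + |x|) ^ 3 := by
  rw [norm_mul, Complex.norm_real, Real.norm_of_nonneg (wt_pos ρ x).le]
  calc _ ≤ Real.exp (2 * ∫ y, ρ y) * (1 + |x|) ^ 3 * ‖u‖ := by
        gcongr
        · exact hq.wt_le x
        · exact u.norm_coe_le_norm x
    _ = _ := by ring

/-- A kernel of growth `(1 + s)^j` produces a function of growth `(1 + |x|)^j`, whatever the growth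
of `M` up to the third power. -/
theorem norm_integral_conv_le {A c : ℝ} {d : ℝ → ℂ} {M : ℝ → ℂ} {j : ℕ} (hj : j ≤ 3) (hA : 0 ≤ A)
    (hd : ∀ s, 0 ≤ s → ‖d s‖ ≤ A * (1 + s) ^ j) (hM : ∀ y, ‖M y‖ ≤ c * (1 + |y|) ^ 3) (x : ℝ) :
    ‖∫ y, d (max (y - x) 0) * ((q y : ℂ) * M y)‖ ≤ A * c * (∫ y, ρ y) * (1 + |x|) ^ j := by
  have hc : 0 ≤ c := by simpa using (norm_nonneg _).trans (hM 0)
  have h : ∀ y, ‖d (max (y - x) 0) * ((q y : ℂ) * M y)‖ ≤ A * c * (1 + |x|) ^ j * ρ y := fun y => by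
    have h1 : ‖d (max (y - x) 0)‖ ≤ A * ((1 + |x|) * (1 + |y|)) ^ j :=
      (hd _ (le_max_right _ _)).trans (by
        have := pow_le_pow_left₀ (by positivity) (one_add_max_le x y) j
        gcongr)
    have h2 : (1 + |y|) ^ j * (1 + |y|) ^ 3 ≤ (1 + |y|) ^ 6 := by
      rw [← pow_add]
      exact pow_le_pow_right₀ (by linarith [abs_nonneg y]) (by omega)
    rw [norm_mul, norm_mul, Complex.norm_real, Real.norm_eq_abs]
    calc _ ≤ A * ((1 + |x|) * (1 + |y|)) ^ j * (|q y| * (c * (1 + |y|) ^ 3)) := by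
          gcongr; exact hM y
      _ = A * c * (1 + |x|) ^ j * (((1 + |y|) ^ j * (1 + |y|) ^ 3) * |q y|) := by
          rw [mul_pow]; ring
      _ ≤ A * c * (1 + |x|) ^ j * ((1 + |y|) ^ 6 * |q y|) := by gcongr
      _ ≤ _ := by
          have := hq.bound y
          gcongr
  refine (norm_integral_le_of_norm_le (hq.int.const_mul _) (Eventually.of_forall h)).trans ?_
  rw [integral_const_mul]
  exact le_of_eq (by ring)

/-- The solution a priori grows like the cubic weight; inserting this bound into the equation once
improves the growth to the linear growth of the kernel. -/
theorem norm_wt_mul_volSol_le {k : ℂ} (hk : k ∈ UH) {a : ℝ →ᵇ ℂ} {A : ℝ}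
    (ha : ∀ x, ‖(wt ρ x : ℂ) * a x‖ ≤ A * (1 + |x|)) (x : ℝ) :
    ‖(wt ρ x : ℂ) * volSol q ρ k a x‖ ≤
      (A + Real.exp (2 * ∫ y, ρ y) * (2 * ‖a‖) * ∫ y, ρ y) * (1 + |x|) := by
  have hu := volSol_eq hq hk a
  set u := volSol q ρ k a
  have h1 : ∀ y, ‖(wt ρ y : ℂ) * u y‖ ≤ Real.exp (2 * ∫ y, ρ y) * (2 * ‖a‖) * (1 + |y|) ^ 3 :=
    fun y => (norm_wt_mul_le hq u y).trans (by
      have := norm_volSol_le hq hk a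
      gcongr)
  have h2 : (wt ρ x : ℂ) * u x = (wt ρ x : ℂ) * a x +
      ∫ y, dker k (max (y - x) 0) * ((q y : ℂ) * ((wt ρ y : ℂ) * u y)) := by
    rw [← wt_mul_volOp hq (kerBd_dker hk), ← mul_add]
    exact congrArg _ (congrArg (fun v : ℝ →ᵇ ℂ => v x) hu)
  have h3 := norm_integral_conv_le hq (j := 1) (by norm_num) zero_le_one (d := dker k)
    (fun s hs => (norm_dker_le hk hs).trans (by linarith)) h1 x
  rw [h2]
  refine (norm_add_le _ _).trans ((add_le_add (ha x) h3).trans (le_of_eq (by ring)))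

/-- The derivative of the solution in the spectral parameter grows at most quadratically, as the
kernel `dker'` does. -/
theorem norm_wt_mul_deriv_volSol_le {k : ℂ} (hk : k ∈ UH) {a a' u' : ℝ →ᵇ ℂ} {A A' : ℝ}
    (ha' : ∀ x, ‖(wt ρ x : ℂ) * a' x‖ ≤ A' * (1 + |x|) ^ 2) (hA : ‖a‖ ≤ A) (hA' : ‖a'‖ ≤ A')
    (hu' : u' = a' + volOp q ρ (dker' k) (volSol q ρ k a) + volOp q ρ (dker k) u') (x : ℝ) :
    ‖(wt ρ x : ℂ) * u' x‖ ≤ (A' + 2 * (Real.exp (2 * ∫ y, ρ y) * (2 * A)) * (∫ y, ρ y) +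
      Real.exp (2 * ∫ y, ρ y) * (2 * (A' + 2 * A)) * ∫ y, ρ y) * (1 + |x|) ^ 2 := by
  have hu : ‖volSol q ρ k a‖ ≤ 2 * A := (norm_volSol_le hq hk a).trans (by gcongr)
  have hA0 : 0 ≤ A := (norm_nonneg _).trans hA
  have hA0' : 0 ≤ A' := (norm_nonneg _).trans hA'
  set u := volSol q ρ k a
  have hn : ‖u'‖ ≤ 2 * (A' + 2 * A) := by
    refine (norm_le_of_volterra hq hk hu').trans ?_
    have h1 : ‖volOp q ρ (dker' k) u‖ ≤ 1 * (2 * A) :=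
      (ContinuousLinearMap.le_opNorm _ _).trans (by
        have := norm_volOp_le hq (kerBd_dker' hk)
        norm_num at this
        gcongr)
    have := norm_add_le a' (volOp q ρ (dker' k) u)
    linarith
  have h1 : ∀ y, ‖(wt ρ y : ℂ) * u y‖ ≤ Real.exp (2 * ∫ y, ρ y) * (2 * A) * (1 + |y|) ^ 3 :=
    fun y => (norm_wt_mul_le hq u y).trans (by gcongr)
  have h1' : ∀ y, ‖(wt ρ y : ℂ) * u' y‖ ≤
      Real.exp (2 * ∫ y, ρ y) * (2 * (A' + 2 * A)) * (1 + |y|) ^ 3 :=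
    fun y => (norm_wt_mul_le hq u' y).trans (by gcongr)
  have h2 : (wt ρ x : ℂ) * u' x = (wt ρ x : ℂ) * a' x +
      (∫ y, dker' k (max (y - x) 0) * ((q y : ℂ) * ((wt ρ y : ℂ) * u y))) +
      ∫ y, dker k (max (y - x) 0) * ((q y : ℂ) * ((wt ρ y : ℂ) * u' y)) := by
    rw [← wt_mul_volOp hq (kerBd_dker hk), ← wt_mul_volOp hq (kerBd_dker' hk), ← mul_add, ← mul_add]
    exact congrArg _ (congrArg (fun v : ℝ →ᵇ ℂ => v x) hu')
  have h3 := norm_integral_conv_le hq (j := 1) (by norm_num) zero_le_one (d := dker k)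
    (fun s hs => (norm_dker_le hk hs).trans (by linarith)) h1' x
  have h4 := norm_integral_conv_le hq (j := 2) (by norm_num) zero_le_two (d := dker' k)
    (fun s hs => (norm_dker'_le hk hs).trans (by nlinarith)) h1 x
  have h5 : (1 + |x|) ^ 1 ≤ (1 + |x|) ^ 2 :=
    pow_le_pow_right₀ (by linarith [abs_nonneg x]) (by norm_num)
  have h6 : 0 ≤ ∫ y, ρ y := integral_nonneg hq.rho_nonneg
  rw [h2]
  calc _ ≤ _ := norm_add₃_le
    _ ≤ A' * (1 + |x|) ^ 2 + 2 * (Real.exp (2 * ∫ y, ρ y) * (2 * A)) * (∫ y, ρ y) * (1 + |x|) ^ 2 +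
      1 * (Real.exp (2 * ∫ y, ρ y) * (2 * (A' + 2 * A))) * (∫ y, ρ y) * (1 + |x|) ^ 2 := by
        refine add_le_add (add_le_add (ha' x) h4) (h3.trans ?_)
        gcongr
    _ = _ := by ring

end growth

/-! ### The Volterra integral as a function of position -/

/-- Differentiation of a half-line convolution with the free kernel. -/
theorem hasDerivAt_conv_dker {k : ℂ} (hk : k ∈ UH) {g : ℝ → ℂ} (hg : Integrable g)
    (hi : Integrable fun y => ((1 + |y| : ℝ) : ℂ) * g y) (x : ℝ) :
    HasDerivAt (fun x => ∫ y, dker k (max (y - x) 0) * g y)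
      (-∫ y in Set.Ioi x, Complex.exp (2 * Complex.I * k * ((y - x : ℝ) : ℂ)) * g y) x := by
  have hdc := (kerBd_dker hk).cont
  have hlip : ∀ s ∈ Set.Ici (0 : ℝ), ∀ t ∈ Set.Ici (0 : ℝ), ‖dker k t - dker k s‖ ≤ 1 * ‖t - s‖ :=
    fun s hs t ht => Convex.norm_image_sub_le_of_norm_hasDerivWithin_le
      (fun u _ => (hasDerivAt_dker k u).hasDerivWithinAt) (fun u hu => norm_exp_le hk hu)
      (convex_Ici 0) hs ht
  have hmeas : ∀ z, AEStronglyMeasurable (fun y => dker k (max (y - z) 0) * g y) volume := fun z =>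
    (Continuous.aestronglyMeasurable (by fun_prop)).mul hg.aestronglyMeasurable
  have hFint : Integrable (fun y => dker k (max (y - x) 0) * g y) volume := by
    refine (hi.norm.const_mul (1 + |x|)).mono' (hmeas x) (Eventually.of_forall fun y => ?_)
    rw [norm_mul, norm_mul, Complex.norm_real, Real.norm_of_nonneg (by positivity)]
    have h1 := norm_dker_le hk (le_max_right (y - x) 0)
    have h2 := one_add_max_le x y
    calc _ ≤ ((1 + |x|) * (1 + |y|)) * ‖g y‖ := by gcongr; linarith
      _ = _ := by ring
  have key := hasDerivAt_integral_of_dominated_loc_of_lip (μ := volume) (𝕜 := ℝ)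
    (F := fun x y => dker k (max (y - x) 0) * g y) (x₀ := x) (s := Set.univ)
    (bound := fun y => ‖g y‖)
    (F' := (Set.Ioi x).indicator
      (fun y => -(Complex.exp (2 * Complex.I * k * ((y - x : ℝ) : ℂ)) * g y)))
    univ_mem (Eventually.of_forall hmeas) hFint ?_ ?_ hg.norm ?_
  · have := key.2
    rw [integral_indicator measurableSet_Ioi, integral_neg] at this
    exact this
  · refine AEStronglyMeasurable.indicator ?_ measurableSet_Ioi
    exact ((Continuous.aestronglyMeasurable (by fun_prop)).mul hg.aestronglyMeasurable).neg
  -- The integrand is Lipschitz in `x` although `max (y - x) 0` is not differentiable at `x = y`,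
  -- which is a null set of `y`.
  · refine Eventually.of_forall fun y => LipschitzOnWith.of_dist_le_mul fun s _ t _ => ?_
    rw [dist_eq_norm, dist_eq_norm, ← sub_mul, norm_mul, Real.coe_nnabs, abs_norm, mul_comm]
    refine mul_le_mul_of_nonneg_left ((hlip _ (Set.mem_Ici.2 (le_max_right _ _)) _ (Set.mem_Ici.2 (le_max_right _ _))).trans ?_)
      (norm_nonneg _)
    rw [one_mul, Real.norm_eq_abs, Real.norm_eq_abs]
    refine (abs_max_sub_max_le_abs _ _ _).trans ?_
    rw [show y - s - (y - t) = -(s - t) by ring, abs_neg]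
  · have : ∀ᵐ y : ℝ, y ≠ x := by simp [ae_iff]
    filter_upwards [this] with y hy
    rcases lt_or_gt_of_ne hy with h | h
    · rw [Set.indicator_of_notMem (by simpa using h.le)]
      have : (fun z => dker k (max (y - z) 0) * g y) =ᶠ[𝓝 x] fun _ => 0 := by
        filter_upwards [lt_mem_nhds h] with z hz
        rw [max_eq_right (by linarith), dker_zero, zero_mul]
      exact (hasDerivAt_const x (0 : ℂ)).congr_of_eventuallyEq this
    · rw [Set.indicator_of_mem (by simpa using h)]
      have : (fun z => dker k (max (y - z) 0) * g y) =ᶠ[𝓝 x] fun z => dker k (y - z) * g y := by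
        filter_upwards [gt_mem_nhds h] with z hz
        rw [max_eq_left (by linarith)]
      refine HasDerivAt.congr_of_eventuallyEq ?_ this
      have h2 : HasDerivAt (fun z => dker k (y - z))
          (-Complex.exp (2 * Complex.I * k * ((y - x : ℝ) : ℂ))) x := by
        have := (hasDerivAt_dker k (y - x)).scomp x ((hasDerivAt_id x).const_sub y)
        simpa [Function.comp_def] using this
      simpa using h2.mul_const (g y)

/-- The algebraic relation between the free kernel and its derivative. -/
theorem two_I_mul_conv_dker {k : ℂ} (hk : k ∈ UH) {g : ℝ → ℂ} (hg : Integrable g) (x : ℝ) :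
    2 * Complex.I * k * ∫ y, dker k (max (y - x) 0) * g y =
      (∫ y in Set.Ioi x, Complex.exp (2 * Complex.I * k * ((y - x : ℝ) : ℂ)) * g y) - tail g x := by
  have hi : IntegrableOn (fun y => Complex.exp (2 * Complex.I * k * ((y - x : ℝ) : ℂ)) * g y)
      (Set.Ioi x) := by
    refine Integrable.mono' hg.norm.integrableOn
      ((Continuous.aestronglyMeasurable (by fun_prop)).mul hg.aestronglyMeasurable.restrict) ?_
    filter_upwards [ae_restrict_mem measurableSet_Ioi] with y hy
    rw [norm_mul]
    exact mul_le_of_le_one_left (norm_nonneg _)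
      (norm_exp_le hk (u := y - x) (by simpa using (Set.mem_Ioi.1 hy).le))
  rw [tail, ← integral_sub hi hg.integrableOn, ← integral_const_mul,
    ← integral_indicator measurableSet_Ioi]
  refine integral_congr_ae (Eventually.of_forall fun y => ?_)
  by_cases hy : x < y
  · simp only [Set.indicator_of_mem (Set.mem_Ioi.2 hy), max_eq_left (sub_nonneg.2 hy.le)]
    rw [← mul_assoc, two_I_mul_dker]
    ring
  · rw [Set.indicator_of_notMem (by simpa using hy)]
    simp only [max_eq_right (sub_nonpos.2 (not_lt.1 hy)), dker_zero, zero_mul, mul_zero]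

/-! ### Jost solutions -/

theorem integrable_pow_mul_abs (V : 𝓢(ℝ, ℝ)) (N : ℕ) :
    Integrable fun y => (1 + |y|) ^ N * |V y| := by
  have h0 := V.integrable_pow_mul volume 0
  have hN := V.integrable_pow_mul volume N
  refine ((h0.add hN).const_mul (2 ^ (N - 1))).mono'
    (Continuous.aestronglyMeasurable (by fun_prop)) (Eventually.of_forall fun y => ?_)
  rw [Real.norm_of_nonneg (by positivity)]
  have := add_pow_le zero_le_one (abs_nonneg y) N
  simp only [Pi.add_apply, Real.norm_eq_abs, pow_zero, one_pow] at *
  calc _ ≤ 2 ^ (N - 1) * (1 + |y| ^ N) * |V y| := by gcongr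
    _ = _ := by ring

/-- The majorant of the potential used in the Volterra equation for the Jost solution. -/
def rho (V : 𝓢(ℝ, ℝ)) (y : ℝ) : ℝ := (1 + |y|) ^ 6 * |V y|

theorem voltData (V : 𝓢(ℝ, ℝ)) : VoltData V (rho V) where
  meas := V.continuous.measurable
  cont := by unfold rho; fun_prop
  int := integrable_pow_mul_abs V 6
  bound := fun _ => le_rfl

/-- The weighted form of the constant function `1`. -/
def wtInv (V : 𝓢(ℝ, ℝ)) : ℝ →ᵇ ℂ :=
  BoundedContinuousFunction.ofNormedAddCommGroup (fun x => ((wt (rho V) x)⁻¹ : ℂ))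
    ((Complex.continuous_ofReal.comp (voltData V).continuous_wt).inv₀ fun x => wt_ne _ x) 1
    (fun x => by
      rw [norm_inv, Complex.norm_real, Real.norm_of_nonneg (wt_pos _ x).le]
      refine inv_le_one_of_one_le₀ (le_trans ?_ ((voltData V).le_wt x))
      exact one_le_pow₀ (by linarith [abs_nonneg x]))

theorem norm_wtInv_le (V : 𝓢(ℝ, ℝ)) : ‖wtInv V‖ ≤ 1 :=
  BoundedContinuousFunction.norm_ofNormedAddCommGroup_le _ zero_le_one _

theorem wt_mul_wtInv (V : 𝓢(ℝ, ℝ)) (x : ℝ) : (wt (rho V) x : ℂ) * wtInv V x = 1 :=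
  mul_inv_cancel₀ (wt_ne _ x)

/-- The weighted solution of the Volterra equation for the Jost solution. -/
def jsol (V : 𝓢(ℝ, ℝ)) (k : ℂ) : ℝ →ᵇ ℂ := volSol V (rho V) k (wtInv V)

/-- The function `m₊(x, k) = e^{-ikx} f₊(x, k)`, for `Im k ≥ 0`. -/
def mP (V : 𝓢(ℝ, ℝ)) (k : ℂ) (x : ℝ) : ℂ := (wt (rho V) x : ℂ) * jsol V k x

/-- The derivative of `m₊` in `x`. -/
def mP' (V : 𝓢(ℝ, ℝ)) (k : ℂ) (x : ℝ) : ℂ :=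
  2 * Complex.I * k * (1 - mP V k x) - tail (fun y => (V y : ℂ) * mP V k y) x

theorem exists_norm_mP_le (V : 𝓢(ℝ, ℝ)) :
    ∃ C : ℝ, 0 < C ∧ ∀ k ∈ UH, ∀ x, ‖mP V k x‖ ≤ C * (1 + |x|) := by
  have h6 : 0 ≤ ∫ y, rho V y := integral_nonneg (voltData V).rho_nonneg
  refine ⟨1 + Real.exp (2 * ∫ y, rho V y) * (2 * ‖wtInv V‖) * ∫ y, rho V y, by positivity,
    fun k hk x => norm_wt_mul_volSol_le (voltData V) hk (A := 1) (fun x => ?_) x⟩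
  rw [wt_mul_wtInv]
  simp

theorem continuous_mP (V : 𝓢(ℝ, ℝ)) (k : ℂ) : Continuous (mP V k) :=
  (Complex.continuous_ofReal.comp (voltData V).continuous_wt).mul (jsol V k).continuous

theorem integrable_pow_mul_V_mul {V : 𝓢(ℝ, ℝ)} {m : ℝ → ℂ} (hm : Continuous m) {C : ℝ} {N : ℕ}
    (h : ∀ x, ‖m x‖ ≤ C * (1 + |x|) ^ N) (j : ℕ) :
    Integrable fun y => (((1 + |y|) ^ j : ℝ) : ℂ) * ((V y : ℂ) * m y) := by
  refine ((integrable_pow_mul_abs V (j + N)).const_mul C).mono'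
    (Continuous.aestronglyMeasurable ?_) (Eventually.of_forall fun y => ?_)
  · have := V.continuous
    fun_prop
  · rw [norm_mul, norm_mul, Complex.norm_real, Complex.norm_real,
      Real.norm_of_nonneg (by positivity), Real.norm_eq_abs]
    calc _ ≤ (1 + |y|) ^ j * (|V y| * (C * (1 + |y|) ^ N)) := by gcongr; exact h y
      _ = _ := by rw [pow_add]; ring

theorem integrable_pow_mul_V_mul_mP (V : 𝓢(ℝ, ℝ)) {k : ℂ} (hk : k ∈ UH) (j : ℕ) :
    Integrable fun y => (((1 + |y|) ^ j : ℝ) : ℂ) * ((V y : ℂ) * mP V k y) := by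
  obtain ⟨C, -, hC⟩ := exists_norm_mP_le V
  exact integrable_pow_mul_V_mul (continuous_mP V k) (N := 1) (by simpa using hC k hk) j

theorem integrable_V_mul_mP (V : 𝓢(ℝ, ℝ)) {k : ℂ} (hk : k ∈ UH) :
    Integrable fun y => (V y : ℂ) * mP V k y := by
  simpa using integrable_pow_mul_V_mul_mP V hk 0

theorem mP_eq (V : 𝓢(ℝ, ℝ)) {k : ℂ} (hk : k ∈ UH) (x : ℝ) :
    mP V k x = 1 + ∫ y, dker k (max (y - x) 0) * ((V y : ℂ) * mP V k y) := by
  have h := volSol_eq (voltData V) hk (wtInv V)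
  have h2 := congrArg (fun v : ℝ →ᵇ ℂ => (wt (rho V) x : ℂ) * v x) h
  simp only [BoundedContinuousFunction.coe_add, Pi.add_apply, mul_add] at h2
  rw [wt_mul_wtInv, wt_mul_volOp (voltData V) (kerBd_dker hk)] at h2
  exact h2

theorem mP'_eq (V : 𝓢(ℝ, ℝ)) {k : ℂ} (hk : k ∈ UH) (x : ℝ) :
    mP' V k x = -∫ y in Set.Ioi x,
      Complex.exp (2 * Complex.I * k * ((y - x : ℝ) : ℂ)) * ((V y : ℂ) * mP V k y) := by
  have h := two_I_mul_conv_dker hk (integrable_V_mul_mP V hk) x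
  rw [mP', mP_eq V hk x]
  linear_combination -h

theorem hasDerivAt_mP (V : 𝓢(ℝ, ℝ)) {k : ℂ} (hk : k ∈ UH) (x : ℝ) :
    HasDerivAt (mP V k) (mP' V k x) x := by
  have h := (hasDerivAt_conv_dker hk (integrable_V_mul_mP V hk)
    (by simpa using integrable_pow_mul_V_mul_mP V hk 1) x).const_add 1
  rw [← mP'_eq V hk] at h
  exact h.congr_of_eventuallyEq (Eventually.of_forall fun y => mP_eq V hk y)

theorem hasDerivAt_mP' (V : 𝓢(ℝ, ℝ)) {k : ℂ} (hk : k ∈ UH) (x : ℝ) :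
    HasDerivAt (mP' V k) ((V x : ℂ) * mP V k x - 2 * Complex.I * k * mP' V k x) x := by
  have h1 := ((hasDerivAt_mP V hk x).const_sub 1).const_mul (2 * Complex.I * k)
  have h2 := hasDerivAt_tail (integrable_V_mul_mP V hk)
    (by have := V.continuous; have := continuous_mP V k; fun_prop) x
  exact (h1.sub h2).congr_deriv (by ring)

/-- On the right half-line, `m₊` tends to `1` and its derivative to `0`, at a rate that is uniform
in the spectral parameter. -/
theorem exists_mP_decay (V : 𝓢(ℝ, ℝ)) : ∃ C : ℝ, 0 < C ∧ ∀ k ∈ UH, ∀ x, 0 ≤ x →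
    ‖mP V k x - 1‖ ≤ C * (1 + x)⁻¹ ∧ ‖mP' V k x‖ ≤ C * ((1 + x)⁻¹) ^ 2 := by
  obtain ⟨C, hC0, hC⟩ := exists_norm_mP_le V
  have hI := integrable_pow_mul_abs V 3
  have hI0 : 0 ≤ ∫ y, (1 + |y|) ^ 3 * |V y| := integral_nonneg fun y => by positivity
  refine ⟨C * (∫ y, (1 + |y|) ^ 3 * |V y|) + 1, by positivity, fun k hk x hx => ?_⟩
  have hb : ∀ y, ‖(V y : ℂ) * mP V k y‖ ≤ |V y| * (C * (1 + |y|)) := fun y => by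
    rw [norm_mul, Complex.norm_real, Real.norm_eq_abs]
    gcongr
    exact hC k hk y
  have hx1 : (0 : ℝ) < 1 + x := by linarith
  constructor
  · rw [mP_eq V hk, add_sub_cancel_left]
    have : ∀ y, ‖dker k (max (y - x) 0) * ((V y : ℂ) * mP V k y)‖ ≤
        C * (1 + x)⁻¹ * ((1 + |y|) ^ 3 * |V y|) := fun y => by
      -- For `y > x` one power of `(1 + y) / (1 + x) ≥ 1` is inserted to gain the decay in `x`.
      by_cases hy : x < y
      · have h1 := norm_dker_le hk (le_max_right (y - x) 0)
        rw [max_eq_left (by linarith)] at h1 ⊢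
        have hy0 : 0 < y := hx.trans_lt hy
        rw [norm_mul, abs_of_pos hy0]
        have hb' := hb y
        rw [abs_of_pos hy0] at hb'
        have h2 : 1 ≤ (1 + x)⁻¹ * (1 + y) := by
          rw [← div_eq_inv_mul, one_le_div hx1]; linarith
        calc _ ≤ (1 + y) * (|V y| * (C * (1 + y))) := by
              gcongr; linarith
          _ ≤ (1 + y) * (|V y| * (C * (1 + y))) * ((1 + x)⁻¹ * (1 + y)) :=
              le_mul_of_one_le_right (by positivity) h2
          _ = _ := by ring
      · rw [max_eq_right (by linarith), dker_zero, zero_mul, norm_zero]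
        positivity
    refine (norm_integral_le_of_norm_le (hI.const_mul _) (Eventually.of_forall this)).trans ?_
    rw [integral_const_mul]
    have : 0 < (1 + x)⁻¹ := by positivity
    nlinarith
  · rw [mP'_eq V hk, norm_neg]
    have : ∀ᵐ y ∂(volume.restrict (Set.Ioi x)),
        ‖Complex.exp (2 * Complex.I * k * ((y - x : ℝ) : ℂ)) * ((V y : ℂ) * mP V k y)‖ ≤
        C * ((1 + x)⁻¹) ^ 2 * ((1 + |y|) ^ 3 * |V y|) := by
      filter_upwards [ae_restrict_mem measurableSet_Ioi] with y hy
      have hy' : x < y := hy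
      have hy0 : 0 < y := hx.trans_lt hy'
      have h1 := norm_exp_le hk (u := y - x) (by linarith)
      have hb' := hb y
      rw [abs_of_pos hy0] at hb'
      have h2 : 1 ≤ (1 + x)⁻¹ * (1 + y) := by
        rw [← div_eq_inv_mul, one_le_div hx1]; linarith
      rw [norm_mul, abs_of_pos hy0]
      calc _ ≤ 1 * (|V y| * (C * (1 + y))) := by gcongr
        _ ≤ 1 * (|V y| * (C * (1 + y))) * ((1 + x)⁻¹ * (1 + y)) ^ 2 :=
            le_mul_of_one_le_right (by positivity) (one_le_pow₀ h2)
        _ = _ := by ring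
    refine (norm_integral_le_of_norm_le (hI.const_mul _).integrableOn this).trans ?_
    rw [integral_const_mul]
    have h3 : ∫ y in Set.Ioi x, (1 + |y|) ^ 3 * |V y| ≤ ∫ y, (1 + |y|) ^ 3 * |V y| :=
      setIntegral_le_integral hI (Eventually.of_forall fun y => by positivity)
    have : 0 < ((1 + x)⁻¹) ^ 2 := by positivity
    calc _ ≤ C * ((1 + x)⁻¹) ^ 2 * ∫ y, (1 + |y|) ^ 3 * |V y| := by gcongr
      _ ≤ _ := by nlinarith

/-! #### Dependence on the spectral parameter -/

theorem exists_hasDerivWithinAt_jsol (V : 𝓢(ℝ, ℝ)) {k : ℂ} (hk : k ∈ UH) :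
    ∃ u' : ℝ →ᵇ ℂ, HasDerivWithinAt (fun l => jsol V l) u' UH k ∧
      u' = 0 + volOp V (rho V) (dker' k) (jsol V k) + volOp V (rho V) (dker k) u' :=
  exists_hasDerivWithinAt_volSol (voltData V) hk (hasDerivWithinAt_const k UH (wtInv V))

open Classical in
/-- The derivative of `jsol` in the spectral parameter. -/
def jsolk (V : 𝓢(ℝ, ℝ)) (k : ℂ) : ℝ →ᵇ ℂ :=
  if hk : k ∈ UH then (exists_hasDerivWithinAt_jsol V hk).choose else 0

/-- The derivative of `m₊` in the spectral parameter. -/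
def mPk (V : 𝓢(ℝ, ℝ)) (k : ℂ) (x : ℝ) : ℂ := (wt (rho V) x : ℂ) * jsolk V k x

theorem hasDerivWithinAt_jsol (V : 𝓢(ℝ, ℝ)) {k : ℂ} (hk : k ∈ UH) :
    HasDerivWithinAt (fun l => jsol V l) (jsolk V k) UH k := by
  rw [jsolk, dif_pos hk]
  exact (exists_hasDerivWithinAt_jsol V hk).choose_spec.1

theorem continuousOn_jsol (V : 𝓢(ℝ, ℝ)) : ContinuousOn (jsol V) UH :=
  fun _ hk => (hasDerivWithinAt_jsol V hk).continuousWithinAt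

theorem hasDerivWithinAt_mP (V : 𝓢(ℝ, ℝ)) {k : ℂ} (hk : k ∈ UH) (x : ℝ) :
    HasDerivWithinAt (fun l => mP V l x) (mPk V k x) UH k := by
  have h := ((BoundedContinuousFunction.evalCLM ℂ x).hasFDerivAt).comp_hasDerivWithinAt k
    (hasDerivWithinAt_jsol V hk)
  exact h.const_mul _

theorem exists_norm_mPk_le (V : 𝓢(ℝ, ℝ)) :
    ∃ C : ℝ, 0 < C ∧ ∀ k ∈ UH, ∀ x, ‖mPk V k x‖ ≤ C * (1 + |x|) ^ 2 := by
  have h6 : 0 ≤ ∫ y, rho V y := integral_nonneg (voltData V).rho_nonneg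
  refine ⟨1 + 2 * (Real.exp (2 * ∫ y, rho V y) * (2 * 1)) * (∫ y, rho V y) +
      Real.exp (2 * ∫ y, rho V y) * (2 * (1 + 2 * 1)) * ∫ y, rho V y, by positivity,
      fun k hk x => ?_⟩
  have h : jsolk V k = 0 + volOp V (rho V) (dker' k) (jsol V k) +
      volOp V (rho V) (dker k) (jsolk V k) := by
    rw [jsolk, dif_pos hk]
    exact (exists_hasDerivWithinAt_jsol V hk).choose_spec.2
  exact norm_wt_mul_deriv_volSol_le (voltData V) hk (a' := 0)
    (fun x => by simp; positivity) (norm_wtInv_le V) (by simp) h x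

theorem continuous_mPk (V : 𝓢(ℝ, ℝ)) (k : ℂ) : Continuous (mPk V k) :=
  (Complex.continuous_ofReal.comp (voltData V).continuous_wt).mul (jsolk V k).continuous

/-! ### Solutions of the stationary equation and their Wronskians -/

/-- `f`, with derivative `f'`, is a classical solution of `-f'' + V f = k² f`. -/
structure IsSol (V : 𝓢(ℝ, ℝ)) (k : ℂ) (f f' : ℝ → ℂ) : Prop where
  hasDeriv : ∀ x, HasDerivAt f (f' x) x
  hasDeriv' : ∀ x, HasDerivAt f' (((V x : ℂ) - k ^ 2) * f x) x

namespace IsSol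

variable {V : 𝓢(ℝ, ℝ)} {k : ℂ} {f f' g g' : ℝ → ℂ}

theorem continuous (hf : IsSol V k f f') : Continuous f :=
  continuous_iff_continuousAt.2 fun x => (hf.hasDeriv x).continuousAt

theorem continuous' (hf : IsSol V k f f') : Continuous f' :=
  continuous_iff_continuousAt.2 fun x => (hf.hasDeriv' x).continuousAt

theorem sub_smul (hf : IsSol V k f f') (hg : IsSol V k g g') (c : ℂ) :
    IsSol V k (fun x => f x - c * g x) (fun x => f' x - c * g' x) where
  hasDeriv := fun x => (hf.hasDeriv x).sub ((hg.hasDeriv x).const_mul c)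
  hasDeriv' := fun x => ((hf.hasDeriv' x).sub ((hg.hasDeriv' x).const_mul c)).congr_deriv (by ring)

theorem wronskian_const (hf : IsSol V k f f') (hg : IsSol V k g g') (x y : ℝ) :
    f' x * g x - f x * g' x = f' y * g y - f y * g' y := by
  have hd : ∀ x, HasDerivAt (fun x => f' x * g x - f x * g' x) 0 x := fun x =>
    (((hf.hasDeriv' x).mul (hg.hasDeriv x)).sub ((hf.hasDeriv x).mul (hg.hasDeriv' x))).congr_deriv (by ring)
  exact is_const_of_deriv_eq_zero (fun x => (hd x).differentiableAt) (fun x => (hd x).deriv) x y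

theorem exists_bound (V : 𝓢(ℝ, ℝ)) : ∃ M : ℝ, 0 ≤ M ∧ ∀ x, |V x| ≤ M := by
  refine ⟨‖V.toBoundedContinuousFunction‖, norm_nonneg _, fun x => ?_⟩
  exact V.toBoundedContinuousFunction.norm_coe_le_norm x

/-- Uniqueness for the initial value problem. -/
theorem eq_zero (hf : IsSol V k f f') {x₀ : ℝ} (h0 : f x₀ = 0) (h1 : f' x₀ = 0) : f = 0 := by
  obtain ⟨M, hM0, hM⟩ := exists_bound V
  let v : ℝ → ℂ × ℂ → ℂ × ℂ := fun t p => (p.2, ((V t : ℂ) - k ^ 2) * p.1)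
  have hv : ∀ t, LipschitzOnWith (Real.toNNReal (1 + (M + ‖k‖ ^ 2))) (v t) Set.univ := fun t => by
    refine LipschitzOnWith.of_dist_le_mul fun p _ p' _ => ?_
    rw [Real.coe_toNNReal _ (by positivity), dist_eq_norm, dist_eq_norm]
    have e : v t p - v t p' = ((p - p').2, ((V t : ℂ) - k ^ 2) * (p - p').1) := by
      simp only [v, Prod.mk_sub_mk, Prod.fst_sub, Prod.snd_sub, mul_sub]
    rw [e, Prod.norm_mk]
    have h2 := norm_snd_le (p - p')
    have h1 := norm_fst_le (p - p')
    have h3 : ‖(V t : ℂ) - k ^ 2‖ ≤ M + ‖k‖ ^ 2 := by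
      refine (norm_sub_le _ _).trans ?_
      rw [norm_pow, Complex.norm_real]
      exact add_le_add_left (hM t) _
    have h4 := norm_nonneg (p - p')
    refine max_le ?_ ?_
    · nlinarith [sq_nonneg ‖k‖, mul_nonneg (add_nonneg hM0 (sq_nonneg ‖k‖)) h4]
    · rw [norm_mul]
      calc _ ≤ (M + ‖k‖ ^ 2) * ‖p - p'‖ := by gcongr
        _ ≤ _ := by nlinarith
  have := ODE_solution_unique_univ (v := v) (s := fun _ => Set.univ) (f := fun x => (f x, f' x))
    (g := fun _ => 0) (t₀ := x₀) hv
    (fun t => ⟨(hf.hasDeriv t).prodMk (hf.hasDeriv' t), Set.mem_univ _⟩)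
    (fun t => ⟨(hasDerivAt_const t (0 : ℂ × ℂ)).congr_deriv (by simp [v]; rfl), Set.mem_univ _⟩)
    (by simp [h0, h1])
  funext x
  exact congrArg Prod.fst (congrFun this x)

/-- Two solutions with vanishing Wronskian are proportional. -/
theorem exists_smul (hf : IsSol V k f f') (hg : IsSol V k g g') (hg0 : g ≠ 0) {x₀ : ℝ}
    (hW : f' x₀ * g x₀ - f x₀ * g' x₀ = 0) : ∃ c : ℂ, f = fun x => c * g x := by
  have key : ∃ c : ℂ, f x₀ - c * g x₀ = 0 ∧ f' x₀ - c * g' x₀ = 0 := by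
    by_cases h0 : g x₀ = 0
    · have h1 : g' x₀ ≠ 0 := fun h1 => hg0 (hg.eq_zero h0 h1)
      refine ⟨f' x₀ / g' x₀, ?_, by field_simp; ring⟩
      rw [h0] at hW ⊢
      have : f x₀ * g' x₀ = 0 := by linear_combination -hW
      rcases mul_eq_zero.1 this with h | h
      · simp [h]
      · exact absurd h h1
    · refine ⟨f x₀ / g x₀, by field_simp; ring, ?_⟩
      field_simp
      linear_combination hW
  obtain ⟨c, h1, h2⟩ := key
  refine ⟨c, funext fun x => ?_⟩
  have := congrFun ((hf.sub_smul hg c).eq_zero h1 h2) x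
  simpa [sub_eq_zero] using this

end IsSol

theorem isSol_of_isSolution {V : 𝓢(ℝ, ℝ)} {ξ : ℝ} {f : ℝ → ℂ} (h : IsSolution V ξ f) :
    IsSol V ξ f (deriv f) where
  hasDeriv := fun x => ((h.1.differentiable (by norm_num)) x).hasDerivAt
  hasDeriv' := fun x => by
    have h1 : ContDiff ℝ 1 (deriv f) := by
      have : ContDiff ℝ (1 + 1) f := h.1
      exact (contDiff_succ_iff_deriv.1 this).2.2
    have h2 := ((h1.differentiable (by norm_num)) x).hasDerivAt
    refine h2.congr_deriv ?_
    linear_combination -h.2 x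

theorem IsSol.isSolution {V : 𝓢(ℝ, ℝ)} {ξ : ℝ} {f f' : ℝ → ℂ} (h : IsSol V ξ f f') :
    IsSolution V ξ f := by
  have e1 : deriv f = f' := funext fun x => (h.hasDeriv x).deriv
  have e2 : deriv f' = fun x => ((V x : ℂ) - (ξ : ℂ) ^ 2) * f x :=
    funext fun x => (h.hasDeriv' x).deriv
  refine ⟨?_, fun x => ?_⟩
  · have : ContDiff ℝ (1 + 1) f := by
      rw [contDiff_succ_iff_deriv, e1]
      refine ⟨fun x => (h.hasDeriv x).differentiableAt, by simp, ?_⟩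
      rw [contDiff_one_iff_deriv, e2]
      refine ⟨fun x => (h.hasDeriv' x).differentiableAt, ?_⟩
      have := h.continuous
      have := V.continuous
      fun_prop
    exact this
  · rw [e1, e2]; ring

/-! ### Jost solutions at both ends -/

/-- The reflected potential `x ↦ V (-x)`. -/
def refl (V : 𝓢(ℝ, ℝ)) : 𝓢(ℝ, ℝ) :=
  SchwartzMap.compCLMOfContinuousLinearEquiv ℝ (ContinuousLinearEquiv.neg ℝ) V

@[simp]
theorem refl_apply (V : 𝓢(ℝ, ℝ)) (x : ℝ) : refl V x = V (-x) := rfl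

theorem refl_refl (V : 𝓢(ℝ, ℝ)) : refl (refl V) = V := by ext x; simp

/-- The Jost solution `f₊(x, k) = e^{ikx} m₊(x, k)`, for `Im k ≥ 0`. -/
def fP (V : 𝓢(ℝ, ℝ)) (k : ℂ) (x : ℝ) : ℂ := Complex.exp (Complex.I * k * x) * mP V k x

/-- The derivative of `f₊` in `x`. -/
def fP' (V : 𝓢(ℝ, ℝ)) (k : ℂ) (x : ℝ) : ℂ :=
  Complex.exp (Complex.I * k * x) * (Complex.I * k * mP V k x + mP' V k x)

/-- The Jost solution `f₋(x, k)`, which is the reflection of the Jost solution `f₊` of the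
reflected potential. -/
def fM (V : 𝓢(ℝ, ℝ)) (k : ℂ) (x : ℝ) : ℂ := fP (refl V) k (-x)

/-- The derivative of `f₋` in `x`. -/
def fM' (V : 𝓢(ℝ, ℝ)) (k : ℂ) (x : ℝ) : ℂ := -fP' (refl V) k (-x)

theorem hasDerivAt_cexp_mul (c : ℂ) (x : ℝ) :
    HasDerivAt (fun x : ℝ => Complex.exp (c * x)) (c * Complex.exp (c * x)) x := by
  have h1 : HasDerivAt (fun u : ℝ => c * (u : ℂ)) (c * 1) x :=
    (Complex.ofRealCLM.hasDerivAt (x := x)).const_mul _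
  exact h1.cexp.congr_deriv (by ring)

theorem isSol_fP (V : 𝓢(ℝ, ℝ)) {k : ℂ} (hk : k ∈ UH) : IsSol V k (fP V k) (fP' V k) where
  hasDeriv := fun x => ((hasDerivAt_cexp_mul _ x).mul (hasDerivAt_mP V hk x)).congr_deriv (by
    rw [fP']; ring)
  hasDeriv' := fun x => ((hasDerivAt_cexp_mul (Complex.I * k) x).mul
    (((hasDerivAt_mP V hk x).const_mul (Complex.I * k)).add (hasDerivAt_mP' V hk x))).congr_deriv
      (by
        simp only [fP, Pi.add_apply]
        linear_combination (Complex.exp (Complex.I * k * x) * k ^ 2 * mP V k x) * Complex.I_sq)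

theorem IsSol.reflect {V : 𝓢(ℝ, ℝ)} {k : ℂ} {f f' : ℝ → ℂ} (h : IsSol (refl V) k f f') :
    IsSol V k (fun x => f (-x)) (fun x => -f' (-x)) where
  hasDeriv := fun x => by
    have := (h.hasDeriv (-x)).scomp x (hasDerivAt_neg x)
    simpa [Function.comp_def] using this
  hasDeriv' := fun x => by
    have := ((h.hasDeriv' (-x)).scomp x (hasDerivAt_neg x)).neg
    exact this.congr_deriv (by simp)

theorem isSol_fM (V : 𝓢(ℝ, ℝ)) {k : ℂ} (hk : k ∈ UH) : IsSol V k (fM V k) (fM' V k) :=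
  (isSol_fP (refl V) hk).reflect

theorem tendsto_inv_one_add : Tendsto (fun x : ℝ => (1 + x)⁻¹) atTop (𝓝 0) :=
  tendsto_inv_atTop_zero.comp (tendsto_atTop_add_const_left _ _ tendsto_id)

theorem tendsto_mP (V : 𝓢(ℝ, ℝ)) {k : ℂ} (hk : k ∈ UH) : Tendsto (mP V k) atTop (𝓝 1) := by
  obtain ⟨C, -, hC⟩ := exists_mP_decay V
  rw [tendsto_iff_norm_sub_tendsto_zero]
  refine squeeze_zero' (Eventually.of_forall fun _ => norm_nonneg _) ?_
    (by simpa using tendsto_inv_one_add.const_mul C)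
  filter_upwards [eventually_ge_atTop 0] with x hx using (hC k hk x hx).1

theorem tendsto_mP' (V : 𝓢(ℝ, ℝ)) {k : ℂ} (hk : k ∈ UH) : Tendsto (mP' V k) atTop (𝓝 0) := by
  obtain ⟨C, -, hC⟩ := exists_mP_decay V
  rw [tendsto_zero_iff_norm_tendsto_zero]
  refine squeeze_zero' (Eventually.of_forall fun _ => norm_nonneg _) ?_
    (by simpa only [ne_eq, OfNat.ofNat_ne_zero, not_false_eq_true, zero_pow, mul_zero] using
      (tendsto_inv_one_add.pow 2).const_mul C)
  filter_upwards [eventually_ge_atTop 0] with x hx using (hC k hk x hx).2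

theorem fP_ne_zero (V : 𝓢(ℝ, ℝ)) {k : ℂ} (hk : k ∈ UH) : fP V k ≠ 0 := by
  intro h
  have h1 : mP V k = 0 := funext fun x => by
    have := congrFun h x
    simpa [fP] using this
  have h2 := tendsto_mP V hk
  rw [h1] at h2
  exact zero_ne_one (tendsto_nhds_unique tendsto_const_nhds h2)

theorem fM_ne_zero (V : 𝓢(ℝ, ℝ)) {k : ℂ} (hk : k ∈ UH) : fM V k ≠ 0 := fun h =>
  fP_ne_zero (refl V) hk (funext fun x => by simpa [fM] using congrFun h (-x))

/-- The Wronskian of the Jost solutions, `W(k) = 2ik - ∫ V m₊`. -/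
def Wr (V : 𝓢(ℝ, ℝ)) (k : ℂ) : ℂ := 2 * Complex.I * k - ∫ y, (V y : ℂ) * mP V k y

theorem tendsto_tail_atBot {f : ℝ → ℂ} (hf : Integrable f) :
    Tendsto (fun x => tail f (-x)) atTop (𝓝 (∫ y, f y)) := by
  have h := intervalIntegral_tendsto_integral_Iic (μ := volume) (0 : ℝ) hf.integrableOn
    tendsto_neg_atTop_atBot
  have h2 : Tendsto (fun x => tail f 0 + ∫ y in (-x)..0, f y) atTop
      (𝓝 (tail f 0 + ∫ y in Set.Iic 0, f y)) := tendsto_const_nhds.add h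
  have e : tail f 0 + ∫ y in Set.Iic 0, f y = ∫ y, f y := by
    rw [add_comm]
    exact intervalIntegral.integral_Iic_add_Ioi hf.integrableOn hf.integrableOn
  rw [e] at h2
  refine h2.congr fun x => ?_
  rw [tail_eq_sub hf 0 (-x), intervalIntegral.integral_symm 0 (-x)]
  ring

/-- The Wronskian identity is obtained by evaluating the constant Wronskian at `-∞`. -/
theorem wronskian_fP_fM (V : 𝓢(ℝ, ℝ)) {k : ℂ} (hk : k ∈ UH) (x : ℝ) :
    fP' V k x * fM V k x - fP V k x * fM' V k x = Wr V k := by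
  set w := fP' V k x * fM V k x - fP V k x * fM' V k x with hw
  have h : ∀ z : ℝ, w = (2 * Complex.I * k - tail (fun y => (V y : ℂ) * mP V k y) (-z)) *
      mP (refl V) k z + mP V k (-z) * mP' (refl V) k z := fun z => by
    rw [hw, (isSol_fP V hk).wronskian_const (isSol_fM V hk) x (-z)]
    have e : Complex.exp (Complex.I * k * ((-z : ℝ) : ℂ)) * Complex.exp (Complex.I * k * z) = 1 := by
      rw [← Complex.exp_add]
      simp
    simp only [fP, fP', fM, fM', neg_neg]
    have e2 : mP' V k (-z) = 2 * Complex.I * k * (1 - mP V k (-z)) -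
      tail (fun y => (V y : ℂ) * mP V k y) (-z) := rfl
    linear_combination (2 * Complex.I * k * mP V k (-z) * mP (refl V) k z +
      mP' V k (-z) * mP (refl V) k z + mP V k (-z) * mP' (refl V) k z) * e +
      mP (refl V) k z * e2
  -- As `z → ∞`, `m₊(-z)` may grow linearly, but `m₋'` decays quadratically.
  have h1 : Tendsto (fun z => (2 * Complex.I * k - tail (fun y => (V y : ℂ) * mP V k y) (-z)) *
      mP (refl V) k z + mP V k (-z) * mP' (refl V) k z) atTop (𝓝 (Wr V k * 1 + 0)) := by
    refine ((tendsto_const_nhds.sub (tendsto_tail_atBot (integrable_V_mul_mP V hk))).mul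
      (tendsto_mP (refl V) hk)).add ?_
    obtain ⟨C, hC0, hC⟩ := exists_norm_mP_le V
    obtain ⟨D, hD0, hD⟩ := exists_mP_decay (refl V)
    rw [tendsto_zero_iff_norm_tendsto_zero]
    refine squeeze_zero' (Eventually.of_forall fun _ => norm_nonneg _) ?_
      (by simpa using tendsto_inv_one_add.const_mul (C * D))
    filter_upwards [eventually_ge_atTop 0] with z hz
    have h2 := hC k hk (-z)
    have h3 := (hD k hk z hz).2
    rw [abs_neg, abs_of_nonneg hz] at h2
    rw [norm_mul]
    have hz1 : (0 : ℝ) < 1 + z := by linarith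
    calc _ ≤ C * (1 + z) * (D * ((1 + z)⁻¹) ^ 2) := by gcongr
      _ = _ := by field_simp
  have h4 : Tendsto (fun _ : ℝ => w) atTop (𝓝 (Wr V k * 1 + 0)) := h1.congr fun z => (h z).symm
  simpa using tendsto_nhds_unique tendsto_const_nhds h4

theorem Wr_refl (V : 𝓢(ℝ, ℝ)) {k : ℂ} (hk : k ∈ UH) : Wr (refl V) k = Wr V k := by
  rw [← wronskian_fP_fM V hk 0, ← wronskian_fP_fM (refl V) hk 0]
  simp only [fM, fM', refl_refl, neg_zero]
  ring

/-! #### Real frequencies -/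

/-- On the real axis, complex conjugation reverses the frequency, by uniqueness for the Volterra
equation. -/
theorem star_mP (V : 𝓢(ℝ, ℝ)) (ξ : ℝ) (x : ℝ) :
    mP V ((-ξ : ℝ) : ℂ) x = starRingEnd ℂ (mP V ξ x) := by
  have hξ := ofReal_mem_UH ξ
  have hξ' := ofReal_mem_UH (-ξ)
  have hd : ∀ s : ℝ, dker ((-ξ : ℝ) : ℂ) s = starRingEnd ℂ (dker ξ s) := fun s => by
    have : ∀ f : ℝ → ℂ, starRingEnd ℂ (∫ u in (0 : ℝ)..s, f u) =
        ∫ u in (0 : ℝ)..s, starRingEnd ℂ (f u) := fun f => by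
      simp only [intervalIntegral, map_sub, ← integral_conj]
    rw [dker, dker, this]
    refine intervalIntegral.integral_congr fun u _ => ?_
    simp only [← Complex.exp_conj, map_mul, Complex.conj_ofReal, Complex.conj_I, map_ofNat]
    push_cast
    ring_nf
  have h : star (jsol V ξ) = jsol V ((-ξ : ℝ) : ℂ) := by
    refine volSol_unique (voltData V) hξ' ?_
    ext y
    have h1 := congrArg (fun v : ℝ →ᵇ ℂ => starRingEnd ℂ (v y)) (volSol_eq (voltData V) hξ (wtInv V))
    simp only [BoundedContinuousFunction.coe_add, Pi.add_apply, map_add] at h1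
    rw [volOp_apply (voltData V) (kerBd_dker hξ)] at h1
    simp only [BoundedContinuousFunction.coe_add, Pi.add_apply]
    rw [volOp_apply (voltData V) (kerBd_dker hξ')]
    refine h1.trans ?_
    congr 1
    · simp [wtInv]
    · rw [← integral_conj]
      refine integral_congr_ae (Eventually.of_forall fun z => ?_)
      simp only [vker, map_mul, Complex.conj_ofReal, hd]
      rfl
  rw [mP, ← h, mP, map_mul, Complex.conj_ofReal]
  rfl

theorem star_fP (V : 𝓢(ℝ, ℝ)) (ξ : ℝ) (x : ℝ) :
    fP V ((-ξ : ℝ) : ℂ) x = starRingEnd ℂ (fP V ξ x) := by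
  rw [fP, star_mP, fP, map_mul, ← Complex.exp_conj]
  simp

theorem star_fM (V : 𝓢(ℝ, ℝ)) (ξ : ℝ) (x : ℝ) :
    fM V ((-ξ : ℝ) : ℂ) x = starRingEnd ℂ (fM V ξ x) := star_fP _ _ _

theorem star_Wr (V : 𝓢(ℝ, ℝ)) (ξ : ℝ) : Wr V ((-ξ : ℝ) : ℂ) = starRingEnd ℂ (Wr V ξ) := by
  rw [Wr, Wr, map_sub, ← integral_conj]
  simp only [star_mP, map_mul, Complex.conj_ofReal, Complex.conj_I, map_ofNat]
  push_cast
  ring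

theorem IsSol.star {V : 𝓢(ℝ, ℝ)} {ξ : ℝ} {f f' : ℝ → ℂ} (h : IsSol V ξ f f') :
    IsSol V ξ (fun x => starRingEnd ℂ (f x)) (fun x => starRingEnd ℂ (f' x)) where
  hasDeriv := fun x => (h.hasDeriv x).star
  hasDeriv' := fun x => by
    have := (h.hasDeriv' x).star
    simpa using this

/-- The Wronskian of `f₊` and its conjugate, evaluated at `+∞`. -/
theorem wronskian_fP_star (V : 𝓢(ℝ, ℝ)) (ξ x : ℝ) :
    fP' V ξ x * starRingEnd ℂ (fP V ξ x) - fP V ξ x * starRingEnd ℂ (fP' V ξ x) =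
      2 * Complex.I * ξ := by
  have hk := ofReal_mem_UH ξ
  set w := fP' V ξ x * starRingEnd ℂ (fP V ξ x) - fP V ξ x * starRingEnd ℂ (fP' V ξ x) with hw
  have h : ∀ z : ℝ, w = (Complex.I * ξ * mP V ξ z + mP' V ξ z) * starRingEnd ℂ (mP V ξ z) -
      mP V ξ z * starRingEnd ℂ (Complex.I * ξ * mP V ξ z + mP' V ξ z) := fun z => by
    rw [hw, (isSol_fP V hk).wronskian_const (isSol_fP V hk).star x z]
    have e : Complex.exp (Complex.I * ξ * z) *
        starRingEnd ℂ (Complex.exp (Complex.I * ξ * z)) = 1 := by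
      rw [← Complex.exp_conj, ← Complex.exp_add]
      simp
    simp only [fP, fP', map_mul]
    linear_combination ((Complex.I * ξ * mP V ξ z + mP' V ξ z) * starRingEnd ℂ (mP V ξ z) -
      mP V ξ z * starRingEnd ℂ (Complex.I * ξ * mP V ξ z + mP' V ξ z)) * e
  have h1 : Tendsto (fun z => Complex.I * ξ * mP V ξ z + mP' V ξ z) atTop
      (𝓝 (Complex.I * ξ * 1 + 0)) := ((tendsto_mP V hk).const_mul _).add (tendsto_mP' V hk)
  have hc : ∀ z, Tendsto (starRingEnd ℂ) (𝓝 z) (𝓝 (starRingEnd ℂ z)) := fun z =>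
    Complex.continuous_conj.tendsto z
  have h2 := (h1.mul ((hc _).comp (tendsto_mP V hk))).sub
    ((tendsto_mP V hk).mul ((hc _).comp h1))
  have h3 : Tendsto (fun _ : ℝ => w) atTop _ := h2.congr fun z => (h z).symm
  rw [tendsto_nhds_unique tendsto_const_nhds h3]
  simp
  ring

theorem wronskian_fM_star (V : 𝓢(ℝ, ℝ)) (ξ x : ℝ) :
    fM' V ξ x * starRingEnd ℂ (fM V ξ x) - fM V ξ x * starRingEnd ℂ (fM' V ξ x) =
      -(2 * Complex.I * ξ) := by
  have := wronskian_fP_star (refl V) ξ (-x)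
  simp only [fM, fM', map_neg]
  linear_combination -this

/-- The coefficient `σ(ξ)`, the Wronskian of `conj f₊` and `f₋`; the ratio `σ / W` is a reflection
coefficient. -/
def sig (V : 𝓢(ℝ, ℝ)) (ξ : ℝ) : ℂ :=
  starRingEnd ℂ (fP' V ξ 0) * fM V ξ 0 - starRingEnd ℂ (fP V ξ 0) * fM' V ξ 0

theorem sig_eq (V : 𝓢(ℝ, ℝ)) (ξ x : ℝ) :
    starRingEnd ℂ (fP' V ξ x) * fM V ξ x - starRingEnd ℂ (fP V ξ x) * fM' V ξ x = sig V ξ :=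
  (isSol_fP V (ofReal_mem_UH ξ)).star.wronskian_const (isSol_fM V (ofReal_mem_UH ξ)) x 0

/-- The scattering relation expressing `conj f₊` by the fundamental system `f₊`, `f₋`. -/
theorem Wr_mul_star_fP (V : 𝓢(ℝ, ℝ)) (ξ x : ℝ) :
    Wr V ξ * starRingEnd ℂ (fP V ξ x) = 2 * Complex.I * ξ * fM V ξ x + sig V ξ * fP V ξ x := by
  rw [← wronskian_fP_fM V (ofReal_mem_UH ξ) x, ← wronskian_fP_star V ξ x, ← sig_eq V ξ x]
  ring

/-- The scattering relation expressing `conj f₋` by the fundamental system `f₊`, `f₋`. -/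
theorem Wr_mul_star_fM (V : 𝓢(ℝ, ℝ)) (ξ x : ℝ) :
    Wr V ξ * starRingEnd ℂ (fM V ξ x) =
      2 * Complex.I * ξ * fP V ξ x + starRingEnd ℂ (sig V ξ) * fM V ξ x := by
  have h : 2 * Complex.I * ξ = -(fM' V ξ x * starRingEnd ℂ (fM V ξ x) -
      fM V ξ x * starRingEnd ℂ (fM' V ξ x)) := by rw [wronskian_fM_star]; ring
  rw [h, ← wronskian_fP_fM V (ofReal_mem_UH ξ) x, ← sig_eq V ξ x]
  simp only [map_sub, map_mul, Complex.conj_conj]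
  ring

/-- Conservation of flux: transmission and reflection probabilities add up to `1`. -/
theorem normSq_Wr (V : 𝓢(ℝ, ℝ)) (ξ : ℝ) : ‖Wr V ξ‖ ^ 2 = 4 * ξ ^ 2 + ‖sig V ξ‖ ^ 2 := by
  have h1 := wronskian_fP_star V ξ 0
  have h2 := wronskian_fM_star V ξ 0
  have h : Wr V ξ * starRingEnd ℂ (Wr V ξ) =
      4 * (ξ : ℂ) ^ 2 + sig V ξ * starRingEnd ℂ (sig V ξ) := by
    rw [← wronskian_fP_fM V (ofReal_mem_UH ξ) 0, ← sig_eq V ξ 0]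
    simp only [map_sub, map_mul, Complex.conj_conj]
    linear_combination h1 * (fM' V ξ 0 * starRingEnd ℂ (fM V ξ 0) -
        fM V ξ 0 * starRingEnd ℂ (fM' V ξ 0)) + 2 * Complex.I * ξ * h2
        - 4 * (ξ : ℂ) ^ 2 * Complex.I_sq
  rw [Complex.mul_conj, Complex.mul_conj, Complex.normSq_eq_norm_sq, Complex.normSq_eq_norm_sq] at h
  exact_mod_cast h

theorem two_abs_le_norm_Wr (V : 𝓢(ℝ, ℝ)) (ξ : ℝ) : 2 * |ξ| ≤ ‖Wr V ξ‖ := by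
  refine le_of_sq_le_sq ?_ (norm_nonneg _) |>.trans le_rfl
  rw [normSq_Wr, mul_pow, sq_abs]
  nlinarith [sq_nonneg ‖sig V ξ‖]

theorem Wr_ne_zero (V : 𝓢(ℝ, ℝ)) {ξ : ℝ} (hξ : ξ ≠ 0) : Wr V ξ ≠ 0 := fun h => by
  have := two_abs_le_norm_Wr V ξ
  rw [h, norm_zero] at this
  exact hξ (abs_eq_zero.1 (le_antisymm (by linarith) (abs_nonneg ξ)))

/-! #### The Wronskian as a function of the spectral parameter -/

/-- Integration against a fixed integrable function is differentiable on bounded continuous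
functions. -/
theorem hasDerivWithinAt_integral_mul {h : ℝ → ℂ} (hh : Integrable h) {u : ℂ → ℝ →ᵇ ℂ}
    {u' : ℝ →ᵇ ℂ} {s : Set ℂ} {k : ℂ} (hu : HasDerivWithinAt u u' s k) :
    HasDerivWithinAt (fun l => ∫ y, h y * u l y) (∫ y, h y * u' y) s k := by
  have hi : ∀ v : ℝ →ᵇ ℂ, Integrable fun y => h y * v y := fun v => by
    simpa [mul_comm] using hh.bdd_mul (c := ‖v‖) v.continuous.aestronglyMeasurable
      (Eventually.of_forall v.norm_coe_le_norm)
  let L : (ℝ →ᵇ ℂ) →L[ℂ] ℂ := LinearMap.mkContinuous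
    { toFun := fun v => ∫ y, h y * v y
      map_add' := fun v w => by
        simp only [BoundedContinuousFunction.coe_add, Pi.add_apply, mul_add]
        exact integral_add (hi v) (hi w)
      map_smul' := fun c v => by
        simp only [BoundedContinuousFunction.coe_smul, smul_eq_mul, RingHom.id_apply,
          mul_left_comm _ c, integral_const_mul] }
    (∫ y, ‖h y‖) (fun v => by
      change ‖∫ y, h y * v y‖ ≤ _
      refine (norm_integral_le_of_norm_le (hh.norm.mul_const ‖v‖)
        (Eventually.of_forall fun y => ?_)).trans (integral_mul_const _ _).le
      rw [norm_mul]
      exact mul_le_mul_of_nonneg_left (v.norm_coe_le_norm y) (norm_nonneg _))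
  exact L.hasFDerivAt.comp_hasDerivWithinAt k hu

theorem integrable_V_mul_wt (V : 𝓢(ℝ, ℝ)) : Integrable fun y => (V y : ℂ) * (wt (rho V) y : ℂ) := by
  have h := (voltData V).continuous_wt
  have := integrable_pow_mul_V_mul (V := V) (m := fun y => (wt (rho V) y : ℂ))
    (C := Real.exp (2 * ∫ y, rho V y)) (N := 3) (by fun_prop) (fun x => by
      rw [Complex.norm_real, Real.norm_of_nonneg (wt_pos _ x).le]
      exact (voltData V).wt_le x) 0
  simpa using this

theorem hasDerivWithinAt_Wr (V : 𝓢(ℝ, ℝ)) {k : ℂ} (hk : k ∈ UH) :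
    HasDerivWithinAt (Wr V) (2 * Complex.I - ∫ y, (V y : ℂ) * mPk V k y) UH k := by
  have h := hasDerivWithinAt_integral_mul (integrable_V_mul_wt V) (hasDerivWithinAt_jsol V hk)
  simp only [mul_assoc] at h
  have h2 : HasDerivWithinAt (fun k : ℂ => 2 * Complex.I * k) (2 * Complex.I) UH k := by
    simpa using (hasDerivWithinAt_id k UH).const_mul (2 * Complex.I)
  exact h2.sub h

theorem continuousOn_Wr (V : 𝓢(ℝ, ℝ)) : ContinuousOn (Wr V) UH :=
  fun _ hk => (hasDerivWithinAt_Wr V hk).continuousWithinAt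

/-- The quotient `k / W(k)` has a limit at `0`, even if `W(0) = 0`: in that case the derivative of
`W` at `0` cannot vanish, because `|W(ξ)| ≥ 2 |ξ|` on the real line. -/
theorem exists_tendsto_div_Wr (V : 𝓢(ℝ, ℝ)) :
    ∃ c : ℂ, Tendsto (fun k => k / Wr V k) (𝓝[UH \ {0}] 0) (𝓝 c) := by
  have h0 : (0 : ℂ) ∈ UH := by simp [UH]
  have hd := hasDerivWithinAt_Wr V h0
  have hle : 𝓝[UH \ {0}] (0 : ℂ) ≤ 𝓝[UH] 0 := nhdsWithin_mono _ Set.sdiff_subset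
  by_cases hW : Wr V 0 = 0
  · rw [hasDerivWithinAt_iff_tendsto_slope] at hd
    set d := 2 * Complex.I - ∫ y, (V y : ℂ) * mPk V 0 y
    have hs : ∀ k : ℂ, slope (Wr V) 0 k = Wr V k / k := fun k => by
      rw [slope_def_field, hW, sub_zero, sub_zero]
    have hd0 : 2 ≤ ‖d‖ := by
      have h1 : Tendsto (fun n : ℕ => (((n : ℝ) + 1)⁻¹ : ℝ)) atTop (𝓝 0) := by
        simpa using tendsto_one_div_add_atTop_nhds_zero_nat (𝕜 := ℝ)
      have h2 : Tendsto (fun n : ℕ => ((((n : ℝ) + 1)⁻¹ : ℝ) : ℂ)) atTop (𝓝[UH \ {0}] 0) := by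
        refine tendsto_nhdsWithin_iff.2 ⟨?_, Eventually.of_forall fun n => ⟨ofReal_mem_UH _, ?_⟩⟩
        · exact (Complex.continuous_ofReal.tendsto' 0 0 (by simp)).comp h1
        · have : (((n : ℝ) + 1)⁻¹ : ℝ) ≠ 0 := by positivity
          exact fun h => this (Complex.ofReal_eq_zero.1 h)
      refine ge_of_tendsto ((hd.comp h2).norm) (Eventually.of_forall fun n => ?_)
      have h3 := two_abs_le_norm_Wr V (((n : ℝ) + 1)⁻¹ : ℝ)
      simp only [Function.comp, hs, norm_div]
      have h4 : (0 : ℝ) < ((n : ℝ) + 1)⁻¹ := by positivity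
      rw [Complex.norm_real, Real.norm_eq_abs, le_div_iff₀ (abs_pos.2 h4.ne')]
      exact h3
    refine ⟨d⁻¹, (hd.inv₀ (fun h => by rw [h, norm_zero] at hd0; linarith)).congr fun k => ?_⟩
    rw [hs, inv_div]
  · refine ⟨0 / Wr V 0, Tendsto.div ?_ (hd.continuousWithinAt.tendsto.mono_left hle) hW⟩
    exact tendsto_id.mono_left nhdsWithin_le_nhds

/-! ### Identification of the Jost solutions -/

/-- A solution that tends to `0` at `+∞` has a derivative tending to `0`, since its second
derivative tends to `0` as well. -/
theorem IsSol.tendsto_deriv {V : 𝓢(ℝ, ℝ)} {k : ℂ} {h h' : ℝ → ℂ} (hs : IsSol V k h h')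
    (h0 : Tendsto h atTop (𝓝 0)) : Tendsto h' atTop (𝓝 0) := by
  obtain ⟨M, hM0, hM⟩ := IsSol.exists_bound V
  set N : ℝ := 1 + (M + ‖k‖ ^ 2) with hN
  have hN1 : 1 ≤ N := by rw [hN]; nlinarith [sq_nonneg ‖k‖]
  have hb : ∀ x, ‖((V x : ℂ) - k ^ 2) * h x‖ ≤ N * ‖h x‖ := fun x => by
    rw [norm_mul]
    gcongr
    refine (norm_sub_le _ _).trans ?_
    rw [norm_pow, Complex.norm_real]
    have := hM x
    rw [Real.norm_eq_abs]
    linarith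
  rw [Metric.tendsto_atTop] at h0 ⊢
  intro ε hε
  obtain ⟨X, hX⟩ := h0 (ε / (4 * N)) (by positivity)
  refine ⟨X, fun x hx => ?_⟩
  have hsm : ∀ y, X ≤ y → ‖h y‖ ≤ ε / (4 * N) := fun y hy => by
    have := hX y hy
    rw [dist_zero_right] at this
    exact this.le
  -- On an interval of length one the derivative is almost constant, and hence close to the
  -- increment of `h` over that interval.
  have h1 : ∀ y ∈ Set.Icc x (x + 1), ‖h' y - h' x‖ ≤ ε / 4 := fun y hy => by
    have := norm_image_sub_le_of_norm_deriv_le_segment' (f := h') (a := x) (b := x + 1)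
      (C := ε / 4) (fun z _ => (hs.hasDeriv' z).hasDerivWithinAt) (fun z hz =>
        (hb z).trans (by
          have := hsm z (hx.trans hz.1)
          calc N * ‖h z‖ ≤ N * (ε / (4 * N)) := by gcongr
            _ = ε / 4 := by field_simp)) y hy
    refine this.trans ?_
    have := hy.2
    nlinarith
  have h2 : ‖(h (x + 1) - h' x * ((x + 1 : ℝ) : ℂ)) - (h x - h' x * (x : ℂ))‖ ≤ ε / 4 * (x + 1 - x) :=
    norm_image_sub_le_of_norm_deriv_le_segment' (f := fun y : ℝ => h y - h' x * (y : ℂ)) (a := x)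
      (b := x + 1) (C := ε / 4) (f' := fun y => h' y - h' x * 1) (fun z _ =>
        ((hs.hasDeriv z).sub ((Complex.ofRealCLM.hasDerivAt (x := z)).const_mul
          (h' x))).hasDerivWithinAt)
      (fun z hz => by
        rw [mul_one]
        exact h1 z ⟨hz.1, hz.2.le⟩) (x + 1) ⟨by linarith, le_rfl⟩
  have e : h' x = h (x + 1) - h x - ((h (x + 1) - h' x * ((x + 1 : ℝ) : ℂ)) -
      (h x - h' x * (x : ℂ))) := by push_cast; ring
  have h3 := hsm x hx
  have h4 := hsm (x + 1) (by linarith)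
  have h5 : ε / (4 * N) ≤ ε / 4 := by
    apply div_le_div_of_nonneg_left hε.le (by norm_num); linarith
  rw [dist_zero_right, e]
  have := norm_sub_le (h (x + 1) - h x) ((h (x + 1) - h' x * ((x + 1 : ℝ) : ℂ)) -
      (h x - h' x * (x : ℂ)))
  have := norm_sub_le (h (x + 1)) (h x)
  linarith

theorem exp_mul_fP (V : 𝓢(ℝ, ℝ)) (ξ x : ℝ) :
    Complex.exp (-(Complex.I * x * ξ)) * fP V ξ x = mP V ξ x := by
  rw [fP, ← mul_assoc, ← Complex.exp_add]
  rw [show -(Complex.I * x * ξ) + Complex.I * ξ * x = 0 by ring, Complex.exp_zero, one_mul]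

theorem norm_exp_I_mul (ξ x : ℝ) : ‖Complex.exp (Complex.I * ξ * x)‖ = 1 := by
  rw [show Complex.I * ξ * x = ((ξ * x : ℝ) : ℂ) * Complex.I by push_cast; ring]
  exact Complex.norm_exp_ofReal_mul_I _

/-- The boundary condition at `+∞` determines the Jost solution, also at zero energy, where there
are solutions of linear growth. -/
theorem eq_fP_of_isSol {V : 𝓢(ℝ, ℝ)} {ξ : ℝ} {f f' : ℝ → ℂ} (hf : IsSol V ξ f f')
    (h1 : Tendsto (fun x : ℝ => Complex.exp (-(Complex.I * x * ξ)) * f x) atTop (𝓝 1)) :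
    f = fP V ξ := by
  have hk := ofReal_mem_UH ξ
  have hP := isSol_fP V hk
  have hs := hf.sub_smul hP 1
  simp only [one_mul] at hs
  have hm : Tendsto (fun x : ℝ => Complex.exp (-(Complex.I * x * ξ)) * fP V ξ x) atTop (𝓝 1) :=
    (tendsto_mP V hk).congr fun x => (exp_mul_fP V ξ x).symm
  have hd : Tendsto (fun x : ℝ => Complex.exp (-(Complex.I * x * ξ)) * (f x - fP V ξ x)) atTop
      (𝓝 0) := by
    have := h1.sub hm
    rw [sub_self] at this
    exact this.congr fun x => by ring
  have hn : ∀ x : ℝ, ‖Complex.exp (-(Complex.I * x * ξ))‖ = 1 := fun x => by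
    have := norm_exp_I_mul (-ξ) x
    rw [← this]
    congr 2
    push_cast
    ring
  have h0 : Tendsto (fun x => f x - fP V ξ x) atTop (𝓝 0) := by
    rw [tendsto_zero_iff_norm_tendsto_zero] at hd ⊢
    refine hd.congr fun x => ?_
    rw [norm_mul, hn, one_mul]
  have h0' := hs.tendsto_deriv h0
  have hPb : ∀ᶠ x in atTop, ‖fP V ξ x‖ ≤ 2 := by
    have := (tendsto_mP V hk).norm
    rw [norm_one] at this
    filter_upwards [this.eventually_le_const one_lt_two] with x hx
    rwa [fP, norm_mul, norm_exp_I_mul, one_mul]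
  have hPb' : ∀ᶠ x in atTop, ‖fP' V ξ x‖ ≤ ‖Complex.I * (ξ : ℂ)‖ + 1 := by
    have h3 : Tendsto (fun x => Complex.I * ξ * mP V ξ x + mP' V ξ x) atTop
      (𝓝 (Complex.I * ξ * 1 + 0)) := ((tendsto_mP V hk).const_mul _).add (tendsto_mP' V hk)
    have := h3.norm
    rw [mul_one, add_zero] at this
    filter_upwards [this.eventually_le_const (lt_add_one _)] with x hx
    rwa [fP', norm_mul, norm_exp_I_mul, one_mul]
  -- The difference tends to `0`, so that its Wronskian with `f₊` vanishes; hence it is a multiple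
  -- of `f₊`, and the multiple is zero since `f₊` does not tend to `0`.
  have hW : (f' 0 - fP' V ξ 0) * fP V ξ 0 - (f 0 - fP V ξ 0) * fP' V ξ 0 = 0 := by
    have h3 : Tendsto (fun x => (f' x - fP' V ξ x) * fP V ξ x - (f x - fP V ξ x) * fP' V ξ x)
        atTop (𝓝 0) := by
      have ha : Tendsto (fun x => (f' x - fP' V ξ x) * fP V ξ x) atTop (𝓝 0) :=
        Tendsto.zero_mul_isBoundedUnder_le h0' ⟨2, hPb⟩
      have hb : Tendsto (fun x => (f x - fP V ξ x) * fP' V ξ x) atTop (𝓝 0) :=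
        Tendsto.zero_mul_isBoundedUnder_le h0 ⟨_, hPb'⟩
      simpa using ha.sub hb
    refine tendsto_nhds_unique (tendsto_const_nhds.congr fun x => ?_) h3
    exact hs.wronskian_const hP 0 x
  obtain ⟨c, hc⟩ := hs.exists_smul hP (fP_ne_zero V hk) hW
  have hc0 : c = 0 := by
    have h4 : Tendsto (fun x : ℝ => Complex.exp (-(Complex.I * x * ξ)) * (f x - fP V ξ x)) atTop
        (𝓝 (c * 1)) := (hm.const_mul c).congr fun x => by
      rw [congrFun hc x]; ring
    simpa using tendsto_nhds_unique h4 hd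
  funext x
  have := congrFun hc x
  rw [hc0, zero_mul] at this
  exact sub_eq_zero.1 this

theorem jostPlus_eq (V : 𝓢(ℝ, ℝ)) (ξ : ℝ) : jostPlus V ξ = fP V ξ := by
  have hk := ofReal_mem_UH ξ
  have hex : ∃ f, IsSolution V ξ f ∧
      Tendsto (fun x : ℝ => Complex.exp (-(Complex.I * x * ξ)) * f x) atTop (𝓝 1) :=
    ⟨fP V ξ, (isSol_fP V hk).isSolution,
      (tendsto_mP V hk).congr fun x => (exp_mul_fP V ξ x).symm⟩
  have := Classical.epsilon_spec hex
  exact eq_fP_of_isSol (isSol_of_isSolution this.1) this.2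

theorem jostMinus_eq (V : 𝓢(ℝ, ℝ)) (ξ : ℝ) : jostMinus V ξ = fM V ξ := by
  have hk := ofReal_mem_UH ξ
  have hex : ∃ f, IsSolution V ξ f ∧
      Tendsto (fun x : ℝ => Complex.exp (Complex.I * x * ξ) * f x) atBot (𝓝 1) := by
    refine ⟨fM V ξ, (isSol_fM V hk).isSolution, ?_⟩
    refine ((tendsto_mP (refl V) hk).comp tendsto_neg_atBot_atTop).congr fun x => ?_
    rw [Function.comp, ← exp_mul_fP, fM]
    congr 2
    push_cast
    ring
  have := Classical.epsilon_spec hex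
  have hs : IsSol (refl (refl V)) ξ (jostMinus V ξ) (deriv (jostMinus V ξ)) := by
    rw [refl_refl]
    exact isSol_of_isSolution this.1
  have h2 := eq_fP_of_isSol hs.reflect ((this.2.comp tendsto_neg_atTop_atBot).congr fun x => by
    rw [Function.comp]
    congr 2
    push_cast
    ring)
  funext x
  have h3 := congrFun h2 (-x)
  simp only [neg_neg] at h3
  exact h3

theorem transmissionAux_eq (V : 𝓢(ℝ, ℝ)) (ξ : ℝ) :
    transmissionAux V ξ = 2 * Complex.I * ξ / Wr V ξ := by
  have : ∀ x, mPlus V ξ x = mP V ξ x := fun x => by rw [mPlus, jostPlus_eq, exp_mul_fP]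
  simp only [transmissionAux, Wr, this]

open Classical in
/-- The quotient `k / W(k)`, extended by continuity to `k = 0`. -/
def kap (V : 𝓢(ℝ, ℝ)) : ℂ → ℂ :=
  Function.update (fun k => k / Wr V k) 0 (exists_tendsto_div_Wr V).choose

theorem kap_of_ne {V : 𝓢(ℝ, ℝ)} {k : ℂ} (hk : k ≠ 0) : kap V k = k / Wr V k :=
  Function.update_of_ne hk _ _

/-- The normalized generalized eigenfunction `T(ξ) f₊(x, ξ) / √(2π)`. -/
def eP (V : 𝓢(ℝ, ℝ)) (ξ x : ℝ) : ℂ :=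
  ((Real.sqrt (2 * Real.pi))⁻¹ : ℝ) * (2 * Complex.I * kap V ξ * fP V ξ x)

/-- The normalized generalized eigenfunction `T(ξ) f₋(x, ξ) / √(2π)`. -/
def eM (V : 𝓢(ℝ, ℝ)) (ξ x : ℝ) : ℂ :=
  ((Real.sqrt (2 * Real.pi))⁻¹ : ℝ) * (2 * Complex.I * kap V ξ * fM V ξ x)

theorem psi_of_pos (V : 𝓢(ℝ, ℝ)) (x : ℝ) {ξ : ℝ} (hξ : 0 < ξ) : psi V x ξ = eP V ξ x := by
  have : (ξ : ℂ) ≠ 0 := by exact_mod_cast hξ.ne'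
  rw [psi, if_pos hξ.le, transmission, if_neg hξ.ne', transmissionAux_eq, jostPlus_eq, eP,
    kap_of_ne this]
  ring

theorem psi_of_neg (V : 𝓢(ℝ, ℝ)) (x : ℝ) {ξ : ℝ} (hξ : ξ < 0) : psi V x ξ = eM V (-ξ) x := by
  have : ((-ξ : ℝ) : ℂ) ≠ 0 := by exact_mod_cast (neg_ne_zero.2 hξ.ne)
  rw [psi, if_neg (not_le.2 hξ), transmission, if_neg (neg_ne_zero.2 hξ.ne), transmissionAux_eq,
    jostMinus_eq, eM, kap_of_ne this]
  ring

theorem kap_refl (V : 𝓢(ℝ, ℝ)) {ξ : ℝ} (hξ : ξ ≠ 0) : kap (refl V) ξ = kap V ξ := by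
  have : (ξ : ℂ) ≠ 0 := by exact_mod_cast hξ
  rw [kap_of_ne this, kap_of_ne this, Wr_refl V (ofReal_mem_UH ξ)]

theorem eM_eq (V : 𝓢(ℝ, ℝ)) {ξ : ℝ} (hξ : ξ ≠ 0) (x : ℝ) : eM V ξ x = eP (refl V) ξ (-x) := by
  rw [eM, eP, kap_refl V hξ, fM]

/-! ### Absence of zeros of the Wronskian and continuity -/

theorem continuousOn_kap {V : 𝓢(ℝ, ℝ)} (hW : ∀ k : ℂ, 0 < k.im → Wr V k ≠ 0) :
    ContinuousOn (kap V) UH := by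
  intro k hk
  by_cases h0 : k = 0
  · subst h0
    have h := (exists_tendsto_div_Wr V).choose_spec
    exact continuousWithinAt_update_same.2 h
  · have hk' : Wr V k ≠ 0 := by
      rcases (show 0 ≤ k.im from hk).lt_or_eq with h | h
      · exact hW k h
      · have e : k = ((k.re : ℝ) : ℂ) := by
          apply Complex.ext <;> simp [← h]
        rw [e]
        refine Wr_ne_zero V fun h1 => h0 ?_
        rw [e, h1, Complex.ofReal_zero]
    refine (continuousWithinAt_update_of_ne h0).2 ?_
    exact continuousWithinAt_id.div (continuousOn_Wr V k hk) hk'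

theorem continuous_kap_ofReal (V : 𝓢(ℝ, ℝ)) : Continuous fun ξ : ℝ => kap V ξ := by
  have hcW : Continuous fun ξ : ℝ => Wr V ξ :=
    (continuousOn_Wr V).comp_continuous Complex.continuous_ofReal ofReal_mem_UH
  rw [continuous_iff_continuousAt]
  intro ξ
  by_cases h0 : ξ = 0
  · subst h0
    have h := (exists_tendsto_div_Wr V).choose_spec
    have h1 : ContinuousWithinAt (kap V) UH ((0 : ℝ) : ℂ) := by
      rw [Complex.ofReal_zero]
      exact continuousWithinAt_update_same.2 h
    have h2 := h1.comp (f := fun ξ : ℝ => (ξ : ℂ)) (s := Set.univ) (x := 0)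
      Complex.continuous_ofReal.continuousWithinAt (fun ξ _ => ofReal_mem_UH ξ)
    exact (continuousWithinAt_univ _ _).1 h2
  · have h1 : ContinuousAt (fun ξ : ℝ => (ξ : ℂ) / Wr V ξ) ξ :=
      Complex.continuous_ofReal.continuousAt.div hcW.continuousAt (Wr_ne_zero V h0)
    refine h1.congr ?_
    filter_upwards [isOpen_ne.mem_nhds h0] with η hη
    exact (kap_of_ne (by exact_mod_cast hη)).symm

theorem norm_kap_le (V : 𝓢(ℝ, ℝ)) (ξ : ℝ) : ‖2 * Complex.I * kap V ξ‖ ≤ 1 := by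
  have hcl : IsClosed {ξ : ℝ | ‖2 * Complex.I * kap V ξ‖ ≤ 1} :=
    isClosed_le (by have := continuous_kap_ofReal V; fun_prop) continuous_const
  have hd : Dense {ξ : ℝ | ξ ≠ 0} := dense_compl_singleton 0
  have hsub : {ξ : ℝ | ξ ≠ 0} ⊆ {ξ : ℝ | ‖2 * Complex.I * kap V ξ‖ ≤ 1} := fun ξ hξ => by
    have h1 := two_abs_le_norm_Wr V ξ
    have h0 : 0 < ‖Wr V ξ‖ := norm_pos_iff.2 (Wr_ne_zero V hξ)
    have : (ξ : ℂ) ≠ 0 := by exact_mod_cast hξ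
    rw [Set.mem_ofPred_eq, kap_of_ne this, norm_mul, norm_div, Complex.norm_real]
    simp only [norm_mul, Complex.norm_ofNat, Complex.norm_I, mul_one, Real.norm_eq_abs]
    rw [← mul_div_assoc, div_le_one h0]
    exact h1
  exact hcl.closure_subset_iff.2 hsub (hd ξ)

theorem continuous_mP_ofReal (V : 𝓢(ℝ, ℝ)) : Continuous fun p : ℝ × ℝ => mP V p.1 p.2 := by
  have h1 : Continuous fun ξ : ℝ => jsol V ξ :=
    (continuousOn_jsol V).comp_continuous Complex.continuous_ofReal ofReal_mem_UH
  have h2 : Continuous fun p : ℝ × ℝ => jsol V p.1 p.2 :=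
    ContinuousEval.continuous_eval.comp ((h1.comp continuous_fst).prodMk continuous_snd)
  have h3 := (voltData V).continuous_wt
  unfold mP
  fun_prop

theorem continuous_fP_ofReal (V : 𝓢(ℝ, ℝ)) : Continuous fun p : ℝ × ℝ => fP V p.1 p.2 := by
  have := continuous_mP_ofReal V
  unfold fP
  fun_prop

theorem continuous_eP (V : 𝓢(ℝ, ℝ)) : Continuous fun p : ℝ × ℝ => eP V p.1 p.2 := by
  have := continuous_fP_ofReal V
  have : Continuous fun p : ℝ × ℝ => kap V p.1 := (continuous_kap_ofReal V).comp continuous_fst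
  unfold eP
  fun_prop

theorem continuous_eM (V : 𝓢(ℝ, ℝ)) : Continuous fun p : ℝ × ℝ => eM V p.1 p.2 := by
  have h1 := continuous_fP_ofReal (refl V)
  have h2 : Continuous fun p : ℝ × ℝ => fP (refl V) p.1 (-p.2) :=
    h1.comp (continuous_fst.prodMk continuous_snd.neg)
  have : Continuous fun p : ℝ × ℝ => kap V p.1 := (continuous_kap_ofReal V).comp continuous_fst
  unfold eM fM
  fun_prop

theorem exists_norm_eP_eM_le (V : 𝓢(ℝ, ℝ)) :
    ∃ C : ℝ, 0 < C ∧ ∀ ξ x : ℝ, ‖eP V ξ x‖ ≤ C * (1 + |x|) ∧ ‖eM V ξ x‖ ≤ C * (1 + |x|) := by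
  obtain ⟨C, hC0, hC⟩ := exists_norm_mP_le V
  obtain ⟨D, hD0, hD⟩ := exists_norm_mP_le (refl V)
  have hs : ‖(((Real.sqrt (2 * Real.pi))⁻¹ : ℝ) : ℂ)‖ ≤ 1 := by
    rw [Complex.norm_real, Real.norm_of_nonneg (by positivity)]
    refine inv_le_one_of_one_le₀ (Real.one_le_sqrt.2 ?_)
    linarith [Real.pi_gt_three]
  have key : ∀ (U : 𝓢(ℝ, ℝ)) (A : ℝ), (∀ k ∈ UH, ∀ x, ‖mP U k x‖ ≤ A * (1 + |x|)) → ∀ ξ x : ℝ,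
      ‖(((Real.sqrt (2 * Real.pi))⁻¹ : ℝ) : ℂ) * (2 * Complex.I * kap V ξ * fP U ξ x)‖
        ≤ A * (1 + |x|) := fun U A hA ξ x => by
    rw [norm_mul, norm_mul (2 * Complex.I * _), fP, norm_mul (Complex.exp _), norm_exp_I_mul,
      one_mul]
    have h1 := norm_kap_le V ξ
    have h2 := hA ξ (ofReal_mem_UH ξ) x
    calc _ ≤ 1 * (1 * (A * (1 + |x|))) := by gcongr
      _ = _ := by ring
  refine ⟨max C D, lt_max_of_lt_left hC0, fun ξ x => ⟨?_, ?_⟩⟩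
  · exact (key V C hC ξ x).trans (by gcongr; exact le_max_left _ _)
  · have := key (refl V) D hD ξ (-x)
    rw [abs_neg] at this
    exact this.trans (by gcongr; exact le_max_right _ _)

/-! ### The resolvent kernel as a function of the spectral parameter -/

theorem UH_mem_nhds {k : ℂ} (hk : 0 < k.im) : UH ∈ 𝓝 k :=
  mem_of_superset ((isOpen_lt continuous_const Complex.continuous_im).mem_nhds hk)
    fun _ (h : 0 < Complex.im _) => h.le

theorem hasDerivWithinAt_fP (V : 𝓢(ℝ, ℝ)) {k : ℂ} (hk : k ∈ UH) (x : ℝ) :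
    HasDerivWithinAt (fun l => fP V l x) (Complex.I * x * Complex.exp (Complex.I * k * x) *
      mP V k x + Complex.exp (Complex.I * k * x) * mPk V k x) UH k := by
  have h1 : HasDerivAt (fun l : ℂ => Complex.I * l * x) (Complex.I * 1 * x) k :=
    ((hasDerivAt_id k).const_mul Complex.I).mul_const _
  exact (h1.cexp.hasDerivWithinAt.mul (hasDerivWithinAt_mP V hk x)).congr_deriv (by ring)

theorem norm_cexp_I_le (k : ℂ) (x : ℝ) :
    ‖Complex.exp (Complex.I * k * x)‖ ≤ Real.exp (‖k‖ * |x|) := by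
  refine (Complex.norm_exp_le_exp_norm _).trans (le_of_eq ?_)
  simp

/-- Local uniform bounds for the Jost solution and its derivative in the spectral parameter. -/
theorem exists_norm_fP_le (V : 𝓢(ℝ, ℝ)) (L r : ℝ) : ∃ K : ℝ, 0 ≤ K ∧ ∀ k ∈ UH, ‖k‖ ≤ r →
    ∀ x, |x| ≤ L → ‖fP V k x‖ ≤ K ∧ ‖Complex.I * x * Complex.exp (Complex.I * k * x) *
      mP V k x + Complex.exp (Complex.I * k * x) * mPk V k x‖ ≤ K := by
  obtain ⟨C, hC0, hC⟩ := exists_norm_mP_le V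
  obtain ⟨D, hD0, hD⟩ := exists_norm_mPk_le V
  rcases lt_or_ge L 0 with hL | hL
  · exact ⟨0, le_rfl, fun k _ _ x hx => absurd ((abs_nonneg x).trans hx) (not_le.2 hL)⟩
  rcases lt_or_ge r 0 with hr | hr
  · exact ⟨0, le_rfl, fun k _ h => absurd ((norm_nonneg k).trans h) (not_le.2 hr)⟩
  refine ⟨Real.exp (r * L) * (C * (1 + L)) + (L * Real.exp (r * L) * (C * (1 + L)) +
    Real.exp (r * L) * (D * (1 + L) ^ 2)), by positivity, fun k hk hkr x hx => ?_⟩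
  have h1 : ‖Complex.exp (Complex.I * k * x)‖ ≤ Real.exp (r * L) :=
    (norm_cexp_I_le k x).trans (Real.exp_le_exp.2 (by gcongr))
  have h2 : ‖mP V k x‖ ≤ C * (1 + L) := (hC k hk x).trans (by gcongr)
  have h3 : ‖mPk V k x‖ ≤ D * (1 + L) ^ 2 := (hD k hk x).trans (by gcongr)
  have h4 : ‖fP V k x‖ ≤ Real.exp (r * L) * (C * (1 + L)) := by
    rw [fP, norm_mul]
    gcongr
  refine ⟨h4.trans (le_add_of_nonneg_right (by positivity)), ?_⟩
  refine le_trans ?_ (le_add_of_nonneg_left (by positivity))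
  refine (norm_add_le _ _).trans ?_
  rw [norm_mul, norm_mul, norm_mul, norm_mul]
  have h5 : ‖Complex.I‖ * ‖(x : ℂ)‖ ≤ L := by simpa using hx
  gcongr

theorem continuous_fP (V : 𝓢(ℝ, ℝ)) (k : ℂ) : Continuous (fP V k) := by
  have := continuous_mP V k
  unfold fP
  fun_prop

theorem integrable_fP_mul (V : 𝓢(ℝ, ℝ)) {k : ℂ} (hk : k ∈ UH) {h : ℝ → ℂ} (hh : Integrable h)
    {L : ℝ} (hL : ∀ y, L < |y| → h y = 0) : Integrable fun y => fP V k y * h y := by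
  obtain ⟨K, hK0, hK⟩ := exists_norm_fP_le V L ‖k‖
  refine (hh.norm.const_mul K).mono' ((continuous_fP V k).aestronglyMeasurable.mul
    hh.aestronglyMeasurable) (Eventually.of_forall fun y => ?_)
  rw [norm_mul]
  rcases le_or_gt |y| L with hy | hy
  · exact mul_le_mul_of_nonneg_right (hK k hk le_rfl y hy).1 (norm_nonneg _)
  · simp [hL y hy]

theorem differentiableAt_integral_fP (V : 𝓢(ℝ, ℝ)) {h : ℝ → ℂ} (hh : Integrable h) {L : ℝ}
    (hL : ∀ y, L < |y| → h y = 0) {k : ℂ} (hk : 0 < k.im) :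
    DifferentiableAt ℂ (fun l => ∫ y, fP V l y * h y) k := by
  obtain ⟨K, hK0, hK⟩ := exists_norm_fP_le V L (‖k‖ + 1)
  have hs : {l : ℂ | 0 < l.im} ∩ Metric.ball k 1 ∈ 𝓝 k :=
    inter_mem ((isOpen_lt continuous_const Complex.continuous_im).mem_nhds hk)
      (Metric.ball_mem_nhds k one_pos)
  have hkU : k ∈ UH := hk.le
  refine (hasDerivAt_integral_of_dominated_loc_of_deriv_le (𝕜 := ℂ) (μ := volume)
    (F := fun l y => fP V l y * h y) (F' := fun l y => (Complex.I * y *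
      Complex.exp (Complex.I * l * y) * mP V l y + Complex.exp (Complex.I * l * y) * mPk V l y) * h y)
    (bound := fun y => K * ‖h y‖) hs ?_ (integrable_fP_mul V hkU hh hL) ?_ ?_
    (hh.norm.const_mul K) ?_).2.differentiableAt
  · exact Eventually.of_forall fun l => (continuous_fP V l).aestronglyMeasurable.mul
      hh.aestronglyMeasurable
  · have h1 := continuous_mP V k
    have h2 := continuous_mPk V k
    exact (Continuous.aestronglyMeasurable (by fun_prop)).mul hh.aestronglyMeasurable
  · refine Eventually.of_forall fun y l hl => ?_
    have h1 : ‖l‖ ≤ ‖k‖ + 1 := by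
      have := norm_sub_norm_le l k
      have h2 := hl.2
      rw [Metric.mem_ball, dist_eq_norm] at h2
      linarith
    rw [norm_mul]
    rcases le_or_gt |y| L with hy | hy
    · exact mul_le_mul_of_nonneg_right (hK l (le_of_lt (show 0 < l.im from hl.1)) h1 y hy).2 (norm_nonneg _)
    · simp [hL y hy]
  · refine Eventually.of_forall fun y l hl => ?_
    exact ((hasDerivWithinAt_fP V (le_of_lt (show 0 < l.im from hl.1) : l ∈ UH) y).hasDerivAt
      (UH_mem_nhds hl.1)).mul_const _

theorem continuousOn_integral_fP (V : 𝓢(ℝ, ℝ)) {h : ℝ → ℂ} (hh : Integrable h) {L : ℝ}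
    (hL : ∀ y, L < |y| → h y = 0) : ContinuousOn (fun l => ∫ y, fP V l y * h y) UH := by
  intro k hk
  obtain ⟨K, hK0, hK⟩ := exists_norm_fP_le V L (‖k‖ + 1)
  refine continuousWithinAt_of_dominated (bound := fun y => K * ‖h y‖) ?_ ?_
    (hh.norm.const_mul K) ?_
  · exact Eventually.of_forall fun l => (continuous_fP V l).aestronglyMeasurable.mul
      hh.aestronglyMeasurable
  · filter_upwards [self_mem_nhdsWithin, mem_nhdsWithin_of_mem_nhds
      (Metric.ball_mem_nhds k one_pos)] with l hl hl2
    have h1 : ‖l‖ ≤ ‖k‖ + 1 := by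
      have := norm_sub_norm_le l k
      rw [Metric.mem_ball, dist_eq_norm] at hl2
      linarith
    refine Eventually.of_forall fun y => ?_
    rw [norm_mul]
    rcases le_or_gt |y| L with hy | hy
    · exact mul_le_mul_of_nonneg_right (hK l hl h1 y hy).1 (norm_nonneg _)
    · simp [hL y hy]
  · exact Eventually.of_forall fun y =>
      (hasDerivWithinAt_fP V hk y).continuousWithinAt.mul continuousWithinAt_const

/-- `-W(k)` times the solution operator of `-u'' + V u - k² u = h`, evaluated at `x`. -/
def solOp (V : 𝓢(ℝ, ℝ)) (h : ℝ → ℂ) (k : ℂ) (x : ℝ) : ℂ :=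
  fP V k x * (∫ y in Set.Iic x, fM V k y * h y) + fM V k x * ∫ y in Set.Ioi x, fP V k y * h y

theorem setIntegral_mul_eq_indicator {s : Set ℝ} (hs : MeasurableSet s) (f h : ℝ → ℂ) :
    ∫ y in s, f y * h y = ∫ y, f y * s.indicator h y := by
  rw [← integral_indicator hs]
  congr 1
  funext y
  by_cases hy : y ∈ s <;> simp [hy]

/-- Both integrals are brought to the form of an integral of `f₊` against a fixed function, which is
differentiable in `k`. -/
theorem solOp_eq (V : 𝓢(ℝ, ℝ)) (h : ℝ → ℂ) (k : ℂ) (x : ℝ) :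
    solOp V h k x = fP V k x * (∫ y, fP (refl V) k y * (Set.Iic x).indicator h (-y)) +
      fP (refl V) k (-x) * ∫ y, fP V k y * (Set.Ioi x).indicator h y := by
  rw [solOp, setIntegral_mul_eq_indicator measurableSet_Iic,
    setIntegral_mul_eq_indicator measurableSet_Ioi,
    ← integral_neg_eq_self (fun y => fM V k y * (Set.Iic x).indicator h y)]
  simp only [fM, neg_neg]

section solOp

variable {V : 𝓢(ℝ, ℝ)} {h : ℝ → ℂ} (hh : Integrable h) {L : ℝ} (hL : ∀ y, L < |y| → h y = 0)
include hh hL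

theorem differentiableAt_solOp {k : ℂ} (hk : 0 < k.im) (x : ℝ) :
    DifferentiableAt ℂ (fun l => solOp V h l x) k := by
  have hd : ∀ (U : 𝓢(ℝ, ℝ)) (x : ℝ), DifferentiableAt ℂ (fun l => fP U l x) k := fun U x =>
    ((hasDerivWithinAt_fP U (le_of_lt hk : k ∈ UH) x).hasDerivAt (UH_mem_nhds hk)).differentiableAt
  simp only [solOp_eq]
  refine ((hd V x).mul (differentiableAt_integral_fP (refl V)
    (h := fun y => (Set.Iic x).indicator h (-y)) ((hh.indicator measurableSet_Iic).comp_neg)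
    (L := L) (fun y hy => ?_) hk)).add ((hd (refl V) (-x)).mul
    (differentiableAt_integral_fP V (h := (Set.Ioi x).indicator h)
      (hh.indicator measurableSet_Ioi) (L := L) (fun y hy => ?_) hk))
  · by_cases hm : -y ∈ Set.Iic x
    · rw [Set.indicator_of_mem hm, hL _ (by rwa [abs_neg])]
    · rw [Set.indicator_of_notMem hm]
  · by_cases hm : y ∈ Set.Ioi x
    · rw [Set.indicator_of_mem hm, hL _ hy]
    · rw [Set.indicator_of_notMem hm]

theorem continuousOn_solOp (x : ℝ) : ContinuousOn (fun l => solOp V h l x) UH := by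
  have hd : ∀ (U : 𝓢(ℝ, ℝ)) (x : ℝ), ContinuousOn (fun l => fP U l x) UH := fun U x k hk =>
    (hasDerivWithinAt_fP U hk x).continuousWithinAt
  simp only [solOp_eq]
  refine ((hd V x).mul (continuousOn_integral_fP (refl V)
    (h := fun y => (Set.Iic x).indicator h (-y)) ((hh.indicator measurableSet_Iic).comp_neg)
    (L := L) (fun y hy => ?_))).add ((hd (refl V) (-x)).mul
    (continuousOn_integral_fP V (h := (Set.Ioi x).indicator h)
      (hh.indicator measurableSet_Ioi) (L := L) (fun y hy => ?_)))
  · by_cases hm : -y ∈ Set.Iic x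
    · rw [Set.indicator_of_mem hm, hL _ (by rwa [abs_neg])]
    · rw [Set.indicator_of_notMem hm]
  · by_cases hm : y ∈ Set.Ioi x
    · rw [Set.indicator_of_mem hm, hL _ hy]
    · rw [Set.indicator_of_notMem hm]

end solOp

/-- For `y ≤ x` the exponential factors combine to `e^{ik(x - y)}`, which is bounded in the closed
upper half-plane. -/
theorem exists_norm_fP_mul_fM_le (V : 𝓢(ℝ, ℝ)) : ∃ C : ℝ, 0 < C ∧ ∀ k ∈ UH, ∀ x y : ℝ, y ≤ x →
    ‖fP V k x * fM V k y‖ ≤ C * (1 + |x|) * (1 + |y|) := by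
  obtain ⟨C, hC0, hC⟩ := exists_norm_mP_le V
  obtain ⟨D, hD0, hD⟩ := exists_norm_mP_le (refl V)
  refine ⟨C * D, by positivity, fun k hk x y hxy => ?_⟩
  have e : fP V k x * fM V k y = Complex.exp (Complex.I * k * ((x - y : ℝ) : ℂ)) *
      (mP V k x * mP (refl V) k (-y)) := by
    rw [fM, fP, fP, mul_mul_mul_comm, ← Complex.exp_add]
    congr 2
    push_cast
    ring
  have h1 : ‖Complex.exp (Complex.I * k * ((x - y : ℝ) : ℂ))‖ ≤ 1 := by
    rw [Complex.norm_exp, Real.exp_le_one_iff]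
    have h2 : (Complex.I * k * ((x - y : ℝ) : ℂ)).re = -(k.im * (x - y)) := by simp
    rw [h2]
    have h3 : 0 ≤ k.im := hk
    have := mul_nonneg h3 (sub_nonneg.2 hxy)
    linarith
  have h2 := hC k hk x
  have h3 := hD k hk (-y)
  rw [abs_neg] at h3
  rw [e, norm_mul, norm_mul]
  calc _ ≤ 1 * ((C * (1 + |x|)) * (D * (1 + |y|))) := by gcongr
    _ = _ := by ring

theorem exists_norm_solOp_le (V : 𝓢(ℝ, ℝ)) : ∃ C : ℝ, 0 < C ∧ ∀ k ∈ UH, ∀ (x : ℝ) (h : ℝ → ℂ),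
    Integrable (fun y => (1 + |y|) * ‖h y‖) →
    ‖solOp V h k x‖ ≤ C * (1 + |x|) * ∫ y, (1 + |y|) * ‖h y‖ := by
  obtain ⟨C, hC0, hC⟩ := exists_norm_fP_mul_fM_le V
  refine ⟨C + C, by positivity, fun k hk x h hi => ?_⟩
  have hnn : ∀ y, 0 ≤ (1 + |y|) * ‖h y‖ := fun y => by positivity
  have h1 : ‖∫ y in Set.Iic x, fP V k x * (fM V k y * h y)‖ ≤
      C * (1 + |x|) * ∫ y, (1 + |y|) * ‖h y‖ := by
    refine (norm_integral_le_of_norm_le (hi.const_mul (C * (1 + |x|))).integrableOn ?_).trans ?_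
    · filter_upwards [ae_restrict_mem measurableSet_Iic] with y hy
      rw [← mul_assoc, norm_mul]
      calc _ ≤ C * (1 + |x|) * (1 + |y|) * ‖h y‖ := by gcongr; exact hC k hk x y hy
        _ = _ := by ring
    · rw [integral_const_mul]
      exact mul_le_mul_of_nonneg_left (setIntegral_le_integral hi (Eventually.of_forall hnn))
        (by positivity)
  have h2 : ‖∫ y in Set.Ioi x, fM V k x * (fP V k y * h y)‖ ≤
      C * (1 + |x|) * ∫ y, (1 + |y|) * ‖h y‖ := by
    refine (norm_integral_le_of_norm_le (hi.const_mul (C * (1 + |x|))).integrableOn ?_).trans ?_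
    · filter_upwards [ae_restrict_mem measurableSet_Ioi] with y hy
      rw [← mul_assoc, norm_mul, mul_comm (fM V k x)]
      calc _ ≤ C * (1 + |y|) * (1 + |x|) * ‖h y‖ := by
            gcongr; exact hC k hk y x (le_of_lt hy)
        _ = _ := by ring
    · rw [integral_const_mul]
      exact mul_le_mul_of_nonneg_left (setIntegral_le_integral hi (Eventually.of_forall hnn))
        (by positivity)
  rw [integral_const_mul] at h1 h2
  rw [solOp]
  refine (norm_add_le _ _).trans ((add_le_add h1 h2).trans (le_of_eq (by ring)))

/-! #### Green's identities -/

theorem hasCompactSupport_of_hasDerivAt {φ φ' : ℝ → ℂ} (h1 : ∀ x, HasDerivAt φ (φ' x) x)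
    (hs : HasCompactSupport φ) : HasCompactSupport φ' := by
  have : φ' = deriv φ := funext fun x => (h1 x).deriv.symm
  rw [this]
  exact hs.deriv

section green

variable {V : 𝓢(ℝ, ℝ)} {k : ℂ} {f f' φ φ' φ'' : ℝ → ℂ} (hf : IsSol V k f f')
  (h1 : ∀ x, HasDerivAt φ (φ' x) x) (h2 : ∀ x, HasDerivAt φ' (φ'' x) x)
  (hc : Continuous φ'') (hs : HasCompactSupport φ)
include hf h1 h2 hs

omit hs in
theorem hasDerivAt_green (x : ℝ) : HasDerivAt (fun x => f' x * φ x - f x * φ' x)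
    (f x * (-φ'' x + (V x : ℂ) * φ x) - k ^ 2 * (f x * φ x)) x :=
  (((hf.hasDeriv' x).mul (h1 x)).sub ((hf.hasDeriv x).mul (h2 x))).congr_deriv (by ring)

omit hf h2 in
theorem hasCompactSupport_green : HasCompactSupport (fun x => f' x * φ x - f x * φ' x) :=
  (hs.mul_left (f := f')).sub ((hasCompactSupport_of_hasDerivAt h1 hs).mul_left (f := f))

include hc

theorem integrable_green : Integrable (fun y => f y * (-φ'' y + (V y : ℂ) * φ y)) ∧
    Integrable (fun y => k ^ 2 * (f y * φ y)) := by
  have hφ : Continuous φ := continuous_iff_continuousAt.2 fun x => (h1 x).continuousAt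
  have hfc := hf.continuous
  have hV := V.continuous
  have hs' := hasCompactSupport_of_hasDerivAt h1 hs
  have hs'' := hasCompactSupport_of_hasDerivAt h2 hs'
  constructor
  · refine Continuous.integrable_of_hasCompactSupport (by fun_prop) ?_
    exact (hs''.neg.add (hs.mul_left (f := fun x => (V x : ℂ)))).mul_left (f := f)
  · refine Continuous.integrable_of_hasCompactSupport (by fun_prop) ?_
    exact (hs.mul_left (f := f)).mul_left (f := fun _ => k ^ 2)

theorem green_Ioi (x : ℝ) : ∫ y in Set.Ioi x, f y * (-φ'' y + (V y : ℂ) * φ y) =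
    k ^ 2 * (∫ y in Set.Ioi x, f y * φ y) + (f x * φ' x - f' x * φ x) := by
  obtain ⟨i1, i2⟩ := integrable_green hf h1 h2 hc hs
  have h := integral_Ioi_of_hasDerivAt_of_tendsto
    (hasDerivAt_green hf h1 h2 x).continuousAt.continuousWithinAt
    (fun y _ => hasDerivAt_green hf h1 h2 y) (i1.sub i2).integrableOn
    ((hasCompactSupport_green h1 hs).is_zero_at_infty.mono_left
      atTop_le_cocompact)
  rw [integral_sub i1.integrableOn i2.integrableOn, integral_const_mul] at h
  linear_combination h

theorem green_Iic (x : ℝ) : ∫ y in Set.Iic x, f y * (-φ'' y + (V y : ℂ) * φ y) =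
    k ^ 2 * (∫ y in Set.Iic x, f y * φ y) - (f x * φ' x - f' x * φ x) := by
  obtain ⟨i1, i2⟩ := integrable_green hf h1 h2 hc hs
  have h := integral_Iic_of_hasDerivAt_of_tendsto
    (hasDerivAt_green hf h1 h2 x).continuousAt.continuousWithinAt
    (fun y _ => hasDerivAt_green hf h1 h2 y) (i1.sub i2).integrableOn
    ((hasCompactSupport_green h1 hs).is_zero_at_infty.mono_left
      atBot_le_cocompact)
  rw [integral_sub i1.integrableOn i2.integrableOn, integral_const_mul] at h
  linear_combination h

omit hf in
/-- Up to the factor `-W(k)` the solution operator inverts `H - k²`. Solving for `solOp V φ k` shows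
that it is of order `W(k) / k²`. -/
theorem solOp_hamiltonian (hk : k ∈ UH) (x : ℝ) :
    solOp V (fun y => -φ'' y + (V y : ℂ) * φ y) k x = k ^ 2 * solOp V φ k x - Wr V k * φ x := by
  rw [solOp, solOp, green_Ioi (isSol_fP V hk) h1 h2 hc hs, green_Iic (isSol_fM V hk) h1 h2 hc hs,
    ← wronskian_fP_fM V hk x]
  ring

end green

/-! ### The contour integral -/

/-- Cauchy's theorem for a function on the closed upper half-plane that decays quadratically. -/
theorem norm_integral_le_of_decay {f : ℂ → ℂ} (hc : ContinuousOn f UH)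
    (hd : ∀ k : ℂ, 0 < k.im → DifferentiableAt ℂ f k) {D R : ℝ} (hR : 0 < R)
    (hb : ∀ k ∈ UH, R ≤ ‖k‖ → ‖f k‖ ≤ D / ‖k‖ ^ 2) :
    ‖∫ ξ in (-R)..R, f ξ‖ ≤ 4 * D / R := by
  have hD : 0 ≤ D := by
    have h0 := (norm_nonneg _).trans (hb R (ofReal_mem_UH R) (by simp [abs_of_pos hR]))
    rw [Complex.norm_real, Real.norm_of_nonneg hR.le] at h0
    by_contra hneg
    exact absurd h0 (not_le.2 (div_neg_of_neg_of_pos (not_le.1 hneg) (by positivity)))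
  have hb' : ∀ k : ℂ, 0 ≤ k.im → R ≤ ‖k‖ → ‖f k‖ ≤ D / R ^ 2 := fun k hk hRk =>
    (hb k hk hRk).trans (by gcongr)
  have h := Complex.integral_boundary_rect_eq_zero_of_continuousOn_of_differentiableOn f
    (⟨-R, 0⟩ : ℂ) (⟨R, R⟩ : ℂ) (hc.mono fun k hk => ?_) (fun k hk => ?_)
  · simp only at h
    have e0 : ∀ x : ℝ, f ((x : ℂ) + ((0 : ℝ) : ℂ) * Complex.I) = f x := fun x => by simp
    simp only [e0] at h
    -- The contour is the rectangle with vertices `±R` and `±R + iR`.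
    have ht : ‖∫ x in (-R)..R, f ((x : ℂ) + (R : ℂ) * Complex.I)‖ ≤ D / R ^ 2 * |R - -R| :=
      intervalIntegral.norm_integral_le_of_norm_le_const fun x _ => by
        refine hb' _ (by simp [hR.le]) ?_
        have := Complex.abs_im_le_norm ((x : ℂ) + (R : ℂ) * Complex.I)
        simpa [abs_of_pos hR] using this
    have hv : ∀ s : ℝ, |s| = R → ‖∫ y in (0 : ℝ)..R, f ((s : ℂ) + (y : ℂ) * Complex.I)‖ ≤
        D / R ^ 2 * |R - 0| := fun s hs =>
      intervalIntegral.norm_integral_le_of_norm_le_const fun y hy => by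
        rw [Set.uIoc_of_le hR.le] at hy
        refine hb' _ (by simpa using hy.1.le) ?_
        have := Complex.abs_re_le_norm ((s : ℂ) + (y : ℂ) * Complex.I)
        simpa [hs] using this
    have hr := hv R (abs_of_pos hR)
    have hl := hv (-R) (by rw [abs_neg, abs_of_pos hR])
    have e : ∫ ξ in (-R)..R, f ξ = (∫ x in (-R)..R, f ((x : ℂ) + (R : ℂ) * Complex.I)) -
        Complex.I * (∫ y in (0 : ℝ)..R, f ((R : ℂ) + (y : ℂ) * Complex.I)) +
        Complex.I * (∫ y in (0 : ℝ)..R, f (((-R : ℝ) : ℂ) + (y : ℂ) * Complex.I)) := by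
      simp only [smul_eq_mul] at h
      linear_combination h
    rw [e]
    refine (norm_add_le _ _).trans ((add_le_add_left (norm_sub_le _ _) _).trans ?_)
    rw [norm_mul, norm_mul, Complex.norm_I, one_mul, one_mul]
    rw [show |R - -R| = 2 * R by rw [sub_neg_eq_add, abs_of_pos] <;> linarith] at ht
    rw [sub_zero, abs_of_pos hR] at hr hl
    calc _ ≤ D / R ^ 2 * (2 * R) + D / R ^ 2 * R + D / R ^ 2 * R := by gcongr
      _ = _ := by field_simp; ring
  · have := hk.2
    simp only [Set.mem_preimage, Set.uIcc_of_le hR.le] at this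
    exact this.1
  · have := hk.2
    simp only [Set.mem_preimage, min_eq_left hR.le] at this
    exact (hd k this.1).differentiableWithinAt

theorem le_norm_add_I {k : ℂ} (hk : k ∈ UH) : ‖k‖ ≤ ‖k + Complex.I‖ := by
  have h0 : 0 ≤ k.im := hk
  rw [Complex.norm_eq_sqrt_sq_add_sq, Complex.norm_eq_sqrt_sq_add_sq]
  apply Real.sqrt_le_sqrt
  simp
  nlinarith

theorem add_I_ne_zero {k : ℂ} (hk : k ∈ UH) : k + Complex.I ≠ 0 := by
  intro h
  have h0 : 0 ≤ k.im := hk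
  have := congrArg Complex.im h
  simp at this
  linarith

/-- At high frequencies `W(k)` is dominated by `2ik`. -/
theorem exists_le_norm_Wr (V : 𝓢(ℝ, ℝ)) : ∃ R₀ : ℝ, 1 ≤ R₀ ∧ ∀ k ∈ UH, R₀ ≤ ‖k‖ →
    ‖k‖ ≤ ‖Wr V k‖ := by
  obtain ⟨C, hC0, hC⟩ := exists_norm_mP_le V
  have hI := integrable_pow_mul_abs V 1
  have hI0 : 0 ≤ ∫ y, (1 + |y|) ^ 1 * |V y| := integral_nonneg fun y => by positivity
  refine ⟨1 + C * ∫ y, (1 + |y|) ^ 1 * |V y|, by nlinarith [mul_nonneg hC0.le hI0],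
    fun k hk hR => ?_⟩
  have h1 : ‖∫ y, (V y : ℂ) * mP V k y‖ ≤ C * ∫ y, (1 + |y|) ^ 1 * |V y| := by
    rw [← integral_const_mul]
    refine norm_integral_le_of_norm_le (hI.const_mul C) (Eventually.of_forall fun y => ?_)
    rw [norm_mul, Complex.norm_real, Real.norm_eq_abs]
    calc _ ≤ |V y| * (C * (1 + |y|)) := by gcongr; exact hC k hk y
      _ = _ := by ring
  have h2 := norm_sub_norm_le (2 * Complex.I * k) (∫ y, (V y : ℂ) * mP V k y)
  have h3 : ‖2 * Complex.I * k‖ = 2 * ‖k‖ := by simp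
  rw [Wr]
  linarith

/-! ### Plancherel's identity for test functions -/

/-- The distorted Fourier transform at positive frequencies, as an absolutely convergent
integral. -/
def tP (V : 𝓢(ℝ, ℝ)) (φ : ℝ → ℂ) (ξ : ℝ) : ℂ := ∫ y, starRingEnd ℂ (eP V ξ y) * φ y

/-- The distorted Fourier transform at the negative frequency `-ξ`, as an absolutely convergent
integral. -/
def tM (V : 𝓢(ℝ, ℝ)) (φ : ℝ → ℂ) (ξ : ℝ) : ℂ := ∫ y, starRingEnd ℂ (eM V ξ y) * φ y

theorem continuous_eP_snd (V : 𝓢(ℝ, ℝ)) (ξ : ℝ) : Continuous (eP V ξ) := by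
  have h : Continuous fun y : ℝ => ((ξ, y) : ℝ × ℝ) := by fun_prop
  have h' := Continuous.comp (continuous_eP V) h
  simpa only [Function.comp_def] using h'

theorem continuous_eM_snd (V : 𝓢(ℝ, ℝ)) (ξ : ℝ) : Continuous (eM V ξ) := by
  have h : Continuous fun y : ℝ => ((ξ, y) : ℝ × ℝ) := by fun_prop
  have h' := Continuous.comp (continuous_eM V) h
  simpa only [Function.comp_def] using h'

theorem continuous_eP_fst (V : 𝓢(ℝ, ℝ)) (x : ℝ) : Continuous fun ξ => eP V ξ x := by
  have h : Continuous fun ξ : ℝ => ((ξ, x) : ℝ × ℝ) := by fun_prop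
  have h' := Continuous.comp (continuous_eP V) h
  simpa only [Function.comp_def] using h'

theorem continuous_eM_fst (V : 𝓢(ℝ, ℝ)) (x : ℝ) : Continuous fun ξ => eM V ξ x := by
  have h : Continuous fun ξ : ℝ => ((ξ, x) : ℝ × ℝ) := by fun_prop
  have h' := Continuous.comp (continuous_eM V) h
  simpa only [Function.comp_def] using h'

theorem continuous_eP_swap (V : 𝓢(ℝ, ℝ)) : Continuous fun p : ℝ × ℝ => eP V p.2 p.1 := by
  have h' := Continuous.comp (continuous_eP V) (continuous_swap (X := ℝ) (Y := ℝ))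
  simpa only [Function.comp_def, Prod.fst_swap, Prod.snd_swap] using h'

theorem continuous_eM_swap (V : 𝓢(ℝ, ℝ)) : Continuous fun p : ℝ × ℝ => eM V p.2 p.1 := by
  have h' := Continuous.comp (continuous_eM V) (continuous_swap (X := ℝ) (Y := ℝ))
  simpa only [Function.comp_def, Prod.fst_swap, Prod.snd_swap] using h'

section transform

variable (V : 𝓢(ℝ, ℝ)) {φ : ℝ → ℂ} (hφ : AEStronglyMeasurable φ)
  (hi : Integrable fun y => (1 + |y|) * ‖φ y‖)
include hφ hi

theorem integrable_star_eP_mul (ξ : ℝ) : Integrable fun y => starRingEnd ℂ (eP V ξ y) * φ y := by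
  obtain ⟨C, hC0, hC⟩ := exists_norm_eP_eM_le V
  have hc : Continuous fun y => starRingEnd ℂ (eP V ξ y) :=
    Complex.continuous_conj.comp (continuous_eP_snd V ξ)
  have hb : ∀ y, ‖starRingEnd ℂ (eP V ξ y) * φ y‖ ≤ C * ((1 + |y|) * ‖φ y‖) := fun y => by
    rw [norm_mul, RCLike.norm_conj, ← mul_assoc]
    exact mul_le_mul_of_nonneg_right (hC ξ y).1 (norm_nonneg _)
  exact Integrable.mono' (hi.const_mul C) (hc.aestronglyMeasurable.mul hφ) (Eventually.of_forall hb)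

theorem integrable_star_eM_mul (ξ : ℝ) : Integrable fun y => starRingEnd ℂ (eM V ξ y) * φ y := by
  obtain ⟨C, hC0, hC⟩ := exists_norm_eP_eM_le V
  have hc : Continuous fun y => starRingEnd ℂ (eM V ξ y) :=
    Complex.continuous_conj.comp (continuous_eM_snd V ξ)
  have hb : ∀ y, ‖starRingEnd ℂ (eM V ξ y) * φ y‖ ≤ C * ((1 + |y|) * ‖φ y‖) := fun y => by
    rw [norm_mul, RCLike.norm_conj, ← mul_assoc]
    exact mul_le_mul_of_nonneg_right (hC ξ y).2 (norm_nonneg _)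
  exact Integrable.mono' (hi.const_mul C) (hc.aestronglyMeasurable.mul hφ) (Eventually.of_forall hb)

theorem continuous_tP : Continuous (tP V φ) := by
  obtain ⟨C, hC0, hC⟩ := exists_norm_eP_eM_le V
  refine continuous_of_dominated (bound := fun y => C * ((1 + |y|) * ‖φ y‖))
    (fun ξ => (integrable_star_eP_mul V hφ hi ξ).aestronglyMeasurable)
    (fun ξ => Eventually.of_forall fun y => ?_) (hi.const_mul C)
    (Eventually.of_forall fun y => (Complex.continuous_conj.comp
      (continuous_eP_fst V y)).mul continuous_const)
  rw [norm_mul, RCLike.norm_conj, ← mul_assoc]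
  exact mul_le_mul_of_nonneg_right (hC ξ y).1 (norm_nonneg _)

theorem continuous_tM : Continuous (tM V φ) := by
  obtain ⟨C, hC0, hC⟩ := exists_norm_eP_eM_le V
  refine continuous_of_dominated (bound := fun y => C * ((1 + |y|) * ‖φ y‖))
    (fun ξ => (integrable_star_eM_mul V hφ hi ξ).aestronglyMeasurable)
    (fun ξ => Eventually.of_forall fun y => ?_) (hi.const_mul C)
    (Eventually.of_forall fun y => (Complex.continuous_conj.comp
      (continuous_eM_fst V y)).mul continuous_const)
  rw [norm_mul, RCLike.norm_conj, ← mul_assoc]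
  exact mul_le_mul_of_nonneg_right (hC ξ y).2 (norm_nonneg _)

end transform

/-- The jump of the resolvent kernel across the real axis, in the region `y ≤ x`. -/
theorem kernel_jump_left (V : 𝓢(ℝ, ℝ)) {ξ : ℝ} (hξ : ξ ≠ 0) (x y : ℝ) :
    -(kap V ξ * (fP V ξ x * fM V ξ y)) - kap V ((-ξ : ℝ) : ℂ) *
      (fP V ((-ξ : ℝ) : ℂ) x * fM V ((-ξ : ℝ) : ℂ) y) =
    Complex.I * Real.pi * (eP V ξ x * starRingEnd ℂ (eP V ξ y) +
      eM V ξ x * starRingEnd ℂ (eM V ξ y)) := by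
  have h0 : (ξ : ℂ) ≠ 0 := by exact_mod_cast hξ
  have h0' : ((-ξ : ℝ) : ℂ) ≠ 0 := by exact_mod_cast neg_ne_zero.2 hξ
  have hW := Wr_ne_zero V hξ
  have hW' : starRingEnd ℂ (Wr V ξ) ≠ 0 := fun h => hW (by simpa using h)
  have hpi : (((Real.sqrt (2 * Real.pi))⁻¹ : ℝ) : ℂ) ^ 2 * (2 * Real.pi) = 1 := by
    rw [← Complex.ofReal_pow, inv_pow, Real.sq_sqrt (by positivity)]
    have : Real.pi ≠ 0 := Real.pi_ne_zero
    push_cast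
    field_simp
  have e1 := Wr_mul_star_fP V ξ x
  have e2 := congrArg (starRingEnd ℂ) (Wr_mul_star_fM V ξ y)
  rw [kap_of_ne h0', star_fP, star_fM, star_Wr]
  simp only [eP, eM, kap_of_ne h0, map_mul, map_div₀, Complex.conj_ofReal, Complex.conj_I,
    Complex.conj_conj, map_ofNat, map_add, Complex.ofReal_neg] at e1 e2 ⊢
  set c : ℂ := (((Real.sqrt (2 * Real.pi))⁻¹ : ℝ) : ℂ)
  have e3 : Complex.I * Real.pi * (c * (2 * Complex.I * (ξ / Wr V ξ) * fP V ξ x) *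
      (c * (2 * -Complex.I * (ξ / starRingEnd ℂ (Wr V ξ)) * starRingEnd ℂ (fP V ξ y))) +
      c * (2 * Complex.I * (ξ / Wr V ξ) * fM V ξ x) *
      (c * (2 * -Complex.I * (ξ / starRingEnd ℂ (Wr V ξ)) * starRingEnd ℂ (fM V ξ y)))) =
      ξ / Wr V ξ / starRingEnd ℂ (Wr V ξ) * (2 * Complex.I * ξ *
      (fP V ξ x * starRingEnd ℂ (fP V ξ y) + fM V ξ x * starRingEnd ℂ (fM V ξ y))) := by
    field_simp
    linear_combination (fP V ξ x * starRingEnd ℂ (fP V ξ y) +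
      fM V ξ x * starRingEnd ℂ (fM V ξ y)) * hpi - 2 * Real.pi * c ^ 2 *
      (fP V ξ x * starRingEnd ℂ (fP V ξ y) + fM V ξ x * starRingEnd ℂ (fM V ξ y)) * Complex.I_sq
  rw [e3]
  field_simp
  linear_combination starRingEnd ℂ (fM V ξ y) * e1 - fP V ξ x * e2

theorem kernel_jump_right (V : 𝓢(ℝ, ℝ)) {ξ : ℝ} (hξ : ξ ≠ 0) (x y : ℝ) :
    -(kap V ξ * (fM V ξ x * fP V ξ y)) - kap V ((-ξ : ℝ) : ℂ) *
      (fM V ((-ξ : ℝ) : ℂ) x * fP V ((-ξ : ℝ) : ℂ) y) =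
    Complex.I * Real.pi * (eP V ξ x * starRingEnd ℂ (eP V ξ y) +
      eM V ξ x * starRingEnd ℂ (eM V ξ y)) := by
  have h := kernel_jump_left (refl V) hξ (-x) (-y)
  have h0' : -ξ ≠ 0 := neg_ne_zero.2 hξ
  simp only [fM, neg_neg, refl_refl, kap_refl V hξ, kap_refl V h0'] at h
  rw [eM_eq V hξ, eM_eq V hξ]
  have hM : ∀ z, eM (refl V) ξ (-z) = eP V ξ z := fun z => by
    rw [eM_eq (refl V) hξ, refl_refl, neg_neg]
  rw [hM, hM] at h
  simp only [fM]
  rw [h]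
  ring

section inversion

variable {V : 𝓢(ℝ, ℝ)} (hW : ∀ k : ℂ, 0 < k.im → Wr V k ≠ 0)
  {φ φ' φ'' : ℝ → ℂ} (h1 : ∀ x, HasDerivAt φ (φ' x) x) (h2 : ∀ x, HasDerivAt φ' (φ'' x) x)
  (hc : Continuous φ'') (hs : HasCompactSupport φ)

omit V in
theorem exists_support_bound {φ : ℝ → ℂ} (hs : HasCompactSupport φ) :
    ∃ L : ℝ, 0 ≤ L ∧ ∀ y, L < |y| → φ y = 0 := by
  obtain ⟨L, hL⟩ := hs.isBounded.exists_norm_le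
  refine ⟨max L 0, le_max_right _ _, fun y hy => ?_⟩
  by_contra h
  have := hL y (subset_tsupport _ h)
  exact absurd this (not_le.2 ((le_max_left _ _).trans_lt hy))

omit V in
theorem integrable_one_add_mul {φ : ℝ → ℂ} (hc : Continuous φ) (hs : HasCompactSupport φ) :
    Integrable fun y => (1 + |y|) * ‖φ y‖ :=
  Continuous.integrable_of_hasCompactSupport (μ := volume) (by fun_prop) (hs.norm.mul_left)

/-- Folding the resolvent across the real axis produces the generalized eigenfunctions. -/
theorem solOp_fold (hφ : Continuous φ) (hs : HasCompactSupport φ) {ξ : ℝ} (hξ : ξ ≠ 0) (x : ℝ) :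
    -(kap V ξ * solOp V φ ξ x) - kap V ((-ξ : ℝ) : ℂ) * solOp V φ ((-ξ : ℝ) : ℂ) x =
      Complex.I * Real.pi * (eP V ξ x * tP V φ ξ + eM V ξ x * tM V φ ξ) := by
  obtain ⟨L, -, hL⟩ := exists_support_bound hs
  have hφi : Integrable φ := hφ.integrable_of_hasCompactSupport hs
  have hi := integrable_one_add_mul hφ hs
  have iP : ∀ ζ : ℝ, Integrable fun y => fP V ζ y * φ y := fun ζ =>
    integrable_fP_mul V (ofReal_mem_UH ζ) hφi hL
  have iM : ∀ ζ : ℝ, Integrable fun y => fM V ζ y * φ y := fun ζ => by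
    have := (integrable_fP_mul (refl V) (ofReal_mem_UH ζ) hφi.comp_neg (L := L)
      (fun y hy => hL _ (by rwa [abs_neg]))).comp_neg
    simpa [fM] using this
  have jP := integrable_star_eP_mul V hφ.aestronglyMeasurable hi ξ
  have jM := integrable_star_eM_mul V hφ.aestronglyMeasurable hi ξ
  have hl : -(kap V ξ * (fP V ξ x * ∫ y in Set.Iic x, fM V ξ y * φ y)) - kap V ((-ξ : ℝ) : ℂ) *
      (fP V ((-ξ : ℝ) : ℂ) x * ∫ y in Set.Iic x, fM V ((-ξ : ℝ) : ℂ) y * φ y) =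
      Complex.I * Real.pi * (eP V ξ x * (∫ y in Set.Iic x, starRingEnd ℂ (eP V ξ y) * φ y) +
      eM V ξ x * ∫ y in Set.Iic x, starRingEnd ℂ (eM V ξ y) * φ y) := by
    rw [← integral_const_mul, ← integral_const_mul, ← integral_const_mul, ← integral_const_mul,
      ← integral_const_mul, ← integral_const_mul, ← integral_neg, ← integral_sub, ← integral_add,
      ← integral_const_mul]
    · refine integral_congr_ae (Eventually.of_forall fun y => ?_)
      simp only
      linear_combination φ y * kernel_jump_left V hξ x y
    · exact (jP.const_mul _).integrableOn
    · exact (jM.const_mul _).integrableOn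
    · exact (((iM ξ).const_mul _).const_mul _).neg.integrableOn
    · exact (((iM (-ξ)).const_mul _).const_mul _).integrableOn
  have hr : -(kap V ξ * (fM V ξ x * ∫ y in Set.Ioi x, fP V ξ y * φ y)) - kap V ((-ξ : ℝ) : ℂ) *
      (fM V ((-ξ : ℝ) : ℂ) x * ∫ y in Set.Ioi x, fP V ((-ξ : ℝ) : ℂ) y * φ y) =
      Complex.I * Real.pi * (eP V ξ x * (∫ y in Set.Ioi x, starRingEnd ℂ (eP V ξ y) * φ y) +
      eM V ξ x * ∫ y in Set.Ioi x, starRingEnd ℂ (eM V ξ y) * φ y) := by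
    rw [← integral_const_mul, ← integral_const_mul, ← integral_const_mul, ← integral_const_mul,
      ← integral_const_mul, ← integral_const_mul, ← integral_neg, ← integral_sub, ← integral_add,
      ← integral_const_mul]
    · refine integral_congr_ae (Eventually.of_forall fun y => ?_)
      simp only
      linear_combination φ y * kernel_jump_right V hξ x y
    · exact (jP.const_mul _).integrableOn
    · exact (jM.const_mul _).integrableOn
    · exact (((iP ξ).const_mul _).const_mul _).neg.integrableOn
    · exact (((iP (-ξ)).const_mul _).const_mul _).integrableOn
  rw [solOp, solOp, tP, tM,
    ← intervalIntegral.integral_Iic_add_Ioi (b := x) jP.integrableOn jP.integrableOn,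
    ← intervalIntegral.integral_Iic_add_Ioi (b := x) jM.integrableOn jM.integrableOn]
  linear_combination hl + hr

include hW h1 h2 hc hs

/-- Approximate inversion formula: the truncated distorted Fourier inversion of a test function
converges to it at rate `1 / R`, uniformly on compact sets. -/
theorem exists_inversion_bound (M : ℝ) : ∃ D R₀ : ℝ, 1 ≤ R₀ ∧ 0 ≤ D ∧ ∀ R, R₀ ≤ R →
    ∀ x, |x| ≤ M → ‖Complex.I * Real.pi * (∫ ξ in (0 : ℝ)..R, (eP V ξ x * tP V φ ξ +
      eM V ξ x * tM V φ ξ)) - 2 * Complex.I * Real.arctan R * φ x‖ ≤ D / R := by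
  have hφ : Continuous φ := continuous_iff_continuousAt.2 fun x => (h1 x).continuousAt
  obtain ⟨L, -, hL⟩ := exists_support_bound hs
  have hφi : Integrable φ := hφ.integrable_of_hasCompactSupport hs
  obtain ⟨C, hC0, hC⟩ := exists_norm_solOp_le V
  obtain ⟨R₀, hR₀1, hR₀⟩ := exists_le_norm_Wr V
  obtain ⟨B, hB⟩ := hs.exists_bound_of_continuous hφ
  have hB0 : 0 ≤ B := (norm_nonneg _).trans (hB 0)
  set h : ℝ → ℂ := fun y => -φ'' y + (V y : ℂ) * φ y with hh
  have hhc : Continuous h := by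
    have := V.continuous
    fun_prop
  have hhs : HasCompactSupport h :=
    (hasCompactSupport_of_hasDerivAt h2 (hasCompactSupport_of_hasDerivAt h1 hs)).neg.add
      (hs.mul_left (f := fun x => (V x : ℂ)))
  have hhi := integrable_one_add_mul hhc hhs
  have hI0 : 0 ≤ ∫ y, (1 + |y|) * ‖h y‖ := integral_nonneg fun y => by positivity
  set D : ℝ := C * (1 + |M|) * (∫ y, (1 + |y|) * ‖h y‖) + B with hD
  refine ⟨4 * D, R₀, hR₀1, by positivity, fun R hR x hx => ?_⟩
  have hR0 : 0 < R := by linarith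
  -- At infinity `k (H - k²)⁻¹ φ` behaves like `-φ / k`; the term `φ / (k + i)` cancels this up to
  -- `O(|k|⁻²)` and is holomorphic in the upper half-plane. On the real axis it contributes the
  -- arctangent.
  let Ψ : ℂ → ℂ := fun k => -(kap V k * solOp V φ k x) + φ x / (k + Complex.I)
  have hΨc : ContinuousOn Ψ UH :=
    ((continuousOn_kap hW).mul (continuousOn_solOp hφi hL x)).neg.add
      (continuousOn_const.div (by fun_prop) fun k hk => add_I_ne_zero hk)
  have hΨd : ∀ k : ℂ, 0 < k.im → DifferentiableAt ℂ Ψ k := fun k hk => by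
    have hk0 : k ≠ 0 := fun h => by simp [h] at hk
    have hd1 : DifferentiableAt ℂ (kap V) k := by
      have hd : DifferentiableAt ℂ (fun k => k / Wr V k) k := differentiableAt_id.div
        ((hasDerivWithinAt_Wr V (le_of_lt hk : k ∈ UH)).hasDerivAt
          (UH_mem_nhds hk)).differentiableAt (hW k hk)
      refine hd.congr_of_eventuallyEq ?_
      filter_upwards [isOpen_ne.mem_nhds hk0] with l hl using kap_of_ne hl
    exact (hd1.mul (differentiableAt_solOp hφi hL hk x)).neg.add
      ((differentiableAt_const _).div (by fun_prop) (add_I_ne_zero hk.le))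
  have hΨb : ∀ k ∈ UH, R ≤ ‖k‖ → ‖Ψ k‖ ≤ D / ‖k‖ ^ 2 := fun k hk hRk => by
    have hk1 : 0 < ‖k‖ := by linarith
    have hk0 : k ≠ 0 := norm_pos_iff.1 hk1
    have hWk := hR₀ k hk (by linarith)
    have hW0 : Wr V k ≠ 0 := norm_pos_iff.1 (hk1.trans_le hWk)
    have hi0 := add_I_ne_zero hk
    have hg := solOp_hamiltonian (V := V) h1 h2 hc hs hk x
    have e : Ψ k = -(solOp V h k x / (k * Wr V k)) - Complex.I * φ x / (k * (k + Complex.I)) := by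
      simp only [Ψ, kap_of_ne hk0, hh, hg]
      field_simp
      ring
    have h3 := hC k hk x h hhi
    have h4 : ‖solOp V h k x‖ ≤ C * (1 + |M|) * ∫ y, (1 + |y|) * ‖h y‖ :=
      h3.trans (by
        have := hx.trans (le_abs_self M)
        gcongr)
    have h5 := le_norm_add_I hk
    rw [e]
    refine (norm_sub_le _ _).trans ?_
    rw [norm_neg, norm_div, norm_div, norm_mul, norm_mul, norm_mul, Complex.norm_I, one_mul, hD,
      add_div, pow_two]
    gcongr
    exact hB x
  have key := norm_integral_le_of_decay hΨc hΨd hR0 hΨb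
  have hΨr : Continuous fun ξ : ℝ => Ψ ξ :=
    hΨc.comp_continuous Complex.continuous_ofReal ofReal_mem_UH
  have hΨr' : Continuous fun ξ : ℝ => Ψ ((-ξ : ℝ) : ℂ) := hΨr.comp continuous_neg
  have hcP := continuous_tP V hφ.aestronglyMeasurable (integrable_one_add_mul hφ hs)
  have hcM := continuous_tM V hφ.aestronglyMeasurable (integrable_one_add_mul hφ hs)
  have heP : Continuous fun ξ => eP V ξ x := continuous_eP_fst V x
  have heM : Continuous fun ξ => eM V ξ x := continuous_eM_fst V x
  -- Folding the negative half of the interval onto the positive one.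
  have e : ∫ ξ in (-R)..R, Ψ ξ = Complex.I * Real.pi * (∫ ξ in (0 : ℝ)..R,
      (eP V ξ x * tP V φ ξ + eM V ξ x * tM V φ ξ)) - 2 * Complex.I * Real.arctan R * φ x := by
    have e1 : ∫ ξ in (-R)..0, Ψ ξ = ∫ ξ in (0 : ℝ)..R, Ψ ((-ξ : ℝ) : ℂ) := by
      have := intervalIntegral.integral_comp_neg (a := 0) (b := R) (fun ξ : ℝ => Ψ ξ)
      rw [neg_zero] at this
      exact this.symm
    have e2 : ((Real.arctan R : ℝ) : ℂ) = ∫ ξ in (0 : ℝ)..R, ((((1 + ξ ^ 2)⁻¹ : ℝ)) : ℂ) := by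
      rw [intervalIntegral.integral_ofReal, integral_inv_one_add_sq]
      simp
    have hinv : Continuous fun ξ : ℝ => (((1 + ξ ^ 2)⁻¹ : ℝ) : ℂ) :=
      Complex.continuous_ofReal.comp (Continuous.inv₀ (by fun_prop) fun ξ => by positivity)
    rw [← intervalIntegral.integral_add_adjacent_intervals (hΨr.intervalIntegrable _ 0)
      (hΨr.intervalIntegrable _ _), e1, ← intervalIntegral.integral_add
      (hΨr'.intervalIntegrable _ _) (hΨr.intervalIntegrable _ _), e2,
      ← intervalIntegral.integral_const_mul, ← intervalIntegral.integral_const_mul,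
      ← intervalIntegral.integral_mul_const, ← intervalIntegral.integral_sub
      (Continuous.intervalIntegrable (by fun_prop) _ _)
      (Continuous.intervalIntegrable (by fun_prop) _ _),
      intervalIntegral.integral_of_le hR0.le, intervalIntegral.integral_of_le hR0.le]
    refine setIntegral_congr_fun measurableSet_Ioc fun ξ hξ => ?_
    have hf := solOp_fold (V := V) hφ hs hξ.1.ne' x
    have hsum : φ x / (((-ξ : ℝ) : ℂ) + Complex.I) + φ x / ((ξ : ℂ) + Complex.I) =
        -(2 * Complex.I * (((1 + ξ ^ 2)⁻¹ : ℝ) : ℂ) * φ x) := by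
      have n1 := add_I_ne_zero (ofReal_mem_UH ξ)
      have n2 := add_I_ne_zero (ofReal_mem_UH (-ξ))
      have n3 : (1 + (ξ : ℂ) ^ 2) ≠ 0 := by
        have : (1 + ξ ^ 2 : ℝ) ≠ 0 := by positivity
        exact_mod_cast this
      push_cast at n2 ⊢
      field_simp
      linear_combination 2 * φ x * Complex.I * Complex.I_sq
    simp only [Ψ]
    linear_combination hf + hsum
  rw [← e]
  exact key

omit hW h1 h2 hc hs in
/-- The squared `L²` norm of the truncated transform, expressed by the truncated inversion
formula. -/
theorem integral_truncated_sq (V : 𝓢(ℝ, ℝ)) {φ : ℝ → ℂ} (hφ : Continuous φ)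
    (hs : HasCompactSupport φ) {R : ℝ} (hR : 0 ≤ R) :
    (∫ x, starRingEnd ℂ (φ x) * ∫ ξ in (0 : ℝ)..R, (eP V ξ x * tP V φ ξ + eM V ξ x * tM V φ ξ)) =
      ((∫ ξ in (0 : ℝ)..R, (‖tP V φ ξ‖ ^ 2 + ‖tM V φ ξ‖ ^ 2) : ℝ) : ℂ) := by
  have hi := integrable_one_add_mul hφ hs
  have hcP := continuous_tP V hφ.aestronglyMeasurable hi
  have hcM := continuous_tM V hφ.aestronglyMeasurable hi
  obtain ⟨C, hC0, hC⟩ := exists_norm_eP_eM_le V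
  rw [← intervalIntegral.integral_ofReal, intervalIntegral.integral_of_le hR]
  have h0 : ∀ x, starRingEnd ℂ (φ x) * ∫ ξ in (0 : ℝ)..R,
      (eP V ξ x * tP V φ ξ + eM V ξ x * tM V φ ξ) = ∫ ξ in Set.Ioc 0 R,
      starRingEnd ℂ (φ x) * (eP V ξ x * tP V φ ξ + eM V ξ x * tM V φ ξ) := fun x => by
    rw [integral_const_mul, intervalIntegral.integral_of_le hR]
  simp only [h0]
  obtain ⟨A, hA⟩ := isCompact_Icc.exists_bound_of_continuousOn (s := Set.Icc 0 R) hcP.continuousOn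
  obtain ⟨B, hB⟩ := isCompact_Icc.exists_bound_of_continuousOn (s := Set.Icc 0 R) hcM.continuousOn
  rw [integral_integral_swap]
  · refine setIntegral_congr_fun measurableSet_Ioc fun ξ hξ => ?_
    have h1 : starRingEnd ℂ (tP V φ ξ) = ∫ y, eP V ξ y * starRingEnd ℂ (φ y) := by
      rw [tP, ← integral_conj]
      simp
    have h2 : starRingEnd ℂ (tM V φ ξ) = ∫ y, eM V ξ y * starRingEnd ℂ (φ y) := by
      rw [tM, ← integral_conj]
      simp
    have e : ∀ z : ℂ, ((‖z‖ ^ 2 : ℝ) : ℂ) = starRingEnd ℂ z * z := fun z => by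
      rw [mul_comm, Complex.mul_conj, Complex.normSq_eq_norm_sq]
    have i1 := ((Complex.conjCLE : ℂ →L[ℝ] ℂ).integrable_comp
      (integrable_star_eP_mul V hφ.aestronglyMeasurable hi ξ)).mul_const (tP V φ ξ)
    have i2 := ((Complex.conjCLE : ℂ →L[ℝ] ℂ).integrable_comp
      (integrable_star_eM_mul V hφ.aestronglyMeasurable hi ξ)).mul_const (tM V φ ξ)
    simp only [Complex.ofReal_add, e, h1, h2]
    rw [← integral_mul_const, ← integral_mul_const, ← integral_add]
    · refine integral_congr_ae (Eventually.of_forall fun y => ?_)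
      simp only
      ring
    · simpa [mul_comm] using i1
    · simpa [mul_comm] using i2
  · have hdom : Integrable (fun p : ℝ × ℝ => (C * ((1 + |p.1|) * ‖φ p.1‖)) * (A + B))
        (volume.prod (volume.restrict (Set.Ioc 0 R))) :=
      (hi.const_mul C).mul_prod (integrable_const (A + B))
    refine hdom.mono' ?_ ?_
    · have c1 : Continuous fun p : ℝ × ℝ => eP V p.2 p.1 := continuous_eP_swap V
      have c2 : Continuous fun p : ℝ × ℝ => eM V p.2 p.1 := continuous_eM_swap V
      have c3 : Continuous fun p : ℝ × ℝ => starRingEnd ℂ (φ p.1) *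
          (eP V p.2 p.1 * tP V φ p.2 + eM V p.2 p.1 * tM V φ p.2) :=
        (Complex.continuous_conj.comp (hφ.comp continuous_fst)).mul
          ((c1.mul (hcP.comp continuous_snd)).add (c2.mul (hcM.comp continuous_snd)))
      exact c3.aestronglyMeasurable
    · have hm : ∀ᵐ p ∂(volume.prod (volume.restrict (Set.Ioc 0 R))),
          p ∈ (Set.univ : Set ℝ) ×ˢ Set.Ioc 0 R := by
        have : (volume : Measure ℝ).prod (volume.restrict (Set.Ioc 0 R)) =
            (volume.prod volume).restrict (Set.univ ×ˢ Set.Ioc 0 R) := by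
          rw [← Measure.prod_restrict, Measure.restrict_univ]
        rw [this]
        exact ae_restrict_mem (MeasurableSet.univ.prod measurableSet_Ioc)
      filter_upwards [hm] with p hp
      have hp2 : p.2 ∈ Set.Icc 0 R := Set.Ioc_subset_Icc_self hp.2
      simp only [Function.uncurry]
      rw [norm_mul, RCLike.norm_conj]
      calc ‖φ p.1‖ * ‖eP V p.2 p.1 * tP V φ p.2 + eM V p.2 p.1 * tM V φ p.2‖
          ≤ ‖φ p.1‖ * (C * (1 + |p.1|) * A + C * (1 + |p.1|) * B) := by
            refine mul_le_mul_of_nonneg_left ((norm_add_le _ _).trans ?_) (norm_nonneg _)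
            rw [norm_mul, norm_mul]
            gcongr
            exacts [(hC p.2 p.1).1, hA _ hp2, (hC p.2 p.1).2, hB _ hp2]
        _ = _ := by ring

include hW h1 h2 hc hs in
/-- **Plancherel's identity** for test functions. -/
theorem plancherel : IntegrableOn (fun ξ => ‖tP V φ ξ‖ ^ 2 + ‖tM V φ ξ‖ ^ 2) (Set.Ioi 0) ∧
    ∫ ξ in Set.Ioi 0, (‖tP V φ ξ‖ ^ 2 + ‖tM V φ ξ‖ ^ 2) = ∫ x, ‖φ x‖ ^ 2 := by
  have hφ : Continuous φ := continuous_iff_continuousAt.2 fun x => (h1 x).continuousAt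
  obtain ⟨L, hL0, hL⟩ := exists_support_bound hs
  have hi := integrable_one_add_mul hφ hs
  have hφi : Integrable φ := hφ.integrable_of_hasCompactSupport hs
  have hφ2 : Integrable fun x => ((‖φ x‖ ^ 2 : ℝ) : ℂ) :=
    Continuous.integrable_of_hasCompactSupport (by fun_prop)
      ((hs.norm.comp_left (g := fun r : ℝ => ((r ^ 2 : ℝ) : ℂ)) (by simp)))
  have hcP := continuous_tP V hφ.aestronglyMeasurable hi
  have hcM := continuous_tM V hφ.aestronglyMeasurable hi
  obtain ⟨D, R₀, hR₀, hD0, hD⟩ := exists_inversion_bound hW h1 h2 hc hs L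
  set G : ℝ → ℝ := fun ξ => ‖tP V φ ξ‖ ^ 2 + ‖tM V φ ξ‖ ^ 2 with hG
  have hGc : Continuous G := by fun_prop
  have hG0 : ∀ ξ, 0 ≤ G ξ := fun ξ => by positivity
  set J : ℝ → ℝ := fun R => ∫ ξ in (0 : ℝ)..R, G ξ with hJ
  set Q : ℝ := ∫ x, ‖φ x‖ ^ 2 with hQ
  -- The inversion formula is tested against `φ`.
  have key : ∀ R, R₀ ≤ R → ‖Complex.I * Real.pi * (J R : ℂ) -
      2 * Complex.I * Real.arctan R * (Q : ℂ)‖ ≤ (D / R) * ∫ x, ‖φ x‖ := fun R hR => by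
    have hR0 : 0 ≤ R := by linarith
    have hcont : Continuous fun x => ∫ ξ in (0 : ℝ)..R,
        (eP V ξ x * tP V φ ξ + eM V ξ x * tM V φ ξ) := by
      refine intervalIntegral.continuous_parametric_intervalIntegral_of_continuous' ?_ 0 R
      have c1 : Continuous fun p : ℝ × ℝ => eP V p.2 p.1 := continuous_eP_swap V
      have c2 : Continuous fun p : ℝ × ℝ => eM V p.2 p.1 := continuous_eM_swap V
      exact (c1.mul (hcP.comp continuous_snd)).add (c2.mul (hcM.comp continuous_snd))
    have i1 : Integrable fun x => starRingEnd ℂ (φ x) * ∫ ξ in (0 : ℝ)..R,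
        (eP V ξ x * tP V φ ξ + eM V ξ x * tM V φ ξ) :=
      Continuous.integrable_of_hasCompactSupport
        ((Complex.continuous_conj.comp hφ).mul hcont)
        ((hs.comp_left (g := starRingEnd ℂ) (map_zero _)).mul_right)
    have eQ : (Q : ℂ) = ∫ x, ((‖φ x‖ ^ 2 : ℝ) : ℂ) := integral_ofReal.symm
    rw [hJ, ← integral_truncated_sq V hφ hs hR0, eQ, ← integral_const_mul, ← integral_const_mul,
      ← integral_sub (i1.const_mul _) (hφ2.const_mul _), ← integral_const_mul]
    refine norm_integral_le_of_norm_le (hφi.norm.const_mul _) (Eventually.of_forall fun x => ?_)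
    have e : Complex.I * Real.pi * (starRingEnd ℂ (φ x) * ∫ ξ in (0 : ℝ)..R,
        (eP V ξ x * tP V φ ξ + eM V ξ x * tM V φ ξ)) -
        2 * Complex.I * Real.arctan R * ((‖φ x‖ ^ 2 : ℝ) : ℂ) =
        (Complex.I * Real.pi * (∫ ξ in (0 : ℝ)..R, (eP V ξ x * tP V φ ξ +
        eM V ξ x * tM V φ ξ)) - 2 * Complex.I * Real.arctan R * φ x) * starRingEnd ℂ (φ x) := by
      have : ((‖φ x‖ ^ 2 : ℝ) : ℂ) = φ x * starRingEnd ℂ (φ x) := by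
        rw [Complex.mul_conj, Complex.normSq_eq_norm_sq]
      rw [this]
      ring
    rw [e, norm_mul, RCLike.norm_conj]
    by_cases hx : |x| ≤ L
    · exact mul_le_mul_of_nonneg_right (hD R hR x hx) (norm_nonneg _)
    · simp [hL x (not_le.1 hx)]
  have hlim : Tendsto (fun R => Complex.I * Real.pi * (J R : ℂ)) atTop
      (𝓝 (Complex.I * Real.pi * (Q : ℂ))) := by
    have t1 : Tendsto (fun R => Complex.I * Real.pi * (J R : ℂ) -
        2 * Complex.I * Real.arctan R * (Q : ℂ)) atTop (𝓝 0) := by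
      refine squeeze_zero_norm' ((eventually_ge_atTop R₀).mono key) ?_
      have := (tendsto_const_nhds (x := D)).div_atTop (tendsto_id (α := ℝ) (x := atTop))
      simpa using this.mul_const (∫ x, ‖φ x‖)
    -- Since `arctan R → π / 2`, the factors `iπ` cancel in the limit.
    have t2 : Tendsto (fun R : ℝ => 2 * Complex.I * Real.arctan R * (Q : ℂ)) atTop
        (𝓝 (2 * Complex.I * ((Real.pi / 2 : ℝ) : ℂ) * (Q : ℂ))) := by
      have := (Complex.continuous_ofReal.tendsto _).comp
        (Real.tendsto_arctan_atTop.mono_right nhdsWithin_le_nhds)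
      exact (this.const_mul _).mul_const _
    have t3 := t1.add t2
    simp only [sub_add_cancel, zero_add] at t3
    convert t3 using 2
    push_cast
    ring
  have hlim' : Tendsto J atTop (𝓝 Q) := by
    have h0 : Complex.I * Real.pi ≠ 0 := by simp [Real.pi_ne_zero]
    have := hlim.const_mul (Complex.I * Real.pi)⁻¹
    simp only [inv_mul_cancel_left₀ h0] at this
    have := (Complex.continuous_re.tendsto _).comp this
    simpa [Function.comp_def] using this
  have hint : IntegrableOn G (Set.Ioi 0) := by
    refine integrableOn_Ioi_of_intervalIntegral_norm_tendsto Q 0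
      (fun R => (hGc.integrableOn_Icc (a := 0) (b := R)).mono_set Set.Ioc_subset_Icc_self) tendsto_id ?_
    refine hlim'.congr fun R => intervalIntegral.integral_congr fun ξ _ => ?_
    exact (Real.norm_of_nonneg (hG0 ξ)).symm
  exact ⟨hint, tendsto_nhds_unique
    (intervalIntegral_tendsto_integral_Ioi 0 hint tendsto_id) hlim'⟩

end inversion

/-! ### Exponentially decaying functions and the domain of the Schrödinger operator -/

/-- `u` decays exponentially. -/
def ExpDecay (u : ℝ → ℂ) : Prop := ∃ κ : ℝ, 0 < κ ∧ ∃ C : ℝ, ∀ x, ‖u x‖ ≤ C * Real.exp (-κ * |x|)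

theorem pow_mul_exp_le {κ : ℝ} (hκ : 0 < κ) (n : ℕ) (x : ℝ) :
    (1 + |x|) ^ n * Real.exp (-κ * |x|) ≤
      ((n + 2).factorial * Real.exp κ / κ ^ (n + 2)) * (1 + x ^ 2)⁻¹ := by
  have h := Real.pow_div_factorial_le_exp (κ * (1 + |x|)) (by positivity) (n + 2)
  have hx : 1 + x ^ 2 ≤ (1 + |x|) ^ 2 := by nlinarith [sq_abs x, abs_nonneg x]
  rw [div_le_iff₀ (by positivity), mul_pow, mul_add, mul_one, Real.exp_add] at h
  rw [neg_mul, Real.exp_neg, ← div_eq_mul_inv, ← div_eq_mul_inv, div_div, div_le_div_iff₀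
    (by positivity) (by positivity)]
  have h0 : 0 ≤ κ ^ (n + 2) * (1 + |x|) ^ n := by positivity
  calc (1 + |x|) ^ n * (κ ^ (n + 2) * (1 + x ^ 2))
      = κ ^ (n + 2) * (1 + |x|) ^ n * (1 + x ^ 2) := by ring
    _ ≤ κ ^ (n + 2) * (1 + |x|) ^ n * (1 + |x|) ^ 2 := mul_le_mul_of_nonneg_left hx h0
    _ = κ ^ (n + 2) * (1 + |x|) ^ (n + 2) := by ring
    _ ≤ _ := h
    _ = _ := by ring

namespace ExpDecay

variable {u v : ℝ → ℂ}

theorem integrable_pow_mul (hu : ExpDecay u) (hc : Continuous u) (n : ℕ) :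
    Integrable fun x => (1 + |x|) ^ n * ‖u x‖ := by
  obtain ⟨κ, hκ, C, hC⟩ := hu
  have hC0 : 0 ≤ C := by
    have := (norm_nonneg _).trans (hC 0)
    simpa using this
  refine (integrable_inv_one_add_sq.const_mul
    (C * ((n + 2).factorial * Real.exp κ / κ ^ (n + 2)))).mono'
    (Continuous.aestronglyMeasurable (by fun_prop)) (Eventually.of_forall fun x => ?_)
  rw [Real.norm_of_nonneg (by positivity), mul_assoc]
  calc (1 + |x|) ^ n * ‖u x‖ ≤ (1 + |x|) ^ n * (C * Real.exp (-κ * |x|)) := by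
        gcongr
        exact hC x
    _ = C * ((1 + |x|) ^ n * Real.exp (-κ * |x|)) := by ring
    _ ≤ _ := mul_le_mul_of_nonneg_left (pow_mul_exp_le hκ n x) hC0

theorem integrable (hu : ExpDecay u) (hc : Continuous u) : Integrable u := by
  have := hu.integrable_pow_mul hc 0
  simp only [pow_zero, one_mul] at this
  exact (integrable_norm_iff hc.aestronglyMeasurable).1 this

theorem mul_of_le (hu : ExpDecay u) {n : ℕ} {K : ℝ} (hv : ∀ x, ‖v x‖ ≤ K * (1 + |x|) ^ n) :
    ExpDecay fun x => v x * u x := by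
  obtain ⟨κ, hκ, C, hC⟩ := hu
  have hC0 : 0 ≤ C := by
    have := (norm_nonneg _).trans (hC 0)
    simpa using this
  have hK0 : 0 ≤ K := by
    have := (norm_nonneg _).trans (hv 0)
    simpa using this
  refine ⟨κ / 2, by positivity,
    K * C * ((n + 2).factorial * Real.exp (κ / 2) / (κ / 2) ^ (n + 2)), fun x => ?_⟩
  have h1 := pow_mul_exp_le (half_pos hκ) n x
  have h2 : (1 + x ^ 2)⁻¹ ≤ 1 := inv_le_one_of_one_le₀ (by nlinarith [sq_nonneg x])
  have h3 : Real.exp (-κ * |x|) = Real.exp (-(κ / 2) * |x|) * Real.exp (-(κ / 2) * |x|) := by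
    rw [← Real.exp_add]
    ring_nf
  rw [norm_mul]
  calc ‖v x‖ * ‖u x‖ ≤ (K * (1 + |x|) ^ n) * (C * Real.exp (-κ * |x|)) := by
        gcongr
        exacts [hv x, hC x]
    _ = K * C * ((1 + |x|) ^ n * Real.exp (-(κ / 2) * |x|)) * Real.exp (-(κ / 2) * |x|) := by
        rw [h3]
        ring
    _ ≤ _ := by
        gcongr
        exact h1.trans (mul_le_of_le_one_right (by positivity) h2)

theorem mul (hu : ExpDecay u) (hv : ExpDecay v) : ExpDecay fun x => v x * u x := by
  obtain ⟨κ, hκ, C, hC⟩ := hv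
  have hC0 : 0 ≤ C := by
    have := (norm_nonneg _).trans (hC 0)
    simpa using this
  refine hu.mul_of_le (n := 0) (K := C) fun x => (hC x).trans ?_
  rw [pow_zero]
  gcongr
  rw [Real.exp_le_one_iff, neg_mul]
  have := mul_nonneg hκ.le (abs_nonneg x)
  linarith

theorem star (hu : ExpDecay u) : ExpDecay fun x => starRingEnd ℂ (u x) := by
  obtain ⟨κ, hκ, C, hC⟩ := hu
  exact ⟨κ, hκ, C, fun x => by simpa using hC x⟩

theorem memLp (hu : ExpDecay u) (hc : Continuous u) : MemLp u 2 := by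
  rw [memLp_two_iff_integrable_sq_norm hc.aestronglyMeasurable]
  refine ((hu.mul hu).integrable (hc.mul hc)).norm.congr (Eventually.of_forall fun x => ?_)
  simp only [norm_mul, pow_two]

/-- Exponential bounds near `±∞` suffice, since a continuous function is bounded on compact sets. -/
theorem of_bounds {κ : ℝ} (hκ : 0 < κ) (hc : Continuous u) {C D L : ℝ}
    (hr : ∀ x, L ≤ x → ‖u x‖ ≤ C * Real.exp (-κ * |x|))
    (hl : ∀ x, x ≤ -L → ‖u x‖ ≤ D * Real.exp (-κ * |x|)) : ExpDecay u := by
  have hcont : Continuous fun x => ‖u x‖ * Real.exp (κ * |x|) := by fun_prop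
  obtain ⟨E, hE⟩ := isCompact_Icc.exists_bound_of_continuousOn (s := Set.Icc (-L) L)
    hcont.continuousOn
  refine ⟨κ, hκ, max E (max C D), fun x => ?_⟩
  have h0 := Real.exp_pos (-κ * |x|)
  rcases le_total L x with h | h
  · exact (hr x h).trans (mul_le_mul_of_nonneg_right
      ((le_max_left _ _).trans (le_max_right _ _)) h0.le)
  rcases le_total x (-L) with h' | h'
  · exact (hl x h').trans (mul_le_mul_of_nonneg_right
      ((le_max_right _ _).trans (le_max_right _ _)) h0.le)
  · have := hE x ⟨h', h⟩
    rw [Real.norm_of_nonneg (by positivity)] at this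
    have e : ‖u x‖ = ‖u x‖ * Real.exp (κ * |x|) * Real.exp (-κ * |x|) := by
      rw [mul_assoc, ← Real.exp_add]
      simp
    rw [e]
    exact mul_le_mul_of_nonneg_right (this.trans (le_max_left _ _)) h0.le

end ExpDecay

theorem hasWeakDeriv_of_hasDerivAt {f f' : ℝ → ℂ} (h : ∀ x, HasDerivAt f (f' x) x)
    (hc : Continuous f') : HasWeakDeriv f f' := by
  have hf : Continuous f := continuous_iff_continuousAt.2 fun x => (h x).continuousAt
  refine ⟨hf.locallyIntegrable, hc.locallyIntegrable, fun φ h1 h2 => ?_⟩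
  have hd : Continuous (deriv φ) := h1.continuous_deriv (by simp)
  have i1 : Integrable fun x => deriv φ x • f x :=
    hf.locallyIntegrable.integrable_smul_left_of_hasCompactSupport hd h2.deriv
  have i2 : Integrable fun x => φ x • f' x :=
    hc.locallyIntegrable.integrable_smul_left_of_hasCompactSupport h1.continuous h2
  have i3 : Integrable fun x => φ x • f x :=
    hf.locallyIntegrable.integrable_smul_left_of_hasCompactSupport h1.continuous h2
  have hφ : ∀ x, HasDerivAt φ (deriv φ x) x := fun x =>
    ((h1.differentiable (by simp)) x).hasDerivAt
  have := integral_eq_zero_of_hasDerivAt_of_integrable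
    (fun x => ((hφ x).smul (h x))) (i2.add i1) i3
  rw [← add_eq_zero_iff_eq_neg, ← integral_add i1 i2, ← this]
  refine integral_congr_ae (Eventually.of_forall fun x => ?_)
  exact add_comm _ _

/-- A classical description of elements of the graph of `H`. -/
theorem mem_schrodingerGraph {V : 𝓢(ℝ, ℝ)} {u u' u'' : ℝ → ℂ} (h1 : ∀ x, HasDerivAt u (u' x) x)
    (h2 : ∀ x, HasDerivAt u' (u'' x) x) (hc : Continuous u'') (m0 : MemLp u 2 volume)
    (m1 : MemLp u' 2 volume) (m2 : MemLp u'' 2 volume) {w : L2} (hw : ∀ᵐ x, w x = -u'' x + (V x : ℂ) * u x) :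
    (m0.toLp u, w) ∈ schrodingerGraph V := by
  have hc' : Continuous u' := continuous_iff_continuousAt.2 fun x => (h2 x).continuousAt
  refine ⟨m1.toLp u', m2.toLp u'',
    (hasWeakDeriv_of_hasDerivAt h1 hc').congr m0.coeFn_toLp.symm m1.coeFn_toLp.symm,
    (hasWeakDeriv_of_hasDerivAt h2 hc).congr m1.coeFn_toLp.symm m2.coeFn_toLp.symm, ?_⟩
  filter_upwards [hw, m0.coeFn_toLp, m2.coeFn_toLp] with x a b c
  simp only [a, b, c]

/-- The Jost solution decays like `e^{-Im k |x|}` at its own end of the line. -/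
theorem exists_norm_fP_le_exp (V : 𝓢(ℝ, ℝ)) {k : ℂ} (hk : k ∈ UH) : ∃ C : ℝ, ∀ x : ℝ, 0 ≤ x →
    ‖fP V k x‖ ≤ C * Real.exp (-k.im * |x|) ∧ ‖fP' V k x‖ ≤ C * Real.exp (-k.im * |x|) := by
  obtain ⟨C, hC0, hC⟩ := exists_mP_decay V
  refine ⟨(1 + ‖k‖) * (C + 1) + C, fun x hx => ?_⟩
  obtain ⟨h1, h2⟩ := hC k hk x hx
  have hx1 : (1 + x)⁻¹ ≤ 1 := inv_le_one_of_one_le₀ (by linarith)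
  have hx0 : 0 ≤ (1 + x)⁻¹ := by positivity
  have h3 : ‖mP V k x‖ ≤ C + 1 := by
    have : mP V k x = (mP V k x - 1) + 1 := by ring
    rw [this]
    refine (norm_add_le _ _).trans ?_
    rw [norm_one]
    have := h1.trans (mul_le_of_le_one_right hC0.le hx1)
    linarith
  have h4 : ‖mP' V k x‖ ≤ C := h2.trans (mul_le_of_le_one_right hC0.le (pow_le_one₀ hx0 hx1))
  have he : ‖Complex.exp (Complex.I * k * x)‖ = Real.exp (-k.im * |x|) := by
    rw [Complex.norm_exp, abs_of_nonneg hx]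
    simp
  have hk0 := norm_nonneg k
  rw [fP, fP', norm_mul, norm_mul, he, mul_comm, mul_comm (Real.exp _)]
  constructor
  · gcongr
    nlinarith
  · gcongr
    refine (norm_add_le _ _).trans ?_
    rw [norm_mul, norm_mul, Complex.norm_I, one_mul]
    nlinarith [mul_le_mul_of_nonneg_left h3 hk0]

theorem exists_norm_fM_le_exp (V : 𝓢(ℝ, ℝ)) {k : ℂ} (hk : k ∈ UH) : ∃ C : ℝ, ∀ x : ℝ, x ≤ 0 →
    ‖fM V k x‖ ≤ C * Real.exp (-k.im * |x|) ∧ ‖fM' V k x‖ ≤ C * Real.exp (-k.im * |x|) := by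
  obtain ⟨C, hC⟩ := exists_norm_fP_le_exp (refl V) hk
  refine ⟨C, fun x hx => ?_⟩
  have := hC (-x) (by linarith)
  rw [abs_neg] at this
  rwa [fM, fM', norm_neg]

/-- A function which is a multiple of `f₊` near `+∞` and of `f₋` near `-∞` decays exponentially,
together with its derivative. -/
theorem expDecay_of_eq {V : 𝓢(ℝ, ℝ)} {k : ℂ} (hk : 0 < k.im) {u u' : ℝ → ℂ} (hu : Continuous u)
    (hu' : Continuous u') {L : ℝ} {a b : ℂ}
    (hr : ∀ x, L ≤ x → u x = a * fP V k x ∧ u' x = a * fP' V k x)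
    (hl : ∀ x, x ≤ -L → u x = b * fM V k x ∧ u' x = b * fM' V k x) :
    ExpDecay u ∧ ExpDecay u' := by
  obtain ⟨C, hC⟩ := exists_norm_fP_le_exp V (le_of_lt hk : k ∈ UH)
  obtain ⟨D, hD⟩ := exists_norm_fM_le_exp V (le_of_lt hk : k ∈ UH)
  have h1 : ∀ x, max L 0 ≤ x → L ≤ x ∧ 0 ≤ x := fun x h => max_le_iff.1 h
  have h2 : ∀ x, x ≤ -max L 0 → x ≤ -L ∧ x ≤ 0 := fun x h => by
    have := max_le_iff.1 (le_neg_of_le_neg h)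
    exact ⟨by linarith, by linarith⟩
  constructor
  · refine .of_bounds (L := max L 0) (C := ‖a‖ * C) (D := ‖b‖ * D) hk hu (fun x hx => ?_)
      (fun x hx => ?_)
    · rw [(hr x (h1 x hx).1).1, norm_mul, mul_assoc]
      exact mul_le_mul_of_nonneg_left (hC x (h1 x hx).2).1 (norm_nonneg _)
    · rw [(hl x (h2 x hx).1).1, norm_mul, mul_assoc]
      exact mul_le_mul_of_nonneg_left (hD x (h2 x hx).2).1 (norm_nonneg _)
  · refine .of_bounds (L := max L 0) (C := ‖a‖ * C) (D := ‖b‖ * D) hk hu' (fun x hx => ?_)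
      (fun x hx => ?_)
    · rw [(hr x (h1 x hx).1).2, norm_mul, mul_assoc]
      exact mul_le_mul_of_nonneg_left (hC x (h1 x hx).2).2 (norm_nonneg _)
    · rw [(hl x (h2 x hx).1).2, norm_mul, mul_assoc]
      exact mul_le_mul_of_nonneg_left (hD x (h2 x hx).2).2 (norm_nonneg _)

theorem exists_abs_potential_le (V : 𝓢(ℝ, ℝ)) : ∃ M : ℝ, ∀ x, |V x| ≤ M := by
  obtain ⟨M, hM⟩ := V.decay 0 0
  exact ⟨M, fun x => by simpa using hM.2 x⟩

/-- If `H` has no eigenvectors, then the Wronskian of the Jost solutions does not vanish in the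
upper half plane: otherwise they would be proportional, hence exponentially decaying at both
ends. -/
theorem Wr_ne_zero_of_eigenvectors {V : 𝓢(ℝ, ℝ)} (hV : eigenvectors V = ∅) {k : ℂ}
    (hk : 0 < k.im) : Wr V k ≠ 0 := by
  intro h0
  have hkU : k ∈ UH := le_of_lt hk
  have hP := isSol_fP V hkU
  have hM := isSol_fM V hkU
  have hM0 := fM_ne_zero V hkU
  obtain ⟨c, hc⟩ := hP.exists_smul hM hM0 (x₀ := 0) (by
    have := wronskian_fP_fM V hkU 0
    rw [h0] at this
    exact this)
  have hd : ∀ x, fP' V k x = c * fM' V k x := fun x => by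
    have e : fP V k = fun x => c * fM V k x := by
      exact hc
    have h1 := hP.hasDeriv x
    rw [e] at h1
    exact h1.unique ((hM.hasDeriv x).const_mul c)
  have hcx : ∀ x, fP V k x = c * fM V k x := congrFun hc
  obtain ⟨d1, d2⟩ := expDecay_of_eq (u := fP V k) (u' := fP' V k) (a := 1) (b := c) (L := 0) hk
    hP.continuous hP.continuous' (fun x _ => by simp) (fun x _ => ⟨hcx x, hd x⟩)
  obtain ⟨M, hM'⟩ := exists_abs_potential_le V
  have hVc := V.continuous
  have hPc := hP.continuous
  have d3 : ExpDecay fun x => ((V x : ℂ) - k ^ 2) * fP V k x :=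
    d1.mul_of_le (n := 0) (K := M + ‖k ^ 2‖) fun x => by
      rw [pow_zero, mul_one]
      refine (norm_sub_le _ _).trans ?_
      gcongr
      simpa using hM' x
  have m0 := d1.memLp hPc
  have hmem := mem_schrodingerGraph (V := V) (w := (k ^ 2) • m0.toLp _) hP.hasDeriv hP.hasDeriv'
    (by fun_prop) m0 (d2.memLp hP.continuous') (d3.memLp (by fun_prop)) (by
      filter_upwards [Lp.coeFn_smul (k ^ 2) (m0.toLp _), m0.coeFn_toLp] with x a b
      rw [a, Pi.smul_apply, b, smul_eq_mul]
      ring)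
  -- The eigenvalue is `k²`; it need not be real here, as an eigenvector may belong to any complex
  -- number.
  have : m0.toLp _ ∈ eigenvectors V := by
    refine ⟨fun h => fP_ne_zero V hkU ?_, k ^ 2, ?_⟩
    · have h3 := m0.coeFn_toLp
      rw [h] at h3
      have h4 : fP V k =ᵐ[volume] (0 : ℝ → ℂ) := h3.symm.trans (Lp.coeFn_zero _ _ _)
      exact (Continuous.ae_eq_iff_eq volume hPc continuous_zero).1 h4
    · rw [schrodinger_graph]
      exact hmem
  rw [hV] at this
  exact this

/-! ### The resolvent at `k = i` -/

/-- The derivative of `solOp V h k`. -/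
def solOp' (V : 𝓢(ℝ, ℝ)) (h : ℝ → ℂ) (k : ℂ) (x : ℝ) : ℂ :=
  fP' V k x * (∫ y in Set.Iic x, fM V k y * h y) + fM' V k x * ∫ y in Set.Ioi x, fP V k y * h y

theorem hasDerivAt_setIntegral_Iic {g : ℝ → ℂ} (hg : Continuous g) (hi : Integrable g) (x : ℝ) :
    HasDerivAt (fun x => ∫ y in Set.Iic x, g y) (g x) x := by
  have e : (fun x => ∫ y in Set.Iic x, g y) = fun x => (∫ y, g y) - tail g x := funext fun x => by
    rw [tail, ← intervalIntegral.integral_Iic_add_Ioi (b := x) hi.integrableOn hi.integrableOn]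
    ring
  rw [e]
  exact ((hasDerivAt_tail hi hg x).const_sub _).congr_deriv (by simp)

section solOp

variable (V : 𝓢(ℝ, ℝ)) {k : ℂ} (hk : k ∈ UH) {h : ℝ → ℂ} (hc : Continuous h)
  (hs : HasCompactSupport h)
include hk hc hs

theorem integrable_fP_fM_mul : (Integrable fun y => fP V k y * h y) ∧
    Integrable fun y => fM V k y * h y :=
  ⟨((isSol_fP V hk).continuous.mul hc).integrable_of_hasCompactSupport hs.mul_left,
    ((isSol_fM V hk).continuous.mul hc).integrable_of_hasCompactSupport hs.mul_left⟩

theorem hasDerivAt_solOp (x : ℝ) : HasDerivAt (solOp V h k) (solOp' V h k x) x := by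
  obtain ⟨i1, i2⟩ := integrable_fP_fM_mul V hk hc hs
  have hP := isSol_fP V hk
  have hM := isSol_fM V hk
  have d1 := hasDerivAt_setIntegral_Iic (hM.continuous.mul hc) i2 x
  have d2 := hasDerivAt_tail i1 (hP.continuous.mul hc) x
  refine (((hP.hasDeriv x).mul d1).add ((hM.hasDeriv x).mul d2)).congr_deriv ?_
  simp only [solOp', tail, Pi.mul_apply]
  ring

/-- The jump of the resolvent kernel at the diagonal produces the Wronskian. -/
theorem hasDerivAt_solOp' (x : ℝ) : HasDerivAt (solOp' V h k)
    (((V x : ℂ) - k ^ 2) * solOp V h k x + Wr V k * h x) x := by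
  obtain ⟨i1, i2⟩ := integrable_fP_fM_mul V hk hc hs
  have hP := isSol_fP V hk
  have hM := isSol_fM V hk
  have d1 := hasDerivAt_setIntegral_Iic (hM.continuous.mul hc) i2 x
  have d2 := hasDerivAt_tail i1 (hP.continuous.mul hc) x
  refine (((hP.hasDeriv' x).mul d1).add ((hM.hasDeriv' x).mul d2)).congr_deriv ?_
  rw [← wronskian_fP_fM V hk x]
  simp only [solOp, tail, Pi.mul_apply]
  ring

omit hk in
/-- Outside the support of `h`, the function `solOp V h k` is a multiple of a Jost solution. -/
theorem expDecay_solOp (hk : 0 < k.im) : ExpDecay (solOp V h k) ∧ ExpDecay (solOp' V h k) := by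
  have hkU : k ∈ UH := le_of_lt hk
  obtain ⟨i1, i2⟩ := integrable_fP_fM_mul V hkU hc hs
  obtain ⟨L, hL0, hL⟩ := exists_support_bound hs
  have c1 : Continuous (solOp V h k) := continuous_iff_continuousAt.2 fun x =>
    (hasDerivAt_solOp V hkU hc hs x).continuousAt
  have c2 : Continuous (solOp' V h k) := continuous_iff_continuousAt.2 fun x =>
    (hasDerivAt_solOp' V hkU hc hs x).continuousAt
  have z1 : ∀ (g : ℝ → ℂ) x, L ≤ x → ∫ y in Set.Ioi x, g y * h y = 0 := fun g x hx =>
    setIntegral_eq_zero_of_forall_eq_zero fun y hy => by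
      rw [hL y ((hx.trans_lt hy).trans_le (le_abs_self y)), mul_zero]
  have z2 : ∀ (g : ℝ → ℂ) x, x < -L → ∫ y in Set.Iic x, g y * h y = 0 := fun g x hx =>
    setIntegral_eq_zero_of_forall_eq_zero fun y hy => by
      have : L < -y := by
        have : y ≤ x := hy
        linarith
      rw [hL y (this.trans_le (neg_le_abs y)), mul_zero]
  refine expDecay_of_eq (V := V) (L := L + 1) (a := ∫ y, fM V k y * h y) (b := ∫ y, fP V k y * h y) hk c1 c2
    (fun x hx => ?_) (fun x hx => ?_)
  · have e := intervalIntegral.integral_Iic_add_Ioi (b := x) i2.integrableOn i2.integrableOn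
    rw [z1 _ x (by linarith), add_zero] at e
    rw [solOp, solOp', e, z1 _ x (by linarith)]
    constructor <;> ring
  · have e := intervalIntegral.integral_Iic_add_Ioi (b := x) i1.integrableOn i1.integrableOn
    rw [z2 _ x (by linarith), zero_add] at e
    rw [solOp, solOp', e, z2 _ x (by linarith)]
    constructor <;> ring

end solOp

/-- The equation `(H + 1) u = g` has an exponentially decaying classical solution for every test
function `g`. -/
theorem exists_resolvent {V : 𝓢(ℝ, ℝ)} (hV : eigenvectors V = ∅) {g : ℝ → ℂ} (hc : Continuous g)
    (hs : HasCompactSupport g) : ∃ u u' : ℝ → ℂ, (∀ x, HasDerivAt u (u' x) x) ∧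
    (∀ x, HasDerivAt u' (((V x : ℂ) + 1) * u x - g x) x) ∧ ExpDecay u ∧ ExpDecay u' := by
  have hI : 0 < Complex.I.im := by simp
  have hIU : Complex.I ∈ UH := le_of_lt hI
  have hW := Wr_ne_zero_of_eigenvectors hV hI
  obtain ⟨e1, e2⟩ := expDecay_solOp V hc hs hI
  set W := Wr V Complex.I
  refine ⟨fun x => -W⁻¹ * solOp V g Complex.I x, fun x => -W⁻¹ * solOp' V g Complex.I x,
    fun x => (hasDerivAt_solOp V hIU hc hs x).const_mul _,
    fun x => ((hasDerivAt_solOp' V hIU hc hs x).const_mul (-W⁻¹)).congr_deriv ?_,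
    e1.mul_of_le (n := 0) (K := ‖-W⁻¹‖) (by simp), e2.mul_of_le (n := 0) (K := ‖-W⁻¹‖) (by simp)⟩
  rw [Complex.I_sq]
  field_simp
  ring

/-! ### Convergence and multiplication operators in `L²` -/

theorem norm_sq_eq_integral (f : L2) : ‖f‖ ^ 2 = ∫ x, ‖f x‖ ^ 2 := by
  have h1 : ((‖f‖ ^ 2 : ℝ) : ℂ) = ⟪f, f⟫_ℂ := by
    rw [inner_self_eq_norm_sq_to_K]
    push_cast
    rfl
  rw [L2.inner_def] at h1
  have h2 : ∀ x, ⟪f x, f x⟫_ℂ = ((‖f x‖ ^ 2 : ℝ) : ℂ) := fun x => by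
    rw [inner_self_eq_norm_sq_to_K]
    push_cast
    rfl
  simp only [h2] at h1
  rw [integral_complex_ofReal] at h1
  exact Complex.ofReal_injective h1

theorem inner_toLp {g : ℝ → ℂ} (hg : MemLp g 2 volume) (f : L2) :
    ⟪hg.toLp g, f⟫_ℂ = ∫ x, starRingEnd ℂ (g x) * f x := by
  rw [L2.inner_def]
  refine integral_congr_ae ?_
  filter_upwards [hg.coeFn_toLp] with x hx
  rw [hx, RCLike.inner_apply, mul_comm]

/-- Convergence in `L²` and pointwise convergence have the same limit. -/
theorem ae_eq_of_tendsto {f : ℕ → L2} {f₀ : L2} {g : ℕ → ℝ → ℂ} {g₀ : ℝ → ℂ}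
    (hf : Tendsto f atTop (𝓝 f₀)) (he : ∀ n, f n =ᵐ[volume] g n)
    (hg : ∀ᵐ x, Tendsto (fun n => g n x) atTop (𝓝 (g₀ x))) : f₀ =ᵐ[volume] g₀ := by
  obtain ⟨φ, hφ, h⟩ := (tendstoInMeasure_of_tendsto_Lp hf).exists_seq_tendsto_ae
  filter_upwards [h, hg, ae_all_iff.2 he] with x h1 h2 h3
  refine tendsto_nhds_unique h1 ?_
  have := h2.comp hφ.tendsto_atTop
  refine this.congr fun n => ?_
  simp [h3]

/-- Dominated convergence in `L²`. -/
theorem tendsto_L2_of_dominated {ι : Type*} {l : Filter ι} [l.IsCountablyGenerated] {F : ι → L2}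
    {f : L2} {G : ι → ℝ → ℂ} (he : ∀ i, F i =ᵐ[volume] G i) {b : ℝ → ℝ} (hb : MemLp b 2 volume)
    (hbd : ∀ᶠ i in l, ∀ᵐ x, ‖G i x‖ ≤ b x)
    (hlim : ∀ᵐ x, Tendsto (fun i => G i x) l (𝓝 (f x))) : Tendsto F l (𝓝 f) := by
  rw [tendsto_iff_norm_sub_tendsto_zero]
  have h2 : ∀ i, ‖F i - f‖ ^ 2 = ∫ x, ‖G i x - f x‖ ^ 2 := fun i => by
    rw [norm_sq_eq_integral]
    refine integral_congr_ae ?_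
    filter_upwards [Lp.coeFn_sub (F i) f, he i] with x h1 h2
    rw [h1, Pi.sub_apply, h2]
  have h3 : Tendsto (fun i => ‖F i - f‖ ^ 2) l (𝓝 0) := by
    simp only [h2]
    have h0 : (0 : ℝ) = ∫ _ : ℝ, (0 : ℝ) := by simp
    rw [h0]
    have hbf : MemLp (fun x => b x + ‖f x‖) 2 volume := hb.add (Lp.memLp f).norm
    refine tendsto_integral_filter_of_dominated_convergence (fun x => (b x + ‖f x‖) ^ 2)
      (Eventually.of_forall fun i => ?_) ?_ hbf.integrable_sq ?_
    · have : AEStronglyMeasurable (G i) volume := (Lp.aestronglyMeasurable (F i)).congr (he i)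
      exact ((this.sub (Lp.aestronglyMeasurable f)).norm.pow 2)
    · filter_upwards [hbd] with i hi
      filter_upwards [hi] with x hx
      rw [Real.norm_of_nonneg (by positivity)]
      have := (norm_sub_le (G i x) (f x)).trans (add_le_add_left hx ‖f x‖)
      gcongr
    · filter_upwards [hlim] with x hx
      have := ((hx.sub_const (f x)).norm).pow 2
      simpa using this
  have h4 := (Real.continuous_sqrt.tendsto 0).comp h3
  simpa [Function.comp_def, Real.sqrt_sq] using h4

theorem integral_smul_eq_inner {φ : ℝ → ℝ} (hc : Continuous φ) (hs : HasCompactSupport φ) :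
    ∃ w : L2, ∀ f : L2, ∫ x, φ x • f x = ⟪w, f⟫_ℂ := by
  have hm : MemLp (fun x => (φ x : ℂ)) 2 volume :=
    Continuous.memLp_of_hasCompactSupport (by fun_prop)
      (hs.comp_left (g := fun r : ℝ => (r : ℂ)) (by simp))
  refine ⟨hm.toLp _, fun f => ?_⟩
  rw [inner_toLp]
  simp

/-- The weak derivative is a closed operator in `L²`. -/
theorem hasWeakDeriv_of_tendsto {u v : ℕ → L2} {u₀ v₀ : L2} (hu : Tendsto u atTop (𝓝 u₀))
    (hv : Tendsto v atTop (𝓝 v₀)) (h : ∀ n, HasWeakDeriv (u n) (v n)) : HasWeakDeriv u₀ v₀ := by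
  have hl : ∀ f : L2, LocallyIntegrable f volume := fun f =>
    (Lp.memLp f).locallyIntegrable one_le_two
  refine ⟨hl _, hl _, fun φ h1 h2 => ?_⟩
  obtain ⟨w, hw⟩ := integral_smul_eq_inner (h1.continuous_deriv (by simp)) h2.deriv
  obtain ⟨z, hz⟩ := integral_smul_eq_inner h1.continuous h2
  rw [hw, hz]
  have t1 : Tendsto (fun n => ⟪w, u n⟫_ℂ) atTop (𝓝 ⟪w, u₀⟫_ℂ) := tendsto_const_nhds.inner hu
  have t2 : Tendsto (fun n => -⟪z, v n⟫_ℂ) atTop (𝓝 (-⟪z, v₀⟫_ℂ)) :=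
    (tendsto_const_nhds.inner hv).neg
  refine tendsto_nhds_unique t1 (t2.congr fun n => ?_)
  rw [← hw, ← hz, (h n).2.2 φ h1 h2]

theorem memLp_bcf_mul (m : ℝ →ᵇ ℂ) (f : L2) : MemLp (fun x => m x * f x) 2 volume :=
  (Lp.memLp f).of_le_mul (m.continuous.aestronglyMeasurable.mul (Lp.aestronglyMeasurable f))
    (c := ‖m‖) (Eventually.of_forall fun x => by
      rw [norm_mul]
      exact mul_le_mul_of_nonneg_right (m.norm_coe_le_norm x) (norm_nonneg _))

/-- Multiplication by a bounded continuous function, as an operator on `L²`. -/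
def mulOp (m : ℝ →ᵇ ℂ) : L2 →L[ℂ] L2 :=
  LinearMap.mkContinuous
    { toFun := fun f => (memLp_bcf_mul m f).toLp _
      map_add' := fun f g => by
        rw [← MemLp.toLp_add, MemLp.toLp_eq_toLp_iff]
        filter_upwards [Lp.coeFn_add f g] with x hx
        simp only [hx, Pi.add_apply]
        ring
      map_smul' := fun c f => by
        rw [RingHom.id_apply, ← MemLp.toLp_const_smul, MemLp.toLp_eq_toLp_iff]
        filter_upwards [Lp.coeFn_smul c f] with x hx
        simp only [hx, Pi.smul_apply, smul_eq_mul]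
        ring } ‖m‖ fun f => by
    refine Lp.norm_le_mul_norm_of_ae_le_mul ?_
    filter_upwards [(memLp_bcf_mul m f).coeFn_toLp] with x hx
    simp only [LinearMap.coe_mk, AddHom.coe_mk]
    rw [hx, norm_mul]
    exact mul_le_mul_of_nonneg_right (m.norm_coe_le_norm x) (norm_nonneg _)

theorem coeFn_mulOp (m : ℝ →ᵇ ℂ) (f : L2) : mulOp m f =ᵐ[volume] fun x => m x * f x :=
  (memLp_bcf_mul m f).coeFn_toLp

theorem norm_mulOp_apply_le (m : ℝ →ᵇ ℂ) (f : L2) : ‖mulOp m f‖ ≤ ‖m‖ * ‖f‖ :=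
  ((mulOp m).le_opNorm f).trans (mul_le_mul_of_nonneg_right
    (LinearMap.mkContinuous_norm_le _ (norm_nonneg _) _) (norm_nonneg _))

theorem mulOp_mul (m n : ℝ →ᵇ ℂ) : mulOp (m * n) = mulOp m * mulOp n := by
  ext1 f
  refine Lp.ext ?_
  filter_upwards [coeFn_mulOp (m * n) f, coeFn_mulOp m (mulOp n f), coeFn_mulOp n f] with x a b c
  rw [a]
  change _ = (mulOp m (mulOp n f)) x
  rw [b, c, BoundedContinuousFunction.mul_apply, mul_assoc]

theorem mulOp_one : mulOp 1 = 1 := by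
  ext1 f
  refine Lp.ext ?_
  filter_upwards [coeFn_mulOp 1 f] with x a
  rw [a]
  simp

theorem inner_mulOp (m : ℝ →ᵇ ℂ) (f g : L2) : ⟪f, mulOp m g⟫_ℂ = ⟪mulOp (star m) f, g⟫_ℂ := by
  rw [L2.inner_def, L2.inner_def]
  refine integral_congr_ae ?_
  filter_upwards [coeFn_mulOp m g, coeFn_mulOp (star m) f] with x a b
  rw [a, b, RCLike.inner_apply, RCLike.inner_apply]
  simp only [BoundedContinuousFunction.star_apply, map_mul, RCLike.star_def, RingHomCompTriple.comp_apply, RingHom.id_apply]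
  ring

/-! ### The distorted Fourier transform on `L²` -/

/-- The kernel of the distorted Fourier transform, which is `ψ(x, ξ)` except at `ξ = 0`. -/
def ker (V : 𝓢(ℝ, ℝ)) (ξ x : ℝ) : ℂ := if 0 < ξ then eP V ξ x else eM V (-ξ) x

theorem psi_eq_ker (V : 𝓢(ℝ, ℝ)) (x : ℝ) {ξ : ℝ} (hξ : ξ ≠ 0) : psi V x ξ = ker V ξ x := by
  rcases lt_or_gt_of_ne hξ with h | h
  · rw [psi_of_neg V x h, ker, if_neg (not_lt.2 h.le)]
  · rw [psi_of_pos V x h, ker, if_pos h]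

theorem continuous_ker_snd (V : 𝓢(ℝ, ℝ)) (ξ : ℝ) : Continuous (ker V ξ) := by
  by_cases h : 0 < ξ
  · have e : ker V ξ = eP V ξ := funext fun x => if_pos h
    rw [e]
    exact continuous_eP_snd V ξ
  · have e : ker V ξ = eM V (-ξ) := funext fun x => if_neg h
    rw [e]
    exact continuous_eM_snd V (-ξ)

theorem measurable_ker (V : 𝓢(ℝ, ℝ)) : Measurable fun p : ℝ × ℝ => ker V p.1 p.2 := by
  have h1 : Continuous fun p : ℝ × ℝ => ((-p.1, p.2) : ℝ × ℝ) := by fun_prop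
  have h2 := Continuous.comp (continuous_eM V) h1
  simp only [Function.comp_def] at h2
  exact Measurable.ite (measurableSet_lt measurable_const measurable_fst)
    (continuous_eP V).measurable h2.measurable

theorem exists_norm_ker_le (V : 𝓢(ℝ, ℝ)) :
    ∃ C : ℝ, 0 < C ∧ ∀ ξ x : ℝ, ‖ker V ξ x‖ ≤ C * (1 + |x|) := by
  obtain ⟨C, hC0, hC⟩ := exists_norm_eP_eM_le V
  refine ⟨C, hC0, fun ξ x => ?_⟩
  rw [ker]
  split_ifs
  exacts [(hC _ _).1, (hC _ _).2]

/-- The distorted Fourier transform as an absolutely convergent integral. -/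
def dft (V : 𝓢(ℝ, ℝ)) (f : ℝ → ℂ) (ξ : ℝ) : ℂ := ∫ y, starRingEnd ℂ (ker V ξ y) * f y

theorem dft_of_pos (V : 𝓢(ℝ, ℝ)) (f : ℝ → ℂ) {ξ : ℝ} (h : 0 < ξ) : dft V f ξ = tP V f ξ := by
  simp only [dft, ker, if_pos h, tP]

theorem dft_of_nonpos (V : 𝓢(ℝ, ℝ)) (f : ℝ → ℂ) {ξ : ℝ} (h : ξ ≤ 0) :
    dft V f ξ = tM V f (-ξ) := by
  simp only [dft, ker, if_neg (not_lt.2 h), tM]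

theorem dft_congr (V : 𝓢(ℝ, ℝ)) {f g : ℝ → ℂ} (h : f =ᵐ[volume] g) : dft V f = dft V g :=
  funext fun ξ => integral_congr_ae (h.mono fun x hx => by simp only [hx])

theorem integrable_star_ker_mul (V : 𝓢(ℝ, ℝ)) {f : ℝ → ℂ} (hf : AEStronglyMeasurable f volume)
    (hi : Integrable fun y => (1 + |y|) * ‖f y‖) (ξ : ℝ) :
    Integrable fun y => starRingEnd ℂ (ker V ξ y) * f y := by
  obtain ⟨C, hC0, hC⟩ := exists_norm_ker_le V
  have hc : Continuous fun y => starRingEnd ℂ (ker V ξ y) :=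
    Complex.continuous_conj.comp (continuous_ker_snd V ξ)
  have hb : ∀ y, ‖starRingEnd ℂ (ker V ξ y) * f y‖ ≤ C * ((1 + |y|) * ‖f y‖) := fun y => by
    rw [norm_mul, RCLike.norm_conj, ← mul_assoc]
    exact mul_le_mul_of_nonneg_right (hC ξ y) (norm_nonneg _)
  exact Integrable.mono' (hi.const_mul C) (hc.aestronglyMeasurable.mul hf) (Eventually.of_forall hb)

theorem measurable_dft (V : 𝓢(ℝ, ℝ)) {f : ℝ → ℂ} (hf : AEStronglyMeasurable f volume)
    (hi : Integrable fun y => (1 + |y|) * ‖f y‖) : Measurable (dft V f) := by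
  have e : dft V f = fun ξ => if 0 < ξ then tP V f ξ else tM V f (-ξ) := funext fun ξ => by
    split_ifs with h
    · exact dft_of_pos V f h
    · exact dft_of_nonpos V f (not_lt.1 h)
  rw [e]
  exact Measurable.ite (measurableSet_lt measurable_const measurable_id)
    (continuous_tP V hf hi).measurable ((continuous_tM V hf hi).comp continuous_neg).measurable

/-- Plancherel's identity for test functions, on the whole frequency line. -/
theorem integral_norm_dft_sq {V : 𝓢(ℝ, ℝ)} (hV : eigenvectors V = ∅) {φ : ℝ → ℂ}
    (hφ : ContDiff ℝ ∞ φ) (hs : HasCompactSupport φ) :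
    Integrable (fun ξ => ‖dft V φ ξ‖ ^ 2) ∧ ∫ ξ, ‖dft V φ ξ‖ ^ 2 = ∫ x, ‖φ x‖ ^ 2 := by
  have hφ' : ContDiff ℝ ∞ (deriv φ) := hφ.deriv'
  have h1 : ∀ x, HasDerivAt φ (deriv φ x) x := fun x =>
    ((hφ.differentiable (by simp)) x).hasDerivAt
  have h2 : ∀ x, HasDerivAt (deriv φ) (deriv (deriv φ) x) x := fun x =>
    ((hφ'.differentiable (by simp)) x).hasDerivAt
  obtain ⟨p1, p2⟩ := plancherel (fun k hk => Wr_ne_zero_of_eigenvectors hV hk) h1 h2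
    (hφ'.continuous_deriv (by simp)) hs
  have hm := hφ.continuous.aestronglyMeasurable (μ := (volume : Measure ℝ))
  have hi := integrable_one_add_mul hφ.continuous hs
  have cP := continuous_tP V hm hi
  have cM := continuous_tM V hm hi
  have i1 : IntegrableOn (fun ξ => ‖tP V φ ξ‖ ^ 2) (Set.Ioi 0) := by
    refine Integrable.mono' p1 (by fun_prop) (Eventually.of_forall fun ξ => ?_)
    rw [Real.norm_of_nonneg (by positivity)]
    have : 0 ≤ ‖tM V φ ξ‖ ^ 2 := by positivity
    linarith
  have i2 : IntegrableOn (fun ξ => ‖tM V φ ξ‖ ^ 2) (Set.Ioi 0) := by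
    refine Integrable.mono' p1 (by fun_prop) (Eventually.of_forall fun ξ => ?_)
    rw [Real.norm_of_nonneg (by positivity)]
    have : 0 ≤ ‖tP V φ ξ‖ ^ 2 := by positivity
    linarith
  have e1 : Set.EqOn (fun ξ => ‖dft V φ ξ‖ ^ 2) (fun ξ => ‖tP V φ ξ‖ ^ 2) (Set.Ioi 0) :=
    fun ξ hξ => by simp only [dft_of_pos V φ hξ]
  have e2 : Set.EqOn (fun ξ => ‖dft V φ ξ‖ ^ 2) (fun ξ => ‖tM V φ (-ξ)‖ ^ 2) (Set.Iic 0) :=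
    fun ξ hξ => by simp only [dft_of_nonpos V φ hξ]
  have i3 : IntegrableOn (fun ξ => ‖tM V φ (-ξ)‖ ^ 2) (Set.Iic 0) := by
    have := (integrableOn_Ici_iff_integrableOn_Ioi (b := (0 : ℝ)) (μ := volume)).2 i2
    have h := this.comp_neg
    simpa using h
  have j1 : IntegrableOn (fun ξ => ‖dft V φ ξ‖ ^ 2) (Set.Ioi 0) :=
    i1.congr_fun e1.symm measurableSet_Ioi
  have j2 : IntegrableOn (fun ξ => ‖dft V φ ξ‖ ^ 2) (Set.Iic 0) :=
    i3.congr_fun e2.symm measurableSet_Iic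
  refine ⟨?_, ?_⟩
  · rw [← integrableOn_univ, ← Set.Iic_union_Ioi (a := (0 : ℝ))]
    exact j2.union j1
  · rw [← intervalIntegral.integral_Iic_add_Ioi j2 j1, setIntegral_congr_fun measurableSet_Ioi e1,
      setIntegral_congr_fun measurableSet_Iic e2, integral_comp_neg_Iic (0 : ℝ)
      (fun ξ => ‖tM V φ ξ‖ ^ 2), neg_zero, add_comm, ← integral_add i1 i2, p2]

/-- The classes of the smooth compactly supported functions in `L²`. -/
def testSpace : Submodule ℂ L2 where
  carrier := {f | ∃ g : ℝ → ℂ, f =ᵐ[volume] g ∧ HasCompactSupport g ∧ ContDiff ℝ ∞ g}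
  zero_mem' := ⟨0, Lp.coeFn_zero _ _ _, HasCompactSupport.zero, contDiff_const⟩
  add_mem' := by
    rintro f g ⟨φ, a, b, c⟩ ⟨φ', a', b', c'⟩
    exact ⟨φ + φ', (Lp.coeFn_add f g).trans (a.add a'), b.add b', c.add c'⟩
  smul_mem' := by
    rintro r f ⟨φ, a, b, c⟩
    exact ⟨r • φ, (Lp.coeFn_smul r f).trans (a.const_smul r), b.comp_left (g := fun z => r • z) (smul_zero r), c.const_smul r⟩

theorem dense_testSpace : Dense (testSpace : Set L2) :=
  Lp.dense_hasCompactSupport_contDiff (by simp)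

theorem integrable_one_add_of_mem_testSpace {f : L2} (hf : f ∈ testSpace) :
    Integrable fun y => (1 + |y|) * ‖f y‖ := by
  obtain ⟨φ, a, b, c⟩ := hf
  refine (integrable_one_add_mul c.continuous b).congr ?_
  filter_upwards [a] with x hx
  rw [hx]

theorem memLp_dft_of_mem_testSpace {V : 𝓢(ℝ, ℝ)} (hV : eigenvectors V = ∅) {f : L2}
    (hf : f ∈ testSpace) : MemLp (dft V f) 2 volume := by
  have hm := measurable_dft V (Lp.aestronglyMeasurable f) (integrable_one_add_of_mem_testSpace hf)
  rw [memLp_two_iff_integrable_sq_norm hm.aestronglyMeasurable]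
  obtain ⟨φ, a, b, c⟩ := hf
  rw [dft_congr V a]
  exact (integral_norm_dft_sq hV c b).1

/-- The distorted Fourier transform on test functions, as a linear map. -/
def dftTest {V : 𝓢(ℝ, ℝ)} (hV : eigenvectors V = ∅) : testSpace →ₗ[ℂ] L2 where
  toFun f := (memLp_dft_of_mem_testSpace hV f.2).toLp _
  map_add' f g := by
    rw [← MemLp.toLp_add, MemLp.toLp_eq_toLp_iff]
    refine Eventually.of_forall fun ξ => ?_
    have i1 := integrable_star_ker_mul V (Lp.aestronglyMeasurable (f : L2))
      (integrable_one_add_of_mem_testSpace f.2) ξ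
    have i2 := integrable_star_ker_mul V (Lp.aestronglyMeasurable (g : L2))
      (integrable_one_add_of_mem_testSpace g.2) ξ
    rw [Pi.add_apply, dft, dft, dft, ← integral_add i1 i2]
    refine integral_congr_ae ?_
    filter_upwards [Lp.coeFn_add (f : L2) (g : L2)] with x hx
    rw [Submodule.coe_add, hx, Pi.add_apply]
    ring
  map_smul' r f := by
    rw [RingHom.id_apply, ← MemLp.toLp_const_smul, MemLp.toLp_eq_toLp_iff]
    refine Eventually.of_forall fun ξ => ?_
    rw [Pi.smul_apply, dft, dft, ← integral_smul]
    refine integral_congr_ae ?_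
    filter_upwards [Lp.coeFn_smul r (f : L2)] with x hx
    rw [Submodule.coe_smul, hx, Pi.smul_apply, smul_eq_mul, smul_eq_mul]
    ring

theorem norm_dftTest {V : 𝓢(ℝ, ℝ)} (hV : eigenvectors V = ∅) (f : testSpace) :
    ‖dftTest hV f‖ = ‖(f : L2)‖ := by
  have h : ‖dftTest hV f‖ ^ 2 = ‖(f : L2)‖ ^ 2 := by
    rw [norm_sq_eq_integral, norm_sq_eq_integral]
    obtain ⟨φ, a, b, c⟩ := f.2
    have e1 : ∫ x, ‖(dftTest hV f : ℝ → ℂ) x‖ ^ 2 = ∫ x, ‖dft V φ x‖ ^ 2 := by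
      refine integral_congr_ae ?_
      filter_upwards [(memLp_dft_of_mem_testSpace hV f.2).coeFn_toLp] with x hx
      rw [← dft_congr V a, ← hx]
      rfl
    have e2 : ∫ x, ‖(f : L2) x‖ ^ 2 = ∫ x, ‖φ x‖ ^ 2 := by
      refine integral_congr_ae ?_
      filter_upwards [a] with x hx
      rw [hx]
    rw [e1, e2]
    exact (integral_norm_dft_sq hV c b).2
  exact (pow_left_inj₀ (norm_nonneg _) (norm_nonneg _) two_ne_zero).1 h

/-- The distorted Fourier transform on `L²`, as the continuous extension of the transform of
test functions. -/
def FT {V : 𝓢(ℝ, ℝ)} (hV : eigenvectors V = ∅) : L2 →L[ℂ] L2 :=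
  (dftTest hV).extendOfNorm testSpace.subtype

section FT

variable {V : 𝓢(ℝ, ℝ)} (hV : eigenvectors V = ∅)

theorem denseRange_testSpace : DenseRange testSpace.subtype := by
  have := dense_testSpace
  rw [DenseRange]
  simpa using this

theorem FT_test (f : testSpace) : FT hV (f : L2) = dftTest hV f :=
  LinearMap.extendOfNorm_eq denseRange_testSpace ⟨1, fun x => by
    rw [norm_dftTest, one_mul]; rfl⟩ f

theorem norm_FT (f : L2) : ‖FT hV f‖ = ‖f‖ := by
  refine dense_testSpace.induction (P := fun f => ‖FT hV f‖ = ‖f‖) (fun f hf => ?_)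
    (isClosed_eq (by fun_prop) (by fun_prop)) f
  have := FT_test hV ⟨f, hf⟩
  rw [this, norm_dftTest]

theorem coeFn_FT_test {f : L2} (hf : f ∈ testSpace) : FT hV f =ᵐ[volume] dft V f := by
  have := FT_test hV ⟨f, hf⟩
  rw [this]
  exact (memLp_dft_of_mem_testSpace hV hf).coeFn_toLp

theorem inner_FT_FT (f g : L2) : ⟪FT hV f, FT hV g⟫_ℂ = ⟪f, g⟫_ℂ :=
  (LinearMap.norm_map_iff_inner_map_map (FT hV)).1 (norm_FT hV) f g

end FT

/-- The truncation of `f` to `(-R, R]`. -/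
def trunc (R : ℝ) (f : L2) : L2 :=
  ((Lp.memLp f).indicator (measurableSet_Ioc (a := -R) (b := R))).toLp _

theorem coeFn_trunc (R : ℝ) (f : L2) : trunc R f =ᵐ[volume] (Set.Ioc (-R) R).indicator f :=
  MemLp.coeFn_toLp _

theorem eventually_mem_Ioc (x : ℝ) : ∀ᶠ R : ℝ in atTop, x ∈ Set.Ioc (-R) R := by
  filter_upwards [eventually_gt_atTop |x|] with R hR
  exact ⟨by linarith [neg_abs_le x], by linarith [le_abs_self x]⟩

theorem tendsto_trunc (f : L2) : Tendsto (fun R => trunc R f) atTop (𝓝 f) := by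
  refine tendsto_L2_of_dominated (fun R => coeFn_trunc R f) (Lp.memLp f).norm
    (Eventually.of_forall fun R => Eventually.of_forall fun x => norm_indicator_le_norm_self _ _)
    (Eventually.of_forall fun x => ?_)
  refine tendsto_const_nhds.congr' ?_
  filter_upwards [eventually_mem_Ioc x] with R hR
  rw [Set.indicator_of_mem hR]

/-- A smooth cutoff function, as a bounded continuous function. -/
def bump (χ : ContDiffBump (0 : ℝ)) : ℝ →ᵇ ℂ :=
  BoundedContinuousFunction.ofNormedAddCommGroup (fun x => (χ x : ℂ))
    (Complex.continuous_ofReal.comp χ.continuous) 1 fun x => by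
      rw [Complex.norm_real, Real.norm_of_nonneg χ.nonneg]
      exact χ.le_one

theorem mulOp_bump_mem_testSpace (χ : ContDiffBump (0 : ℝ)) {f : L2} (hf : f ∈ testSpace) :
    mulOp (bump χ) f ∈ testSpace := by
  obtain ⟨φ, a, b, c⟩ := hf
  refine ⟨fun x => (χ x : ℂ) * φ x, ?_, b.mul_left, ?_⟩
  · filter_upwards [coeFn_mulOp (bump χ) f, a] with x h1 h2
    rw [h1, h2]
    rfl
  · exact (Complex.ofRealCLM.contDiff.comp χ.contDiff).mul c

section FT

variable {V : 𝓢(ℝ, ℝ)} (hV : eigenvectors V = ∅)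

/-- On functions supported in a fixed compact set, evaluation of the transform at a point is
continuous for the `L²` norm. -/
theorem exists_dft_eq_inner (V : 𝓢(ℝ, ℝ)) (ξ r : ℝ) : ∃ w : L2, ∀ f : L2,
    (∀ᵐ y, r < |y| → f y = 0) → dft V f ξ = ⟪w, f⟫_ℂ := by
  have hm : MemLp ((Set.Icc (-r) r).indicator (ker V ξ)) 2 volume := by
    obtain ⟨K, hK⟩ := isCompact_Icc.exists_bound_of_continuousOn (s := Set.Icc (-r) r)
      (continuous_ker_snd V ξ).continuousOn
    rw [memLp_indicator_iff_restrict measurableSet_Icc]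
    refine MemLp.of_bound (continuous_ker_snd V ξ).aestronglyMeasurable K ?_
    filter_upwards [ae_restrict_mem measurableSet_Icc] with x hx using hK x hx
  refine ⟨hm.toLp _, fun f hf => ?_⟩
  rw [inner_toLp, dft]
  refine integral_congr_ae ?_
  filter_upwards [hf] with y hy
  by_cases h : y ∈ Set.Icc (-r) r
  · rw [Set.indicator_of_mem h]
  · rw [hy (by
      by_contra h'
      exact h (abs_le.1 (not_lt.1 h'))), mul_zero, mul_zero]

/-- The integral formula for compactly supported functions, by approximation with test functions
supported in a fixed compact set. -/
theorem coeFn_FT_of_support {f : L2} {L : ℝ} (hL : ∀ᵐ y, L < |y| → f y = 0) :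
    FT hV f =ᵐ[volume] dft V f := by
  -- The cutoff keeps the supports of the approximants in a fixed ball without affecting `f`.
  let χ : ContDiffBump (0 : ℝ) := ⟨max L 1, max L 1 + 1, by positivity, by linarith⟩
  have hχ : mulOp (bump χ) f = f := by
    refine Lp.ext ?_
    filter_upwards [coeFn_mulOp (bump χ) f, hL] with x h1 h2
    rw [h1]
    by_cases h : L < |x|
    · rw [h2 h, mul_zero]
    · have : χ x = 1 := χ.one_of_mem_closedBall (by
        rw [mem_closedBall_zero_iff, Real.norm_eq_abs]
        exact (not_lt.1 h).trans (le_max_left _ _))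
      have e : bump χ x = 1 := by
        change ((χ x : ℝ) : ℂ) = 1
        rw [this, Complex.ofReal_one]
      rw [e, one_mul]
  have hs : ∀ h : L2, ∀ᵐ y, max L 1 + 1 < |y| → (mulOp (bump χ) h : L2) y = 0 := fun h => by
    filter_upwards [coeFn_mulOp (bump χ) h] with y h1 hy
    have : χ y = 0 := χ.zero_of_le_dist (by
      rw [dist_zero_right, Real.norm_eq_abs]
      exact hy.le)
    have e : bump χ y = 0 := by
      change ((χ y : ℝ) : ℂ) = 0
      rw [this, Complex.ofReal_zero]
    rw [h1, e, zero_mul]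
  obtain ⟨g, hg, hgf⟩ := mem_closure_iff_seq_limit.1 (dense_testSpace f)
  have ht : Tendsto (fun n => mulOp (bump χ) (g n)) atTop (𝓝 f) := by
    have := ((mulOp (bump χ)).continuous.tendsto f).comp hgf
    rwa [hχ] at this
  refine ae_eq_of_tendsto (((FT hV).continuous.tendsto f).comp ht)
    (g := fun n => dft V (mulOp (bump χ) (g n)))
    (fun n => coeFn_FT_test hV (mulOp_bump_mem_testSpace χ (hg n)))
    (Eventually.of_forall fun ξ => ?_)
  obtain ⟨w, hw⟩ := exists_dft_eq_inner V ξ (max L 1 + 1)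
  have h2 := hs f
  rw [hχ] at h2
  simp only [hw _ (hs _), hw _ h2]
  exact tendsto_const_nhds.inner ht

theorem coeFn_FT_trunc (R : ℝ) (f : L2) :
    FT hV (trunc R f) =ᵐ[volume] dft V ((Set.Ioc (-R) R).indicator f) := by
  rw [← dft_congr V (coeFn_trunc R f)]
  refine coeFn_FT_of_support hV (L := |R|) ?_
  filter_upwards [coeFn_trunc R f] with x hx hR
  rw [hx, Set.indicator_of_notMem]
  intro h
  have : |x| ≤ R := abs_le.2 ⟨h.1.le, h.2⟩
  linarith [le_abs_self R]

/-- On functions with an integrable first moment, the distorted Fourier transform is the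
absolutely convergent integral. -/
theorem coeFn_FT_of_integrable {f : L2} (hi : Integrable fun y => (1 + |y|) * ‖f y‖) :
    FT hV f =ᵐ[volume] dft V f := by
  have ht : Tendsto (fun n : ℕ => trunc n f) atTop (𝓝 f) :=
    (tendsto_trunc f).comp tendsto_natCast_atTop_atTop
  refine ae_eq_of_tendsto (((FT hV).continuous.tendsto f).comp ht)
    (fun n => coeFn_FT_trunc hV n f) (Eventually.of_forall fun ξ => ?_)
  have hk := integrable_star_ker_mul V (Lp.aestronglyMeasurable f) hi ξ
  refine tendsto_integral_of_dominated_convergence _ (fun n => ?_) hk.norm (fun n => ?_)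
    (Eventually.of_forall fun x => ?_)
  · exact ((Complex.continuous_conj.comp (continuous_ker_snd V ξ)).aestronglyMeasurable).mul
      ((Lp.aestronglyMeasurable f).indicator measurableSet_Ioc)
  · refine Eventually.of_forall fun x => ?_
    rw [norm_mul, norm_mul]
    exact mul_le_mul_of_nonneg_left (norm_indicator_le_norm_self _ _) (norm_nonneg _)
  · refine tendsto_const_nhds.congr' ?_
    filter_upwards [(tendsto_natCast_atTop_atTop (R := ℝ)).eventually (eventually_mem_Ioc x)]
      with n hn
    rw [Set.indicator_of_mem hn]

theorem integral_psi_ae_eq {R : ℝ} (hR : 0 ≤ R) (f : L2) :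
    (fun ξ : ℝ => ∫ x in (-R)..R, starRingEnd ℂ (psi V x ξ) * f x) =ᵐ[volume]
      FT hV (trunc R f) := by
  filter_upwards [coeFn_FT_trunc hV R f, (Set.countable_singleton (0 : ℝ)).ae_notMem volume]
    with ξ hξ hξ0
  have hξ0' : ξ ≠ 0 := hξ0
  rw [hξ, dft, intervalIntegral.integral_of_le (by linarith), ← integral_indicator
    measurableSet_Ioc]
  congr 1
  funext x
  by_cases hx : x ∈ Set.Ioc (-R) R
  · rw [Set.indicator_of_mem hx, Set.indicator_of_mem hx, psi_eq_ker V x hξ0']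
  · rw [Set.indicator_of_notMem hx, Set.indicator_of_notMem hx, mul_zero]

theorem isDistFT_iff (f g : L2) :
    IsDistFT V f g ↔ Tendsto (fun R => FT hV (trunc R f)) atTop (𝓝 g) := by
  rw [Lp.tendsto_Lp_iff_tendsto_eLpNorm', IsDistFT]
  refine tendsto_congr' ?_
  filter_upwards [eventually_ge_atTop 0] with R hR
  refine eLpNorm_congr_ae ?_
  filter_upwards [integral_psi_ae_eq hV hR f] with ξ hξ
  rw [Pi.sub_apply, hξ]

/-- The `L²` limit of the truncated integrals exists and is given by the isometry `FT`. -/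
theorem distFT_eq (f : L2) : distFT V f = FT hV f := by
  have h : IsDistFT V f (FT hV f) :=
    (isDistFT_iff hV f _).2 (((FT hV).continuous.tendsto f).comp (tendsto_trunc f))
  have h' : IsDistFT V f (distFT V f) := Classical.epsilon_spec ⟨_, h⟩
  exact tendsto_nhds_unique ((isDistFT_iff hV f _).1 h') ((isDistFT_iff hV f _).1 h)

end FT

/-! ### The resolvent of `H` at `-1` -/

theorem IsSol.const_mul {V : 𝓢(ℝ, ℝ)} {k : ℂ} {f f' : ℝ → ℂ} (h : IsSol V k f f') (c : ℂ) :
    IsSol V k (fun x => c * f x) (fun x => c * f' x) where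
  hasDeriv := fun x => (h.hasDeriv x).const_mul c
  hasDeriv' := fun x => ((h.hasDeriv' x).const_mul c).congr_deriv (by ring)

theorem exists_isSol_ker (V : 𝓢(ℝ, ℝ)) (ξ : ℝ) : ∃ e', IsSol V ξ (ker V ξ) e' := by
  by_cases h : 0 < ξ
  · have e : ker V ξ = fun x => (((Real.sqrt (2 * Real.pi))⁻¹ : ℝ) : ℂ) *
        (2 * Complex.I * kap V ξ) * fP V ξ x := funext fun x => by
      rw [ker, if_pos h, eP]
      ring
    rw [e]
    exact ⟨_, (isSol_fP V (ofReal_mem_UH ξ)).const_mul _⟩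
  · have e : ker V ξ = fun x => (((Real.sqrt (2 * Real.pi))⁻¹ : ℝ) : ℂ) *
        (2 * Complex.I * kap V ((-ξ : ℝ) : ℂ)) * fM V ((-ξ : ℝ) : ℂ) x := funext fun x => by
      rw [ker, if_neg h, eM]
      ring
    rw [e]
    have h1 := (isSol_fM V (ofReal_mem_UH (-ξ))).const_mul
      ((((Real.sqrt (2 * Real.pi))⁻¹ : ℝ) : ℂ) * (2 * Complex.I * kap V ((-ξ : ℝ) : ℂ)))
    exact ⟨_, ⟨h1.hasDeriv, fun x => (h1.hasDeriv' x).congr_deriv (by push_cast; ring)⟩⟩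

/-- A solution of linear growth has a bounded second derivative up to linear growth, hence a first
derivative of at most quadratic growth. -/
theorem IsSol.exists_deriv_le {V : 𝓢(ℝ, ℝ)} {k : ℂ} {f f' : ℝ → ℂ} (h : IsSol V k f f') {C : ℝ}
    (hC : ∀ x, ‖f x‖ ≤ C * (1 + |x|)) : ∃ K : ℝ, ∀ x, ‖f' x‖ ≤ K * (1 + |x|) ^ 2 := by
  obtain ⟨M, hM⟩ := exists_abs_potential_le V
  have hM0 : 0 ≤ M := (abs_nonneg _).trans (hM 0)
  have hC0 : 0 ≤ C := by
    have := (norm_nonneg _).trans (hC 0)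
    simpa using this
  refine ⟨‖f' 0‖ + (M + ‖k ^ 2‖) * C, fun x => ?_⟩
  have hb : ∀ y ∈ Set.Icc (-|x|) |x|, ‖((V y : ℂ) - k ^ 2) * f y‖ ≤
      (M + ‖k ^ 2‖) * (C * (1 + |x|)) := fun y hy => by
    rw [norm_mul]
    have h1 : |y| ≤ |x| := abs_le.2 hy
    gcongr
    · refine (norm_sub_le _ _).trans ?_
      gcongr
      simpa using hM y
    · exact (hC y).trans (by gcongr)
  have h2 := (convex_Icc (-|x|) |x|).norm_image_sub_le_of_norm_hasDerivWithin_le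
    (fun y _ => (h.hasDeriv' y).hasDerivWithinAt) hb (x := 0) (y := x)
    ⟨by simp, by simp⟩ ⟨neg_abs_le x, le_abs_self x⟩
  rw [sub_zero, Real.norm_eq_abs] at h2
  have h3 : ‖f' x‖ ≤ ‖f' 0‖ + ‖f' x - f' 0‖ := by
    have := norm_add_le (f' 0) (f' x - f' 0)
    rwa [add_sub_cancel] at this
  have hx := abs_nonneg x
  have h4 : (1 + |x|) * |x| ≤ (1 + |x|) ^ 2 := by nlinarith
  have h5 : 1 ≤ (1 + |x|) ^ 2 := by nlinarith
  calc ‖f' x‖ ≤ ‖f' 0‖ + (M + ‖k ^ 2‖) * (C * (1 + |x|)) * |x| := h3.trans (by gcongr)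
    _ = ‖f' 0‖ * 1 + (M + ‖k ^ 2‖) * C * ((1 + |x|) * |x|) := by ring
    _ ≤ ‖f' 0‖ * (1 + |x|) ^ 2 + (M + ‖k ^ 2‖) * C * (1 + |x|) ^ 2 := by gcongr
    _ = _ := by ring

/-- The distorted Fourier transform diagonalizes the resolvent. -/
theorem dft_resolvent {V : 𝓢(ℝ, ℝ)} {u u' g : ℝ → ℂ} (h1 : ∀ x, HasDerivAt u (u' x) x)
    (h2 : ∀ x, HasDerivAt u' (((V x : ℂ) + 1) * u x - g x) x) (d1 : ExpDecay u)
    (d2 : ExpDecay u') (hc : Continuous g) (hs : HasCompactSupport g) (ξ : ℝ) :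
    (1 + (ξ : ℂ) ^ 2) * dft V u ξ = dft V g ξ := by
  have cu : Continuous u := continuous_iff_continuousAt.2 fun x => (h1 x).continuousAt
  have cu' : Continuous u' := continuous_iff_continuousAt.2 fun x => (h2 x).continuousAt
  obtain ⟨C, hC0, hC⟩ := exists_norm_ker_le V
  obtain ⟨e', he⟩ := exists_isSol_ker V ξ
  obtain ⟨K, hK⟩ := he.exists_deriv_le (hC ξ)
  have hs' := he.star
  have i1 := integrable_star_ker_mul V cu.aestronglyMeasurable
    (by simpa using d1.integrable_pow_mul cu 1) ξ
  have i2 := integrable_star_ker_mul V hc.aestronglyMeasurable (integrable_one_add_mul hc hs) ξ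
  -- The Wronskian of the eigenfunction and `u` vanishes at both ends, by the exponential decay of
  -- `u`.
  have hd : ∀ x, HasDerivAt (fun x => starRingEnd ℂ (e' x) * u x - starRingEnd ℂ (ker V ξ x) * u' x)
      (starRingEnd ℂ (ker V ξ x) * g x - (1 + (ξ : ℂ) ^ 2) * (starRingEnd ℂ (ker V ξ x) * u x)) x :=
    fun x => (((hs'.hasDeriv' x).mul (h1 x)).sub ((hs'.hasDeriv x).mul (h2 x))).congr_deriv (by ring)
  have j1 : Integrable fun x => starRingEnd ℂ (e' x) * u x :=
    (d1.mul_of_le (n := 2) (K := K) fun x => by simpa using hK x).integrable (hs'.continuous'.mul cu)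
  have j2 : Integrable fun x => starRingEnd ℂ (ker V ξ x) * u' x :=
    (d2.mul_of_le (n := 1) (K := C) fun x => by simpa using hC ξ x).integrable
      (hs'.continuous.mul cu')
  have := integral_eq_zero_of_hasDerivAt_of_integrable hd (i2.sub (i1.const_mul _)) (j1.sub j2)
  rw [integral_sub i2 (i1.const_mul _), integral_const_mul, sub_eq_zero] at this
  exact this.symm

/-- The multiplier `(1 + ξ²)⁻¹`. -/
def invMul : ℝ →ᵇ ℂ :=
  BoundedContinuousFunction.ofNormedAddCommGroup (fun ξ : ℝ => (((1 + ξ ^ 2)⁻¹ : ℝ) : ℂ))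
    (Complex.continuous_ofReal.comp (Continuous.inv₀ (by fun_prop) fun ξ => by positivity)) 1
    fun ξ => by
      rw [Complex.norm_real, Real.norm_of_nonneg (by positivity)]
      exact inv_le_one_of_one_le₀ (by nlinarith [sq_nonneg ξ])

theorem norm_invMul_le : ‖invMul‖ ≤ 1 :=
  BoundedContinuousFunction.norm_ofNormedAddCommGroup_le _ zero_le_one _

/-- The multiplier `V + 1`. -/
def potMul (V : 𝓢(ℝ, ℝ)) : ℝ →ᵇ ℂ :=
  BoundedContinuousFunction.ofNormedAddCommGroup (fun x : ℝ => (V x : ℂ) + 1)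
    (by have := V.continuous; fun_prop) ((exists_abs_potential_le V).choose + 1) fun x => by
      refine (norm_add_le _ _).trans ?_
      rw [norm_one]
      have := (exists_abs_potential_le V).choose_spec x
      gcongr
      simpa using this

section resolvent

variable {V : 𝓢(ℝ, ℝ)} (hV : eigenvectors V = ∅)

/-- The resolvent `(H + 1)⁻¹`, constructed through the distorted Fourier transform. -/
def resOp : L2 →L[ℂ] L2 := ContinuousLinearMap.adjoint (FT hV) * mulOp invMul * FT hV

theorem adjoint_FT_FT (f : L2) : ContinuousLinearMap.adjoint (FT hV) (FT hV f) = f := by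
  refine ext_inner_left ℂ fun g => ?_
  rw [ContinuousLinearMap.adjoint_inner_right, inner_FT_FT]

theorem norm_adjoint_FT_le (f : L2) : ‖ContinuousLinearMap.adjoint (FT hV) f‖ ≤ ‖f‖ := by
  have h1 : ‖FT hV‖ ≤ 1 := (FT hV).opNorm_le_bound zero_le_one fun f => by rw [norm_FT, one_mul]
  have h2 := (ContinuousLinearMap.adjoint (FT hV)).le_opNorm f
  rw [LinearIsometryEquiv.norm_map] at h2
  exact h2.trans (mul_le_of_le_one_left (norm_nonneg _) h1)

theorem norm_resOp_apply_le (g : L2) : ‖resOp hV g‖ ≤ ‖g‖ := by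
  refine (norm_adjoint_FT_le hV _).trans ((norm_mulOp_apply_le _ _).trans ?_)
  change ‖invMul‖ * ‖FT hV g‖ ≤ ‖g‖
  rw [norm_FT]
  exact mul_le_of_le_one_left (norm_nonneg _) norm_invMul_le

/-- The resolvent of a test function has two weak derivatives, with an energy bound on the
first. -/
theorem resOp_test {g : L2} (hg : g ∈ testSpace) : FT hV (resOp hV g) = mulOp invMul (FT hV g) ∧
    ∃ v : L2, HasWeakDeriv (resOp hV g) v ∧
      HasWeakDeriv v (mulOp (potMul V) (resOp hV g) - g : L2) ∧
      ‖v‖ ^ 2 ≤ (‖potMul V‖ + 1) * ‖g‖ ^ 2 := by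
  obtain ⟨φ, hgφ, hs, hφ⟩ := hg
  have hc := hφ.continuous
  obtain ⟨u, u', h1, h2, d1, d2⟩ := exists_resolvent hV hc hs
  have cu : Continuous u := continuous_iff_continuousAt.2 fun x => (h1 x).continuousAt
  have cu' : Continuous u' := continuous_iff_continuousAt.2 fun x => (h2 x).continuousAt
  have hVc := V.continuous
  have mu := d1.memLp cu
  have mu' := d2.memLp cu'
  have iu : Integrable fun y => (1 + |y|) * ‖mu.toLp u y‖ := by
    refine (d1.integrable_pow_mul cu 1).congr ?_
    filter_upwards [mu.coeFn_toLp] with x hx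
    rw [hx, pow_one]
  have ig : Integrable fun y => (1 + |y|) * ‖g y‖ := by
    refine (integrable_one_add_mul hc hs).congr ?_
    filter_upwards [hgφ] with x hx
    rw [hx]
  -- The classical solution `u` is identified with `resOp hV g` by its transform.
  have e1 : FT hV (mu.toLp u) = mulOp invMul (FT hV g) := by
    refine Lp.ext ?_
    filter_upwards [coeFn_FT_of_integrable hV iu, coeFn_mulOp invMul (FT hV g),
      coeFn_FT_of_integrable hV ig] with ξ a b c
    rw [a, b, c, dft_congr V mu.coeFn_toLp, dft_congr V hgφ, ← dft_resolvent h1 h2 d1 d2 hc hs ξ]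
    have h0 : (1 + (ξ : ℂ) ^ 2) ≠ 0 := by
      have : (1 + ξ ^ 2 : ℝ) ≠ 0 := by positivity
      exact_mod_cast this
    have e : invMul ξ = (1 + (ξ : ℂ) ^ 2)⁻¹ := by
      change (((1 + ξ ^ 2)⁻¹ : ℝ) : ℂ) = _
      push_cast
      rfl
    rw [e, inv_mul_cancel_left₀ h0]
  have e2 : resOp hV g = mu.toLp u := by
    rw [← adjoint_FT_FT hV (mu.toLp u), e1]
    rfl
  rw [e2]
  have hw : (mulOp (potMul V) (mu.toLp u) - g : L2) =ᵐ[volume]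
      fun x => ((V x : ℂ) + 1) * u x - φ x := by
    filter_upwards [Lp.coeFn_sub (mulOp (potMul V) (mu.toLp u)) g,
      coeFn_mulOp (potMul V) (mu.toLp u), mu.coeFn_toLp, hgφ] with x a b c d
    rw [a, Pi.sub_apply, b, c, d]
    rfl
  refine ⟨e1, mu'.toLp u', (hasWeakDeriv_of_hasDerivAt h1 cu').congr mu.coeFn_toLp.symm
    mu'.coeFn_toLp.symm, (hasWeakDeriv_of_hasDerivAt h2 (by fun_prop)).congr
    mu'.coeFn_toLp.symm hw.symm, ?_⟩
  have hn : ‖mu.toLp u‖ ≤ ‖g‖ := by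
    rw [← e2]
    exact norm_resOp_apply_le hV g
  -- The energy identity, obtained by integrating `(conj u u')'`.
  have hen : ⟪mu'.toLp u', mu'.toLp u'⟫_ℂ =
      -⟪mu.toLp u, (mulOp (potMul V) (mu.toLp u) - g : L2)⟫_ℂ := by
    have d3 : ExpDecay fun x => starRingEnd ℂ (u x) * u' x := d2.mul d1.star
    have hd : ∀ x, HasDerivAt (fun x => starRingEnd ℂ (u x) * u' x)
        (starRingEnd ℂ (u' x) * u' x + starRingEnd ℂ (u x) * (((V x : ℂ) + 1) * u x - φ x)) x :=
      fun x => (h1 x).star.mul (h2 x)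
    have i1 : Integrable fun x => starRingEnd ℂ (u' x) * u' x :=
      (d2.mul d2.star).integrable ((Complex.continuous_conj.comp cu').mul cu')
    have i2 : Integrable fun x => starRingEnd ℂ (u x) * (((V x : ℂ) + 1) * u x - φ x) := by
      have j1 : Integrable fun x => starRingEnd ℂ (u x) * φ x :=
        Continuous.integrable_of_hasCompactSupport
          ((Complex.continuous_conj.comp cu).mul hc) hs.mul_left
      have j2 : ExpDecay fun x => potMul V x * (starRingEnd ℂ (u x) * u x) :=
        (d1.mul d1.star).mul_of_le (n := 0) (K := ‖potMul V‖) fun x => by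
          simpa using (potMul V).norm_coe_le_norm x
      have j3 := (j2.integrable ((potMul V).continuous.mul
        ((Complex.continuous_conj.comp cu).mul cu))).sub j1
      refine j3.congr (Eventually.of_forall fun x => ?_)
      change ((V x : ℂ) + 1) * (starRingEnd ℂ (u x) * u x) - starRingEnd ℂ (u x) * φ x = _
      ring
    have h0 := integral_eq_zero_of_hasDerivAt_of_integrable hd (i1.add i2)
      (d3.integrable ((Complex.continuous_conj.comp cu).mul cu'))
    rw [integral_add i1 i2] at h0
    rw [inner_toLp, inner_toLp]
    have k1 : ∫ x, starRingEnd ℂ (u' x) * mu'.toLp u' x = ∫ x, starRingEnd ℂ (u' x) * u' x := by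
      refine integral_congr_ae ?_
      filter_upwards [mu'.coeFn_toLp] with x hx
      rw [hx]
    have k2 : ∫ x, starRingEnd ℂ (u x) * (mulOp (potMul V) (mu.toLp u) - g : L2) x =
        ∫ x, starRingEnd ℂ (u x) * (((V x : ℂ) + 1) * u x - φ x) := by
      refine integral_congr_ae ?_
      filter_upwards [hw] with x hx
      rw [hx]
    rw [k1, k2]
    linear_combination h0
  have h3 : ‖mu'.toLp u'‖ ^ 2 = ‖⟪mu'.toLp u', mu'.toLp u'⟫_ℂ‖ := by
    rw [inner_self_eq_norm_sq_to_K]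
    simp
  rw [h3, hen, norm_neg]
  have h4 : ‖(mulOp (potMul V) (mu.toLp u) - g : L2)‖ ≤ (‖potMul V‖ + 1) * ‖g‖ := by
    refine (norm_sub_le _ _).trans ?_
    have := (norm_mulOp_apply_le (potMul V) (mu.toLp u)).trans
      (mul_le_mul_of_nonneg_left hn (norm_nonneg _))
    linarith
  calc _ ≤ ‖mu.toLp u‖ * ‖(mulOp (potMul V) (mu.toLp u) - g : L2)‖ := norm_inner_le_norm _ _
    _ ≤ ‖g‖ * ((‖potMul V‖ + 1) * ‖g‖) := by gcongr
    _ = _ := by ring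

theorem FT_resOp (g : L2) : FT hV (resOp hV g) = mulOp invMul (FT hV g) :=
  dense_testSpace.induction (P := fun g => FT hV (resOp hV g) = mulOp invMul (FT hV g))
    (fun _ hg => (resOp_test hV hg).1) (isClosed_eq (by fun_prop) (by fun_prop)) g

theorem HasWeakDeriv.sub {f g f' g' : ℝ → ℂ} (h : HasWeakDeriv f g) (h' : HasWeakDeriv f' g') :
    HasWeakDeriv (f - f') (g - g') := by
  have := h.add (h'.smul (-1))
  simpa [sub_eq_add_neg] using this

/-- The range of `resOp` lies in the domain of `H`: by the energy bound, the derivatives of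
approximating resolvents form a Cauchy sequence. -/
theorem exists_weakDeriv_resOp (g : L2) : ∃ v : L2, HasWeakDeriv (resOp hV g) v ∧
    HasWeakDeriv v (mulOp (potMul V) (resOp hV g) - g : L2) := by
  obtain ⟨G, hG, hlim⟩ := mem_closure_iff_seq_limit.1 (dense_testSpace g)
  choose v hv1 hv2 hv3 using fun n => (resOp_test hV (hG n)).2
  have hdiff : ∀ m n, ‖v m - v n‖ ≤ Real.sqrt (‖potMul V‖ + 1) * ‖G m - G n‖ := fun m n => by
    obtain ⟨w, hw1, -, hw3⟩ := (resOp_test hV (testSpace.sub_mem (hG m) (hG n))).2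
    have e : w = v m - v n := by
      refine Lp.ext (hw1.unique ?_)
      refine ((hv1 m).sub (hv1 n)).congr ?_ (Lp.coeFn_sub _ _).symm
      rw [map_sub]
      exact (Lp.coeFn_sub _ _).symm
    rw [← e]
    have := Real.sqrt_le_sqrt hw3
    rwa [Real.sqrt_sq (norm_nonneg _), Real.sqrt_mul (by positivity),
      Real.sqrt_sq (norm_nonneg _)] at this
  have hcau : CauchySeq v := by
    have hcG := hlim.cauchySeq
    rw [Metric.cauchySeq_iff] at hcG ⊢
    intro ε hε
    obtain ⟨N, hN⟩ := hcG (ε / (Real.sqrt (‖potMul V‖ + 1) + 1)) (by positivity)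
    refine ⟨N, fun m hm n hn => ?_⟩
    have h1 := hN m hm n hn
    rw [dist_eq_norm, lt_div_iff₀ (by positivity)] at h1
    rw [dist_eq_norm]
    have := hdiff m n
    nlinarith [norm_nonneg (G m - G n)]
  obtain ⟨v₀, hv₀⟩ := cauchySeq_tendsto_of_complete hcau
  have t1 := ((resOp hV).continuous.tendsto g).comp hlim
  have t2 := (((mulOp (potMul V)).continuous.tendsto _).comp t1).sub hlim
  exact ⟨v₀, hasWeakDeriv_of_tendsto t1 hv₀ hv1, hasWeakDeriv_of_tendsto hv₀ t2 hv2⟩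

/-- The operator `H + 1`. -/
abbrev opA (V : 𝓢(ℝ, ℝ)) : L2 →ₗ.[ℂ] L2 := (LinearMap.id : L2 →ₗ[ℂ] L2) +ᵥ schrodinger V

theorem mem_graph_opA (u w : L2) : (u, w) ∈ (opA V).graph ↔ (u, w - u) ∈ schrodingerGraph V := by
  rw [← schrodinger_graph, LinearPMap.mem_graph_iff, LinearPMap.mem_graph_iff]
  constructor
  · rintro ⟨y, hy1, hy2⟩
    refine ⟨y, hy1, ?_⟩
    rw [LinearPMap.vadd_apply] at hy2
    simp only at hy1 hy2 ⊢
    rw [← hy2, ← hy1]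
    simp
  · rintro ⟨y, hy1, hy2⟩
    refine ⟨y, hy1, ?_⟩
    rw [LinearPMap.vadd_apply]
    rw [hy2]
    change (y : L2) + (w - u) = w
    rw [hy1]
    exact add_sub_cancel u w

/-- `H + 1` is the inverse of the resolvent operator. The absence of eigenvectors gives the
injectivity of `H + 1`. -/
theorem mem_graph_opA_iff (u g : L2) : (u, g) ∈ (opA V).graph ↔ u = resOp hV g := by
  have hS : ∀ g, (resOp hV g, g) ∈ (opA V).graph := fun g => by
    rw [mem_graph_opA]
    obtain ⟨v, hv1, hv2⟩ := exists_weakDeriv_resOp hV g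
    refine ⟨v, _, hv1, hv2, ?_⟩
    filter_upwards [Lp.coeFn_sub g (resOp hV g), Lp.coeFn_sub (mulOp (potMul V) (resOp hV g)) g,
      coeFn_mulOp (potMul V) (resOp hV g)] with x a b c
    rw [a, b, Pi.sub_apply, Pi.sub_apply, c]
    change _ = -(((V x : ℂ) + 1) * resOp hV g x - g x) + _
    ring
  refine ⟨fun h => ?_, fun h => h ▸ hS g⟩
  have h1 := (opA V).graph.sub_mem h (hS g)
  rw [Prod.mk_sub_mk, sub_self, mem_graph_opA, zero_sub, ← schrodinger_graph] at h1
  by_contra hne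
  have : u - resOp hV g ∈ eigenvectors V := ⟨sub_ne_zero.2 hne, -1, by simpa using h1⟩
  rw [hV] at this
  exact this

end resolvent

/-! ### Square roots and unitary groups with a bounded inverse of the generator -/

theorem eq_of_mul_self_eq {E : Type*} [NormedAddCommGroup E] [InnerProductSpace ℂ E]
    [CompleteSpace E] {a b : E →L[ℂ] E} (ha : 0 ≤ a) (hb : 0 ≤ b) (h : a * a = b * b) : a = b := by
  rw [← CFC.sqrt_unique h ha, CFC.sqrt_unique rfl hb]

theorem commute_of_mul_self {E : Type*} [NormedAddCommGroup E] [InnerProductSpace ℂ E]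
    [CompleteSpace E] {a b : E →L[ℂ] E} (ha : 0 ≤ a) (h : Commute (a * a) b) : Commute a b := by
  have h1 : Commute (CFC.sqrt (a * a)) b := h.cfcₙ_nnreal NNReal.sqrt
  rwa [CFC.sqrt_unique rfl ha] at h1

section abstract_theory

variable {Q S : L2 →L[ℂ] L2}

theorem nonneg_of_symm (hs : ∀ x y, ⟪Q x, y⟫_ℂ = ⟪x, Q y⟫_ℂ) (hp : ∀ x, 0 ≤ (⟪Q x, x⟫_ℂ).re) :
    0 ≤ Q := by
  rw [ContinuousLinearMap.nonneg_iff_isPositive]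
  exact ⟨hs, hp⟩

/-- The inverse of an injective operator, as an unbounded operator. -/
def invGraph (Q : L2 →L[ℂ] L2) : Submodule ℂ (L2 × L2) where
  carrier := {p | p.1 = Q p.2}
  zero_mem' := by simp
  add_mem' := by
    rintro ⟨a, b⟩ ⟨c, d⟩ h1 h2
    simp only [Set.mem_ofPred_eq] at h1 h2 ⊢
    simp [h1, h2]
  smul_mem' := by
    rintro r ⟨a, b⟩ h1
    simp only [Set.mem_ofPred_eq] at h1 ⊢
    simp [h1]

theorem mem_invGraph (p : L2 × L2) : p ∈ invGraph Q ↔ p.1 = Q p.2 := Iff.rfl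

theorem graph_toLinearPMap_invGraph (hQ : Function.Injective Q) :
    (invGraph Q).toLinearPMap.graph = invGraph Q :=
  Submodule.toLinearPMap_graph_eq _ fun p hp h0 => hQ (by
    rw [map_zero, ← (mem_invGraph p).1 hp, h0])

theorem dense_range_of_symm (hQ : Function.Injective Q) (hs : ∀ x y, ⟪Q x, y⟫_ℂ = ⟪x, Q y⟫_ℂ) :
    DenseRange Q := by
  have h : (LinearMap.range (Q : L2 →ₗ[ℂ] L2))ᗮ = ⊥ := by
    rw [Submodule.eq_bot_iff]
    intro x hx
    refine hQ ?_
    rw [map_zero, ← inner_self_eq_zero (𝕜 := ℂ), hs]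
    rw [Submodule.mem_orthogonal'] at hx
    exact hx _ ⟨Q x, rfl⟩
  have := (Submodule.topologicalClosure_eq_top_iff).2 h
  rw [DenseRange]
  have h2 := Submodule.dense_iff_topologicalClosure_eq_top.2 this
  exact h2

/-- If the inverse of `A` is the square of an injective nonnegative bounded operator `Q`, then `Q⁻¹`
is a nonnegative square root of `A`. -/
theorem isNonnegSqrt_invGraph {A : L2 →ₗ.[ℂ] L2} (hQ : Function.Injective Q)
    (hs : ∀ x y, ⟪Q x, y⟫_ℂ = ⟪x, Q y⟫_ℂ) (hp : ∀ x, 0 ≤ (⟪Q x, x⟫_ℂ).re)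
    (hA : ∀ f g, (f, g) ∈ A.graph ↔ f = Q (Q g)) :
    IsNonnegSqrt A (invGraph Q).toLinearPMap := by
  have hg := graph_toLinearPMap_invGraph hQ
  set T := (invGraph Q).toLinearPMap
  have hd : Dense (T.domain : Set L2) := by
    refine (dense_range_of_symm hQ hs).mono ?_
    rintro _ ⟨x, rfl⟩
    have : (Q x, x) ∈ T.graph := by
      rw [hg]
      exact (mem_invGraph _).2 rfl
    exact LinearPMap.mem_domain_of_mem_graph this
  refine ⟨?_, fun f => ?_, fun f g => ?_⟩
  · rw [LinearPMap.isSelfAdjoint_def]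
    refine LinearPMap.eq_of_eq_graph ?_
    rw [LinearPMap.adjoint_graph_eq_graph_adjoint hd, hg]
    ext ⟨x, y⟩
    rw [Submodule.mem_adjoint_iff, mem_invGraph]
    constructor
    · intro h
      refine ext_inner_left ℂ fun v => ?_
      have := h (Q v) v rfl
      rw [sub_eq_zero] at this
      rw [← hs]
      exact this
    · rintro h a b hab
      have h1 : a = Q b := hab
      have h2 : x = Q y := h
      change ⟪b, x⟫_ℂ - ⟪a, y⟫_ℂ = 0
      rw [h1, h2, hs, sub_self]
  · have h := T.mem_graph f
    rw [hg, mem_invGraph] at h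
    have h' : (f : L2) = Q (T f) := h
    rw [h']
    exact hp _
  · rw [hA, hg]
    simp only [mem_invGraph]
    exact ⟨fun h => ⟨Q g, h, rfl⟩, fun ⟨k, h1, h2⟩ => by rw [h1, h2]⟩

/-- Uniqueness of the nonnegative square root of an operator with a bounded inverse. -/
theorem IsNonnegSqrt.mem_graph_iff {A T : L2 →ₗ.[ℂ] L2} (hT : IsNonnegSqrt A T)
    (hs : ∀ x y, ⟪Q x, y⟫_ℂ = ⟪x, Q y⟫_ℂ) (hp : ∀ x, 0 ≤ (⟪Q x, x⟫_ℂ).re)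
    (hA : ∀ f g, (f, g) ∈ A.graph ↔ f = Q (Q g)) (f g : L2) :
    (f, g) ∈ T.graph ↔ f = Q g := by
  obtain ⟨h1, h2, h3⟩ := hT
  have hsymm : ∀ {a b c d : L2}, (a, b) ∈ T.graph → (c, d) ∈ T.graph → ⟪b, c⟫_ℂ = ⟪a, d⟫_ℂ := by
    intro a b c d hab hcd
    have hd := h1.dense_domain
    have e : T.graph.adjoint = T.graph := by
      rw [← LinearPMap.adjoint_graph_eq_graph_adjoint hd, LinearPMap.isSelfAdjoint_def.1 h1]
    rw [← e, Submodule.mem_adjoint_iff] at hcd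
    exact sub_eq_zero.1 (hcd a b hab)
  have hsurj : ∀ g, ∃ k, (k, g) ∈ T.graph := fun g => by
    obtain ⟨k, -, hk⟩ := (h3 (Q (Q g)) g).1 ((hA _ _).2 rfl)
    exact ⟨k, hk⟩
  have hinj : ∀ k, (k, 0) ∈ T.graph → k = 0 := fun k hk => by
    have := (h3 k 0).2 ⟨0, hk, T.graph.zero_mem⟩
    simpa using (hA _ _).1 this
  have huniq : ∀ {a b g : L2}, (a, g) ∈ T.graph → (b, g) ∈ T.graph → a = b := by
    intro a b g ha hb
    have := T.graph.sub_mem ha hb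
    rw [Prod.mk_sub_mk, sub_self] at this
    exact sub_eq_zero.1 (hinj _ this)
  -- The inverse of `T` is everywhere defined and symmetric, hence bounded, and the nonnegative
  -- square root of a bounded operator is unique.
  choose R hR using hsurj
  let R' : L2 →ₗ[ℂ] L2 :=
    { toFun := R
      map_add' := fun x y => huniq (hR _) (T.graph.add_mem (hR x) (hR y))
      map_smul' := fun c x => huniq (hR _) (T.graph.smul_mem c (hR x)) }
  have hR'sym : R'.IsSymmetric := fun x y => (hsymm (hR x) (hR y)).symm
  let R'' : L2 →L[ℂ] L2 := ⟨R', hR'sym.continuous⟩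
  have hR'' : ∀ x, R'' x = R x := fun _ => rfl
  have hpos : 0 ≤ R'' := nonneg_of_symm hR'sym fun x => by
    have hx : R x ∈ T.domain := LinearPMap.mem_domain_of_mem_graph (hR x)
    have := h2 ⟨R x, hx⟩
    have e : T ⟨R x, hx⟩ = x :=
      T.mem_graph_snd_inj (T.mem_graph ⟨R x, hx⟩) (hR x) rfl
    rwa [e] at this
  have hsq : R'' * R'' = Q * Q := by
    ext1 x
    exact (hA _ _).1 ((h3 _ _).2 ⟨R x, hR (R x), hR x⟩)
  have hQ0 : 0 ≤ Q := nonneg_of_symm hs hp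
  have hRQ : R'' = Q := eq_of_mul_self_eq hpos hQ0 hsq
  constructor
  · intro h
    rw [← hRQ, hR'']
    exact huniq h (hR g)
  · rintro rfl
    rw [← hRQ, hR'']
    exact hR g

/-- Conservation law behind the uniqueness of unitary groups: for two families of operators with
the same generator `i N⁻¹`, the form `⟪P U'(t) N h, U(t) N k⟫` does not depend on time. -/
theorem inner_const {N P : L2 →L[ℂ] L2} (hN : ∀ x y, ⟪N x, y⟫_ℂ = ⟪x, N y⟫_ℂ)
    (hP : ∀ x, P (N x) = N (P x)) {U U' : ℝ → L2 →L[ℂ] L2}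
    (hU : ∀ t g, HasDerivAt (fun t => U t (N g)) (Complex.I • U t g) t)
    (hU' : ∀ t g, HasDerivAt (fun t => U' t (N g)) (Complex.I • U' t g) t)
    (hc : ∀ t x, U t (N x) = N (U t x)) (hc' : ∀ t x, U' t (N x) = N (U' t x)) (t : ℝ)
    (h k : L2) : ⟪P (U' t (N h)), U t (N k)⟫_ℂ = ⟪P (U' 0 (N h)), U 0 (N k)⟫_ℂ := by
  have hd : ∀ t, HasDerivAt (fun t => ⟪P (U' t (N h)), U t (N k)⟫_ℂ) 0 t := fun t => by
    have d1 : HasDerivAt (fun t => P (U' t (N h))) (P (Complex.I • U' t h)) t :=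
      ((P.restrictScalars ℝ).hasFDerivAt.comp_hasDerivAt t (hU' t h))
    refine (d1.inner ℂ (hU t k)).congr_deriv ?_
    rw [hc, hc', hP, map_smul, inner_smul_left, inner_smul_right, hN, Complex.conj_I]
    ring
  have := is_const_of_deriv_eq_zero (fun t => (hd t).differentiableAt) (fun t => (hd t).deriv) t 0
  exact this

/-- Uniqueness of the unitary group generated by `i Q⁻¹`. -/
theorem IsUnitaryGroup.eq {T : L2 →ₗ.[ℂ] L2} (hQ : Function.Injective Q)
    (hs : ∀ x y, ⟪Q x, y⟫_ℂ = ⟪x, Q y⟫_ℂ) (hT : ∀ f g, (f, g) ∈ T.graph ↔ f = Q g)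
    {U U' : ℝ → L2 →L[ℂ] L2} (hU : IsUnitaryGroup T U) (hU' : IsUnitaryGroup T U') : U' = U := by
  have key : ∀ {U : ℝ → L2 →L[ℂ] L2}, IsUnitaryGroup T U →
      (∀ t g, HasDerivAt (fun t => U t (Q g)) (Complex.I • U t g) t) ∧
      ∀ t x, U t (Q x) = Q (U t x) := by
    rintro U ⟨-, -, h2, -, h4⟩
    have d0 : ∀ t g, HasDerivAt (fun s => U t (U s (Q g))) (Complex.I • U t g) 0 := fun t g => by
      have := (h4 (Q g) g).1 ((hT _ _).2 rfl)
      have h5 := ((U t).restrictScalars ℝ).hasFDerivAt.comp_hasDerivAt 0 this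
      refine h5.congr_deriv ?_
      change U t (Complex.I • g) = _
      rw [map_smul]
    refine ⟨fun t g => ?_, fun t x => ?_⟩
    · have h5 : HasDerivAt (fun s => U (t + s) (Q g)) (Complex.I • U t g) 0 := by
        simp only [h2]
        exact d0 t g
      have h6 := HasDerivAt.comp_sub_const t t (f := fun s => U (t + s) (Q g))
        (by rwa [sub_self])
      simpa using h6
    · have h5 : HasDerivAt (fun s => U s (U t (Q x))) (Complex.I • U t x) 0 := by
        refine (d0 t x).congr_of_eventuallyEq (Eventually.of_forall fun s => ?_)
        change (U s * U t) (Q x) = (U t * U s) (Q x)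
        rw [← h2, ← h2, add_comm]
      exact (hT _ _).1 ((h4 _ _).2 h5)
  obtain ⟨k1, k2⟩ := key hU
  obtain ⟨k1', k2'⟩ := key hU'
  have hdense := dense_range_of_symm hQ hs
  funext t
  -- The conservation law on the range of `Q`, which is dense.
  have hinner : ∀ h k, ⟪U' t h, U t k⟫_ℂ = ⟪h, k⟫_ℂ := by
    intro h k
    refine hdense.induction_on₂ (p := fun h k => ⟪U' t h, U t k⟫_ℂ = ⟪h, k⟫_ℂ)
      (isClosed_eq (by fun_prop) (by fun_prop)) (fun x y => ?_) h k
    have := inner_const (P := 1) hs (fun _ => rfl) k1 k1' k2 k2' t x y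
    simpa [hU.2.1, hU'.2.1] using this
  have hu := hU.1 t
  ext1 x
  have h1 : ⟪U' t x, U t (star (U t) (U' t x))⟫_ℂ = ⟪x, star (U t) (U' t x)⟫_ℂ := hinner _ _
  refine (ext_inner_right ℂ fun y => ?_)
  have h2 : U t (star (U t) y) = y := by
    have := (Unitary.mem_iff.1 hu).2
    exact congrArg (fun W : L2 →L[ℂ] L2 => W y) this
  have h3 : ⟪U t x, U t (star (U t) y)⟫_ℂ = ⟪x, star (U t) y⟫_ℂ := by
    rw [ContinuousLinearMap.star_eq_adjoint, ← ContinuousLinearMap.adjoint_inner_left]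
    have := (Unitary.mem_iff.1 hu).1
    have h4 : ContinuousLinearMap.adjoint (U t) (U t x) = x :=
      congrArg (fun W : L2 →L[ℂ] L2 => W x) this
    rw [h4]
  rw [← h2, hinner, h3]

end abstract_theory

/-! ### The propagator in distorted Fourier space -/

theorem continuous_jap : Continuous jap := by
  unfold jap
  fun_prop

theorem one_le_jap (x : ℝ) : 1 ≤ jap x := by
  rw [jap, Real.one_le_sqrt]
  nlinarith [sq_nonneg x]

theorem jap_pos (x : ℝ) : 0 < jap x := one_pos.trans_le (one_le_jap x)

theorem jap_sq (x : ℝ) : jap x ^ 2 = 1 + x ^ 2 := Real.sq_sqrt (by positivity)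

/-- The multiplier `⟨ξ⟩⁻¹`. -/
def sqrtMul : ℝ →ᵇ ℂ :=
  BoundedContinuousFunction.ofNormedAddCommGroup (fun ξ : ℝ => (((jap ξ)⁻¹ : ℝ) : ℂ))
    (Complex.continuous_ofReal.comp (continuous_jap.inv₀ fun ξ => (jap_pos ξ).ne')) 1
    fun ξ => by
      rw [Complex.norm_real, Real.norm_of_nonneg (inv_nonneg.2 (jap_pos ξ).le)]
      exact inv_le_one_of_one_le₀ (one_le_jap ξ)

/-- The multiplier `e^{it⟨ξ⟩}`. -/
def expMul (t : ℝ) : ℝ →ᵇ ℂ :=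
  BoundedContinuousFunction.ofNormedAddCommGroup
    (fun ξ : ℝ => Complex.exp (Complex.I * (t * jap ξ : ℝ)))
    (by have := continuous_jap; fun_prop) 1 fun ξ => by
      rw [mul_comm, Complex.norm_exp_ofReal_mul_I]

theorem sqrtMul_apply (ξ : ℝ) : sqrtMul ξ = (((jap ξ)⁻¹ : ℝ) : ℂ) := rfl

theorem expMul_apply (t ξ : ℝ) : expMul t ξ = Complex.exp (Complex.I * (t * jap ξ : ℝ)) := rfl

theorem norm_expMul_apply (t ξ : ℝ) : ‖expMul t ξ‖ = 1 := by
  rw [expMul_apply, mul_comm, Complex.norm_exp_ofReal_mul_I]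

theorem sqrtMul_mul_self : sqrtMul * sqrtMul = invMul := by
  ext ξ
  change (((jap ξ)⁻¹ : ℝ) : ℂ) * (((jap ξ)⁻¹ : ℝ) : ℂ) = (((1 + ξ ^ 2)⁻¹ : ℝ) : ℂ)
  rw [← jap_sq]
  push_cast
  ring

theorem star_sqrtMul : star sqrtMul = sqrtMul := by
  ext ξ
  exact Complex.conj_ofReal _

theorem star_invMul : star invMul = invMul := by
  ext ξ
  exact Complex.conj_ofReal _

theorem star_expMul (t : ℝ) : star (expMul t) = expMul (-t) := by
  ext ξ
  change starRingEnd ℂ (Complex.exp _) = Complex.exp _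
  rw [← Complex.exp_conj]
  congr 1
  simp

theorem expMul_add (s t : ℝ) : expMul (s + t) = expMul s * expMul t := by
  ext ξ
  change Complex.exp _ = Complex.exp _ * Complex.exp _
  rw [← Complex.exp_add]
  congr 1
  push_cast
  ring

theorem expMul_zero : expMul 0 = 1 := by
  ext ξ
  change Complex.exp _ = 1
  simp

theorem continuous_mulOp_expMul (h : L2) : Continuous fun t => mulOp (expMul t) h := by
  refine continuous_iff_continuousAt.2 fun t => ?_
  have hl : ∀ᵐ ξ, Tendsto (fun s => expMul s ξ * h ξ) (𝓝 t) (𝓝 ((mulOp (expMul t) h : L2) ξ)) := by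
    filter_upwards [coeFn_mulOp (expMul t) h] with ξ hξ
    rw [hξ]
    have hc : Continuous fun s : ℝ => expMul s ξ * h ξ := by
      simp only [expMul_apply]
      fun_prop
    exact hc.tendsto t
  exact tendsto_L2_of_dominated (fun s => coeFn_mulOp (expMul s) h) (Lp.memLp h).norm
    (Eventually.of_forall fun s => Eventually.of_forall fun ξ => by
      rw [norm_mul, norm_expMul_apply, one_mul]) hl

theorem hasDerivAt_mulOp_expMul (t : ℝ) (h : L2) :
    HasDerivAt (fun t => mulOp (expMul t) (mulOp sqrtMul h)) (Complex.I • mulOp (expMul t) h) t := by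
  rw [hasDerivAt_iff_tendsto_slope_zero]
  have hG : ∀ s : ℝ, (s⁻¹ • (mulOp (expMul (t + s)) (mulOp sqrtMul h) -
      mulOp (expMul t) (mulOp sqrtMul h)) : L2) =ᵐ[volume]
      fun ξ => (s : ℂ)⁻¹ * ((expMul (t + s) ξ - expMul t ξ) * (sqrtMul ξ * h ξ)) := fun s => by
    filter_upwards [Lp.coeFn_smul s⁻¹ (mulOp (expMul (t + s)) (mulOp sqrtMul h) -
      mulOp (expMul t) (mulOp sqrtMul h)), Lp.coeFn_sub (mulOp (expMul (t + s)) (mulOp sqrtMul h))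
      (mulOp (expMul t) (mulOp sqrtMul h)), coeFn_mulOp (expMul (t + s)) (mulOp sqrtMul h),
      coeFn_mulOp (expMul t) (mulOp sqrtMul h), coeFn_mulOp sqrtMul h] with ξ a b c d e
    rw [a, Pi.smul_apply, b, Pi.sub_apply, c, d, e, Complex.real_smul]
    push_cast
    ring
  have hdiff : ∀ ξ, HasDerivAt (fun s => expMul s ξ) (Complex.I * jap ξ * expMul t ξ) t := fun ξ => by
    simp only [expMul_apply]
    have := hasDerivAt_cexp_mul (Complex.I * jap ξ) t
    convert this using 1
    · funext s
      congr 1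
      push_cast
      ring
    · congr 2
      push_cast
      ring
  -- The difference quotients of `e^{it⟨ξ⟩} ⟨ξ⟩⁻¹` are bounded by `1`.
  refine tendsto_L2_of_dominated hG (Lp.memLp h).norm (Eventually.of_forall fun s =>
    Eventually.of_forall fun ξ => ?_) ?_
  · have h1 : expMul (t + s) ξ - expMul t ξ =
        expMul t ξ * (Complex.exp (Complex.I * (s * jap ξ : ℝ)) - 1) := by
      rw [expMul_add, BoundedContinuousFunction.mul_apply, expMul_apply s]
      ring
    have h2 : ‖Complex.exp (Complex.I * (s * jap ξ : ℝ)) - 1‖ ≤ |s| * jap ξ := by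
      have := Real.norm_exp_I_mul_ofReal_sub_one_le (x := s * jap ξ)
      rwa [Real.norm_eq_abs, abs_mul, abs_of_pos (jap_pos ξ)] at this
    rw [h1, norm_mul, norm_mul, norm_mul, norm_mul, norm_expMul_apply, one_mul, norm_inv,
      Complex.norm_real, sqrtMul_apply, Complex.norm_real, Real.norm_eq_abs, Real.norm_eq_abs,
      abs_of_pos (inv_pos.2 (jap_pos ξ))]
    rcases eq_or_ne s 0 with rfl | hs
    · simp
    · have hj := jap_pos ξ
      calc |s|⁻¹ * (‖Complex.exp (Complex.I * (s * jap ξ : ℝ)) - 1‖ * ((jap ξ)⁻¹ * ‖h ξ‖))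
          ≤ |s|⁻¹ * ((|s| * jap ξ) * ((jap ξ)⁻¹ * ‖h ξ‖)) := by gcongr
        _ = ‖h ξ‖ := by
          have : |s| ≠ 0 := abs_ne_zero.2 hs
          field_simp
  · filter_upwards [Lp.coeFn_smul Complex.I (mulOp (expMul t) h), coeFn_mulOp (expMul t) h]
      with ξ a b
    rw [a, Pi.smul_apply, b]
    have h1 := (hasDerivAt_iff_tendsto_slope_zero.1 (hdiff ξ)).mul_const (sqrtMul ξ * h ξ)
    have e : Complex.I * jap ξ * expMul t ξ * (sqrtMul ξ * h ξ) =
        Complex.I • (expMul t ξ * h ξ) := by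
      have : ((jap ξ : ℝ) : ℂ) ≠ 0 := by exact_mod_cast (jap_pos ξ).ne'
      rw [sqrtMul_apply, smul_eq_mul]
      push_cast
      field_simp
    rw [e] at h1
    refine h1.congr fun s => ?_
    rw [Complex.real_smul]
    push_cast
    ring

theorem mulOp_sqrtMul_symm (x y : L2) : ⟪mulOp sqrtMul x, y⟫_ℂ = ⟪x, mulOp sqrtMul y⟫_ℂ := by
  rw [inner_mulOp, star_sqrtMul]

theorem mulOp_sqrtMul_pos (x : L2) : 0 ≤ (⟪mulOp sqrtMul x, x⟫_ℂ).re := by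
  rw [L2.inner_def]
  have e : ∫ ξ, ⟪(mulOp sqrtMul x : L2) ξ, x ξ⟫_ℂ = ∫ ξ, (((jap ξ)⁻¹ * ‖x ξ‖ ^ 2 : ℝ) : ℂ) := by
    refine integral_congr_ae ?_
    filter_upwards [coeFn_mulOp sqrtMul x] with ξ hξ
    rw [hξ, sqrtMul_apply, RCLike.inner_apply, map_mul, mul_left_comm, RCLike.mul_conj]
    push_cast
    rw [map_inv₀, Complex.conj_ofReal]
    rfl
  rw [e, integral_complex_ofReal, Complex.ofReal_re]
  exact integral_nonneg fun ξ => mul_nonneg (inv_nonneg.2 (jap_pos ξ).le) (by positivity)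

theorem mulOp_sqrtMul_injective : Function.Injective (mulOp sqrtMul) := by
  rw [injective_iff_map_eq_zero]
  intro x hx
  refine Lp.ext ?_
  have h := coeFn_mulOp sqrtMul x
  rw [hx] at h
  filter_upwards [h, Lp.coeFn_zero ℂ 2 (volume : Measure ℝ)] with ξ a b
  rw [b] at a ⊢
  have h0 : sqrtMul ξ ≠ 0 := by
    rw [sqrtMul_apply]
    exact_mod_cast (inv_pos.2 (jap_pos ξ)).ne'
  exact ((mul_eq_zero.1 a.symm).resolve_left h0)

theorem mulOp_comm (m n : ℝ →ᵇ ℂ) (x : L2) : mulOp m (mulOp n x) = mulOp n (mulOp m x) := by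
  have h : mulOp m * mulOp n = mulOp n * mulOp m := by rw [← mulOp_mul, ← mulOp_mul, mul_comm]
  exact congrArg (fun W : L2 →L[ℂ] L2 => W x) h

theorem mulOp_expMul_neg (t : ℝ) (x : L2) : mulOp (expMul (-t)) (mulOp (expMul t) x) = x := by
  have h : mulOp (expMul (-t)) * mulOp (expMul t) = 1 := by
    rw [← mulOp_mul, ← expMul_add, neg_add_cancel, expMul_zero, mulOp_one]
  exact congrArg (fun W : L2 →L[ℂ] L2 => W x) h

section propagator

variable {V : 𝓢(ℝ, ℝ)} (hV : eigenvectors V = ∅)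

/-- The inverse of the distorted Fourier transform on its range. -/
abbrev FTi : L2 →L[ℂ] L2 := ContinuousLinearMap.adjoint (FT hV)

/-- The orthogonal projection onto the range of the distorted Fourier transform. -/
def rangeProj : L2 →L[ℂ] L2 := FT hV * FTi hV

theorem rangeProj_apply (x : L2) : rangeProj hV x = FT hV (FTi hV x) := rfl

theorem rangeProj_symm (x y : L2) : ⟪rangeProj hV x, y⟫_ℂ = ⟪x, rangeProj hV y⟫_ℂ := by
  rw [rangeProj_apply, rangeProj_apply, ← ContinuousLinearMap.adjoint_inner_right,
    ContinuousLinearMap.adjoint_inner_left]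

/-- The range of the distorted Fourier transform reduces the multiplier `(1 + ξ²)⁻¹`: it is
invariant by `FT_resOp`, and the multiplier is symmetric. -/
theorem rangeProj_invMul (x : L2) :
    rangeProj hV (mulOp invMul x) = mulOp invMul (rangeProj hV x) := by
  have h : ∀ x, rangeProj hV (mulOp invMul (rangeProj hV x)) = mulOp invMul (rangeProj hV x) :=
    fun x => by
      rw [rangeProj_apply, rangeProj_apply, ← FT_resOp, adjoint_FT_FT]
  refine ext_inner_left ℂ fun y => ?_
  calc ⟪y, rangeProj hV (mulOp invMul x)⟫_ℂ = ⟪mulOp invMul (rangeProj hV y), x⟫_ℂ := by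
        rw [← rangeProj_symm, inner_mulOp, star_invMul]
    _ = ⟪rangeProj hV y, mulOp invMul (rangeProj hV x)⟫_ℂ := by
        rw [← h y, rangeProj_symm, inner_mulOp, star_invMul]
    _ = ⟪y, mulOp invMul (rangeProj hV x)⟫_ℂ := by
        rw [rangeProj_symm, h x]

theorem rangeProj_sqrtMul (x : L2) :
    rangeProj hV (mulOp sqrtMul x) = mulOp sqrtMul (rangeProj hV x) := by
  have h1 : Commute (mulOp sqrtMul * mulOp sqrtMul) (rangeProj hV) := by
    rw [← mulOp_mul, sqrtMul_mul_self]
    ext1 x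
    exact (rangeProj_invMul hV x).symm
  have h2 := commute_of_mul_self (nonneg_of_symm mulOp_sqrtMul_symm mulOp_sqrtMul_pos) h1
  exact congrArg (fun W : L2 →L[ℂ] L2 => W x) h2.symm.eq

/-- Commutation with the generator passes to the group by the conservation law `inner_const`. -/
theorem rangeProj_expMul (t : ℝ) (x : L2) :
    rangeProj hV (mulOp (expMul t) x) = mulOp (expMul t) (rangeProj hV x) := by
  have hd := dense_range_of_symm mulOp_sqrtMul_injective mulOp_sqrtMul_symm
  have key : ∀ h k, ⟪rangeProj hV (mulOp (expMul t) h), mulOp (expMul t) k⟫_ℂ =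
      ⟪rangeProj hV h, k⟫_ℂ := fun h k => by
    refine hd.induction_on₂ (p := fun h k => ⟪rangeProj hV (mulOp (expMul t) h),
      mulOp (expMul t) k⟫_ℂ = ⟪rangeProj hV h, k⟫_ℂ) (isClosed_eq (by fun_prop) (by fun_prop))
      (fun h k => ?_) h k
    have := inner_const (P := rangeProj hV) mulOp_sqrtMul_symm (rangeProj_sqrtMul hV)
      hasDerivAt_mulOp_expMul hasDerivAt_mulOp_expMul (fun t x => mulOp_comm _ _ x)
      (fun t x => mulOp_comm _ _ x) t h k
    simpa [expMul_zero, mulOp_one] using this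
  refine ext_inner_right ℂ fun y => ?_
  have h2 := key x (mulOp (expMul (-t)) y)
  have h3 : mulOp (expMul t) (mulOp (expMul (-t)) y) = y := by
    have := mulOp_expMul_neg (-t) y
    rwa [neg_neg] at this
  rw [h3] at h2
  rw [h2, inner_mulOp, star_expMul, neg_neg]

theorem rangeProj_FT (x : L2) : rangeProj hV (FT hV x) = FT hV x := by
  rw [rangeProj_apply, adjoint_FT_FT]

/-- The operator `(H + 1)^{-1/2}`. -/
def sqrtRes : L2 →L[ℂ] L2 := FTi hV * mulOp sqrtMul * FT hV

theorem sqrtRes_apply (x : L2) : sqrtRes hV x = FTi hV (mulOp sqrtMul (FT hV x)) := rfl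

theorem FT_sqrtRes (x : L2) : FT hV (sqrtRes hV x) = mulOp sqrtMul (FT hV x) := by
  rw [sqrtRes_apply, ← rangeProj_apply, rangeProj_sqrtMul, rangeProj_FT]

theorem FT_injective : Function.Injective (FT hV) := fun x y h => by
  rw [← adjoint_FT_FT hV x, h, adjoint_FT_FT]

theorem sqrtRes_sqrtRes (x : L2) : sqrtRes hV (sqrtRes hV x) = resOp hV x := by
  refine FT_injective hV ?_
  rw [FT_sqrtRes, FT_sqrtRes, FT_resOp, ← sqrtMul_mul_self, mulOp_mul]
  rfl

theorem sqrtRes_symm (x y : L2) : ⟪sqrtRes hV x, y⟫_ℂ = ⟪x, sqrtRes hV y⟫_ℂ := by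
  rw [← inner_FT_FT hV, ← inner_FT_FT hV x, FT_sqrtRes, FT_sqrtRes, mulOp_sqrtMul_symm]

theorem sqrtRes_pos (x : L2) : 0 ≤ (⟪sqrtRes hV x, x⟫_ℂ).re := by
  rw [← inner_FT_FT hV, FT_sqrtRes]
  exact mulOp_sqrtMul_pos _

theorem sqrtRes_injective : Function.Injective (sqrtRes hV) := fun x y h => by
  refine FT_injective hV (mulOp_sqrtMul_injective ?_)
  rw [← FT_sqrtRes, ← FT_sqrtRes, h]

theorem mem_graph_opA_iff_sqrtRes (f g : L2) :
    (f, g) ∈ (opA V).graph ↔ f = sqrtRes hV (sqrtRes hV g) := by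
  rw [sqrtRes_sqrtRes, mem_graph_opA_iff hV]

theorem mem_graph_B_iff (f g : L2) : (f, g) ∈ (B V).graph ↔ f = sqrtRes hV g := by
  have h : IsNonnegSqrt (opA V) (B V) := Classical.epsilon_spec
    ⟨_, isNonnegSqrt_invGraph (sqrtRes_injective hV) (sqrtRes_symm hV) (sqrtRes_pos hV)
      (mem_graph_opA_iff_sqrtRes hV)⟩
  exact h.mem_graph_iff (sqrtRes_symm hV) (sqrtRes_pos hV) (mem_graph_opA_iff_sqrtRes hV) f g

/-- The unitary group `e^{itB}`, in terms of the distorted Fourier transform. -/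
def propag (t : ℝ) : L2 →L[ℂ] L2 := FTi hV * mulOp (expMul t) * FT hV

theorem propag_apply (t : ℝ) (x : L2) :
    propag hV t x = FTi hV (mulOp (expMul t) (FT hV x)) := rfl

theorem FT_propag (t : ℝ) (x : L2) : FT hV (propag hV t x) = mulOp (expMul t) (FT hV x) := by
  rw [propag_apply, ← rangeProj_apply, rangeProj_expMul, rangeProj_FT]

theorem propag_zero : propag hV 0 = 1 := by
  ext1 x
  refine FT_injective hV ?_
  rw [FT_propag, expMul_zero, mulOp_one]
  rfl

theorem propag_add (s t : ℝ) : propag hV (s + t) = propag hV s * propag hV t := by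
  ext1 x
  refine FT_injective hV ?_
  change _ = FT hV (propag hV s (propag hV t x))
  rw [FT_propag, FT_propag, FT_propag, expMul_add, mulOp_mul]
  rfl

theorem adjoint_propag (t : ℝ) : ContinuousLinearMap.adjoint (propag hV t) = propag hV (-t) := by
  refine ((ContinuousLinearMap.eq_adjoint_iff _ _).2 fun x y => ?_).symm
  rw [← inner_FT_FT hV, ← inner_FT_FT hV x, FT_propag, FT_propag, inner_mulOp, star_expMul]

theorem hasDerivAt_propag (t : ℝ) (g : L2) :
    HasDerivAt (fun t => propag hV t (sqrtRes hV g)) (Complex.I • propag hV t g) t := by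
  have h := ((FTi hV).restrictScalars ℝ).hasFDerivAt.comp_hasDerivAt t
    (hasDerivAt_mulOp_expMul t (FT hV g))
  have h2 : HasDerivAt (fun t => propag hV t (sqrtRes hV g))
      (FTi hV (Complex.I • mulOp (expMul t) (FT hV g))) t := by
    refine h.congr_of_eventuallyEq (Eventually.of_forall fun s => ?_)
    change FTi hV (mulOp (expMul s) (FT hV (sqrtRes hV g))) = _
    rw [FT_sqrtRes]
    rfl
  rwa [map_smul] at h2

theorem isUnitaryGroup_propag : IsUnitaryGroup (B V) (propag hV) := by
  refine ⟨fun t => ?_, propag_zero hV, propag_add hV, fun f => ?_, fun f g => ?_⟩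
  · rw [Unitary.mem_iff, ContinuousLinearMap.star_eq_adjoint, adjoint_propag, ← propag_add,
      ← propag_add, neg_add_cancel, add_neg_cancel, propag_zero]
    exact ⟨rfl, rfl⟩
  · exact (FTi hV).continuous.comp (continuous_mulOp_expMul (FT hV f))
  · rw [mem_graph_B_iff hV]
    constructor
    · rintro rfl
      have := hasDerivAt_propag hV 0 g
      rwa [propag_zero] at this
    · intro h
      have h1 := ((sqrtRes hV).restrictScalars ℝ).hasFDerivAt.comp_hasDerivAt 0 h
      have h2 := hasDerivAt_propag hV 0 f
      have e : (fun t => propag hV t (sqrtRes hV f)) =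
          (((sqrtRes hV).restrictScalars ℝ : L2 →L[ℝ] L2) ∘ fun t => propag hV t f) := by
        funext t
        refine FT_injective hV ?_
        change _ = FT hV (sqrtRes hV (propag hV t f))
        rw [FT_propag, FT_sqrtRes, FT_sqrtRes, FT_propag, mulOp_comm]
      rw [e] at h2
      have h3 := h1.unique h2
      have h4 : Complex.I • sqrtRes hV g = Complex.I • f := by
        rw [propag_zero] at h3
        rw [← map_smul]
        exact h3
      exact (smul_right_injective L2 Complex.I_ne_zero h4).symm

/-- The evolution in terms of the distorted Fourier transform. In the absence of eigenvectors `Pc`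
is the identity. -/
theorem expI_eq (t : ℝ) (f : L2) :
    expI (B V) t (Pc V f) = FTi hV (mulOp (expMul t) (FT hV f)) := by
  have h : IsUnitaryGroup (B V) (expI (B V)) :=
    Classical.epsilon_spec ⟨_, isUnitaryGroup_propag hV⟩
  have e := (isUnitaryGroup_propag hV).eq (sqrtRes_injective hV) (sqrtRes_symm hV)
    (mem_graph_B_iff hV) h
  have hp : Pc V f = f := by
    rw [Pc, Submodule.starProjection_eq_self_iff, hV, Submodule.span_empty,
      Submodule.bot_orthogonal_eq_top]
    trivial
  rw [hp, e, propag_apply]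

end propagator

/-! ### The inversion formula -/

/-- For an integrable `k ∈ L²`, the adjoint of the distorted Fourier transform is given by the
absolutely convergent integral of `k` against the generalized eigenfunctions. -/
theorem coeFn_FTi_of_integrable {V : 𝓢(ℝ, ℝ)} (hV : eigenvectors V = ∅) {k : L2}
    (hk : Integrable k volume) : FTi hV k =ᵐ[volume] fun x => ∫ ξ, ker V ξ x * k ξ := by
  obtain ⟨C, hC0, hC⟩ := exists_norm_ker_le V
  have hm : AEStronglyMeasurable (fun p : ℝ × ℝ => ker V p.2 p.1 * k p.2)
      ((volume : Measure ℝ).prod volume) :=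
    ((measurable_ker V).comp measurable_swap).aestronglyMeasurable.mul hk.1.comp_snd
  have hb : ∀ x, ‖∫ ξ, ker V ξ x * k ξ‖ ≤ C * (1 + |x|) * ∫ ξ, ‖k ξ‖ := fun x => by
    rw [← integral_const_mul]
    refine norm_integral_le_of_norm_le (hk.norm.const_mul _) (Eventually.of_forall fun ξ => ?_)
    rw [norm_mul]
    exact mul_le_mul_of_nonneg_right (hC ξ x) (norm_nonneg _)
  have hl : LocallyIntegrable (fun x => ∫ ξ, ker V ξ x * k ξ) volume := by
    have hc : Continuous fun x : ℝ => C * (1 + |x|) * ∫ ξ, ‖k ξ‖ := by fun_prop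
    refine (hc.locallyIntegrable (μ := volume)).mono hm.integral_prod_right'
      (Eventually.of_forall fun x => (hb x).trans (le_abs_self _))
  -- Both sides are tested against `φ`; the left side becomes `⟪FT φ, k⟫`, and Fubini's theorem
  -- gives the right side.
  refine ae_eq_of_integral_contDiff_smul_eq
    ((Lp.memLp _).locallyIntegrable (by norm_num)) hl fun φ h1 h2 => ?_
  have hc : Continuous fun x => (φ x : ℂ) := Complex.continuous_ofReal.comp h1.continuous
  have hs : HasCompactSupport fun x => (φ x : ℂ) := h2.comp_left Complex.ofReal_zero
  have hL : MemLp (fun x => (φ x : ℂ)) 2 volume := hc.memLp_of_hasCompactSupport hs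
  have hi := integrable_one_add_mul hc hs
  have hF : FT hV (hL.toLp _) =ᵐ[volume] dft V fun x => (φ x : ℂ) := by
    have h := coeFn_FT_of_integrable hV (f := hL.toLp _) (hi.congr (by
      filter_upwards [hL.coeFn_toLp] with x hx
      rw [hx]))
    refine h.trans (Eventually.of_forall fun ξ => ?_)
    refine integral_congr_ae ?_
    filter_upwards [hL.coeFn_toLp] with x hx
    rw [hx]
  have e1 : ∫ x, φ x • (FTi hV k : L2) x = ⟪FT hV (hL.toLp _), k⟫_ℂ := by
    rw [← ContinuousLinearMap.adjoint_inner_right, inner_toLp]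
    refine integral_congr_ae (Eventually.of_forall fun x => ?_)
    simp [Complex.real_smul]
  have e2 : ⟪FT hV (hL.toLp _), k⟫_ℂ = ∫ ξ, ∫ y, (φ y : ℂ) * (ker V ξ y * k ξ) := by
    rw [L2.inner_def]
    refine integral_congr_ae ?_
    filter_upwards [hF] with ξ hξ
    rw [hξ, RCLike.inner_apply, dft, ← integral_conj, ← integral_const_mul]
    refine integral_congr_ae (Eventually.of_forall fun y => ?_)
    simp only [map_mul, Complex.conj_conj, Complex.conj_ofReal]
    ring
  have hI : Integrable (fun p : ℝ × ℝ => (φ p.1 : ℂ) * (ker V p.2 p.1 * k p.2))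
      ((volume : Measure ℝ).prod volume) := by
    refine Integrable.mono' ((hi.const_mul C).mul_prod hk.norm)
      ((hc.comp continuous_fst).aestronglyMeasurable.mul hm) (Eventually.of_forall fun p => ?_)
    rw [norm_mul, norm_mul]
    calc ‖(φ p.1 : ℂ)‖ * (‖ker V p.2 p.1‖ * ‖k p.2‖)
        ≤ ‖(φ p.1 : ℂ)‖ * (C * (1 + |p.1|) * ‖k p.2‖) := by
          gcongr
          exact hC _ _
      _ = C * ((1 + |p.1|) * ‖(φ p.1 : ℂ)‖) * ‖k p.2‖ := by ring
  rw [e1, e2, ← integral_integral_swap hI]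
  refine integral_congr_ae (Eventually.of_forall fun y => ?_)
  simp only [integral_const_mul, Complex.real_smul]

/-! ### Integrable functions with integrable weak derivative -/

/-- Integration by parts of a differentiable function against the primitive `H` of a merely
integrable function, by Fubini's theorem on the triangle `a < s ≤ x ≤ b`. -/
theorem integral_mul_primitive_of_le {u u' g H : ℝ → ℂ} {a b : ℝ} (hab : a ≤ b)
    (hu : ∀ x ∈ Set.Icc a b, HasDerivAt u (u' x) x) (hu' : IntegrableOn u' (Set.Ioc a b) volume)
    (hg : IntegrableOn g (Set.Ioc a b) volume)
    (hH : ∀ x ∈ Set.Icc a b, H x - H a = ∫ s in a..x, g s) :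
    ∫ x in a..b, u' x * H x = u b * H b - u a * H a - ∫ x in a..b, u x * g x := by
  set μ := (volume : Measure ℝ).restrict (Set.Ioc a b) with hμ
  have hFTC : ∀ s ∈ Set.Icc a b, ∫ x in s..b, u' x = u b - u s := fun s hs => by
    refine intervalIntegral.integral_eq_sub_of_hasDerivAt (fun x hx => hu x ?_) ?_
    · rw [Set.uIcc_of_le hs.2] at hx
      exact ⟨hs.1.trans hx.1, hx.2⟩
    · rw [intervalIntegrable_iff_integrableOn_Ioc_of_le hs.2]
      exact hu'.mono_set (Set.Ioc_subset_Ioc_left hs.1)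
  have hS : MeasurableSet {p : ℝ × ℝ | p.2 ≤ p.1} := measurableSet_le measurable_snd measurable_fst
  have hI : Integrable ({p : ℝ × ℝ | p.2 ≤ p.1}.indicator fun p => u' p.1 * g p.2)
      (μ.prod μ) := (hu'.mul_prod hg).indicator hS
  have hsw := integral_integral_swap (f := fun x s => {p : ℝ × ℝ | p.2 ≤ p.1}.indicator
    (fun p => u' p.1 * g p.2) (x, s)) hI
  have e1 : ∫ x, (∫ s, {p : ℝ × ℝ | p.2 ≤ p.1}.indicator (fun p => u' p.1 * g p.2) (x, s) ∂μ) ∂μ =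
      ∫ x, u' x * (H x - H a) ∂μ := by
    refine setIntegral_congr_fun measurableSet_Ioc fun x hx => ?_
    have e : ∀ s, {p : ℝ × ℝ | p.2 ≤ p.1}.indicator (fun p => u' p.1 * g p.2) (x, s) =
        (Set.Iic x).indicator (fun s => u' x * g s) s := fun s => rfl
    simp only [e]
    rw [hH x ⟨hx.1.le, hx.2⟩, hμ, setIntegral_indicator measurableSet_Iic, Set.Ioc_inter_Iic,
      min_eq_right hx.2, integral_const_mul, intervalIntegral.integral_of_le hx.1.le]
  have e2 : ∫ s, (∫ x, {p : ℝ × ℝ | p.2 ≤ p.1}.indicator (fun p => u' p.1 * g p.2) (x, s) ∂μ) ∂μ =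
      ∫ s, (u b - u s) * g s ∂μ := by
    refine setIntegral_congr_fun measurableSet_Ioc fun s hs => ?_
    have e : ∀ x, {p : ℝ × ℝ | p.2 ≤ p.1}.indicator (fun p => u' p.1 * g p.2) (x, s) =
        (Set.Ici s).indicator (fun x => u' x * g s) x := fun x => rfl
    have hset : Set.Ioc a b ∩ Set.Ici s = Set.Icc s b := by
      ext x
      simp only [Set.mem_inter_iff, Set.mem_Ioc, Set.mem_Ici, Set.mem_Icc]
      exact ⟨fun h => ⟨h.2, h.1.2⟩, fun h => ⟨⟨hs.1.trans_le h.1, h.2⟩, h.1⟩⟩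
    simp only [e]
    rw [hμ, setIntegral_indicator measurableSet_Ici, hset, integral_mul_const,
      integral_Icc_eq_integral_Ioc, ← intervalIntegral.integral_of_le hs.2,
      hFTC s ⟨hs.1.le, hs.2⟩]
  rw [e1, e2] at hsw
  have hug : Integrable (fun s => u s * g s) μ := by
    have hcu : ContinuousOn u (Set.Icc a b) := fun x hx => (hu x hx).continuousAt.continuousWithinAt
    obtain ⟨K, hK⟩ := isCompact_Icc.exists_bound_of_continuousOn hcu
    refine Integrable.bdd_mul hg ((hcu.mono Set.Ioc_subset_Icc_self).aestronglyMeasurable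
      measurableSet_Ioc) (c := K) ?_
    filter_upwards [ae_restrict_mem measurableSet_Ioc] with x hx
      using hK x (Set.Ioc_subset_Icc_self hx)
  have hHc : ContinuousOn H (Set.Icc a b) := by
    have h1 := intervalIntegral.continuousOn_primitive_interval (μ := volume) (f := g) (a := a) (b := b)
      (by rw [Set.uIcc_of_le hab, integrableOn_Icc_iff_integrableOn_Ioc]; exact hg)
    rw [Set.uIcc_of_le hab] at h1
    refine (h1.add (continuousOn_const (c := H a))).congr fun x hx => ?_
    rw [Pi.add_apply, ← hH x hx, sub_add_cancel]
  have hu'H : Integrable (fun s => u' s * H s) μ := by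
    obtain ⟨K, hK⟩ := isCompact_Icc.exists_bound_of_continuousOn hHc
    refine Integrable.mul_bdd (c := K) hu' ((hHc.mono Set.Ioc_subset_Icc_self).aestronglyMeasurable
      measurableSet_Ioc) ?_
    filter_upwards [ae_restrict_mem measurableSet_Ioc] with x hx
      using hK x (Set.Ioc_subset_Icc_self hx)
  have l1 : ∫ x, u' x * (H x - H a) ∂μ = (∫ x, u' x * H x ∂μ) - (u b - u a) * H a := by
    simp only [mul_sub]
    rw [integral_sub hu'H (hu'.mul_const _), integral_mul_const, hμ,
      ← intervalIntegral.integral_of_le hab, ← intervalIntegral.integral_of_le hab,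
      hFTC a ⟨le_rfl, hab⟩]
  have l2 : ∫ s, (u b - u s) * g s ∂μ = u b * (H b - H a) - ∫ s, u s * g s ∂μ := by
    simp only [sub_mul]
    rw [integral_sub (hg.const_mul _) hug, integral_const_mul, hH b ⟨hab, le_rfl⟩,
      intervalIntegral.integral_of_le hab]
  rw [l1, l2] at hsw
  rw [intervalIntegral.integral_of_le hab, intervalIntegral.integral_of_le hab]
  linear_combination hsw

/-- A locally integrable function with vanishing weak derivative is almost everywhere constant. -/
theorem HasWeakDeriv.ae_eq_const {f : ℝ → ℂ} (h : HasWeakDeriv f 0) :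
    ∃ c : ℂ, f =ᵐ[volume] fun _ => c := by
  let ρ : ContDiffBump (0 : ℝ) := ⟨1, 2, one_pos, one_lt_two⟩
  set η : ℝ → ℝ := ρ.normed volume with hη
  have hη1 : ContDiff ℝ ∞ η := ρ.contDiff_normed
  have hη2 : HasCompactSupport η := ρ.hasCompactSupport_normed
  refine ⟨∫ x, η x • f x, ae_eq_of_integral_contDiff_smul_eq h.1
    (continuous_const.locallyIntegrable) fun φ h1 h2 => ?_⟩
  set c := ∫ x, φ x
  -- A test function `φ` minus a multiple of the normalized bump has integral zero, hence is the
  -- derivative of a test function `ψ`.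
  set θ : ℝ → ℝ := fun x => φ x - c * η x with hθ
  have hθ1 : ContDiff ℝ ∞ θ := h1.sub (contDiff_const.mul hη1)
  have hθ2 : HasCompactSupport θ := h2.sub hη2.mul_left
  have hθc : Continuous θ := hθ1.continuous
  have hθi : Integrable θ volume := hθc.integrable_of_hasCompactSupport hθ2
  have hφi : Integrable φ volume := h1.continuous.integrable_of_hasCompactSupport h2
  have hηi : Integrable η volume := hη1.continuous.integrable_of_hasCompactSupport hη2
  have hθ0 : ∫ x, θ x = 0 := by
    rw [hθ, integral_sub hφi (hηi.const_mul c), integral_const_mul, ρ.integral_normed, mul_one,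
      sub_self]
  set ψ : ℝ → ℝ := fun x => ∫ y in Set.Iic x, θ y with hψ
  have hψd : ∀ x, HasDerivAt ψ (θ x) x := fun x => by
    have e : ψ = fun x => (∫ y in (0 : ℝ)..x, θ y) + ∫ y in Set.Iic (0 : ℝ), θ y := by
      funext x
      rw [← intervalIntegral.integral_Iic_sub_Iic hθi.integrableOn hθi.integrableOn, sub_add_cancel]
    rw [e]
    exact (intervalIntegral.integral_hasDerivAt_right (hθc.intervalIntegrable _ _)
      (hθc.stronglyMeasurableAtFilter _ _) hθc.continuousAt).add_const _
  have hψd' : deriv ψ = θ := funext fun x => (hψd x).deriv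
  have hψ1 : ContDiff ℝ ∞ ψ :=
    contDiff_infty_iff_deriv.2 ⟨fun x => (hψd x).differentiableAt, hψd' ▸ hθ1⟩
  obtain ⟨r, hr⟩ := hθ2.isCompact.isBounded.subset_closedBall (0 : ℝ)
  have hz : ∀ y, r < |y| → θ y = 0 := fun y hy => image_eq_zero_of_notMem_tsupport fun hy' => by
    have := hr hy'
    rw [mem_closedBall_zero_iff, Real.norm_eq_abs] at this
    linarith
  have hψ2 : HasCompactSupport ψ := by
    refine HasCompactSupport.of_support_subset_isCompact (isCompact_closedBall (0 : ℝ) (|r|))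
      fun x hx => ?_
    by_contra hxr
    rw [mem_closedBall_zero_iff, Real.norm_eq_abs, not_le] at hxr
    refine hx ?_
    rcases le_or_gt 0 x with h0 | h0
    · rw [abs_of_nonneg h0] at hxr
      rw [hψ, ← hθ0]
      refine setIntegral_eq_integral_of_forall_compl_eq_zero fun y hy => hz y ?_
      rw [Set.mem_Iic, not_le] at hy
      exact ((le_abs_self r).trans_lt (hxr.trans hy)).trans_le (le_abs_self y)
    · rw [abs_of_neg h0] at hxr
      refine setIntegral_eq_zero_of_forall_eq_zero fun y hy => hz y ?_
      have : y ≤ x := hy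
      exact ((le_abs_self r).trans_lt (hxr.trans_le (neg_le_neg this))).trans_le (neg_le_abs y)
  have hw := h.2.2 ψ hψ1 hψ2
  rw [hψd'] at hw
  simp only [Pi.zero_apply, smul_zero, integral_zero, neg_zero] at hw
  have i1 := h.1.integrable_smul_left_of_hasCompactSupport h1.continuous h2
  have i2 := h.1.integrable_smul_left_of_hasCompactSupport hη1.continuous hη2
  have e : ∫ x, θ x • f x = (∫ x, φ x • f x) - c • ∫ x, η x • f x := by
    have i3 : Integrable (fun x => c • η x • f x) volume := i2.smul c
    rw [← integral_smul, ← integral_sub i1 i3]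
    refine integral_congr_ae (Eventually.of_forall fun x => ?_)
    simp only [hθ, sub_smul, mul_smul]
  rw [e, sub_eq_zero] at hw
  rw [hw, integral_smul_const]

/-- A function in `W^{1,1}(ℝ)` is almost everywhere equal to the primitive of its weak derivative
that vanishes at `-∞`. -/
theorem HasWeakDeriv.ae_eq_integral_Iic {f g : ℝ → ℂ} (h : HasWeakDeriv f g)
    (hf : Integrable f volume) (hg : Integrable g volume) :
    f =ᵐ[volume] fun x => ∫ y in Set.Iic x, g y := by
  set H : ℝ → ℂ := fun x => ∫ y in Set.Iic x, g y with hH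
  have hsub : ∀ a x, H x - H a = ∫ s in a..x, g s := fun a x =>
    intervalIntegral.integral_Iic_sub_Iic hg.integrableOn hg.integrableOn
  have hHc : Continuous H := by
    have h1 := intervalIntegral.continuous_primitive (fun a b => hg.intervalIntegrable (a := a) (b := b)) 0
    refine (h1.add (continuous_const (y := H 0))).congr fun x => ?_
    rw [Pi.add_apply, ← hsub, sub_add_cancel]
  -- The primitive of an integrable function has it as its weak derivative, so that `f` differs from
  -- `H` by a constant; the constant vanishes because `f` is integrable and `H` tends to `0` at
  -- `-∞`.
  have hHw : HasWeakDeriv H g := by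
    refine ⟨hHc.locallyIntegrable, hg.locallyIntegrable, fun φ h1 h2 => ?_⟩
    have hd : Continuous (deriv φ) := h1.continuous_deriv (by simp)
    obtain ⟨r, hr⟩ := h2.isCompact.isBounded.subset_closedBall (0 : ℝ)
    have hz : ∀ y, |r| < |y| → φ y = 0 ∧ deriv φ y = 0 := fun y hy => by
      have hy' : y ∉ tsupport φ := fun hy' => by
        have := hr hy'
        rw [mem_closedBall_zero_iff, Real.norm_eq_abs] at this
        exact absurd ((le_abs_self r).trans_lt hy) (not_lt.2 this)
      exact ⟨image_eq_zero_of_notMem_tsupport hy', image_eq_zero_of_notMem_tsupport fun h =>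
        hy' (tsupport_deriv_subset h)⟩
    set R := |r| + 1 with hR
    have hR0 : 0 ≤ |r| := abs_nonneg r
    have hle : -R ≤ R := by linarith
    have hRz : ∀ y, y ∉ Set.Ioc (-R) R → φ y = 0 ∧ deriv φ y = 0 := fun y hy => hz y (by
      by_contra hc
      rw [not_lt, abs_le] at hc
      exact hy ⟨by linarith [hc.1], by linarith [hc.2]⟩)
    have hIBP := integral_mul_primitive_of_le (u := fun x => (φ x : ℂ))
      (u' := fun x => ((deriv φ x : ℝ) : ℂ)) (g := g) (H := H) hle
      (fun x _ => ((h1.differentiable (by simp)) x).hasDerivAt.ofReal_comp)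
      ((Complex.continuous_ofReal.comp hd).integrableOn_Ioc) hg.integrableOn
      (fun x _ => hsub _ x)
    have hRa : |R| = R := abs_of_nonneg (by linarith)
    have z1 : φ R = 0 := (hz R (by rw [hRa]; linarith)).1
    have z2 : φ (-R) = 0 := (hz (-R) (by rw [abs_neg, hRa]; linarith)).1
    simp only [z1, z2, Complex.ofReal_zero, zero_mul, sub_zero, zero_sub] at hIBP
    rw [intervalIntegral.integral_of_le hle, intervalIntegral.integral_of_le hle,
      setIntegral_eq_integral_of_forall_compl_eq_zero (fun y hy => by rw [(hRz y hy).2]; simp),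
      setIntegral_eq_integral_of_forall_compl_eq_zero (fun y hy => by rw [(hRz y hy).1]; simp)]
      at hIBP
    simpa only [Complex.real_smul] using hIBP
  have hdiff : HasWeakDeriv (f - H) 0 := by
    have h1 := h.add (hHw.smul (-1))
    refine h1.congr (Eventually.of_forall fun x => ?_) (Eventually.of_forall fun x => ?_)
    · simp [sub_eq_add_neg]
    · simp
  obtain ⟨c, hc⟩ := hdiff.ae_eq_const
  have hfc : f =ᵐ[volume] fun x => H x + c := by
    filter_upwards [hc] with x hx
    rw [Pi.sub_apply] at hx
    rw [← hx]
    ring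
  have hlim : Tendsto (fun x => H x + c) atBot (𝓝 (0 + c)) :=
    (tendsto_integral_Iic_zero tendsto_id).add_const c
  have hc0 : 0 + c = 0 := by
    refine IntegrableAtFilter.eq_zero_of_tendsto (μ := volume) (f := fun x => H x + c) (l := atBot)
      ((hf.congr hfc).integrableAtFilter _) (fun s hs => ?_) hlim
    obtain ⟨a, ha⟩ := mem_atBot_sets.1 hs
    exact top_unique (Real.volume_Iic (a := a) ▸ measure_mono fun y hy => ha y hy)
  rw [zero_add] at hc0
  simpa only [hc0, add_zero] using hfc

/-! ### The oscillatory integral estimate -/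

theorem hasDerivAt_jap (x : ℝ) : HasDerivAt jap (x / jap x) x := by
  have h : HasDerivAt (fun x : ℝ => 1 + x ^ 2) (2 * x) x := by
    simpa using (hasDerivAt_pow 2 x).const_add 1
  refine (h.sqrt (by positivity)).congr_deriv ?_
  have := jap_pos x
  change 2 * x / (2 * jap x) = _
  field_simp

theorem abs_le_jap (x : ℝ) : |x| ≤ jap x := Real.abs_le_sqrt (by linarith)

theorem hasDerivAt_expMul (t ξ : ℝ) :
    HasDerivAt (fun ξ => expMul t ξ) (Complex.I * t * ((ξ / jap ξ : ℝ) * expMul t ξ)) ξ := by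
  simp only [expMul_apply]
  have h := (((hasDerivAt_jap ξ).const_mul t).ofReal_comp.const_mul Complex.I).cexp
  refine h.congr_deriv ?_
  push_cast
  ring

/-- Nonstationary phase for the phase `t⟨ξ⟩`: the factor `ξ / ⟨ξ⟩` is the derivative of the phase,
so that one integration by parts gains `1 / |t|`. -/
theorem norm_integral_mul_expMul_le {w w' g H : ℝ → ℂ} {K t : ℝ} (ht : t ≠ 0)
    (hw : ∀ ξ, 0 < ξ → HasDerivAt w (w' ξ) ξ) (hK : ∀ ξ, 0 < ξ → ‖w ξ‖ ≤ K)
    (hK' : ∀ ξ, 0 < ξ → ‖w' ξ‖ ≤ K) (hg : Integrable g volume) (hH : Integrable H volume)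
    (hHb : ∀ ξ, ‖H ξ‖ ≤ ∫ s, ‖g s‖) (hHg : ∀ a b, H b - H a = ∫ s in a..b, g s) :
    ‖∫ ξ in Set.Ioi (0 : ℝ), w ξ * ((ξ / jap ξ : ℝ) * expMul t ξ) * H ξ‖ ≤
      K / |t| * (3 * (∫ ξ, ‖g ξ‖) + ∫ ξ, ‖H ξ‖) := by
  have hK0 : 0 ≤ K := (norm_nonneg _).trans (hK 1 one_pos)
  have ht0 : 0 < |t| := abs_pos.2 ht
  have hIt : Complex.I * t ≠ 0 := mul_ne_zero Complex.I_ne_zero (by exact_mod_cast ht)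
  set G : ℝ → ℂ := fun ξ => expMul t ξ / (Complex.I * t) with hG
  have hGd : ∀ ξ, HasDerivAt G ((ξ / jap ξ : ℝ) * expMul t ξ) ξ := fun ξ => by
    refine ((hasDerivAt_expMul t ξ).div_const _).congr_deriv ?_
    rw [mul_div_cancel_left₀ _ hIt]
  have hGn : ∀ ξ, ‖G ξ‖ = |t|⁻¹ := fun ξ => by
    rw [hG, norm_div, norm_expMul_apply, norm_mul, Complex.norm_I, Complex.norm_real, one_mul,
      one_div, Real.norm_eq_abs]
  have hGc : Continuous G := continuous_iff_continuousAt.2 fun ξ => (hGd ξ).continuousAt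
  have hpc : Continuous fun ξ : ℝ => ((ξ / jap ξ : ℝ) : ℂ) * expMul t ξ :=
    (Complex.continuous_ofReal.comp
      (continuous_id.div continuous_jap fun ξ => (jap_pos ξ).ne')).mul (expMul t).continuous
  have hpn : ∀ ξ, ‖((ξ / jap ξ : ℝ) : ℂ) * expMul t ξ‖ ≤ 1 := fun ξ => by
    rw [norm_mul, norm_expMul_apply, mul_one, Complex.norm_real, Real.norm_eq_abs, abs_div,
      abs_of_pos (jap_pos ξ), div_le_one (jap_pos ξ)]
    exact abs_le_jap ξ
  have hwc : ContinuousOn w (Set.Ioi 0) := fun ξ hξ => (hw ξ hξ).continuousAt.continuousWithinAt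
  have hwm : AEStronglyMeasurable w (volume.restrict (Set.Ioi 0)) :=
    hwc.aestronglyMeasurable measurableSet_Ioi
  have hwm' : AEStronglyMeasurable w' (volume.restrict (Set.Ioi 0)) := by
    refine (aestronglyMeasurable_deriv w _).congr ?_
    filter_upwards [ae_restrict_mem measurableSet_Ioi] with ξ hξ using (hw ξ hξ).deriv
  have hF : IntegrableOn (fun ξ => w ξ * ((ξ / jap ξ : ℝ) * expMul t ξ) * H ξ) (Set.Ioi 0) := by
    refine Integrable.bdd_mul (c := K) hH.integrableOn (hwm.mul hpc.aestronglyMeasurable) ?_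
    filter_upwards [ae_restrict_mem measurableSet_Ioi] with ξ hξ
    rw [norm_mul]
    exact (mul_le_of_le_one_right (norm_nonneg _) (hpn ξ)).trans (hK ξ hξ)
  have hF' : IntegrableOn (fun ξ => w' ξ * G ξ * H ξ) (Set.Ioi 0) := by
    refine Integrable.bdd_mul (c := K * |t|⁻¹) hH.integrableOn
      (hwm'.mul hGc.aestronglyMeasurable) ?_
    filter_upwards [ae_restrict_mem measurableSet_Ioi] with ξ hξ
    rw [norm_mul, hGn]
    exact mul_le_mul_of_nonneg_right (hK' ξ hξ) (by positivity)
  -- The bound on compact subintervals of `(0, ∞)`, which suffices by dominated convergence: `w` is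
  -- not assumed to be continuous up to `0`.
  have key : ∀ a b, 0 < a → a ≤ b →
      ‖∫ ξ in a..b, w ξ * ((ξ / jap ξ : ℝ) * expMul t ξ) * H ξ‖ ≤
        K / |t| * (3 * (∫ ξ, ‖g ξ‖) + ∫ ξ, ‖H ξ‖) := by
    intro a b ha hab
    have hsub : Set.Ioc a b ⊆ Set.Ioi 0 := fun x hx => ha.trans hx.1
    have hun : ∀ ξ, 0 < ξ → ‖w ξ * G ξ‖ ≤ K / |t| := fun ξ hξ => by
      rw [norm_mul, hGn, div_eq_mul_inv]
      exact mul_le_mul_of_nonneg_right (hK ξ hξ) (by positivity)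
    have hu' : IntegrableOn (fun ξ => w' ξ * G ξ + w ξ * ((ξ / jap ξ : ℝ) * expMul t ξ))
        (Set.Ioc a b) := by
      refine Integrable.of_bound (((hwm'.mul
        hGc.aestronglyMeasurable).add (hwm.mul hpc.aestronglyMeasurable)).mono_set hsub)
        (K * |t|⁻¹ + K) ?_
      filter_upwards [ae_restrict_mem measurableSet_Ioc] with ξ hξ
      refine (norm_add_le _ _).trans (add_le_add ?_ ?_)
      · rw [norm_mul, hGn]
        exact mul_le_mul_of_nonneg_right (hK' ξ (hsub hξ)) (by positivity)
      · rw [norm_mul]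
        exact (mul_le_of_le_one_right (norm_nonneg _) (hpn ξ)).trans (hK ξ (hsub hξ))
    have hIBP := integral_mul_primitive_of_le (u := fun ξ => w ξ * G ξ) (H := H) hab
      (fun x hx => (hw x (ha.trans_le hx.1)).mul (hGd x)) hu' hg.integrableOn
      (fun x _ => hHg a x)
    have i1 : IntervalIntegrable (fun ξ => w' ξ * G ξ * H ξ) volume a b := by
      rw [intervalIntegrable_iff_integrableOn_Ioc_of_le hab]
      exact hF'.mono_set hsub
    have i2 : IntervalIntegrable (fun ξ => w ξ * ((ξ / jap ξ : ℝ) * expMul t ξ) * H ξ)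
        volume a b := by
      rw [intervalIntegrable_iff_integrableOn_Ioc_of_le hab]
      exact hF.mono_set hsub
    simp only [add_mul] at hIBP
    rw [intervalIntegral.integral_add i1 i2] at hIBP
    have e : ∫ ξ in a..b, w ξ * ((ξ / jap ξ : ℝ) * expMul t ξ) * H ξ =
        w b * G b * H b - w a * G a * H a - (∫ ξ in a..b, w ξ * G ξ * g ξ) -
          ∫ ξ in a..b, w' ξ * G ξ * H ξ := by
      rw [← hIBP]
      ring
    have b1 : ∀ ξ, 0 < ξ → ‖w ξ * G ξ * H ξ‖ ≤ K / |t| * ∫ ξ, ‖g ξ‖ := fun ξ hξ => by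
      rw [norm_mul]
      exact mul_le_mul (hun ξ hξ) (hHb ξ) (norm_nonneg _) (by positivity)
    have b2 : ∀ p q : ℝ → ℂ, (∀ ξ, 0 < ξ → ‖p ξ‖ ≤ K / |t|) → Integrable q volume →
        ‖∫ ξ in a..b, p ξ * q ξ‖ ≤ K / |t| * ∫ ξ, ‖q ξ‖ := fun p q hp hq => by
      rw [intervalIntegral.integral_of_le hab, ← integral_const_mul]
      refine (norm_integral_le_of_norm_le (hq.norm.const_mul (K / |t|)).integrableOn ?_).trans
        (setIntegral_le_integral (hq.norm.const_mul _) (Eventually.of_forall fun ξ => by positivity))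
      filter_upwards [ae_restrict_mem measurableSet_Ioc] with ξ hξ
      rw [norm_mul]
      exact mul_le_mul_of_nonneg_right (hp ξ (hsub hξ)) (norm_nonneg _)
    have b3 := b2 _ g hun hg
    have b4 := b2 (fun ξ => w' ξ * G ξ) H (fun ξ hξ => by
      rw [norm_mul, hGn, div_eq_mul_inv]
      exact mul_le_mul_of_nonneg_right (hK' ξ hξ) (by positivity)) hH
    have b5 := b1 a ha
    have b6 := b1 b (ha.trans_le hab)
    rw [e]
    refine (norm_sub_le _ _).trans ((add_le_add_left (norm_sub_le _ _) _).trans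
      ((add_le_add_left (add_le_add_left (norm_sub_le _ _) _) _).trans ?_))
    linarith
  have hcov := (aecover_Ioi_of_Ioi (μ := volume) (A := (0 : ℝ)) (l := 𝓝[>] (0 : ℝ)) (a := fun a => a)
    (tendsto_nhdsWithin_of_tendsto_nhds tendsto_id)).integral_tendsto_of_countably_generated hF
  refine le_of_tendsto hcov.norm ?_
  filter_upwards [self_mem_nhdsWithin] with a ha
  have ha' : (0 : ℝ) < a := ha
  rw [Measure.restrict_restrict measurableSet_Ioi, Set.inter_eq_left.2 (Set.Ioi_subset_Ioi ha'.le)]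
  refine le_of_tendsto (intervalIntegral_tendsto_integral_Ioi a
    (hF.mono_set (Set.Ioi_subset_Ioi ha'.le)) tendsto_id).norm ?_
  filter_upwards [eventually_ge_atTop a] with b hb using key a b ha' hb

/-! ### Solutions with prescribed Cauchy data at the origin -/

/-- A function on the closed upper half-plane that is differentiable up to the boundary restricts
to a differentiable function on the real line. -/
theorem hasDerivAt_comp_ofReal {f : ℂ → ℂ} {f' : ℂ} {ξ : ℝ} (h : HasDerivWithinAt f f' UH ξ) :
    HasDerivAt (fun ξ : ℝ => f ξ) f' ξ := by
  have h1 : HasDerivAt (fun ξ : ℝ => (ξ : ℂ)) 1 ξ := Complex.ofRealCLM.hasDerivAt (x := ξ)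
  have h2 := h.scomp_hasDerivAt ξ h1 fun ζ => ofReal_mem_UH ζ
  simpa [Function.comp_def] using h2

/-- The potential on the left half-line for which the Volterra equation describes the solutions of
the Schrödinger equation on the right half-line in terms of their Cauchy data at `0`. -/
def halfPot (V : 𝓢(ℝ, ℝ)) (y : ℝ) : ℝ := if y < 0 then V (-y) else 0

theorem voltData_halfPot (V : 𝓢(ℝ, ℝ)) : VoltData (halfPot V) fun y => rho V (-y) where
  meas := Measurable.ite measurableSet_Iio (V.continuous.comp continuous_neg).measurable
    measurable_const
  cont := (voltData V).cont.comp continuous_neg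
  int := (voltData V).int.comp_neg
  bound := fun y => by
    rw [halfPot, rho, abs_neg]
    split_ifs
    · exact le_rfl
    · rw [abs_zero, mul_zero]
      positivity

/-- The weight belonging to `halfPot`. -/
def hwt (V : 𝓢(ℝ, ℝ)) (x : ℝ) : ℝ := wt (fun y => rho V (-y)) x

theorem norm_div_hwt_le (V : 𝓢(ℝ, ℝ)) {x A : ℝ} {z : ℂ} (hA : 0 ≤ A)
    (h : ‖z‖ ≤ A * (1 + |x|) ^ 3) : ‖z / hwt V x‖ ≤ A := by
  have h0 : 0 < hwt V x := wt_pos _ x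
  rw [norm_div, Complex.norm_real, Real.norm_of_nonneg h0.le, div_le_iff₀ h0]
  exact h.trans (mul_le_mul_of_nonneg_left ((voltData_halfPot V).le_wt x) hA)

theorem continuous_hwt (V : 𝓢(ℝ, ℝ)) : Continuous (hwt V) := (voltData_halfPot V).continuous_wt

theorem hwt_ne (V : 𝓢(ℝ, ℝ)) (x : ℝ) : (hwt V x : ℂ) ≠ 0 := wt_ne _ x

/-- The function `z / hwt` for a continuous function `z` of at most cubic growth. -/
def overWt (V : 𝓢(ℝ, ℝ)) (z : ℝ → ℂ) (hz : Continuous z) (A : ℝ) (hA : 0 ≤ A)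
    (h : ∀ x, ‖z x‖ ≤ A * (1 + |x|) ^ 3) : ℝ →ᵇ ℂ :=
  BoundedContinuousFunction.ofNormedAddCommGroup (fun x => z x / hwt V x)
    (hz.div (Complex.continuous_ofReal.comp (continuous_hwt V)) (hwt_ne V)) A
    fun x => norm_div_hwt_le V hA (h x)

theorem hwt_mul_overWt (V : 𝓢(ℝ, ℝ)) {z : ℝ → ℂ} (hz : Continuous z) {A : ℝ} (hA : 0 ≤ A)
    (h : ∀ x, ‖z x‖ ≤ A * (1 + |x|) ^ 3) (x : ℝ) : (hwt V x : ℂ) * overWt V z hz A hA h x = z x :=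
  mul_div_cancel₀ _ (hwt_ne V x)

theorem norm_overWt_le (V : 𝓢(ℝ, ℝ)) {z : ℝ → ℂ} (hz : Continuous z) {A : ℝ} (hA : 0 ≤ A)
    (h : ∀ x, ‖z x‖ ≤ A * (1 + |x|) ^ 3) : ‖overWt V z hz A hA h‖ ≤ A :=
  BoundedContinuousFunction.norm_ofNormedAddCommGroup_le _ hA _

open Classical in
/-- The weighted form of the function `d (max (-x) 0)`, for a half-line kernel `d`; it is `0` by
convention if `d` is not admissible. -/
def kerSrc (V : 𝓢(ℝ, ℝ)) (d : ℝ → ℂ) : ℝ →ᵇ ℂ :=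
  if h : ∃ A, KerBd A d then
    overWt V (fun x => d (max (-x) 0)) (h.choose_spec.cont.comp (by fun_prop)) h.choose
      h.choose_spec.nonneg (fun x => (h.choose_spec.bound _ (le_max_right _ _)).trans (by
        have h1 : max (-x) 0 ≤ |x| := max_le (neg_le_abs x) (abs_nonneg x)
        have h2 : 0 ≤ max (-x) 0 := le_max_right _ _
        have := h.choose_spec.nonneg
        gcongr))
  else 0

theorem hwt_mul_kerSrc (V : 𝓢(ℝ, ℝ)) {A : ℝ} {d : ℝ → ℂ} (hd : KerBd A d) (x : ℝ) :
    (hwt V x : ℂ) * kerSrc V d x = d (max (-x) 0) := by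
  rw [kerSrc, dif_pos ⟨A, hd⟩, hwt_mul_overWt]

theorem kerSrc_apply (V : 𝓢(ℝ, ℝ)) {A : ℝ} {d : ℝ → ℂ} (hd : KerBd A d) (x : ℝ) :
    kerSrc V d x = d (max (-x) 0) / hwt V x := by
  rw [← hwt_mul_kerSrc V hd, mul_div_cancel_left₀ _ (hwt_ne V x)]

theorem norm_kerSrc_le (V : 𝓢(ℝ, ℝ)) {A : ℝ} {d : ℝ → ℂ} (hd : KerBd A d) :
    ‖kerSrc V d‖ ≤ A := by
  rw [BoundedContinuousFunction.norm_le hd.nonneg]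
  intro x
  rw [kerSrc_apply V hd]
  refine norm_div_hwt_le V hd.nonneg ((hd.bound _ (le_max_right _ _)).trans ?_)
  have h1 : max (-x) 0 ≤ |x| := max_le (neg_le_abs x) (abs_nonneg x)
  have h2 : 0 ≤ max (-x) 0 := le_max_right _ _
  have := hd.nonneg
  gcongr

theorem hasDerivWithinAt_kerSrc (V : 𝓢(ℝ, ℝ)) {k : ℂ} (hk : k ∈ UH) :
    HasDerivWithinAt (fun l => kerSrc V (dker l)) (kerSrc V (dker' k)) UH k := by
  refine hasDerivWithinAt_of_sq 12 fun l hl => ?_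
  have e : kerSrc V (dker l) - kerSrc V (dker k) - (l - k) • kerSrc V (dker' k) =
      kerSrc V fun s => dker l s - dker k s - (l - k) * dker' k s := by
    ext x
    simp only [BoundedContinuousFunction.coe_sub, BoundedContinuousFunction.coe_smul, Pi.sub_apply,
      kerSrc_apply V (kerBd_dker hl), kerSrc_apply V (kerBd_dker hk),
      kerSrc_apply V (kerBd_dker' hk), kerSrc_apply V (kerBd_taylor hk hl), smul_eq_mul]
    ring
  rw [e]
  exact norm_kerSrc_le V (kerBd_taylor hk hl)

/-- The Volterra equation on `[0, ∞)` for `n = e^{ikx} u`, where `u` solves the Schrödinger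
equation. -/
theorem IsSol.volterra {V : 𝓢(ℝ, ℝ)} {k : ℂ} {u u' : ℝ → ℂ} (h : IsSol V k u u') (x : ℝ) :
    Complex.exp (Complex.I * k * x) * u x =
      u 0 + dker k x * (Complex.I * k * u 0 + u' 0) +
        ∫ y in (0 : ℝ)..x, dker k (x - y) * (V y * (Complex.exp (Complex.I * k * y) * u y)) := by
  set n : ℝ → ℂ := fun y => Complex.exp (Complex.I * k * y) * u y with hn
  set n' : ℝ → ℂ := fun y => Complex.exp (Complex.I * k * y) * (Complex.I * k * u y + u' y) with hn'
  have d1 : ∀ y, HasDerivAt n (n' y) y := fun y =>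
    ((hasDerivAt_cexp_mul (Complex.I * k) y).mul (h.hasDeriv y)).congr_deriv (by
      rw [hn']; ring)
  have d2 : ∀ y, HasDerivAt n' (2 * Complex.I * k * n' y + V y * n y) y := fun y =>
    ((hasDerivAt_cexp_mul (Complex.I * k) y).mul
      (((h.hasDeriv y).const_mul (Complex.I * k)).add (h.hasDeriv' y))).congr_deriv (by
      simp only [hn, hn', Pi.add_apply]
      linear_combination (-k ^ 2 * Complex.exp (Complex.I * k * y) * u y) * Complex.I_mul_I)
  have d3 : ∀ y, HasDerivAt (fun y => dker k (x - y))
      (-Complex.exp (2 * Complex.I * k * ((x - y : ℝ) : ℂ))) y := fun y => by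
    have := (hasDerivAt_dker k (x - y)).scomp y ((hasDerivAt_id y).const_sub x)
    simpa [Function.comp_def] using this
  -- The equation for `n` is `n'' = 2ik n' + V n`; the function `D(x - y) n' + n` interpolates
  -- between the Cauchy data at `y = 0` and `n(x)` at `y = x`.
  have d4 : ∀ y, HasDerivAt (fun y => dker k (x - y) * n' y + n y)
      (dker k (x - y) * (V y * n y)) y := fun y =>
    (((d3 y).mul (d2 y)).add (d1 y)).congr_deriv (by
      linear_combination (n' y) * two_I_mul_dker k (x - y))
  have hc : Continuous fun y => dker k (x - y) * (V y * n y) := by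
    have c1 : Continuous n := continuous_iff_continuousAt.2 fun y => (d1 y).continuousAt
    have c2 : Continuous fun y => dker k (x - y) :=
      continuous_iff_continuousAt.2 fun y => (d3 y).continuousAt
    have c3 := V.continuous
    fun_prop
  have hI := intervalIntegral.integral_eq_sub_of_hasDerivAt (fun y _ => d4 y)
    (hc.intervalIntegrable 0 x)
  rw [hI]
  simp only [hn, hn', sub_self, dker_zero, sub_zero, Complex.ofReal_zero, mul_zero, Complex.exp_zero]
  ring

/-- The weighted form of the constant function `1`. -/
def oneSrc (V : 𝓢(ℝ, ℝ)) : ℝ →ᵇ ℂ :=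
  overWt V (fun _ => 1) continuous_const 1 zero_le_one fun x => by
    rw [norm_one, one_mul]
    exact one_le_pow₀ (by linarith [abs_nonneg x])

/-- The weighted form of the inhomogeneous term of the Volterra equation with Cauchy data
`u(0) = p` and `u'(0) = r`. -/
def cauchySrc (V : 𝓢(ℝ, ℝ)) (p r k : ℂ) : ℝ →ᵇ ℂ :=
  p • oneSrc V + (Complex.I * k * p + r) • kerSrc V (dker k)

theorem hwt_mul_cauchySrc (V : 𝓢(ℝ, ℝ)) (p r : ℂ) {k : ℂ} (hk : k ∈ UH) (x : ℝ) :
    (hwt V x : ℂ) * cauchySrc V p r k x =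
      p + (Complex.I * k * p + r) * dker k (max (-x) 0) := by
  rw [← hwt_mul_kerSrc V (kerBd_dker hk)]
  have h1 : (hwt V x : ℂ) * oneSrc V x = 1 := hwt_mul_overWt V _ _ _ x
  simp only [cauchySrc, BoundedContinuousFunction.coe_add, BoundedContinuousFunction.coe_smul,
    Pi.add_apply, smul_eq_mul]
  linear_combination p * h1

/-- The derivative of `cauchySrc` in the spectral parameter. -/
def cauchySrck (V : 𝓢(ℝ, ℝ)) (p r k : ℂ) : ℝ →ᵇ ℂ :=
  (Complex.I * k * p + r) • kerSrc V (dker' k) + (Complex.I * p) • kerSrc V (dker k)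

theorem hwt_mul_cauchySrck (V : 𝓢(ℝ, ℝ)) (p r : ℂ) {k : ℂ} (hk : k ∈ UH) (x : ℝ) :
    (hwt V x : ℂ) * cauchySrck V p r k x =
      (Complex.I * k * p + r) * dker' k (max (-x) 0) + Complex.I * p * dker k (max (-x) 0) := by
  rw [← hwt_mul_kerSrc V (kerBd_dker hk), ← hwt_mul_kerSrc V (kerBd_dker' hk)]
  simp only [cauchySrck, BoundedContinuousFunction.coe_add, BoundedContinuousFunction.coe_smul,
    Pi.add_apply, smul_eq_mul]
  ring

theorem hasDerivWithinAt_cauchySrc (V : 𝓢(ℝ, ℝ)) (p r : ℂ) {k : ℂ} (hk : k ∈ UH) :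
    HasDerivWithinAt (cauchySrc V p r) (cauchySrck V p r k) UH k := by
  have h1 : HasDerivAt (fun l : ℂ => Complex.I * l * p + r) (Complex.I * p) k := by
    simpa using (((hasDerivAt_id k).const_mul Complex.I).mul_const p).add_const r
  exact (h1.hasDerivWithinAt.smul (hasDerivWithinAt_kerSrc V hk)).const_add (p • oneSrc V)

theorem norm_slope_le {p r k : ℂ} (hk1 : ‖k‖ ≤ 1) : ‖Complex.I * k * p + r‖ ≤ ‖p‖ + ‖r‖ := by
  refine (norm_add_le _ _).trans (add_le_add ?_ le_rfl)
  rw [norm_mul, norm_mul, Complex.norm_I, one_mul]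
  exact mul_le_of_le_one_left (norm_nonneg _) hk1

theorem norm_cauchySrc_le (V : 𝓢(ℝ, ℝ)) (p r : ℂ) {k : ℂ} (hk : k ∈ UH) (hk1 : ‖k‖ ≤ 1) :
    ‖cauchySrc V p r k‖ ≤ 3 * (‖p‖ + ‖r‖) := by
  have h0 : ‖oneSrc V‖ ≤ 1 := norm_overWt_le V _ _ _
  have h1 := norm_kerSrc_le V (kerBd_dker hk)
  have h2 := norm_slope_le (p := p) (r := r) hk1
  refine (norm_add_le _ _).trans ?_
  rw [norm_smul, norm_smul]
  nlinarith [mul_le_mul h2 h1 (norm_nonneg _) (by positivity), norm_nonneg p, norm_nonneg r,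
    mul_le_of_le_one_right (norm_nonneg p) h0]

theorem norm_cauchySrck_le (V : 𝓢(ℝ, ℝ)) (p r : ℂ) {k : ℂ} (hk : k ∈ UH) (hk1 : ‖k‖ ≤ 1) :
    ‖cauchySrck V p r k‖ ≤ 3 * (‖p‖ + ‖r‖) := by
  have h0 := norm_kerSrc_le V (kerBd_dker' hk)
  have h1 := norm_kerSrc_le V (kerBd_dker hk)
  have h2 := norm_slope_le (p := p) (r := r) hk1
  refine (norm_add_le _ _).trans ?_
  rw [norm_smul, norm_smul, norm_mul, Complex.norm_I, one_mul]
  nlinarith [mul_le_mul h2 h0 (norm_nonneg _) (by positivity), norm_nonneg p, norm_nonneg r,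
    mul_le_of_le_one_right (norm_nonneg p) h1]

theorem norm_hwt_mul_cauchySrc_le (V : 𝓢(ℝ, ℝ)) (p r : ℂ) {k : ℂ} (hk : k ∈ UH) (hk1 : ‖k‖ ≤ 1)
    (x : ℝ) : ‖(hwt V x : ℂ) * cauchySrc V p r k x‖ ≤ 3 * (‖p‖ + ‖r‖) * (1 + |x|) := by
  have hm0 : 0 ≤ max (-x) 0 := le_max_right _ _
  have hm : max (-x) 0 ≤ |x| := max_le (neg_le_abs x) (abs_nonneg x)
  have h1 := (norm_dker_le hk hm0).trans hm
  have h2 := norm_slope_le (p := p) (r := r) hk1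
  rw [hwt_mul_cauchySrc V p r hk]
  refine (norm_add_le _ _).trans ?_
  rw [norm_mul]
  nlinarith [mul_le_mul h2 h1 (norm_nonneg _) (by positivity), norm_nonneg p, norm_nonneg r,
    mul_nonneg (norm_nonneg p) (abs_nonneg x), mul_nonneg (norm_nonneg r) (abs_nonneg x)]

theorem norm_hwt_mul_cauchySrck_le (V : 𝓢(ℝ, ℝ)) (p r : ℂ) {k : ℂ} (hk : k ∈ UH) (hk1 : ‖k‖ ≤ 1)
    (x : ℝ) : ‖(hwt V x : ℂ) * cauchySrck V p r k x‖ ≤ 3 * (‖p‖ + ‖r‖) * (1 + |x|) ^ 2 := by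
  have hm0 : 0 ≤ max (-x) 0 := le_max_right _ _
  have hm : max (-x) 0 ≤ |x| := max_le (neg_le_abs x) (abs_nonneg x)
  have h1 := (norm_dker_le hk hm0).trans hm
  have h3 : ‖dker' k (max (-x) 0)‖ ≤ 2 * |x| ^ 2 := (norm_dker'_le hk hm0).trans (by gcongr)
  have h2 := norm_slope_le (p := p) (r := r) hk1
  rw [hwt_mul_cauchySrck V p r hk]
  refine (norm_add_le _ _).trans ?_
  rw [norm_mul, norm_mul, norm_mul, Complex.norm_I, one_mul]
  have h4 := mul_le_mul h2 h3 (norm_nonneg _) (by positivity)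
  have h5 := mul_le_mul_of_nonneg_left h1 (norm_nonneg p)
  have h6 := norm_nonneg p
  have h7 := norm_nonneg r
  have h8 := abs_nonneg x
  calc _ ≤ (‖p‖ + ‖r‖) * (2 * |x| ^ 2) + ‖p‖ * |x| := add_le_add h4 h5
    _ ≤ (‖p‖ + ‖r‖) * (2 * |x| ^ 2) + (‖p‖ + ‖r‖) * |x| := by gcongr; linarith
    _ = (‖p‖ + ‖r‖) * (2 * |x| ^ 2 + |x|) := by ring
    _ ≤ (‖p‖ + ‖r‖) * (3 * (1 + |x|) ^ 2) := by
      gcongr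
      nlinarith
    _ = _ := by ring

/-- On the right half-line, a solution is given by the solution of the Volterra equation with its
Cauchy data at the origin. -/
theorem IsSol.eq_volSol {V : 𝓢(ℝ, ℝ)} {k : ℂ} (hk : k ∈ UH) {u u' : ℝ → ℂ} (h : IsSol V k u u')
    {M : ℝ} (hM : ∀ x : ℝ, 0 ≤ x → ‖Complex.exp (Complex.I * k * x) * u x‖ ≤ M * (1 + |x|) ^ 3)
    {x : ℝ} (hx : 0 ≤ x) :
    Complex.exp (Complex.I * k * x) * u x = (hwt V (-x) : ℂ) *
      volSol (halfPot V) (fun y => rho V (-y)) k (cauchySrc V (u 0) (u' 0) k) (-x) := by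
  set n : ℝ → ℂ := fun y => Complex.exp (Complex.I * k * y) * u y with hn
  set N : ℝ → ℂ := fun x => n (max (-x) 0) with hN
  have hnc : Continuous n := by
    have := h.continuous
    fun_prop
  have hNc : Continuous N := hnc.comp (by fun_prop)
  have hM0 : 0 ≤ M := by
    have := (norm_nonneg _).trans (hM 0 le_rfl)
    simpa using this
  have hNb : ∀ x, ‖N x‖ ≤ M * (1 + |x|) ^ 3 := fun x => by
    refine (hM _ (le_max_right _ _)).trans ?_
    have h1 : |max (-x) 0| ≤ |x| := by
      rw [abs_of_nonneg (le_max_right _ _)]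
      exact max_le (neg_le_abs x) (abs_nonneg x)
    gcongr
  -- The function `n(-x)`, extended to `x > 0` by its value at the origin, solves the Volterra
  -- equation of `halfPot V` on the whole line.
  set U := overWt V N hNc M hM0 hNb with hU
  have hUN : ∀ x, (hwt V x : ℂ) * U x = N x := hwt_mul_overWt V hNc hM0 hNb
  have hvol : U = cauchySrc V (u 0) (u' 0) k +
      volOp (halfPot V) (fun y => rho V (-y)) (dker k) U := by
    ext x
    refine mul_left_cancel₀ (hwt_ne V x) ?_
    have e1 := wt_mul_volOp (voltData_halfPot V) (kerBd_dker hk) U x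
    change (hwt V x : ℂ) * _ = ∫ y, _ * (_ * ((hwt V y : ℂ) * U y)) at e1
    rw [BoundedContinuousFunction.add_apply, mul_add, e1, hUN, hwt_mul_cauchySrc V _ _ hk]
    simp only [hUN]
    set z := max (-x) 0 with hz
    have hz0 : 0 ≤ z := le_max_right _ _
    have e2 : ∫ y, dker k (max (y - x) 0) * ((halfPot V y : ℂ) * N y) =
        ∫ y in (0 : ℝ)..z, dker k (z - y) * (V y * n y) := by
      rw [← integral_neg_eq_self, intervalIntegral.integral_of_le hz0,
        ← integral_indicator measurableSet_Ioc]
      refine integral_congr_ae (Eventually.of_forall fun y => ?_)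
      simp only [hN, halfPot, neg_neg, neg_lt_zero]
      by_cases hy : 0 < y
      · rw [if_pos hy, max_eq_left hy.le]
        by_cases hyz : y ≤ z
        · have : z = -x := max_eq_left (by
            by_contra hc
            have : z = 0 := max_eq_right (not_le.1 hc).le
            linarith)
          rw [Set.indicator_of_mem (Set.mem_Ioc.2 ⟨hy, hyz⟩), max_eq_left (by linarith), this]
          congr 2
          ring
        · have : -x ≤ z := le_max_left _ _
          rw [Set.indicator_of_notMem (fun h => hyz h.2), max_eq_right (by linarith), dker_zero,
            zero_mul]
      · rw [if_neg hy, Set.indicator_of_notMem (fun h => hy h.1)]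
        simp
    rw [e2]
    have := h.volterra z
    simp only [hN, hn, ← hz] at this ⊢
    rw [this]
    ring
  have := volSol_unique (voltData_halfPot V) hk hvol
  rw [← this, hUN]
  simp only [hN, hn, neg_neg, max_eq_left hx]

/-- Solutions with fixed Cauchy data at the origin are bounded on the right half-line, together
with their derivative in the frequency, uniformly for small frequencies. -/
theorem exists_norm_le_of_cauchy (V : 𝓢(ℝ, ℝ)) (p r : ℂ) : ∃ C : ℝ, 0 ≤ C ∧
    ∀ u u' : ℝ → ℝ → ℂ, (∀ ξ ∈ Set.Ioo (0 : ℝ) 1, IsSol V ξ (u ξ) (u' ξ) ∧ u ξ 0 = p ∧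
      u' ξ 0 = r ∧ ∃ M : ℝ, ∀ x, ‖u ξ x‖ ≤ M * (1 + |x|)) →
    ∀ ξ ∈ Set.Ioo (0 : ℝ) 1, ∀ x, 0 ≤ x → ‖u ξ x‖ ≤ C * (1 + |x|) ∧
      ∃ d, HasDerivAt (fun ξ => u ξ x) d ξ ∧ ‖d‖ ≤ C * (1 + |x|) ^ 2 := by
  set ρ : ℝ → ℝ := fun y => rho V (-y) with hρ
  set E := Real.exp (2 * ∫ y, ρ y)
  set J := ∫ y, ρ y with hJ
  have hJ0 : 0 ≤ J := integral_nonneg (voltData_halfPot V).rho_nonneg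
  set A := 3 * (‖p‖ + ‖r‖) with hA
  have hA0 : 0 ≤ A := by positivity
  have hE0 : 0 < E := Real.exp_pos _
  set C1 := A + E * (2 * A) * J with hC1
  set C2 := A + 2 * (E * (2 * A)) * J + E * (2 * (A + 2 * A)) * J with hC2
  have hC10 : 0 ≤ C1 := by positivity
  have hC20 : 0 ≤ C2 := by positivity
  refine ⟨C1 + C2, by positivity, fun u u' hu ξ hξ x hx => ?_⟩
  -- The linear growth of each single solution, with a constant depending on the frequency, serves
  -- only to identify it with the solution of the Volterra equation; the bound on the latter is
  -- uniform.
  have hrep : ∀ ζ ∈ Set.Ioo (0 : ℝ) 1, Complex.exp (Complex.I * ζ * x) * u ζ x =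
      (hwt V (-x) : ℂ) * volSol (halfPot V) ρ ζ (cauchySrc V p r ζ) (-x) := fun ζ hζ => by
    obtain ⟨h1, h2, h3, M, hM⟩ := hu ζ hζ
    have hM0 : 0 ≤ M := by
      have := (norm_nonneg _).trans (hM 0)
      simpa using this
    have := h1.eq_volSol (ofReal_mem_UH ζ) (M := M) (fun y _ => by
      rw [norm_mul, norm_exp_I_mul, one_mul]
      refine (hM y).trans (mul_le_mul_of_nonneg_left ?_ hM0)
      exact le_self_pow₀ (by linarith [abs_nonneg y]) (by norm_num)) hx
    rwa [h2, h3] at this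
  have hk := ofReal_mem_UH ξ
  have hk1 : ‖(ξ : ℂ)‖ ≤ 1 := by
    rw [Complex.norm_real, Real.norm_of_nonneg hξ.1.le]
    exact hξ.2.le
  have hsrc := norm_cauchySrc_le V p r hk hk1
  have hsrck := norm_cauchySrck_le V p r hk hk1
  have hx1 : |(-x)| = |x| := abs_neg x
  have hb1 : ‖(hwt V (-x) : ℂ) * volSol (halfPot V) ρ ξ (cauchySrc V p r ξ) (-x)‖ ≤
      C1 * (1 + |x|) := by
    have := norm_wt_mul_volSol_le (voltData_halfPot V) hk
      (norm_hwt_mul_cauchySrc_le V p r hk hk1) (-x)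
    rw [hx1] at this
    refine this.trans ?_
    gcongr
    rw [hC1]
    gcongr
  obtain ⟨v', hv1, hv2⟩ := exists_hasDerivWithinAt_volSol (voltData_halfPot V) hk
    (hasDerivWithinAt_cauchySrc V p r hk)
  have hb2 : ‖(hwt V (-x) : ℂ) * v' (-x)‖ ≤ C2 * (1 + |x|) ^ 2 := by
    have := norm_wt_mul_deriv_volSol_le (voltData_halfPot V) hk
      (norm_hwt_mul_cauchySrck_le V p r hk hk1) hsrc hsrck hv2 (-x)
    rwa [hx1] at this
  have hexp : ∀ ζ : ℝ, Complex.exp (-(Complex.I * x) * ζ) * Complex.exp (Complex.I * ζ * x) = 1 :=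
    fun ζ => by
      rw [← Complex.exp_add, Complex.exp_eq_one_iff]
      exact ⟨0, by push_cast; ring⟩
  have hexpn : ∀ ζ : ℝ, ‖Complex.exp (-(Complex.I * x) * ζ)‖ = 1 := fun ζ => by
    have := congrArg norm (hexp ζ)
    rwa [norm_mul, norm_exp_I_mul, mul_one, norm_one] at this
  have hu_eq : ∀ ζ ∈ Set.Ioo (0 : ℝ) 1, u ζ x = Complex.exp (-(Complex.I * x) * ζ) *
      ((hwt V (-x) : ℂ) * volSol (halfPot V) ρ ζ (cauchySrc V p r ζ) (-x)) := fun ζ hζ => by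
    rw [← hrep ζ hζ, ← mul_assoc, hexp, one_mul]
  have hx2 : 1 + |x| ≤ (1 + |x|) ^ 2 := le_self_pow₀ (by linarith [abs_nonneg x]) (by norm_num)
  refine ⟨?_, -(Complex.I * x) * Complex.exp (-(Complex.I * x) * ξ) *
      ((hwt V (-x) : ℂ) * volSol (halfPot V) ρ ξ (cauchySrc V p r ξ) (-x)) +
      Complex.exp (-(Complex.I * x) * ξ) * ((hwt V (-x) : ℂ) * v' (-x)), ?_, ?_⟩
  · rw [hu_eq ξ hξ, norm_mul, hexpn, one_mul]
    refine hb1.trans ?_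
    gcongr
    linarith
  · have h1 := ((BoundedContinuousFunction.evalCLM ℂ (-x)).hasFDerivAt).comp_hasDerivWithinAt
      (ξ : ℂ) hv1
    have h2 := hasDerivAt_comp_ofReal (h1.const_mul (hwt V (-x) : ℂ))
    have h3 := (hasDerivAt_cexp_mul (-(Complex.I * x)) ξ).mul h2
    refine h3.congr_of_eventuallyEq ?_
    filter_upwards [Ioo_mem_nhds hξ.1 hξ.2] with ζ hζ using hu_eq ζ hζ
  · refine (norm_add_le _ _).trans ?_
    rw [norm_mul, norm_mul, norm_mul _ ((hwt V (-x) : ℂ) * v' (-x)), hexpn, one_mul, mul_one,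
      norm_neg, norm_mul, Complex.norm_I, one_mul, Complex.norm_real, Real.norm_eq_abs]
    have : |x| * ‖(hwt V (-x) : ℂ) * volSol (halfPot V) ρ ξ (cauchySrc V p r ξ) (-x)‖ ≤
        C1 * (1 + |x|) ^ 2 := by
      calc _ ≤ (1 + |x|) * (C1 * (1 + |x|)) := by
            gcongr
            linarith
        _ = _ := by ring
    linarith

/-! ### Zero energy resonances and the Jost solutions -/

/-- In the generic case the Wronskian of the Jost solutions does not vanish at zero energy: the
Jost solutions would be proportional otherwise, hence bounded. -/
theorem IsGeneric.Wr_zero_ne {V : 𝓢(ℝ, ℝ)} (h : IsGeneric V) : Wr V 0 ≠ 0 := fun h0 => by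
  have hk : (0 : ℂ) ∈ UH := by simpa using ofReal_mem_UH 0
  have hb : ∀ V : 𝓢(ℝ, ℝ), ∃ C : ℝ, ∀ x, 0 ≤ x → ‖fP V 0 x‖ ≤ C := fun V => by
    obtain ⟨C, hC0, hC⟩ := exists_mP_decay V
    refine ⟨C + 1, fun x hx => ?_⟩
    have h1 := (hC 0 hk x hx).1
    have h2 : C * (1 + x)⁻¹ ≤ C :=
      mul_le_of_le_one_right hC0.le (inv_le_one_of_one_le₀ (by linarith))
    have h3 : fP V 0 x = (mP V 0 x - 1) + 1 := by simp [fP]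
    rw [h3]
    refine (norm_add_le _ _).trans ?_
    rw [norm_one]
    linarith
  obtain ⟨c, hc⟩ := (isSol_fP V hk).exists_smul (isSol_fM V hk) (fM_ne_zero V hk) (x₀ := 0)
    (by rw [wronskian_fP_fM V hk, h0])
  obtain ⟨C, hC⟩ := hb V
  obtain ⟨D, hD⟩ := hb (refl V)
  have hsol : IsSol V ((0 : ℝ) : ℂ) (fP V 0) (fP' V 0) := by simpa using isSol_fP V hk
  refine h ⟨fP V 0, hsol.isSolution, ⟨max C (‖c‖ * D), fun x => ?_⟩, fP_ne_zero V hk⟩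
  rcases le_total 0 x with hx | hx
  · exact (hC x hx).trans (le_max_left _ _)
  · rw [congrFun hc x, norm_mul, fM]
    exact (mul_le_mul_of_nonneg_left (hD (-x) (by linarith)) (norm_nonneg _)).trans
      (le_max_right _ _)

/-- If the derivative of a bounded function converges at infinity, then its limit is zero. -/
theorem eq_zero_of_tendsto_deriv_of_bounded {φ φ' : ℝ → ℂ} {w : ℂ} {M : ℝ}
    (hd : ∀ x, HasDerivAt φ (φ' x) x) (hM : ∀ x, ‖φ x‖ ≤ M) (hw : Tendsto φ' atTop (𝓝 w)) :
    w = 0 := by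
  by_contra h0
  have hw0 : 0 < ‖w‖ := norm_pos_iff.2 h0
  obtain ⟨X, hX⟩ := eventually_atTop.1 ((tendsto_iff_norm_sub_tendsto_zero.1 hw).eventually_le_const
    (half_pos hw0))
  have hg : ∀ x ∈ Set.Ici X, HasDerivWithinAt (fun x : ℝ => φ x - x * w) (φ' x - w) (Set.Ici X) x :=
    fun x _ => by
      have h1 : HasDerivAt (fun x : ℝ => (x : ℂ) * w) (1 * w) x :=
        (Complex.ofRealCLM.hasDerivAt (x := x)).mul_const w
      rw [one_mul] at h1
      exact ((hd x).sub h1).hasDerivWithinAt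
  have hM0 : 0 ≤ M := (norm_nonneg _).trans (hM 0)
  -- An interval of this length would force an increment of `φ` larger than `2 M`.
  set L := (4 * M + 1) / ‖w‖ with hL
  have hL0 : 0 ≤ L := by positivity
  have h2 := (convex_Ici X).norm_image_sub_le_of_norm_hasDerivWithin_le hg
    (fun x hx => hX x hx) Set.self_mem_Ici (Set.mem_Ici.2 (le_add_of_nonneg_right hL0))
  rw [add_sub_cancel_left, Real.norm_of_nonneg hL0] at h2
  have h3 : (L : ℂ) * w = (φ (X + L) - φ X) - ((φ (X + L) - ((X + L : ℝ) : ℂ) * w) - (φ X - X * w)) := by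
    push_cast
    ring
  have h4 : ‖(L : ℂ) * w‖ ≤ (M + M) + ‖w‖ / 2 * L := by
    rw [h3]
    refine (norm_sub_le _ _).trans (add_le_add ((norm_sub_le _ _).trans
      (add_le_add (hM _) (hM _))) h2)
  rw [norm_mul, Complex.norm_real, Real.norm_of_nonneg hL0] at h4
  have h5 : L * ‖w‖ = 4 * M + 1 := by
    rw [hL]
    field_simp
  linarith

/-- A zero energy resonance is a multiple of the Jost solution `f₊` at zero energy. -/
theorem IsResonance.exists_smul_fP {V : 𝓢(ℝ, ℝ)} {φ : ℝ → ℂ} (h : IsResonance V φ) :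
    ∃ c : ℂ, c ≠ 0 ∧ φ = fun x => c * fP V 0 x := by
  have hk : (0 : ℂ) ∈ UH := by simpa using ofReal_mem_UH 0
  obtain ⟨h1, ⟨M, hM⟩, h2⟩ := h
  have hs : IsSol V 0 φ (deriv φ) := by simpa using isSol_of_isSolution h1
  have hP := isSol_fP V hk
  have t1 : Tendsto (fP V 0) atTop (𝓝 1) := (tendsto_mP V hk).congr fun x => by simp [fP]
  have t2 : Tendsto (fP' V 0) atTop (𝓝 0) := (tendsto_mP' V hk).congr fun x => by simp [fP']
  set w := deriv φ 0 * fP V 0 0 - φ 0 * fP' V 0 0 with hw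
  have t3 : Tendsto (fun x => φ x * fP' V 0 x) atTop (𝓝 0) := by
    have hb : ∀ᶠ x in atTop, ‖φ x‖ ≤ M := Eventually.of_forall hM
    have := Tendsto.zero_mul_isBoundedUnder_le t2 (g := φ) ⟨M, hb⟩
    exact this.congr fun x => mul_comm _ _
  -- The constant Wronskian `w` of `φ` and `f₊` is the limit of the derivative of `φ`, which has to
  -- vanish because `φ` is bounded.
  have t4 : Tendsto (fun x => deriv φ x) atTop (𝓝 w) := by
    have h5 : Tendsto (fun x => (w + φ x * fP' V 0 x) / fP V 0 x) atTop (𝓝 ((w + 0) / 1)) :=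
      (t3.const_add w).div t1 one_ne_zero
    rw [add_zero, div_one] at h5
    refine h5.congr' ?_
    filter_upwards [t1.eventually_ne one_ne_zero] with x hx
    rw [div_eq_iff hx, hw, hs.wronskian_const hP 0 x]
    ring
  have hw0 := eq_zero_of_tendsto_deriv_of_bounded hs.hasDeriv hM t4
  obtain ⟨c, hc⟩ := hs.exists_smul hP (fP_ne_zero V hk) (x₀ := 0) hw0
  refine ⟨c, fun h0 => h2 ?_, hc⟩
  rw [hc, h0]
  funext x
  simp

/-- For an even resonance, `f₊(·, 0)` is even, so that its derivative vanishes at the origin and its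
value cannot. -/
theorem IsResonance.fP_zero_ne {V : 𝓢(ℝ, ℝ)} {φ : ℝ → ℂ} (h : IsResonance V φ)
    (he : ∀ x, φ (-x) = φ x) : fP V 0 0 ≠ 0 := fun h0 => by
  have hk : (0 : ℂ) ∈ UH := by simpa using ofReal_mem_UH 0
  obtain ⟨c, hc0, hc⟩ := h.exists_smul_fP
  have hP := isSol_fP V hk
  have h1 : ∀ x, fP V 0 (-x) = fP V 0 x := fun x => by
    have := he x
    rw [hc] at this
    exact mul_left_cancel₀ hc0 this
  have h2 : HasDerivAt (fun x => fP V 0 (-x)) (-fP' V 0 0) 0 := by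
    have h3 : HasDerivAt (fP V 0) (fP' V 0 0) (-0) := by simpa using hP.hasDeriv 0
    have := h3.scomp (0 : ℝ) (hasDerivAt_neg (0 : ℝ))
    simpa [Function.comp_def] using this
  simp only [h1] at h2
  have h4 : -fP' V 0 0 = fP' V 0 0 := h2.unique (hP.hasDeriv 0)
  have h5 : fP' V 0 0 = 0 := by linear_combination (-1 / 2 : ℂ) * h4
  exact fP_ne_zero V hk (hP.eq_zero h0 h5)

/-- For an odd resonance, `f₊(·, 0)` vanishes at the origin, so that its derivative cannot. -/
theorem IsResonance.fP'_zero_ne {V : 𝓢(ℝ, ℝ)} {φ : ℝ → ℂ} (h : IsResonance V φ)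
    (ho : ∀ x, φ (-x) = -φ x) : fP' V 0 0 ≠ 0 := fun h0 => by
  have hk : (0 : ℂ) ∈ UH := by simpa using ofReal_mem_UH 0
  obtain ⟨c, hc0, hc⟩ := h.exists_smul_fP
  have h1 := ho 0
  rw [neg_zero, hc] at h1
  have h2 : c * fP V 0 0 = 0 := by linear_combination (1 / 2 : ℂ) * h1
  exact fP_ne_zero V hk ((isSol_fP V hk).eq_zero ((mul_eq_zero.1 h2).resolve_left hc0) h0)

/-! ### Kernels that are regular at low frequencies -/

/-- At the frequency `ξ` and the point `x`, the quotient of the kernel `E` by `ξ / ⟨ξ⟩` is bounded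
and differentiable in the frequency, with a bounded derivative, up to the weight `(1 + |x|)²`. -/
def RegularAt (C : ℝ) (E : ℝ → ℝ → ℂ) (ξ x : ℝ) : Prop :=
  ‖((jap ξ / ξ : ℝ) : ℂ) * E ξ x‖ ≤ C * (1 + |x|) ^ 2 ∧
    ∃ d, HasDerivAt (fun ξ => ((jap ξ / ξ : ℝ) : ℂ) * E ξ x) d ξ ∧ ‖d‖ ≤ C * (1 + |x|) ^ 2

theorem RegularAt.mono {C D : ℝ} {E : ℝ → ℝ → ℂ} {ξ x : ℝ} (h : RegularAt C E ξ x) (hCD : C ≤ D) :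
    RegularAt D E ξ x := by
  have h1 : C * (1 + |x|) ^ 2 ≤ D * (1 + |x|) ^ 2 := by gcongr
  obtain ⟨h2, d, h3, h4⟩ := h
  exact ⟨h2.trans h1, d, h3, h4.trans h1⟩

/-- Regularity passes to the symmetrization of a kernel. -/
theorem RegularAt.add_reflect {C : ℝ} {E : ℝ → ℝ → ℂ} {ξ x : ℝ} {σ : ℂ} (hσ : ‖σ‖ = 1)
    (h : RegularAt C E ξ x) (h' : RegularAt C E ξ (-x)) :
    RegularAt (C + C) (fun ξ x => E ξ x + σ * E ξ (-x)) ξ x := by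
  obtain ⟨h2, d, h3, h4⟩ := h
  obtain ⟨h2', d', h3', h4'⟩ := h'
  rw [abs_neg] at h2' h4'
  refine ⟨?_, d + σ * d', ?_, ?_⟩
  · have e : ((jap ξ / ξ : ℝ) : ℂ) * (E ξ x + σ * E ξ (-x)) =
        ((jap ξ / ξ : ℝ) : ℂ) * E ξ x + σ * (((jap ξ / ξ : ℝ) : ℂ) * E ξ (-x)) := by ring
    rw [e]
    refine (norm_add_le _ _).trans ?_
    rw [norm_mul σ, hσ, one_mul]
    linarith
  · refine (h3.add (h3'.const_mul σ)).congr_of_eventuallyEq (Eventually.of_forall fun ζ => ?_)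
    simp only [Pi.add_apply]
    ring
  · refine (norm_add_le _ _).trans ?_
    rw [norm_mul σ, hσ, one_mul]
    linarith

theorem RegularAt.reflect {C : ℝ} {E F : ℝ → ℝ → ℂ} {ξ x : ℝ} {σ : ℂ} (hσ : ‖σ‖ = 1)
    (h : RegularAt C E ξ (-x)) (hF : ∀ᶠ ζ in 𝓝 ξ, F ζ x = σ * E ζ (-x)) : RegularAt C F ξ x := by
  obtain ⟨h2, d, h3, h4⟩ := h
  rw [abs_neg] at h2 h4
  have e : ∀ᶠ ζ in 𝓝 ξ, ((jap ζ / ζ : ℝ) : ℂ) * F ζ x =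
      σ * (((jap ζ / ζ : ℝ) : ℂ) * E ζ (-x)) := hF.mono fun ζ hζ => by rw [hζ]; ring
  refine ⟨?_, σ * d, (h3.const_mul σ).congr_of_eventuallyEq e, ?_⟩
  · rw [e.self_of_nhds, norm_mul σ, hσ, one_mul]
    exact h2
  · rw [norm_mul, hσ, one_mul]
    exact h4

/-- A kernel of the form `ξ u(ξ, x) / κ(ξ)` is regular wherever `|κ|` dominates `⟨ξ⟩`. -/
theorem regularAt_of_quotient {E : ℝ → ℝ → ℂ} {κ u : ℝ → ℂ} {κ' u' c : ℂ} {ξ x K M A : ℝ}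
    (hξ : 0 < ξ) (hκ : HasDerivAt κ κ' ξ) (hu : HasDerivAt u u' ξ) (hK : ‖κ'‖ ≤ K)
    (hM0 : 0 ≤ M) (hM : jap ξ ≤ M * ‖κ ξ‖) (hA : ‖u ξ‖ ≤ A * (1 + |x|) ^ 2)
    (hA' : ‖u'‖ ≤ A * (1 + |x|) ^ 2) (hc : ‖c‖ ≤ 1)
    (hE : ∀ᶠ ζ : ℝ in 𝓝 ξ, E ζ x = c * (ζ * u ζ / κ ζ)) :
    RegularAt ((2 * M + M ^ 2 * K) * A) E ξ x := by
  have hj := one_le_jap ξ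
  have hK0 : 0 ≤ K := (norm_nonneg _).trans hK
  have hκ0 : 0 < ‖κ ξ‖ := by
    by_contra h
    have : M * ‖κ ξ‖ ≤ 0 := mul_nonpos_of_nonneg_of_nonpos hM0 (not_lt.1 h)
    linarith
  have hκ1 : κ ξ ≠ 0 := norm_pos_iff.1 hκ0
  set X := (1 + |x|) ^ 2 with hX
  have hAX : 0 ≤ A * X := (norm_nonneg _).trans hA
  have hq : ‖((jap ξ : ℝ) : ℂ) / κ ξ‖ ≤ M := by
    rw [norm_div, Complex.norm_real, Real.norm_of_nonneg (jap_pos ξ).le, div_le_iff₀ hκ0]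
    exact hM
  have hinv : ‖κ ξ‖⁻¹ ≤ M := by
    rw [inv_le_iff_one_le_mul₀ hκ0]
    linarith
  have e : ∀ᶠ ζ : ℝ in 𝓝 ξ, ((jap ζ / ζ : ℝ) : ℂ) * E ζ x = c * (((jap ζ : ℝ) : ℂ) / κ ζ * u ζ) := by
    filter_upwards [hE, eventually_gt_nhds hξ] with ζ h1 h2
    have : (ζ : ℂ) ≠ 0 := by exact_mod_cast h2.ne'
    rw [h1]
    push_cast
    field_simp
  have hd1 : HasDerivAt (fun ζ : ℝ => ((jap ζ : ℝ) : ℂ)) ((ξ / jap ξ : ℝ) : ℂ) ξ :=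
    (hasDerivAt_jap ξ).ofReal_comp
  have hd2 := (((hd1.div hκ hκ1).mul hu).const_mul c).congr_of_eventuallyEq e
  have hjd : ‖((ξ / jap ξ : ℝ) : ℂ)‖ ≤ 1 := by
    rw [Complex.norm_real, Real.norm_eq_abs, abs_div, abs_of_pos (jap_pos ξ),
      div_le_one (jap_pos ξ)]
    exact abs_le_jap ξ
  refine ⟨?_, _, hd2, ?_⟩
  · rw [e.self_of_nhds, norm_mul, norm_mul]
    calc ‖c‖ * (‖((jap ξ : ℝ) : ℂ) / κ ξ‖ * ‖u ξ‖) ≤ 1 * (M * (A * X)) := by gcongr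
      _ ≤ (2 * M + M ^ 2 * K) * A * X := by
        have := mul_nonneg hM0 hAX
        have := mul_nonneg (mul_nonneg (sq_nonneg M) hK0) hAX
        nlinarith
  · have hdq : ‖(((ξ / jap ξ : ℝ) : ℂ) * κ ξ - ((jap ξ : ℝ) : ℂ) * κ') / κ ξ ^ 2‖ ≤ M + M ^ 2 * K := by
      have e2 : (((ξ / jap ξ : ℝ) : ℂ) * κ ξ - ((jap ξ : ℝ) : ℂ) * κ') / κ ξ ^ 2 =
          ((ξ / jap ξ : ℝ) : ℂ) * (κ ξ)⁻¹ - ((jap ξ : ℝ) : ℂ) / κ ξ * (κ ξ)⁻¹ * κ' := by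
        field_simp
      rw [e2]
      refine (norm_sub_le _ _).trans ?_
      rw [norm_mul, norm_mul, norm_mul, norm_inv]
      refine add_le_add ?_ ?_
      · calc _ ≤ 1 * M := by gcongr
          _ = M := one_mul M
      · calc _ ≤ M * M * K := by gcongr
          _ = M ^ 2 * K := by ring
    rw [norm_mul]
    refine (mul_le_of_le_one_left (norm_nonneg _) hc).trans ((norm_add_le _ _).trans ?_)
    rw [norm_mul, norm_mul]
    calc _ ≤ (M + M ^ 2 * K) * (A * X) + M * (A * X) := by
          refine add_le_add ?_ ?_
          · exact mul_le_mul hdq hA (norm_nonneg _) (by positivity)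
          · exact mul_le_mul hq hA' (norm_nonneg _) hM0
      _ = (2 * M + M ^ 2 * K) * A * X := by ring

/-! ### Regularity of the generalized eigenfunctions at low frequencies -/

theorem jap_le_one_add (ξ : ℝ) : jap ξ ≤ 1 + |ξ| := by
  rw [jap, Real.sqrt_le_left (by positivity)]
  nlinarith [abs_nonneg ξ, sq_abs ξ]

/-- The constant `2i / √(2π)`. -/
def cnorm : ℂ := ((Real.sqrt (2 * Real.pi))⁻¹ : ℝ) * (2 * Complex.I)

theorem norm_cnorm_le : ‖cnorm‖ ≤ 1 := by
  have h : 2 ≤ Real.sqrt (2 * Real.pi) := Real.le_sqrt_of_sq_le (by nlinarith [Real.pi_gt_three])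
  rw [cnorm, norm_mul, norm_mul, Complex.norm_I, Complex.norm_real, Complex.norm_two, mul_one,
    Real.norm_of_nonneg (by positivity), inv_mul_le_iff₀ (by linarith), mul_one]
  exact h

theorem eP_eq (V : 𝓢(ℝ, ℝ)) {ξ : ℝ} (hξ : 0 < ξ) (x : ℝ) :
    eP V ξ x = cnorm * (ξ * fP V ξ x / Wr V ξ) := by
  have : (ξ : ℂ) ≠ 0 := by exact_mod_cast hξ.ne'
  rw [eP, kap_of_ne this, cnorm]
  ring

theorem exists_hasDerivAt_fP (V : 𝓢(ℝ, ℝ)) : ∃ C : ℝ, 0 ≤ C ∧ ∀ ξ x : ℝ,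
    ‖fP V ξ x‖ ≤ C * (1 + |x|) ∧
      ∃ d, HasDerivAt (fun ξ : ℝ => fP V ξ x) d ξ ∧ ‖d‖ ≤ C * (1 + |x|) ^ 2 := by
  obtain ⟨C, hC0, hC⟩ := exists_norm_mP_le V
  obtain ⟨D, hD0, hD⟩ := exists_norm_mPk_le V
  refine ⟨C + D, by positivity, fun ξ x => ⟨?_, _,
    hasDerivAt_comp_ofReal (hasDerivWithinAt_fP V (ofReal_mem_UH ξ) x), ?_⟩⟩
  · rw [fP, norm_mul, norm_exp_I_mul, one_mul]
    refine (hC ξ (ofReal_mem_UH ξ) x).trans ?_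
    gcongr
    linarith
  · have h1 := hC ξ (ofReal_mem_UH ξ) x
    have h2 := hD ξ (ofReal_mem_UH ξ) x
    refine (norm_add_le _ _).trans ?_
    rw [norm_mul, norm_mul, norm_mul, norm_mul, norm_exp_I_mul, Complex.norm_I, Complex.norm_real,
      Real.norm_eq_abs, one_mul, mul_one, one_mul]
    have h3 : |x| * ‖mP V ξ x‖ ≤ (1 + |x|) * (C * (1 + |x|)) := by
      gcongr
      linarith
    linarith

theorem exists_hasDerivAt_Wr (V : 𝓢(ℝ, ℝ)) : ∃ K : ℝ, 0 ≤ K ∧ ∀ ξ : ℝ,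
    ∃ d, HasDerivAt (fun ξ : ℝ => Wr V ξ) d ξ ∧ ‖d‖ ≤ K := by
  obtain ⟨D, hD0, hD⟩ := exists_norm_mPk_le V
  have hi := integrable_pow_mul_abs V 2
  refine ⟨2 + ∫ y, D * ((1 + |y|) ^ 2 * |V y|), add_nonneg zero_le_two
    (integral_nonneg fun y => by positivity), fun ξ =>
      ⟨_, hasDerivAt_comp_ofReal (hasDerivWithinAt_Wr V (ofReal_mem_UH ξ)), ?_⟩⟩
  refine (norm_sub_le _ _).trans (add_le_add (by simp) ?_)
  refine norm_integral_le_of_norm_le (hi.const_mul D) (Eventually.of_forall fun y => ?_)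
  rw [norm_mul, Complex.norm_real, Real.norm_eq_abs]
  calc |V y| * ‖mPk V ξ y‖ ≤ |V y| * (D * (1 + |y|) ^ 2) := by
        gcongr
        exact hD ξ (ofReal_mem_UH ξ) y
    _ = _ := by ring

/-- The slope `f₊'(0, ξ)` is differentiable in the frequency, since `f₊'(0, k) = 2ik - ik m₊(0, k) -
∫_0^∞ V m₊`. -/
theorem exists_hasDerivAt_fP'_zero (V : 𝓢(ℝ, ℝ)) : ∃ K : ℝ, 0 ≤ K ∧ ∀ ξ : ℝ, |ξ| ≤ 1 →
    ∃ d, HasDerivAt (fun ξ : ℝ => fP' V ξ 0) d ξ ∧ ‖d‖ ≤ K := by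
  obtain ⟨C, hC0, hC⟩ := exists_norm_mP_le V
  obtain ⟨D, hD0, hD⟩ := exists_norm_mPk_le V
  have hi := integrable_pow_mul_abs V 2
  have hJ0 : 0 ≤ ∫ y, D * ((1 + |y|) ^ 2 * |V y|) := integral_nonneg fun y => by positivity
  refine ⟨2 + C + D + ∫ y, D * ((1 + |y|) ^ 2 * |V y|), by positivity, fun ξ hξ => ?_⟩
  have hk := ofReal_mem_UH ξ
  have e : ∀ k : ℂ, fP' V k 0 = 2 * Complex.I * k - Complex.I * k * mP V k 0 -
      ∫ y, (Set.Ioi (0 : ℝ)).indicator (fun y => (V y : ℂ) * (wt (rho V) y : ℂ)) y * jsol V k y :=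
    fun k => by
      have e1 : ∫ y, (Set.Ioi (0 : ℝ)).indicator (fun y => (V y : ℂ) * (wt (rho V) y : ℂ)) y *
          jsol V k y = tail (fun y => (V y : ℂ) * mP V k y) 0 := by
        rw [tail, ← integral_indicator measurableSet_Ioi]
        refine integral_congr_ae (Eventually.of_forall fun y => ?_)
        by_cases hy : y ∈ Set.Ioi (0 : ℝ)
        · simp only [Set.indicator_of_mem hy, mP, mul_assoc]
        · simp only [Set.indicator_of_notMem hy, zero_mul]
      rw [e1, fP', mP', Complex.ofReal_zero, mul_zero, Complex.exp_zero]
      ring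
  have h1 := hasDerivWithinAt_integral_mul
    ((integrable_V_mul_wt V).indicator (measurableSet_Ioi (a := (0 : ℝ))))
    (hasDerivWithinAt_jsol V hk)
  have h2 : HasDerivWithinAt (fun k : ℂ => 2 * Complex.I * k) (2 * Complex.I) UH ξ := by
    simpa using (hasDerivWithinAt_id (ξ : ℂ) UH).const_mul (2 * Complex.I)
  have h3 : HasDerivWithinAt (fun k : ℂ => Complex.I * k) Complex.I UH ξ := by
    simpa using (hasDerivWithinAt_id (ξ : ℂ) UH).const_mul Complex.I
  have h4 := (h2.sub (h3.mul (hasDerivWithinAt_mP V hk 0))).sub h1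
  refine ⟨_, (hasDerivAt_comp_ofReal h4).congr_of_eventuallyEq
    (Eventually.of_forall fun ζ => e ζ), ?_⟩
  have b1 : ‖mP V ξ 0‖ ≤ C := by simpa using hC ξ hk 0
  have b2 : ‖mPk V ξ 0‖ ≤ D := by simpa using hD ξ hk 0
  refine (norm_sub_le _ _).trans (add_le_add ((norm_sub_le _ _).trans ?_) ?_)
  · rw [add_assoc]
    refine add_le_add (by simp) ((norm_add_le _ _).trans (add_le_add ?_ ?_))
    · rw [norm_mul, Complex.norm_I, one_mul]
      exact b1
    · rw [norm_mul, norm_mul, Complex.norm_I, one_mul, Complex.norm_real, Real.norm_eq_abs]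
      exact (mul_le_of_le_one_left (norm_nonneg _) hξ).trans b2
  · refine norm_integral_le_of_norm_le (hi.const_mul D) (Eventually.of_forall fun y => ?_)
    by_cases hy : y ∈ Set.Ioi (0 : ℝ)
    · rw [Set.indicator_of_mem hy, mul_assoc, norm_mul, Complex.norm_real, Real.norm_eq_abs]
      calc |V y| * ‖mPk V ξ y‖ ≤ |V y| * (D * (1 + |y|) ^ 2) := by
            gcongr
            exact hD ξ hk y
        _ = _ := by ring
    · rw [Set.indicator_of_notMem hy, zero_mul, norm_zero]
      positivity

theorem one_add_abs_le_sq (x : ℝ) : 1 + |x| ≤ (1 + |x|) ^ 2 :=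
  le_self_pow₀ (by linarith [abs_nonneg x]) (by norm_num)

/-- The generalized eigenfunction is regular at the frequencies where the Wronskian dominates
`⟨ξ⟩`. -/
theorem exists_regularAt_eP (V : 𝓢(ℝ, ℝ)) {M : ℝ} (hM0 : 0 ≤ M) : ∃ C : ℝ, 0 ≤ C ∧
    ∀ ξ : ℝ, 0 < ξ → jap ξ ≤ M * ‖Wr V ξ‖ → ∀ x, RegularAt C (eP V) ξ x := by
  obtain ⟨A, hA0, hA⟩ := exists_hasDerivAt_fP V
  obtain ⟨K, hK0, hK⟩ := exists_hasDerivAt_Wr V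
  refine ⟨(2 * M + M ^ 2 * K) * A, by positivity, fun ξ hξ hM x => ?_⟩
  obtain ⟨h1, d, h2, h3⟩ := hA ξ x
  obtain ⟨d', h4, h5⟩ := hK ξ
  refine regularAt_of_quotient hξ h4 h2 h5 hM0 hM
    (h1.trans (mul_le_mul_of_nonneg_left (one_add_abs_le_sq x) hA0)) h3 norm_cnorm_le ?_
  filter_upwards [eventually_gt_nhds hξ] with ζ hζ using eP_eq V hζ x

/-- Away from zero frequency, the Wronskian dominates `⟨ξ⟩`, since `|W(ξ)| ≥ 2 |ξ|`. -/
theorem jap_le_mul_norm_Wr (V : 𝓢(ℝ, ℝ)) {δ ξ : ℝ} (hδ : 0 < δ) (hξ : δ ≤ ξ) :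
    jap ξ ≤ (δ⁻¹ + 1) * ‖Wr V ξ‖ := by
  have h0 : 0 < ξ := hδ.trans_le hξ
  have h1 := two_abs_le_norm_Wr V ξ
  have h2 := jap_le_one_add ξ
  rw [abs_of_pos h0] at h1 h2
  have h3 : 1 ≤ δ⁻¹ * ξ := by
    rw [inv_mul_eq_div, one_le_div hδ]
    exact hξ
  have h4 : ξ ≤ ‖Wr V ξ‖ := by linarith
  calc jap ξ ≤ δ⁻¹ * ξ + ξ := by linarith
    _ = (δ⁻¹ + 1) * ξ := by ring
    _ ≤ _ := by gcongr

theorem exists_le_norm_of_continuousAt {κ : ℝ → ℂ} (hκ : ContinuousAt κ 0) (h0 : κ 0 ≠ 0) :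
    ∃ δ M : ℝ, 0 < δ ∧ δ ≤ 1 ∧ 0 ≤ M ∧ ∀ ξ ∈ Set.Ioo 0 δ, jap ξ ≤ M * ‖κ ξ‖ := by
  have hp : 0 < ‖κ 0‖ := norm_pos_iff.2 h0
  obtain ⟨ε, hε, h⟩ := Metric.eventually_nhds_iff.1
    (hκ.norm.eventually_const_le (half_lt_self hp))
  refine ⟨min ε 1, 4 / ‖κ 0‖, by positivity, min_le_right _ _, by positivity, fun ξ hξ => ?_⟩
  have h1 : ‖κ 0‖ / 2 ≤ ‖κ ξ‖ := h (by
    rw [Real.dist_eq, sub_zero, abs_of_pos hξ.1]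
    exact hξ.2.trans_le (min_le_left _ _))
  have h2 := jap_le_one_add ξ
  rw [abs_of_pos hξ.1] at h2
  have h3 : ξ ≤ 1 := hξ.2.le.trans (min_le_right _ _)
  calc jap ξ ≤ 4 / ‖κ 0‖ * (‖κ 0‖ / 2) := by
        field_simp
        linarith
    _ ≤ _ := by gcongr

/-- If `W(0) ≠ 0`, then the generalized eigenfunctions are regular at all positive frequencies. -/
theorem exists_regularAt_eP_of_Wr_ne {V : 𝓢(ℝ, ℝ)} (h : Wr V 0 ≠ 0) :
    ∃ C : ℝ, 0 ≤ C ∧ ∀ ξ : ℝ, 0 < ξ → ∀ x, RegularAt C (eP V) ξ x := by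
  obtain ⟨K, hK0, hK⟩ := exists_hasDerivAt_Wr V
  obtain ⟨d, hd, -⟩ := hK 0
  obtain ⟨δ, M, hδ0, hδ1, hM0, hM⟩ := exists_le_norm_of_continuousAt hd.continuousAt
    (by simpa using h)
  obtain ⟨C, hC0, hC⟩ := exists_regularAt_eP V (M := max M (δ⁻¹ + 1))
    (hM0.trans (le_max_left _ _))
  refine ⟨C, hC0, fun ξ hξ x => hC ξ hξ ?_ x⟩
  rcases lt_or_ge ξ δ with h1 | h1
  · refine (hM ξ ⟨hξ, h1⟩).trans ?_
    gcongr
    exact le_max_left _ _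
  · refine (jap_le_mul_norm_Wr V hδ0 h1).trans ?_
    gcongr
    exact le_max_right _ _

/-- The symmetrization of the generalized eigenfunctions of an even potential. -/
def symP (V : 𝓢(ℝ, ℝ)) (σ : ℂ) (ξ x : ℝ) : ℂ := eP V ξ x + σ * eP V ξ (-x)

/-- The symmetrized generalized eigenfunctions are regular if they are quotients of solutions with
fixed Cauchy data at the origin by a function that does not vanish at zero energy. -/
theorem exists_regularAt_symP {V : 𝓢(ℝ, ℝ)} {σ p r : ℂ} (hσ : σ * σ = 1) {κ : ℝ → ℂ} {K : ℝ}
    {u u' : ℝ → ℝ → ℂ}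
    (hκ : ∀ ξ ∈ Set.Ico (0 : ℝ) 1, ∃ d, HasDerivAt κ d ξ ∧ ‖d‖ ≤ K) (hκ0 : κ 0 ≠ 0)
    (hu : ∀ ξ ∈ Set.Ioo (0 : ℝ) 1, IsSol V ξ (u ξ) (u' ξ) ∧ u ξ 0 = p ∧ u' ξ 0 = r ∧
      ∃ M : ℝ, ∀ x, ‖u ξ x‖ ≤ M * (1 + |x|))
    (h : ∀ ξ ∈ Set.Ioo (0 : ℝ) 1, ∀ x, (fP V ξ x + σ * fP V ξ (-x)) / Wr V ξ = u ξ x / κ ξ) :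
    ∃ C : ℝ, 0 ≤ C ∧ ∀ ξ : ℝ, 0 < ξ → ∀ x, RegularAt C (symP V σ) ξ x := by
  have hσ1 : ‖σ‖ = 1 := by
    have := congrArg norm hσ
    rw [norm_mul, norm_one] at this
    nlinarith [norm_nonneg σ]
  obtain ⟨d, hd, -⟩ := hκ 0 ⟨le_rfl, one_pos⟩
  obtain ⟨δ, M, hδ0, hδ1, hM0, hM⟩ := exists_le_norm_of_continuousAt hd.continuousAt hκ0
  obtain ⟨C, hC0, hC⟩ := exists_regularAt_eP V (M := δ⁻¹ + 1) (by positivity)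
  obtain ⟨A, hA0, hA⟩ := exists_norm_le_of_cauchy V p r
  -- Low frequencies: the quotient representation, on the right half-line.
  have key : ∀ ξ ∈ Set.Ioo 0 δ, ∀ x, 0 ≤ x →
      RegularAt ((2 * M + M ^ 2 * K) * A) (symP V σ) ξ x := fun ξ hξ x hx => by
    have hξ1 : ξ < 1 := hξ.2.trans_le hδ1
    obtain ⟨h1, d, h2, h3⟩ := hA u u' hu ξ ⟨hξ.1, hξ1⟩ x hx
    obtain ⟨d', h4, h5⟩ := hκ ξ ⟨hξ.1.le, hξ1⟩
    refine regularAt_of_quotient hξ.1 h4 h2 h5 hM0 (hM ξ hξ)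
      (h1.trans (mul_le_mul_of_nonneg_left (one_add_abs_le_sq x) hA0)) h3 norm_cnorm_le ?_
    filter_upwards [Ioo_mem_nhds hξ.1 hξ1] with ζ hζ
    rw [symP, eP_eq V hζ.1, eP_eq V hζ.1, mul_div_assoc _ (u ζ x), ← h ζ hζ x]
    ring
  refine ⟨max (C + C) ((2 * M + M ^ 2 * K) * A), by positivity, fun ξ hξ x => ?_⟩
  rcases lt_or_ge ξ δ with h1 | h1
  · refine RegularAt.mono ?_ (le_max_right _ _)
    rcases le_total 0 x with hx | hx
    · exact key ξ ⟨hξ, h1⟩ x hx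
    -- The left half-line, by symmetry of the kernel.
    · refine (key ξ ⟨hξ, h1⟩ (-x) (by linarith)).reflect hσ1 (Eventually.of_forall fun ζ => ?_)
      rw [symP, symP, neg_neg]
      linear_combination (-eP V ζ x) * hσ
  · refine RegularAt.mono ?_ (le_max_left _ _)
    -- High frequencies: each of the two terms is regular.
    have hW := jap_le_mul_norm_Wr V hδ0 h1
    exact (hC ξ hξ hW x).add_reflect hσ1 (hC ξ hξ hW (-x))

theorem exists_norm_symm_le (V : 𝓢(ℝ, ℝ)) (a : ℂ) (σ : ℂ) (ξ : ℝ) :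
    ∃ M : ℝ, ∀ x, ‖a * (fP V ξ x + σ * fP V ξ (-x))‖ ≤ M * (1 + |x|) := by
  obtain ⟨C, hC0, hC⟩ := exists_hasDerivAt_fP V
  refine ⟨‖a‖ * (C + ‖σ‖ * C), fun x => ?_⟩
  have h1 := (hC ξ x).1
  have h2 := (hC ξ (-x)).1
  rw [abs_neg] at h2
  rw [norm_mul, mul_assoc]
  refine mul_le_mul_of_nonneg_left ((norm_add_le _ _).trans ?_) (norm_nonneg _)
  rw [norm_mul]
  have := mul_le_mul_of_nonneg_left h2 (norm_nonneg σ)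
  linarith

section even

variable {V : 𝓢(ℝ, ℝ)} (hV : refl V = V)

include hV

theorem Wr_eq_of_even {k : ℂ} (hk : k ∈ UH) : Wr V k = 2 * fP V k 0 * fP' V k 0 := by
  rw [← wronskian_fP_fM V hk 0, fM, fM', hV, neg_zero]
  ring

theorem isSol_symm {k : ℂ} (hk : k ∈ UH) (a σ : ℂ) :
    IsSol V k (fun x => a * (fP V k x + σ * fP V k (-x)))
      (fun x => a * (fP' V k x - σ * fP' V k (-x))) := by
  have h := ((isSol_fP V hk).sub_smul (isSol_fM V hk) (-σ)).const_mul a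
  simp only [fM, fM', hV] at h
  convert h using 2
  · ring
  · ring

/-- If `f₊(0, 0) ≠ 0`, then the odd symmetrization is regular: it is the quotient by `f₊(0, ξ)` of
the solution with value `0` and slope `1` at the origin. -/
theorem exists_regularAt_symP_of_fP_ne (h0 : fP V 0 0 ≠ 0) :
    ∃ C : ℝ, 0 ≤ C ∧ ∀ ξ : ℝ, 0 < ξ → ∀ x, RegularAt C (symP V (-1)) ξ x := by
  obtain ⟨K, -, hK⟩ := exists_hasDerivAt_fP V
  refine exists_regularAt_symP (p := 0) (r := 1) (K := K) (by norm_num) (κ := fun ξ => fP V ξ 0)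
    (u := fun ξ x => (2 * fP' V ξ 0)⁻¹ * (fP V ξ x + (-1) * fP V ξ (-x)))
    (u' := fun ξ x => (2 * fP' V ξ 0)⁻¹ * (fP' V ξ x - (-1) * fP' V ξ (-x)))
    (fun ξ _ => ?_) (by simpa using h0) (fun ξ hξ => ?_) (fun ξ hξ x => ?_)
  · obtain ⟨-, d, h1, h2⟩ := hK ξ 0
    exact ⟨d, h1, by simpa using h2⟩
  · have hW := Wr_ne_zero V hξ.1.ne'
    rw [Wr_eq_of_even hV (ofReal_mem_UH ξ)] at hW
    have hf' : fP' V ξ 0 ≠ 0 := right_ne_zero_of_mul hW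
    refine ⟨isSol_symm hV (ofReal_mem_UH ξ) _ _, by simp, ?_,
      exists_norm_symm_le V _ _ ξ⟩
    rw [neg_zero]
    field_simp
    ring
  · rw [Wr_eq_of_even hV (ofReal_mem_UH ξ)]
    field_simp

/-- If `f₊'(0, 0) ≠ 0`, then the even symmetrization is regular: it is the quotient by `f₊'(0, ξ)`
of the solution with value `1` and slope `0` at the origin. -/
theorem exists_regularAt_symP_of_fP'_ne (h0 : fP' V 0 0 ≠ 0) :
    ∃ C : ℝ, 0 ≤ C ∧ ∀ ξ : ℝ, 0 < ξ → ∀ x, RegularAt C (symP V 1) ξ x := by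
  obtain ⟨K, -, hK⟩ := exists_hasDerivAt_fP'_zero V
  refine exists_regularAt_symP (p := 1) (r := 0) (by norm_num) (κ := fun ξ => fP' V ξ 0)
    (u := fun ξ x => (2 * fP V ξ 0)⁻¹ * (fP V ξ x + 1 * fP V ξ (-x)))
    (u' := fun ξ x => (2 * fP V ξ 0)⁻¹ * (fP' V ξ x - 1 * fP' V ξ (-x)))
    (fun ξ hξ => hK ξ (by rw [abs_of_nonneg hξ.1]; exact hξ.2.le)) (by simpa using h0)
    (fun ξ hξ => ?_) (fun ξ hξ x => ?_)
  · have hW := Wr_ne_zero V hξ.1.ne'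
    rw [Wr_eq_of_even hV (ofReal_mem_UH ξ)] at hW
    have hf : fP V ξ 0 ≠ 0 := right_ne_zero_of_mul (left_ne_zero_of_mul hW)
    refine ⟨isSol_symm hV (ofReal_mem_UH ξ) _ _, ?_, by simp,
      exists_norm_symm_le V _ _ ξ⟩
    rw [neg_zero]
    field_simp
    ring
  · rw [Wr_eq_of_even hV (ofReal_mem_UH ξ)]
    field_simp

end even

/-! ### Decay in time -/

theorem inv_abs_le_inv_jap {t : ℝ} (ht : 1 ≤ |t|) : |t|⁻¹ ≤ 2 * (jap t)⁻¹ := by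
  have h1 := jap_le_one_add t
  have h2 := jap_pos t
  rw [← div_eq_mul_inv, inv_le_iff_one_le_mul₀ (by linarith), div_mul_eq_mul_div, one_le_div h2]
  linarith

theorem one_le_two_mul_inv_jap {t : ℝ} (ht : |t| ≤ 1) : 1 ≤ 2 * (jap t)⁻¹ := by
  have h1 := jap_le_one_add t
  rw [← div_eq_mul_inv, one_le_div (jap_pos t)]
  linarith

/-- An oscillatory integral with a kernel that is regular at low frequencies decays like
`⟨t⟩⁻¹`. -/
theorem norm_integral_regular_le {E : ℝ → ℝ → ℂ} {C : ℝ} (hC0 : 0 ≤ C)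
    (hE : ∀ ξ : ℝ, 0 < ξ → ∀ x, RegularAt C E ξ x) {g H : ℝ → ℂ} (hg : Integrable g volume)
    (hH : Integrable H volume) (hHb : ∀ ξ, ‖H ξ‖ ≤ ∫ s, ‖g s‖)
    (hHg : ∀ a b, H b - H a = ∫ s in a..b, g s) (t x : ℝ) :
    ‖∫ ξ in Set.Ioi (0 : ℝ), E ξ x * (expMul t ξ * H ξ)‖ ≤
      6 * C * (1 + |x|) ^ 2 * (jap t)⁻¹ * ((∫ ξ, ‖g ξ‖) + ∫ ξ, ‖H ξ‖) := by
  set w : ℝ → ℂ := fun ξ => ((jap ξ / ξ : ℝ) : ℂ) * E ξ x with hw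
  set K := C * (1 + |x|) ^ 2 with hK
  have hK0 : 0 ≤ K := by positivity
  have hG0 : 0 ≤ ∫ ξ, ‖g ξ‖ := integral_nonneg fun _ => norm_nonneg _
  have hH0 : 0 ≤ ∫ ξ, ‖H ξ‖ := integral_nonneg fun _ => norm_nonneg _
  have hjt := jap_pos t
  have hEw : ∀ ξ : ℝ, 0 < ξ → E ξ x = w ξ * ((ξ / jap ξ : ℝ) : ℂ) := fun ξ hξ => by
    have h1 : (ξ : ℂ) ≠ 0 := by exact_mod_cast hξ.ne'
    have h2 : ((jap ξ : ℝ) : ℂ) ≠ 0 := by exact_mod_cast (jap_pos ξ).ne'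
    simp only [hw]
    push_cast
    field_simp
  -- For `|t| ≤ 1` the trivial bound suffices; for `|t| > 1` the integration by parts applies.
  rcases le_or_gt |t| 1 with ht | ht
  · have h1 : ‖∫ ξ in Set.Ioi (0 : ℝ), E ξ x * (expMul t ξ * H ξ)‖ ≤ K * ∫ ξ, ‖H ξ‖ := by
      rw [← integral_const_mul]
      refine (norm_integral_le_of_norm_le (hH.norm.const_mul K).integrableOn ?_).trans
        (setIntegral_le_integral (hH.norm.const_mul _) (Eventually.of_forall fun ξ => by positivity))
      filter_upwards [ae_restrict_mem measurableSet_Ioi] with ξ hξ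
      have hξ0 : 0 < ξ := hξ
      rw [norm_mul, norm_mul, norm_expMul_apply, one_mul]
      refine mul_le_mul_of_nonneg_right ?_ (norm_nonneg _)
      rw [hEw ξ hξ0, norm_mul, Complex.norm_real, Real.norm_eq_abs, abs_div,
        abs_of_pos (jap_pos ξ)]
      exact (mul_le_of_le_one_right (norm_nonneg _) ((div_le_one (jap_pos ξ)).2
        (abs_le_jap ξ))).trans (hE ξ hξ0 x).1
    have h2 := one_le_two_mul_inv_jap ht
    calc _ ≤ 1 * (K * ∫ ξ, ‖H ξ‖) := by rwa [one_mul]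
      _ ≤ 6 * (jap t)⁻¹ * (K * ((∫ ξ, ‖g ξ‖) + ∫ ξ, ‖H ξ‖)) := by
        gcongr
        · linarith [inv_pos.2 hjt]
        · linarith
      _ = _ := by rw [hK]; ring
  · have ht0 : t ≠ 0 := by
      rintro rfl
      norm_num at ht
    have hd : ∀ ξ, 0 < ξ → HasDerivAt w (deriv w ξ) ξ ∧ ‖deriv w ξ‖ ≤ K := fun ξ hξ => by
      obtain ⟨-, d, h1, h2⟩ := hE ξ hξ x
      have h3 : HasDerivAt w d ξ := h1
      rw [h3.deriv]
      exact ⟨h3, h2⟩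
    have h1 := norm_integral_mul_expMul_le ht0 (fun ξ hξ => (hd ξ hξ).1)
      (fun ξ hξ => (hE ξ hξ x).1) (fun ξ hξ => (hd ξ hξ).2) hg hH hHb hHg
    have h2 : ∫ ξ in Set.Ioi (0 : ℝ), E ξ x * (expMul t ξ * H ξ) =
        ∫ ξ in Set.Ioi (0 : ℝ), w ξ * ((ξ / jap ξ : ℝ) * expMul t ξ) * H ξ := by
      refine setIntegral_congr_fun measurableSet_Ioi fun ξ hξ => ?_
      simp only [hEw ξ hξ]
      ring
    rw [h2]
    refine h1.trans ?_
    have h3 := inv_abs_le_inv_jap ht.le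
    calc _ = K * |t|⁻¹ * (3 * (∫ ξ, ‖g ξ‖) + ∫ ξ, ‖H ξ‖) := by rw [div_eq_mul_inv]
      _ ≤ K * (2 * (jap t)⁻¹) * (3 * (∫ ξ, ‖g ξ‖) + 3 * ∫ ξ, ‖H ξ‖) := by
        gcongr
        linarith
      _ = _ := by rw [hK]; ring

/-! ### Parity -/

theorem ker_neg_neg {V : 𝓢(ℝ, ℝ)} (hV : refl V = V) {ξ : ℝ} (hξ : ξ ≠ 0) (x : ℝ) :
    ker V (-ξ) (-x) = ker V ξ x := by
  rcases lt_or_gt_of_ne hξ with h | h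
  · rw [ker, ker, if_pos (neg_pos.2 h), if_neg (not_lt.2 h.le), eM_eq V (neg_ne_zero.2 hξ), hV]
  · rw [ker, ker, if_neg (by linarith), if_pos h, neg_neg, eM_eq V hξ, hV, neg_neg]

/-- For an even potential, the distorted Fourier transform preserves parity. -/
theorem FT_parity {V : 𝓢(ℝ, ℝ)} (hV : eigenvectors V = ∅) (he : refl V = V) {σ : ℂ} {f : L2}
    (hf : ∀ᵐ x, f (-x) = σ * f x) : ∀ᵐ ξ, (FT hV f : L2) (-ξ) = σ * (FT hV f : L2) ξ := by
  have ht : Tendsto (fun n : ℕ => FT hV (trunc n f)) atTop (𝓝 (FT hV f)) :=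
    ((FT hV).continuous.tendsto f).comp ((tendsto_trunc f).comp tendsto_natCast_atTop_atTop)
  obtain ⟨φ, hφ, h⟩ := (tendstoInMeasure_of_tendsto_Lp ht).exists_seq_tendsto_ae
  have hn := ae_all_iff.2 fun n : ℕ => coeFn_FT_trunc hV (n : ℝ) f
  have hneg : ∀ {p : ℝ → Prop}, (∀ᵐ ξ, p ξ) → ∀ᵐ ξ : ℝ, p (-ξ) := fun hp =>
    (Measure.measurePreserving_neg (volume : Measure ℝ)).quasiMeasurePreserving.ae hp
  have hpar : ∀ (R : ℝ) (ξ : ℝ), ξ ≠ 0 → dft V ((Set.Ioc (-R) R).indicator f) (-ξ) =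
      σ * dft V ((Set.Ioc (-R) R).indicator f) ξ := fun R ξ hξ => by
    rw [dft, dft, ← integral_neg_eq_self, ← integral_const_mul]
    refine integral_congr_ae ?_
    filter_upwards [hf, (Set.countable_singleton R).ae_notMem volume,
      (Set.countable_singleton (-R)).ae_notMem volume] with y h1 h2 h3
    rw [ker_neg_neg he hξ]
    by_cases hy : y ∈ Set.Ioc (-R) R
    · have hy' : -y ∈ Set.Ioc (-R) R :=
        ⟨by linarith [lt_of_le_of_ne hy.2 h2], by linarith [hy.1]⟩
      rw [Set.indicator_of_mem hy, Set.indicator_of_mem hy', h1]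
      ring
    · have hy' : -y ∉ Set.Ioc (-R) R := fun h' =>
        hy ⟨lt_of_le_of_ne (by linarith [h'.2]) (Ne.symm h3), by linarith [h'.1]⟩
      rw [Set.indicator_of_notMem hy, Set.indicator_of_notMem hy']
      ring
  filter_upwards [h, hneg h, hn, hneg hn, (Set.countable_singleton (0 : ℝ)).ae_notMem volume]
    with ξ h1 h2 h3 h4 h5
  refine tendsto_nhds_unique h2 ((h1.const_mul σ).congr fun n => ?_)
  rw [h3, h4, hpar _ ξ h5]

/-! ### The local decay estimate -/

/-- The negative frequencies are the positive frequencies of the reflected potential at the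
reflected point. -/
theorem integral_ker_eq {V : 𝓢(ℝ, ℝ)} {k : ℝ → ℂ} (x : ℝ)
    (hk : Integrable (fun ξ => ker V ξ x * k ξ) volume) :
    ∫ ξ, ker V ξ x * k ξ = (∫ ξ in Set.Ioi (0 : ℝ), eP V ξ x * k ξ) +
      ∫ ξ in Set.Ioi (0 : ℝ), eP (refl V) ξ (-x) * k (-ξ) := by
  rw [← intervalIntegral.integral_Iic_add_Ioi (b := 0) hk.integrableOn hk.integrableOn, add_comm]
  congr 1
  · refine setIntegral_congr_fun measurableSet_Ioi fun ξ hξ => ?_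
    have hξ0 : 0 < ξ := hξ
    simp only [ker, if_pos hξ0]
  · rw [← neg_zero, ← integral_comp_neg_Ioi, neg_zero]
    refine setIntegral_congr_fun measurableSet_Ioi fun ξ hξ => ?_
    have hξ0 : 0 < ξ := hξ
    simp only [ker, if_neg (not_lt.2 (neg_nonpos.2 hξ0.le)), neg_neg, eM_eq V hξ0.ne']

theorem expMul_neg (t ξ : ℝ) : expMul t (-ξ) = expMul t ξ := by
  simp only [expMul_apply, jap, neg_sq]

theorem integrable_ker_mul (V : 𝓢(ℝ, ℝ)) {k : ℝ → ℂ} (hk : Integrable k volume) (x : ℝ) :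
    Integrable (fun ξ => ker V ξ x * k ξ) volume := by
  obtain ⟨C, -, hC⟩ := exists_norm_ker_le V
  exact hk.bdd_mul (c := C * (1 + |x|)) ((measurable_ker V).comp
    (measurable_id.prodMk measurable_const)).aestronglyMeasurable
    (Eventually.of_forall fun ξ => hC ξ x)

theorem refl_eq_self {V : 𝓢(ℝ, ℝ)} (h : ∀ x, V (-x) = V x) : refl V = V := by
  ext x
  rw [refl_apply, h]

/-- The oscillatory integral representing the evolution decays like `⟨t⟩⁻¹`. -/
theorem exists_norm_integral_ker_le (V : 𝓢(ℝ, ℝ)) (hV : eigenvectors V = ∅) : ∃ C : ℝ, 0 ≤ C ∧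
    ∀ f : L2, ParityAssumption V f → ∀ g H : ℝ → ℂ, Integrable g volume → Integrable H volume →
    (∀ ξ, ‖H ξ‖ ≤ ∫ s, ‖g s‖) → (∀ a b, H b - H a = ∫ s in a..b, g s) →
    FT hV f =ᵐ[volume] H → ∀ t x : ℝ, ‖∫ ξ, ker V ξ x * (expMul t ξ * H ξ)‖ ≤
      C * (1 + |x|) ^ 2 * (jap t)⁻¹ * ((∫ ξ, ‖g ξ‖) + ∫ ξ, ‖H ξ‖) := by
  -- The constants have to be chosen before `f`, so each of the three regularity statements is made
  -- conditional on its nonvanishing hypothesis.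
  have hA : ∃ A : ℝ, 0 ≤ A ∧ (Wr V 0 ≠ 0 → ∀ ξ : ℝ, 0 < ξ → ∀ x, RegularAt A (eP V) ξ x ∧
      RegularAt A (eP (refl V)) ξ x) := by
    by_cases h : Wr V 0 = 0
    · exact ⟨0, le_rfl, fun h' => absurd h h'⟩
    · obtain ⟨A, hA0, hA⟩ := exists_regularAt_eP_of_Wr_ne h
      obtain ⟨D, hD0, hD⟩ := exists_regularAt_eP_of_Wr_ne (V := refl V) (by
        have := Wr_refl V (k := 0) (by simpa using ofReal_mem_UH 0)
        rwa [this])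
      exact ⟨max A D, by positivity, fun _ ξ hξ x => ⟨(hA ξ hξ x).mono (le_max_left _ _),
        (hD ξ hξ x).mono (le_max_right _ _)⟩⟩
  have hB : ∃ A : ℝ, 0 ≤ A ∧ (refl V = V → fP V 0 0 ≠ 0 → ∀ ξ : ℝ, 0 < ξ → ∀ x,
      RegularAt A (symP V (-1)) ξ x) := by
    by_cases h : refl V = V ∧ fP V 0 0 ≠ 0
    · obtain ⟨A, hA0, hA⟩ := exists_regularAt_symP_of_fP_ne h.1 h.2
      exact ⟨A, hA0, fun _ _ => hA⟩
    · exact ⟨0, le_rfl, fun h1 h2 => absurd ⟨h1, h2⟩ h⟩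
  have hD : ∃ A : ℝ, 0 ≤ A ∧ (refl V = V → fP' V 0 0 ≠ 0 → ∀ ξ : ℝ, 0 < ξ → ∀ x,
      RegularAt A (symP V 1) ξ x) := by
    by_cases h : refl V = V ∧ fP' V 0 0 ≠ 0
    · obtain ⟨A, hA0, hA⟩ := exists_regularAt_symP_of_fP'_ne h.1 h.2
      exact ⟨A, hA0, fun _ _ => hA⟩
    · exact ⟨0, le_rfl, fun h1 h2 => absurd ⟨h1, h2⟩ h⟩
  obtain ⟨A, hA0, hA⟩ := hA
  obtain ⟨A₁, hB0, hB⟩ := hB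
  obtain ⟨A₂, hD0, hD⟩ := hD
  refine ⟨12 * A + 6 * A₁ + 6 * A₂, by positivity, fun f hf g H hg hH hHb hHg hfH t x => ?_⟩
  have hS0 : 0 ≤ (∫ ξ, ‖g ξ‖) + ∫ ξ, ‖H ξ‖ := add_nonneg
    (integral_nonneg fun _ => norm_nonneg _) (integral_nonneg fun _ => norm_nonneg _)
  set S := (∫ ξ, ‖g ξ‖) + ∫ ξ, ‖H ξ‖ with hS
  have hjt := inv_pos.2 (jap_pos t)
  set Y := (1 + |x|) ^ 2 * (jap t)⁻¹ * S with hY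
  have hY0 : 0 ≤ Y := by positivity
  have hki : Integrable (fun ξ => expMul t ξ * H ξ) volume :=
    hH.bdd_mul (c := 1) (expMul t).continuous.aestronglyMeasurable
      (Eventually.of_forall fun ξ => (norm_expMul_apply t ξ).le)
  have hint := fun y => integrable_ker_mul V hki y
  suffices h : ‖∫ ξ, ker V ξ x * (expMul t ξ * H ξ)‖ ≤ 12 * A * Y ∨
      ‖∫ ξ, ker V ξ x * (expMul t ξ * H ξ)‖ ≤ 6 * A₁ * Y ∨
      ‖∫ ξ, ker V ξ x * (expMul t ξ * H ξ)‖ ≤ 6 * A₂ * Y by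
    have h1 := mul_nonneg hA0 hY0
    have h2 := mul_nonneg hB0 hY0
    have h3 := mul_nonneg hD0 hY0
    have e : (12 * A + 6 * A₁ + 6 * A₂) * (1 + |x|) ^ 2 * (jap t)⁻¹ * S =
        12 * (A * Y) + 6 * (A₁ * Y) + 6 * (A₂ * Y) := by rw [hY]; ring
    rw [e]
    rcases h with h | h | h <;> linarith
  -- With parity, the negative frequencies fold onto the positive ones.
  have hfold : ∀ σ : ℂ, refl V = V → (∀ᵐ y, f (-y) = σ * f y) →
      ∫ ξ, ker V ξ x * (expMul t ξ * H ξ) =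
        ∫ ξ in Set.Ioi (0 : ℝ), symP V σ ξ x * (expMul t ξ * H ξ) := fun σ he hσ => by
    have hHσ : ∀ᵐ ξ, H (-ξ) = σ * H ξ := by
      filter_upwards [FT_parity hV he hσ, hfH, (Measure.measurePreserving_neg
        (volume : Measure ℝ)).quasiMeasurePreserving.ae hfH] with ξ h1 h2 h3
      rw [← h2, ← h3, h1]
    have i1 : IntegrableOn (fun ξ => eP V ξ x * (expMul t ξ * H ξ)) (Set.Ioi 0) := by
      refine (hint x).integrableOn.congr_fun (fun ξ hξ => ?_) measurableSet_Ioi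
      have hξ0 : 0 < ξ := hξ
      simp only [ker, if_pos hξ0]
    have i2 : IntegrableOn (fun ξ => eP V ξ (-x) * (expMul t ξ * H ξ)) (Set.Ioi 0) := by
      refine (hint (-x)).integrableOn.congr_fun (fun ξ hξ => ?_) measurableSet_Ioi
      have hξ0 : 0 < ξ := hξ
      simp only [ker, if_pos hξ0]
    rw [integral_ker_eq x (hint x), he]
    have e1 : ∫ ξ in Set.Ioi (0 : ℝ), eP V ξ (-x) * (expMul t (-ξ) * H (-ξ)) =
        ∫ ξ in Set.Ioi (0 : ℝ), σ * (eP V ξ (-x) * (expMul t ξ * H ξ)) := by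
      refine integral_congr_ae (ae_restrict_of_ae ?_)
      filter_upwards [hHσ] with ξ hξ
      rw [hξ, expMul_neg]
      ring
    rw [e1, ← integral_add i1 (i2.const_mul σ)]
    refine integral_congr_ae (Eventually.of_forall fun ξ => ?_)
    simp only [symP]
    ring
  rcases hf with hf | ⟨h1, ⟨φ, hφ, h2⟩, h3⟩ | ⟨h1, ⟨φ, hφ, h2⟩, h3⟩
  · left
    have hreg := hA hf.Wr_zero_ne
    rw [integral_ker_eq x (hint x)]
    have b1 := norm_integral_regular_le hA0 (fun ξ hξ x => (hreg ξ hξ x).1) hg hH hHb hHg t x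
    -- At negative frequencies, `H` is replaced by its reflection.
    have b2 := norm_integral_regular_le hA0 (fun ξ hξ x => (hreg ξ hξ x).2) (g := fun s => -g (-s))
      (H := fun ξ => H (-ξ)) hg.comp_neg.neg hH.comp_neg (fun ξ => by
        simp only [norm_neg]
        rw [integral_neg_eq_self (fun s => ‖g s‖)]
        exact hHb (-ξ)) (fun a b => by
        rw [intervalIntegral.integral_neg, intervalIntegral.integral_comp_neg,
          intervalIntegral.integral_symm, neg_neg]
        exact hHg (-a) (-b)) t (-x)
    simp only [norm_neg, abs_neg] at b2
    rw [integral_neg_eq_self (fun s => ‖g s‖), integral_neg_eq_self (fun s => ‖H s‖)] at b2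
    simp only [expMul_neg]
    refine (norm_add_le _ _).trans ((add_le_add b1 b2).trans (le_of_eq ?_))
    rw [hY]
    ring
  · right; left
    have he := refl_eq_self h1
    rw [hfold (-1) he (h3.mono fun y hy => by rw [hy]; ring)]
    refine (norm_integral_regular_le hB0 (hB he (hφ.fP_zero_ne h2)) hg hH hHb hHg t x).trans
      (le_of_eq ?_)
    rw [hY]
    ring
  · right; right
    have he := refl_eq_self h1
    rw [hfold 1 he (h3.mono fun y hy => by rw [hy]; ring)]
    refine (norm_integral_regular_le hD0 (hD he (hφ.fP'_zero_ne h2)) hg hH hHb hHg t x).trans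
      (le_of_eq ?_)
    rw [hY]
    ring

end LocalDecay

end

theorem proposition3p2 (V : SchwartzMap ℝ ℝ) (hV : LocalDecay.eigenvectors V = ∅) :
    ∃ C : ℝ, ∀ f f' : LocalDecay.L2, LocalDecay.HasWeakDeriv f f' →
      LocalDecay.ParityAssumption V f →
      ∀ g' : ℝ → ℂ, LocalDecay.HasWeakDeriv (LocalDecay.distFT V f) g' →
      Integrable (LocalDecay.distFT V f : ℝ → ℂ) volume → Integrable g' volume →
      ∀ t : ℝ,
        eLpNorm (fun x : ℝ => (((LocalDecay.jap x ^ 2)⁻¹ : ℝ) : ℂ) *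
            (LocalDecay.expI (LocalDecay.B V) t (LocalDecay.Pc V f) : ℝ → ℂ) x) ⊤ volume ≤
          ENNReal.ofReal (C * (LocalDecay.jap t)⁻¹ *
            ((∫ ξ : ℝ, ‖g' ξ‖) + (∫ ξ : ℝ, ‖(LocalDecay.distFT V f : ℝ → ℂ) ξ‖) +
              Real.sqrt (‖f‖ ^ 2 + ‖f'‖ ^ 2))) := by
  open LocalDecay in
  obtain ⟨C, hC0, hC⟩ := exists_norm_integral_ker_le V hV
  refine ⟨2 * C, fun f f' _ hp g hg hi hgi t => ?_⟩
  rw [distFT_eq hV] at hg hi ⊢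
  rw [expI_eq hV]
  -- The continuous representative of the transform of `f`.
  set H : ℝ → ℂ := fun x => ∫ y in Set.Iic x, g y
  have hfH : FT hV f =ᵐ[volume] H := hg.ae_eq_integral_Iic hi hgi
  have hHi : Integrable H volume := hi.congr hfH
  have hHb : ∀ ξ, ‖H ξ‖ ≤ ∫ s, ‖g s‖ := fun ξ => (norm_integral_le_integral_norm _).trans
    (setIntegral_le_integral hgi.norm (Eventually.of_forall fun _ => norm_nonneg _))
  have hHg : ∀ a b, H b - H a = ∫ s in a..b, g s := fun a b =>
    intervalIntegral.integral_Iic_sub_Iic hgi.integrableOn hgi.integrableOn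
  have hnorm : ∫ ξ, ‖(FT hV f : ℝ → ℂ) ξ‖ = ∫ ξ, ‖H ξ‖ :=
    integral_congr_ae (hfH.mono fun ξ hξ => by simp only [hξ])
  have hk : (mulOp (expMul t) (FT hV f) : ℝ → ℂ) =ᵐ[volume] fun ξ => expMul t ξ * H ξ := by
    filter_upwards [coeFn_mulOp (expMul t) (FT hV f), hfH] with ξ h1 h2
    rw [h1, h2]
  have hki : Integrable (fun ξ => expMul t ξ * H ξ) volume :=
    hHi.bdd_mul (c := 1) (expMul t).continuous.aestronglyMeasurable
      (Eventually.of_forall fun ξ => (norm_expMul_apply t ξ).le)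
  have hS0 : 0 ≤ (∫ ξ, ‖g ξ‖) + ∫ ξ, ‖H ξ‖ := add_nonneg
    (integral_nonneg fun _ => norm_nonneg _) (integral_nonneg fun _ => norm_nonneg _)
  rw [eLpNorm_exponent_top]
  refine eLpNormEssSup_le_of_ae_bound ?_
  filter_upwards [coeFn_FTi_of_integrable hV (hki.congr hk.symm)] with x hx
  have e : ∫ ξ, ker V ξ x * (mulOp (expMul t) (FT hV f) : L2) ξ =
      ∫ ξ, ker V ξ x * (expMul t ξ * H ξ) :=
    integral_congr_ae (hk.mono fun ξ hξ => by simp only [hξ])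
  have hj := pow_pos (jap_pos x) 2
  have hjt := inv_pos.2 (jap_pos t)
  rw [hx, e, norm_mul, Complex.norm_real, Real.norm_of_nonneg (inv_pos.2 hj).le,
    inv_mul_le_iff₀ hj, hnorm]
  refine (hC f hp g H hgi hHi hHb hHg hfH t x).trans ?_
  -- The weight `⟨x⟩⁻²` absorbs the growth of the kernel.
  have hx2 : (1 + |x|) ^ 2 ≤ 2 * jap x ^ 2 := by
    rw [jap_sq]
    nlinarith [sq_nonneg (1 - |x|), sq_abs x]
  set S := (∫ ξ, ‖g ξ‖) + ∫ ξ, ‖H ξ‖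
  calc C * (1 + |x|) ^ 2 * (jap t)⁻¹ * S ≤ C * (2 * jap x ^ 2) * (jap t)⁻¹ * S := by gcongr
    _ = jap x ^ 2 * (2 * C * (jap t)⁻¹ * S) := by ring
    _ ≤ jap x ^ 2 * (2 * C * (jap t)⁻¹ * (S + Real.sqrt (‖f‖ ^ 2 + ‖f'‖ ^ 2))) := by
      gcongr
      exact le_add_of_nonneg_right (Real.sqrt_nonneg _)
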